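/- **Setting.** Let $(X,0)\subset(\mathbb C^3,0)$ be an irreducible quasi-ordinary surface germ $f=0$, where $f\in\mathbb C\{x_1,x_2\}[z]$ is an irreducible Weierstrass polynomial of degree $n$ whose discriminant is a monomial times a unit. Let $\zeta=\sum\beta_\lambda \mathbf x^\lambda\in\mathbb C\{x_1^{1/n},x_2^{1/n}\}$ be a root of $f$ with characteristic exponents $\lambda_1\le\dots\le\lambda_g$ in $\mathbb Q^2_{\ge0}$, $g\ge1$ (coordinatewise order): with $\lambda_0=0$, $\lambda_{g+1}=\infty$, $M_j=\mathbb Z^2+\mathbb Z\lambda_1+\dots+\mathbb Z\lambda_j$, one has $\beta_{\lambda_j}\ne0$ and $\lambda_j\notin M_{j-1}$ for $1\le j\le g$, and if $\beta_\lambda\neq0$ then $\lambda\in M_j$ for the $j$ with $\lambda_j\le\lambda$, $\lambda_{j+1}\not\le\lambda$. Assume $(\lambda_1^{(1)},\dots,\lambda_g^{(1)})\ge_{\rm lex}(\lambda_1^{(2)},\dots,\lambda_g^{(2)})$ and that $\zeta$ is normalized: $\lambda_1$ is not of the form $(a,0)$ with $a<1$. Put $\sigma=\mathbb R^2_{\ge0}$;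 let $N_j$ be the dual lattice of $M_j$ (so $N_0=\mathbb Z^2$); $n_0=1$ and $n_j=[M_j:M_{j-1}]$ for $1\le j\le g$; $e_j=n_{j+1}\cdots n_g$ (so $e_g=1$); $\gamma_0=0$, $\gamma_1=\lambda_1$, $\gamma_{j+1}=n_j\gamma_j+\lambda_{j+1}-\lambda_j$. For $\nu\in\sigma\cap N_0$ let $l_i(\nu)=n_ie_i\langle\nu,\gamma_i\rangle$ for $0\le i\le g$ (so $l_0(\nu)=0$), $l_{g+1}(\nu)=\infty$; let $i(\nu)=g+1$ if $\nu\in N_g$ and $i(\nu)=\min\{1\le i\le g:\nu\notin N_i\}$ otherwise; let $m(\nu)=\min\{1\le i\le g: n_i\langle\nu,\gamma_i\rangle<\langle\nu,\gamma_{i+1}\rangle\}$, the inequality being true by convention for $i=g$. For $m\in\mathbb Z_{>0}$ let $j(m,\nu)\in\{0,\dots,i(\nu)-1\}$ be the integer $j$ with $l_j(\nu)\le m<l_{j+1}(\nu)$, and let $j'(m,\nu)$ be the largest $j\in\{0,\dots,j(m,\nu)\}$ with $l_j(\nu)+e_j\le m<l_{j+1}(\nu)+e_{j+1}$. For $1\le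 j\le g$ let $X^{(j)}$ be the quasi-ordinary germ parametrized by $\zeta_j=\sum_{\lambda\not\ge\lambda_{j+1}}\beta_\lambda\mathbf x^\lambda$ (so $\zeta_g=\zeta$, $X^{(g)}=X$), i.e. defined by the minimal polynomial of $\zeta_j$ over $\mathbb C\{x_1,x_2\}$, and let $\nu_j:X(\sigma,N_j)\to X^{(j)}$ be its normalization, the germ at the distinguished point of the toric variety $\operatorname{Spec}\mathbb C[\sigma^\vee\cap M_j]$. Let $\sigma_{Sing,j}$ (resp. $\sigma_{Reg,j}$) be the union of the relative interiors of those faces of $\sigma$ whose orbit is contained in $\nu_j^{-1}(X^{(j)}_{Sing})$ (resp. in its complement), and $\sigma_{Sing}=\sigma_{Sing,g}$. Let - $H_m=\{\nu\in[0,m]^2\cap\sigma_{Sing}\cap N_0: l_{m(\nu)}(\nu)\ge m+1\}$, - $L_m=\{\nu\in[0,m]^2\cap\sigma_{Sing}\cap N_1: l_{m(\nu)}(\nu)\le m<l_{i(\nu)}(\nu)\}$, - $L_m^{=}=\{\nu\in L_m: l_{m(\nu)}(\nu)\le m<\min\{l_{m(\nu)}(\nu)+e_{m(\nu)},\,l_{i(\nu)}(\nu)\}\}$,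 - $L_m^{<}=\{\nu\in L_m: l_{m(\nu)}(\nu)+e_{m(\nu)}\le m<l_{i(\nu)}(\nu)\}$, - $P_m$ the set of minimal elements of $H_m\cup L_m^{=}$ for the product order $\le_p$ on $\mathbb Z^2$. For $\varepsilon>0$ let $X_\varepsilon=\{|x_1|<\varepsilon,\ |x_2|<\varepsilon,\ f=0\}$. For $\nu\in[0,m]^2\cap N_0$ let $D_m^\nu$ be the set of $m$-jets $\gamma$ of $X_\varepsilon$ (i.e. $\gamma(t)=(x_1(t),x_2(t),z(t))$ modulo $t^{m+1}$, with $|x_1(0)|,|x_2(0)|<\varepsilon$ and $f(\gamma(t))\equiv0\bmod t^{m+1}$) such that $\operatorname{ord}_t(x_i\circ\gamma)=\nu_i$ for $i=1,2$, and let $C_m^\nu=\overline{D_m^\nu}$ be its Zariski closure, i.e. the smallest closed analytic subset containing it of the space of all $m$-jets of $\mathbb C^3$ centred in $\{|x_1|<\varepsilon,|x_2|<\varepsilon\}$. **Proposition.** There is $\varepsilon_0>0$ (depending only on $X$) such that for every $0<\varepsilon\le\varepsilon_0$ the following holds: for all $m\in\mathbb Z_{>0}$, $\nu\in L_m^<$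 and $\nu'\in P_m\cup L_m^<$ with $\nu\le_p\nu'$ and $\nu\ne\nu'$, if $\nu'-\nu\in\sigma_{Reg,j'(m,\nu)}$ then $C_m^{\nu'}\subseteq C_m^{\nu}$. -/

import Mathlib

open Filter Topology

namespace QuasiOrdinary

noncomputable section

/-! ### Convergent power series in two variables -/

/-- A formal power series in `x₁, x₂` is convergent if it converges absolutely on some polydisc. -/
def IsConvergent (h : MvPowerSeries (Fin 2) ℂ) : Prop :=
  ∃ r : ℝ, 0 < r ∧ Summable fun a : Fin 2 →₀ ℕ => ‖MvPowerSeries.coeff a h‖ * r ^ a.degree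

theorem summable_of_le {h : MvPowerSeries (Fin 2) ℂ} {r s : ℝ} (hs : 0 < s) (hsr : s ≤ r)
    (H : Summable fun a : Fin 2 →₀ ℕ => ‖MvPowerSeries.coeff a h‖ * r ^ a.degree) :
    Summable fun a : Fin 2 →₀ ℕ => ‖MvPowerSeries.coeff a h‖ * s ^ a.degree :=
  H.of_nonneg_of_le (fun _ => by positivity) (fun _ => by gcongr)

theorem isConvergent_mul {h k : MvPowerSeries (Fin 2) ℂ} (hh : IsConvergent h)
    (hk : IsConvergent k) : IsConvergent (h * k) := by
  obtain ⟨r, hr, Hr⟩ := hh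
  obtain ⟨s, hs, Hs⟩ := hk
  refine ⟨min r s, lt_min hr hs, ?_⟩
  have Hr' := summable_of_le (lt_min hr hs) (min_le_left r s) Hr
  have Hs' := summable_of_le (lt_min hr hs) (min_le_right r s) Hs
  have hpos : 0 < min r s := lt_min hr hs
  set q := min r s
  have := summable_sum_mul_antidiagonal_of_summable_mul (A := Fin 2 →₀ ℕ)
    (Summable.mul_of_nonneg Hr' Hs' (fun _ => by positivity) (fun _ => by positivity))
  refine this.of_nonneg_of_le (fun _ => by positivity) (fun a => ?_)
  rw [MvPowerSeries.coeff_mul]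
  refine (mul_le_mul_of_nonneg_right (norm_sum_le _ _) (by positivity)).trans (le_of_eq ?_)
  rw [Finset.sum_mul]
  refine Finset.sum_congr rfl fun b hb => ?_
  rw [← Finset.HasAntidiagonal.mem_antidiagonal.mp hb, map_add, pow_add, norm_mul]
  ring

theorem isConvergent_add {h k : MvPowerSeries (Fin 2) ℂ} (hh : IsConvergent h)
    (hk : IsConvergent k) : IsConvergent (h + k) := by
  obtain ⟨r, hr, Hr⟩ := hh
  obtain ⟨s, hs, Hs⟩ := hk
  refine ⟨min r s, lt_min hr hs, ?_⟩
  have Hr' := summable_of_le (lt_min hr hs) (min_le_left r s) Hr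
  have Hs' := summable_of_le (lt_min hr hs) (min_le_right r s) Hs
  have hpos : 0 < min r s := lt_min hr hs
  refine (Hr'.add Hs').of_nonneg_of_le (fun _ => by positivity) (fun a => ?_)
  rw [map_add, ← add_mul]
  gcongr
  exact norm_add_le _ _

theorem isConvergent_one : IsConvergent 1 := by
  refine ⟨1, one_pos, summable_of_hasFiniteSupport ((Set.finite_singleton 0).subset fun a ha => ?_)⟩
  by_contra h
  exact ha (by simp [MvPowerSeries.coeff_one, show a ≠ 0 from h])

theorem isConvergent_zero : IsConvergent 0 := ⟨1, one_pos, by simp⟩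

theorem isConvergent_neg {h : MvPowerSeries (Fin 2) ℂ} (hh : IsConvergent h) :
    IsConvergent (-h) := by
  obtain ⟨r, hr, Hr⟩ := hh
  exact ⟨r, hr, by simpa using Hr⟩

/-- The ring `ℂ{x₁, x₂}` of convergent power series. -/
def ConvSeries : Subring (MvPowerSeries (Fin 2) ℂ) where
  carrier := {h | IsConvergent h}
  mul_mem' := isConvergent_mul
  one_mem' := isConvergent_one
  add_mem' := isConvergent_add
  zero_mem' := isConvergent_zero
  neg_mem' := isConvergent_neg

/-- The sum of the power series `h` at the point `x` (used only where the series converges). -/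
def evalSeries (h : MvPowerSeries (Fin 2) ℂ) (x : Fin 2 → ℂ) : ℂ :=
  ∑' a : Fin 2 →₀ ℕ, MvPowerSeries.coeff a h * ∏ i, x i ^ a i

/-- The value at `p = (x₁, x₂, z)` of a polynomial in `z` with coefficients in `ℂ{x₁, x₂}`. -/
def evalPoly (P : Polynomial ConvSeries) (p : Fin 3 → ℂ) : ℂ :=
  ∑ k ∈ Finset.range (P.natDegree + 1),
    evalSeries (P.coeff k : MvPowerSeries (Fin 2) ℂ) ![p 0, p 1] * p 2 ^ k

/-- Singular points of the surface `P = 0`, for a polynomial `P` without multiple factors: the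
points of the surface at which all first order partial derivatives of `P` vanish. -/
def IsSingularPoint (P : Polynomial ConvSeries) (p : Fin 3 → ℂ) : Prop :=
  evalPoly P p = 0 ∧ fderiv ℂ (evalPoly P) p = 0

/-! ### Fractional power series -/

/-- Formal power series in `u₁ = x₁^(1/n)`, `u₂ = x₂^(1/n)`. -/
def Puiseux (_n : ℕ) : Type := MvPowerSeries (Fin 2) ℂ

instance (n : ℕ) : CommRing (Puiseux n) := inferInstanceAs (CommRing (MvPowerSeries (Fin 2) ℂ))

/-- A convergent series in `x₁, x₂` becomes a series in `u₁, u₂` by `xᵢ = uᵢ ^ n`. -/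
instance (n : ℕ) [NeZero n] : Algebra ConvSeries (Puiseux n) :=
  RingHom.toAlgebra (S := MvPowerSeries (Fin 2) ℂ)
    ((MvPowerSeries.expand (σ := Fin 2) (R := ℂ) n (NeZero.ne n)).toRingHom.comp
      ConvSeries.subtype)

variable {n : ℕ}

/-- The fractional power series seen as a power series in `u₁, u₂`. -/
def Puiseux.toSeries (ζ : Puiseux n) : MvPowerSeries (Fin 2) ℂ := ζ

open Classical in
/-- The coefficient `β_λ` of `x^λ` in the fractional power series `ζ = ∑ β_λ x^λ`. -/
def Puiseux.coeffAt (ζ : Puiseux n) (lam : Fin 2 → ℚ) : ℂ :=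
  if h : ∃ a : Fin 2 →₀ ℕ, ∀ i, (a i : ℚ) = n * lam i then
    MvPowerSeries.coeff h.choose ζ.toSeries else 0

/-! ### The lattices and the integers attached to a sequence of exponents
A sequence `λ₁, …, λ_g` in `ℚ²` is given by a function `lam` on `ℕ` with `lam 0 = 0`; only the
values at `0, …, g` are used. -/

/-- The lattice `M_j = ℤ² + ℤ λ₁ + ⋯ + ℤ λ_j`. -/
def latM (lam : ℕ → Fin 2 → ℚ) (j : ℕ) : AddSubgroup (Fin 2 → ℚ) :=
  AddSubgroup.closure (Set.range (fun i : Fin 2 => Pi.single i (1 : ℚ)) ∪ lam '' Set.Icc 1 j)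

theorem single_mem_latM (lam : ℕ → Fin 2 → ℚ) (j : ℕ) (i : Fin 2) :
    Pi.single i (1 : ℚ) ∈ latM lam j :=
  AddSubgroup.subset_closure (Or.inl ⟨i, rfl⟩)

/-- `n_j = [M_j : M_{j-1}]` for `j ≥ 1`, and `n_0 = 1`. -/
def idx (lam : ℕ → Fin 2 → ℚ) (j : ℕ) : ℕ :=
  if j = 0 then 1 else (latM lam (j - 1)).relIndex (latM lam j)

/-- `γ_0 = 0` and `γ_{j+1} = n_j γ_j + λ_{j+1} - λ_j`; in particular `γ_1 = λ_1`. -/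
def gam (lam : ℕ → Fin 2 → ℚ) : ℕ → Fin 2 → ℚ
  | 0 => 0
  | j + 1 => (idx lam j : ℚ) • gam lam j + lam (j + 1) - lam j

/-- The characteristic exponents `λ₁ ≤ ⋯ ≤ λ_g` of `ζ`. -/
structure IsCharExponents (ζ : Puiseux n) (g : ℕ) (lam : ℕ → Fin 2 → ℚ) : Prop where
  lam_zero : lam 0 = 0
  mono : ∀ j < g, lam j ≤ lam (j + 1)
  coeff_ne_zero : ∀ j, 1 ≤ j → j ≤ g → ζ.coeffAt (lam j) ≠ 0
  mem_latM : ∀ mu, ζ.coeffAt mu ≠ 0 → ∀ j ≤ g, lam j ≤ mu → (j < g → ¬ lam (j + 1) ≤ mu) →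
    mu ∈ latM lam j
  not_mem_latM : ∀ j < g, lam (j + 1) ∉ latM lam j

/-- An irreducible quasi-ordinary surface germ `(X, 0) ⊂ (ℂ³, 0)`, given by an irreducible
quasi-ordinary Weierstrass polynomial `f ∈ ℂ{x₁, x₂}[z]` of degree `n` and a normalized root
`ζ ∈ ℂ{x₁^(1/n), x₂^(1/n)}` of `f`, with its characteristic exponents `λ₁, …, λ_g`, `g ≥ 1`. -/
structure QOSurface (n : ℕ) [NeZero n] where
  f : Polynomial ConvSeries
  monic : f.Monic
  natDegree_eq : f.natDegree = n
  weierstrass : ∀ k < n,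
    MvPowerSeries.constantCoeff (f.coeff k : MvPowerSeries (Fin 2) ℂ) = 0
  irreducible : Irreducible f
  /-- the discriminant is a monomial times a unit of `ℂ{x₁, x₂}` -/
  discr_eq : ∃ (d : Fin 2 →₀ ℕ) (u : ConvSeriesˣ), (f.discr : MvPowerSeries (Fin 2) ℂ) =
    MvPowerSeries.monomial d 1 * ((u : ConvSeries) : MvPowerSeries (Fin 2) ℂ)
  ζ : Puiseux n
  convergent : IsConvergent ζ.toSeries
  root : Polynomial.aeval ζ f = 0
  g : ℕ
  one_le_g : 1 ≤ g
  lam : ℕ → Fin 2 → ℚ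
  charExponents : IsCharExponents ζ g lam
  /-- `(λ₁⁽¹⁾, …, λ_g⁽¹⁾)` is lexicographically at least `(λ₁⁽²⁾, …, λ_g⁽²⁾)` -/
  lex : ∀ k, 1 ≤ k → k ≤ g → (∀ i, 1 ≤ i → i < k → lam i 0 = lam i 1) → lam k 1 ≤ lam k 0
  /-- `λ₁` is not of the form `(a, 0)` with `a < 1` -/
  normalized : ¬ (lam 1 1 = 0 ∧ lam 1 0 < 1)

namespace QOSurface

variable [NeZero n] (X : QOSurface n)

/-- `n_j` -/
def nn (j : ℕ) : ℕ := idx X.lam j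

/-- `e_j = n_{j+1} ⋯ n_g`, so that `e_g = 1` -/
def e (j : ℕ) : ℕ := ∏ k ∈ Finset.Ioc j X.g, X.nn k

/-- The pairing `⟨ν, u⟩`. -/
def pair (ν : Fin 2 → ℕ) (u : Fin 2 → ℚ) : ℚ := ∑ i, (ν i : ℚ) * u i

/-- The vector `ν ∈ ℤ²_{≥0} = σ ∩ N_0` lies in the lattice `N_j` dual to `M_j`. -/
def MemN (j : ℕ) (ν : Fin 2 → ℕ) : Prop :=
  ∀ u ∈ latM X.lam j, ∃ k : ℤ, pair ν u = k

/-- `l_i(ν) = n_i e_i ⟨ν, γ_i⟩` for `i ≤ g` (so `l_0(ν) = 0`), and `l_{g+1}(ν) = ∞`. -/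
def l (i : ℕ) (ν : Fin 2 → ℕ) : WithTop ℚ :=
  if i ≤ X.g then ((X.nn i * X.e i * pair ν (gam X.lam i) : ℚ) : WithTop ℚ) else ⊤

open Classical in
/-- `i(ν) = g + 1` if `ν ∈ N_g`, and otherwise the least `i ∈ {1, …, g}` with `ν ∉ N_i`. -/
def iIdx (ν : Fin 2 → ℕ) : ℕ :=
  if X.MemN X.g ν then X.g + 1 else sInf {i | 1 ≤ i ∧ i ≤ X.g ∧ ¬ X.MemN i ν}

/-- `m(ν)` is the least `i ∈ {1, …, g}` with `n_i ⟨ν, γ_i⟩ < ⟨ν, γ_{i+1}⟩`, where `γ_{g+1} = ∞`,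
that is, the inequality is satisfied for `i = g`. -/
def mIdx (ν : Fin 2 → ℕ) : ℕ :=
  sInf {i | 1 ≤ i ∧ i ≤ X.g ∧
    (i < X.g → X.nn i * pair ν (gam X.lam i) < pair ν (gam X.lam (i + 1)))}

/-- `j(m, ν)`: the integer `j ∈ {0, …, i(ν) - 1}` with `l_j(ν) ≤ m < l_{j+1}(ν)`. -/
def jIdx (m : ℕ) (ν : Fin 2 → ℕ) : ℕ :=
  sSup {j | j < X.iIdx ν ∧ X.l j ν ≤ (m : WithTop ℚ) ∧ (m : WithTop ℚ) < X.l (j + 1) ν}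

/-- `j'(m, ν)`: the integer `j ∈ {0, …, j(m, ν)}` with
`l_j(ν) + e_j ≤ m < l_{j+1}(ν) + e_{j+1}` (the largest one if there are several). -/
def jIdx' (m : ℕ) (ν : Fin 2 → ℕ) : ℕ :=
  sSup {j | j ≤ X.jIdx m ν ∧ X.l j ν + (X.e j : WithTop ℚ) ≤ (m : WithTop ℚ) ∧
    (m : WithTop ℚ) < X.l (j + 1) ν + (X.e (j + 1) : WithTop ℚ)}

/-! ### The surfaces `X⁽ʲ⁾`, their normalizations and the fans `σ_Sing,j`, `σ_Reg,j` -/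

open Classical in
/-- The truncation `ζ_j = ∑_{λ ≱ λ_{j+1}} β_λ x^λ`, for `j < g`; and `ζ_g = ζ`. -/
def trunc (j : ℕ) : Puiseux n :=
  (fun a : Fin 2 →₀ ℕ =>
    if j < X.g ∧ X.lam (j + 1) ≤ (fun i => (a i : ℚ) / n) then 0
    else MvPowerSeries.coeff a X.ζ.toSeries : MvPowerSeries (Fin 2) ℂ)

/-- The polynomial `f_j` defining the surface `X⁽ʲ⁾` parametrized by `ζ_j`: the minimal
polynomial of `ζ_j` over `ℂ{x₁, x₂}`. -/
def semiRoot (j : ℕ) : Polynomial ConvSeries := minpoly ConvSeries (X.trunc j)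

/-- The semigroup `σ^∨ ∩ M_j`. -/
def dualSemigroup (j : ℕ) : AddSubmonoid (Fin 2 → ℚ) where
  carrier := {u | u ∈ latM X.lam j ∧ 0 ≤ u}
  add_mem' ha hb := ⟨add_mem ha.1 hb.1, add_nonneg ha.2 hb.2⟩
  zero_mem' := ⟨zero_mem _, le_rfl⟩

/-- The closed points of the toric variety `X(σ, N_j) = Spec ℂ[σ^∨ ∩ M_j]`. -/
abbrev ToricPoint (j : ℕ) : Type := Multiplicative (X.dualSemigroup j) →* ℂ

/-- The value of the monomial `x^u` at a point of the toric variety. -/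
def monomialAt {j : ℕ} (p : X.ToricPoint j) (u : X.dualSemigroup j) : ℂ :=
  p (Multiplicative.ofAdd u)

/-- The value of the coordinate `x_i` at a point of the toric variety. -/
def coordAt {j : ℕ} (p : X.ToricPoint j) (i : Fin 2) : ℂ :=
  X.monomialAt p ⟨Pi.single i 1, single_mem_latM X.lam j i, by simp⟩

/-- The normalization `ν_j : X(σ, N_j) → X⁽ʲ⁾`, which sends a point (near the distinguished
point, where all `x^u` with `u ≠ 0` vanish) to the values of `x₁`, `x₂` and `ζ_j` there. -/
def normalization (j : ℕ) (p : X.ToricPoint j) : Fin 3 → ℂ :=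
  ![X.coordAt p 0, X.coordAt p 1,
    ∑' u : X.dualSemigroup j, (X.trunc j).coeffAt (u : Fin 2 → ℚ) * X.monomialAt p u]

/-- The torus orbit of the toric variety that corresponds to the face `τ` of `σ = ℝ²_{≥0}` whose
relative interior contains `v`: the points at which `x^u ≠ 0` exactly for the `u` orthogonal to
`τ`. -/
def orbit (j : ℕ) (v : Fin 2 → ℝ) : Set (X.ToricPoint j) :=
  {p | ∀ u : X.dualSemigroup j,
    X.monomialAt p u ≠ 0 ↔ ∀ i, v i ≠ 0 → (u : Fin 2 → ℚ) i = 0}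

/-- `σ_Sing,j`: the union of the relative interiors of the faces of `σ` whose orbits are contained
in the preimage of the singular locus of the germ `X⁽ʲ⁾`. -/
def sigmaSing (j : ℕ) : Set (Fin 2 → ℝ) :=
  {v | 0 ≤ v ∧ ∃ δ : ℝ, 0 < δ ∧ ∀ p ∈ X.orbit j v, (∀ i, ‖X.coordAt p i‖ < δ) →
    IsSingularPoint (X.semiRoot j) (X.normalization j p)}

/-- `σ_Reg,j`: the union of the relative interiors of the faces of `σ` whose orbits are contained
in the complement of the preimage of the singular locus of the germ `X⁽ʲ⁾`. -/
def sigmaReg (j : ℕ) : Set (Fin 2 → ℝ) :=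
  {v | 0 ≤ v ∧ ∃ δ : ℝ, 0 < δ ∧ ∀ p ∈ X.orbit j v, (∀ i, ‖X.coordAt p i‖ < δ) →
    ¬ IsSingularPoint (X.semiRoot j) (X.normalization j p)}

/-! ### The index sets -/

/-- `[0, m]² ∩ σ_Sing ∩ N_0`, where `σ_Sing = σ_Sing,g` -/
def box (m : ℕ) : Set (Fin 2 → ℕ) :=
  {ν | (∀ i, ν i ≤ m) ∧ (fun i => (ν i : ℝ)) ∈ X.sigmaSing X.g}

/-- `H_m` -/
def H (m : ℕ) : Set (Fin 2 → ℕ) :=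
  {ν | ν ∈ X.box m ∧ (m : WithTop ℚ) + 1 ≤ X.l (X.mIdx ν) ν}

/-- `L_m` -/
def L (m : ℕ) : Set (Fin 2 → ℕ) :=
  {ν | ν ∈ X.box m ∧ X.MemN 1 ν ∧
    X.l (X.mIdx ν) ν ≤ (m : WithTop ℚ) ∧ (m : WithTop ℚ) < X.l (X.iIdx ν) ν}

/-- `L_m^=` -/
def Leq (m : ℕ) : Set (Fin 2 → ℕ) :=
  {ν | ν ∈ X.L m ∧ X.l (X.mIdx ν) ν ≤ (m : WithTop ℚ) ∧
    (m : WithTop ℚ) < min (X.l (X.mIdx ν) ν + (X.e (X.mIdx ν) : WithTop ℚ)) (X.l (X.iIdx ν) ν)}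

/-- `L_m^<` -/
def Llt (m : ℕ) : Set (Fin 2 → ℕ) :=
  {ν | ν ∈ X.L m ∧ X.l (X.mIdx ν) ν + (X.e (X.mIdx ν) : WithTop ℚ) ≤ (m : WithTop ℚ) ∧
    (m : WithTop ℚ) < X.l (X.iIdx ν) ν}

/-- `P_m`: the minimal elements of `H_m ∪ L_m^=` for the product order -/
def P (m : ℕ) : Set (Fin 2 → ℕ) := {ν | Minimal (· ∈ X.H m ∪ X.Leq m) ν}

end QOSurface

/-! ### Jets -/

/-- The `m`-jets of `ℂ³`: the coordinate `γ i k` is the coefficient of `t ^ k` in the `i`-th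
component; the components are `x₁, x₂, z`. -/
abbrev Jet (m : ℕ) : Type := Fin 3 → Fin (m + 1) → ℂ

/-- The polynomial curve `t ↦ γ(t)` in `ℂ³`. -/
def Jet.curve {m : ℕ} (γ : Jet m) (t : ℂ) : Fin 3 → ℂ :=
  fun i => ∑ k : Fin (m + 1), γ i k * t ^ (k : ℕ)

/-- The jets centred in the open set `{|x₁| < ε, |x₂| < ε}` of `ℂ³`. -/
def jetDomain (ε : ℝ) (m : ℕ) : Set (Jet m) := {γ | ‖γ 0 0‖ < ε ∧ ‖γ 1 0‖ < ε}

/-- A closed analytic subset of the open set `Ω`: it is, near every point of `Ω`, the set of common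
zeros of finitely many holomorphic functions. -/
def IsAnalyticSubset {E : Type*} [NormedAddCommGroup E] [NormedSpace ℂ E] (Ω A : Set E) : Prop :=
  A ⊆ Ω ∧ ∀ p ∈ Ω, ∃ W : Set E, IsOpen W ∧ p ∈ W ∧ W ⊆ Ω ∧
    ∃ (r : ℕ) (h : Fin r → E → ℂ), (∀ i, AnalyticOnNhd ℂ (h i) W) ∧
      ∀ q ∈ W, q ∈ A ↔ ∀ i, h i q = 0

/-- The (analytic) Zariski closure of `S` in the open set `Ω`: the smallest closed analytic subset
of `Ω` that contains `S`. -/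
def zariskiClosure {E : Type*} [NormedAddCommGroup E] [NormedSpace ℂ E] (Ω S : Set E) : Set E :=
  {p | p ∈ Ω ∧ ∀ A : Set E, IsAnalyticSubset Ω A → S ⊆ A → p ∈ A}

namespace QOSurface

variable [NeZero n] (X : QOSurface n)

/-- The `m`-jets of the representative `{|x₁| < ε, |x₂| < ε, f = 0}` of `(X, 0)`: the jets with
`f(γ(t)) ≡ 0 mod t ^ (m + 1)`. -/
def jets (ε : ℝ) (m : ℕ) : Set (Jet m) :=
  {γ | γ ∈ jetDomain ε m ∧ ∀ k ≤ m, iteratedDeriv k (fun t => evalPoly X.f (γ.curve t)) 0 = 0}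

/-- `D_m^ν`: the `m`-jets `γ` of `X` with `ord_t (x_i ∘ γ) = ν_i` for `i = 1, 2`
(for `ν ∈ [0, m]²`). -/
def D (ε : ℝ) (m : ℕ) (ν : Fin 2 → ℕ) : Set (Jet m) :=
  {γ | γ ∈ X.jets ε m ∧ ∀ i : Fin 2,
    (∀ k : Fin (m + 1), (k : ℕ) < ν i → γ i.castSucc k = 0) ∧
    ∃ k : Fin (m + 1), (k : ℕ) = ν i ∧ γ i.castSucc k ≠ 0}

/-- `C_m^ν`: the Zariski closure of `D_m^ν`. -/
def C (ε : ℝ) (m : ℕ) (ν : Fin 2 → ℕ) : Set (Jet m) := zariskiClosure (jetDomain ε m) (X.D ε m ν)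

end QOSurface

end

end QuasiOrdinary

/-! Put `x_i = u_i ^ n` and let `ω ∈ μ_n × μ_n` act on `u`. Since `f` is irreducible, it is the
product of `z - ζ'` over the distinct conjugates `ζ'` of `ζ`, so a power of `f` is the product of `z
- ζ(ω u)` over all `ω`. Let `G_k` be the group of those `ω` that act trivially on monomials with
exponents in `M_k`; then `|G_{k-1}| = n_k |G_k|`. For `ω ∈ G_k` outside `G_{k+1}`, the difference
`ζ(ω u) - ζ(u)` is the monomial of exponent `λ_{k+1}` times a unit. Along a curve with `ord x = ν`
the order of `f` is therefore governed by the pairings `⟨ν, λ_k⟩`, and `|G_g| l_k(ν) = S_k + |G_k|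
⟨ν, λ_k⟩`, where `S_k` collects the conjugates outside `G_k`. With `J = j(m, ν)`, a curve whose `z`
agrees with `ζ_J` up to the order `c_J = (|G_g| (m + 1) - S_J) / |G_J|` has its `m`-jet on `X`
(`jetOf_mem_D`). Conversely, a jet on `X` is close to some conjugate of `ζ`: the factors far from
the closest conjugate have known size and can be divided out (`exists_closest_conjugate`).

Regularity enters once. Put `j = j'(m, ν) ≥ 1`. The origin of `X⁽ʲ⁾` is singular, so a nonzero `ν' -
ν` in `σ_Reg,j` lies on a coordinate ray, in direction `i` say. Estimating the product formula for
`f_j` near the curve `x_i = 0` shows that this curve consists of singular points unless `λ_j^{(i)} =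
0`, or `λ_{j-1}^{(i)} = 0` and `n_j λ_j^{(i)} = 1` (`exists_of_mem_sigmaReg`).

Analytic sets are closed, so it suffices to exhibit each jet in `D_m^{ν'}` as a limit, for `s → 0`,
of jets in `D_m^ν`. Write `x_i = t ^ ν_i g(t)` with `g(0) = 0`; the deformation has to make `g(0)`
nonzero and keep `z` close to `ζ_J`.

If `λ_j^{(i)} = 0`, take the largest `k` between `j` and `J` with `λ_k^{(i)} = 0`. Then `ζ_k` is a
genuine power series in `x_i`: replace `g` by `g + s` and keep `z - ζ_k` fixed
(`mem_C_of_lam_eq_zero`).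

In the other case put `k = j - 1`. Now `ζ_{k+1} - ζ_k` is `t ^ q y` times a unit, where `y ^ n_{k+1}
= g`. So `y` can be recovered from `z - ζ_k` to any order, and `y ↦ y + s` gives the deformation
(`exists_approx`, `mem_C_of_transversal`).

It remains to pass from the level `k ≥ j` reached in this way (`j` itself in the second case) to
`J`. By the definition of `j'(m, ν)`, the numbers `⟨ν, λ_{k+1}⟩, …, ⟨ν, λ_J⟩` are all equal to one
integer `Q` and `c_J ≤ Q + 1`. Hence only the coefficient of `t ^ Q` in `ζ_J - ζ_k` matters; it is
removed by adding `W_s t ^ Q` to `z`, and `W_s → 0` because `x_i` divides the leading monomial to a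
positive power (`exists_correction`, `mem_C_of_family`).

Rational bounds become integral ones because the functions compared are analytic in `t`. That is
where `ν ∈ N_J` is used: monomials with exponents in `M_J` restrict to integral powers of `t`. -/

namespace QuasiOrdinary

open Polynomial Asymptotics

noncomputable section

set_option linter.unusedSectionVars false

/-! ### Evaluation of convergent power series -/

/-- The power series `h` converges absolutely on the closed polydisc of radius `r`. -/
def ConvOn (r : ℝ) (h : MvPowerSeries (Fin 2) ℂ) : Prop :=
  Summable fun a : Fin 2 →₀ ℕ => ‖MvPowerSeries.coeff a h‖ * r ^ a.degree

theorem ConvOn.mono {h : MvPowerSeries (Fin 2) ℂ} {r s : ℝ} (H : ConvOn r h) (hs : 0 ≤ s)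
    (hsr : s ≤ r) : ConvOn s h :=
  Summable.of_nonneg_of_le (fun _ => by positivity) (fun _ => by gcongr) H

theorem ConvOn.mul {h k : MvPowerSeries (Fin 2) ℂ} {r : ℝ} (hr : 0 ≤ r) (hh : ConvOn r h)
    (hk : ConvOn r k) : ConvOn r (h * k) := by
  have := summable_sum_mul_antidiagonal_of_summable_mul (A := Fin 2 →₀ ℕ)
    (Summable.mul_of_nonneg hh hk (fun _ => by positivity) (fun _ => by positivity))
  refine this.of_nonneg_of_le (fun _ => by positivity) (fun a => ?_)
  rw [MvPowerSeries.coeff_mul]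
  refine (mul_le_mul_of_nonneg_right (norm_sum_le _ _) (by positivity)).trans (le_of_eq ?_)
  rw [Finset.sum_mul]
  refine Finset.sum_congr rfl fun b hb => ?_
  rw [← Finset.HasAntidiagonal.mem_antidiagonal.mp hb, map_add, pow_add, norm_mul]
  ring

theorem ConvOn.add {h k : MvPowerSeries (Fin 2) ℂ} {r : ℝ} (hr : 0 ≤ r) (hh : ConvOn r h)
    (hk : ConvOn r k) : ConvOn r (h + k) := by
  refine (Summable.add hh hk).of_nonneg_of_le (fun _ => by positivity) (fun a => ?_)
  rw [map_add, ← add_mul]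
  gcongr
  exact norm_add_le _ _

theorem ConvOn.neg {h : MvPowerSeries (Fin 2) ℂ} {r : ℝ} (hh : ConvOn r h) : ConvOn r (-h) := by
  simpa [ConvOn] using hh

theorem ConvOn.sub {h k : MvPowerSeries (Fin 2) ℂ} {r : ℝ} (hr : 0 ≤ r) (hh : ConvOn r h)
    (hk : ConvOn r k) : ConvOn r (h - k) := by
  rw [sub_eq_add_neg]; exact hh.add hr hk.neg

theorem convOn_zero (r : ℝ) : ConvOn r 0 := by simp [ConvOn, summable_zero]

theorem convOn_one (r : ℝ) : ConvOn r 1 := by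
  refine summable_of_hasFiniteSupport ((Set.finite_singleton 0).subset fun a ha => ?_)
  by_contra h
  exact ha (by simp [MvPowerSeries.coeff_one, show a ≠ 0 from h])

theorem ConvOn.of_norm_le {h k : MvPowerSeries (Fin 2) ℂ} {r : ℝ} (hr : 0 ≤ r) (hk : ConvOn r k)
    (H : ∀ a, ‖MvPowerSeries.coeff a h‖ ≤ ‖MvPowerSeries.coeff a k‖) : ConvOn r h :=
  Summable.of_nonneg_of_le (fun _ => by positivity)
    (fun a => mul_le_mul_of_nonneg_right (H a) (by positivity)) hk

/-- The ring of power series that converge absolutely on the closed polydisc of radius `r`. -/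
def convRing (r : ℝ) (hr : 0 ≤ r) : Subring (MvPowerSeries (Fin 2) ℂ) where
  carrier := {h | ConvOn r h}
  mul_mem' := ConvOn.mul hr
  one_mem' := convOn_one r
  add_mem' := ConvOn.add hr
  zero_mem' := convOn_zero r
  neg_mem' := ConvOn.neg

theorem norm_prod_pow_le {U : Fin 2 → ℂ} {r : ℝ} (hU : ∀ i, ‖U i‖ ≤ r) (a : Fin 2 →₀ ℕ) :
    ‖∏ i, U i ^ a i‖ ≤ r ^ a.degree := by
  rw [norm_prod, Finsupp.degree_eq_sum, ← Finset.prod_pow_eq_pow_sum]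
  refine Finset.prod_le_prod (fun _ _ => norm_nonneg _) fun i _ => ?_
  rw [norm_pow]
  exact pow_le_pow_left₀ (norm_nonneg _) (hU i) _

theorem norm_term_le {h : MvPowerSeries (Fin 2) ℂ} {U : Fin 2 → ℂ} {r : ℝ} (hU : ∀ i, ‖U i‖ ≤ r)
    (a : Fin 2 →₀ ℕ) :
    ‖MvPowerSeries.coeff a h * ∏ i, U i ^ a i‖ ≤ ‖MvPowerSeries.coeff a h‖ * r ^ a.degree := by
  rw [norm_mul]
  exact mul_le_mul_of_nonneg_left (norm_prod_pow_le hU a) (norm_nonneg _)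

theorem ConvOn.summable_norm {h : MvPowerSeries (Fin 2) ℂ} {U : Fin 2 → ℂ} {r : ℝ}
    (H : ConvOn r h) (hU : ∀ i, ‖U i‖ ≤ r) :
    Summable fun a => ‖MvPowerSeries.coeff a h * ∏ i, U i ^ a i‖ :=
  Summable.of_nonneg_of_le (fun _ => norm_nonneg _) (norm_term_le hU) H

theorem ConvOn.summable {h : MvPowerSeries (Fin 2) ℂ} {U : Fin 2 → ℂ} {r : ℝ}
    (H : ConvOn r h) (hU : ∀ i, ‖U i‖ ≤ r) :
    Summable fun a => MvPowerSeries.coeff a h * ∏ i, U i ^ a i :=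
  (H.summable_norm hU).of_norm

theorem evalSeries_one (U : Fin 2 → ℂ) : evalSeries 1 U = 1 := by
  rw [evalSeries, tsum_eq_single 0]
  · simp
  · intro a ha
    simp [MvPowerSeries.coeff_one, ha]

theorem evalSeries_zero (U : Fin 2 → ℂ) : evalSeries 0 U = 0 := by simp [evalSeries]

theorem evalSeries_neg (h : MvPowerSeries (Fin 2) ℂ) (U : Fin 2 → ℂ) :
    evalSeries (-h) U = - evalSeries h U := by simp [evalSeries, tsum_neg]

theorem evalSeries_add {h k : MvPowerSeries (Fin 2) ℂ} {U : Fin 2 → ℂ} {r : ℝ}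
    (hh : ConvOn r h) (hk : ConvOn r k) (hU : ∀ i, ‖U i‖ ≤ r) :
    evalSeries (h + k) U = evalSeries h U + evalSeries k U := by
  rw [evalSeries, evalSeries, evalSeries, ← (hh.summable hU).tsum_add (hk.summable hU)]
  simp [add_mul]

theorem evalSeries_sub {h k : MvPowerSeries (Fin 2) ℂ} {U : Fin 2 → ℂ} {r : ℝ}
    (hh : ConvOn r h) (hk : ConvOn r k) (hU : ∀ i, ‖U i‖ ≤ r) :
    evalSeries (h - k) U = evalSeries h U - evalSeries k U := by
  rw [sub_eq_add_neg, evalSeries_add hh hk.neg hU, evalSeries_neg, sub_eq_add_neg]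

theorem tsum_mul_tsum_antidiagonal {f g : (Fin 2 →₀ ℕ) → ℂ} (hf : Summable fun a => ‖f a‖)
    (hg : Summable fun a => ‖g a‖) : (∑' a, f a) * ∑' a, g a =
      ∑' a, ∑ b ∈ Finset.HasAntidiagonal.antidiagonal a, f b.1 * g b.2 :=
  Summable.tsum_mul_tsum_eq_tsum_sum_antidiagonal hf.of_norm hg.of_norm
    (summable_mul_of_summable_norm hf hg)

theorem evalSeries_mul {h k : MvPowerSeries (Fin 2) ℂ} {U : Fin 2 → ℂ} {r : ℝ}
    (hh : ConvOn r h) (hk : ConvOn r k) (hU : ∀ i, ‖U i‖ ≤ r) :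
    evalSeries (h * k) U = evalSeries h U * evalSeries k U := by
  rw [evalSeries, evalSeries, evalSeries,
    tsum_mul_tsum_antidiagonal (hh.summable_norm hU) (hk.summable_norm hU)]
  refine tsum_congr fun a => ?_
  rw [MvPowerSeries.coeff_mul, Finset.sum_mul]
  refine Finset.sum_congr rfl fun b hb => ?_
  rw [← Finset.HasAntidiagonal.mem_antidiagonal.mp hb]
  simp only [Finsupp.add_apply, pow_add, Finset.prod_mul_distrib]
  ring

/-- Evaluation at a point of the polydisc of radius `r`, as a ring homomorphism. -/
def evalHom (r : ℝ) (hr : 0 ≤ r) (U : Fin 2 → ℂ) (hU : ∀ i, ‖U i‖ ≤ r) : convRing r hr →+* ℂ where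
  toFun h := evalSeries h U
  map_one' := evalSeries_one U
  map_zero' := evalSeries_zero U
  map_add' h k := evalSeries_add h.2 k.2 hU
  map_mul' h k := evalSeries_mul h.2 k.2 hU

theorem evalSeries_at_zero (h : MvPowerSeries (Fin 2) ℂ) :
    evalSeries h 0 = MvPowerSeries.constantCoeff h := by
  rw [evalSeries, tsum_eq_single 0]
  · simp
  · intro a ha
    obtain ⟨i, hi⟩ : ∃ i, a i ≠ 0 := by
      by_contra! H
      exact ha (Finsupp.ext H)
    rw [Finset.prod_eq_zero (Finset.mem_univ i) (by simp [hi]), mul_zero]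

theorem ConvOn.exists_bound {h : MvPowerSeries (Fin 2) ℂ} {r : ℝ} (H : ConvOn r h) :
    ∃ C : ℝ, 0 ≤ C ∧ ∀ U : Fin 2 → ℂ, (∀ i, ‖U i‖ ≤ r) → ‖evalSeries h U‖ ≤ C := by
  by_cases hr : 0 ≤ r
  · refine ⟨∑' a : Fin 2 →₀ ℕ, ‖MvPowerSeries.coeff a h‖ * r ^ a.degree,
      tsum_nonneg fun _ => by positivity, fun U hU => ?_⟩
    exact tsum_of_norm_bounded (Summable.hasSum H) (norm_term_le hU)
  · exact ⟨0, le_rfl, fun U hU => absurd ((norm_nonneg _).trans (hU 0)) hr⟩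

/-- Telescoping `x ^ k - y ^ k` costs the factor `k s ^ (k - 1)`. Passing to the larger radius
absorbs it, since `(r - s) k s ^ (k - 1) ≤ r ^ k - s ^ k`, and the resulting constant can be summed
over a convergent series. -/
theorem norm_pow_sub_pow_le' {x y : ℂ} {r s : ℝ} (hx : ‖x‖ ≤ s) (hy : ‖y‖ ≤ s) (hsr : s < r)
    (k : ℕ) : ‖x ^ k - y ^ k‖ ≤ r ^ k / (r - s) * ‖x - y‖ := by
  have hs : 0 ≤ s := (norm_nonneg _).trans hx
  have h1 : ‖∑ i ∈ Finset.range k, x ^ i * y ^ (k - 1 - i)‖ ≤ k * s ^ (k - 1) := by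
    refine (norm_sum_le _ _).trans ((Finset.sum_le_sum (g := fun _ => s ^ (k - 1)) ?_).trans ?_)
    · intro i hi
      have hi' : i < k := by simpa using hi
      rw [norm_mul, norm_pow, norm_pow]
      calc ‖x‖ ^ i * ‖y‖ ^ (k - 1 - i) ≤ s ^ i * s ^ (k - 1 - i) := by gcongr
        _ = s ^ (k - 1) := by rw [← pow_add]; congr 1; omega
    · simp
  have h2 : (k * s ^ (k - 1)) * (r - s) ≤ r ^ k := by
    have h3 : (∑ i ∈ Finset.range k, r ^ i * s ^ (k - 1 - i)) * (r - s) = r ^ k - s ^ k :=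
      geom_sum₂_mul r s k
    have h4 : k * s ^ (k - 1) ≤ ∑ i ∈ Finset.range k, r ^ i * s ^ (k - 1 - i) := by
      have : (k : ℝ) * s ^ (k - 1) = ∑ i ∈ Finset.range k, s ^ (k - 1) := by simp
      rw [this]
      refine Finset.sum_le_sum fun i hi => ?_
      have hi' : i < k := by simpa using hi
      calc s ^ (k - 1) = s ^ i * s ^ (k - 1 - i) := by rw [← pow_add]; congr 1; omega
        _ ≤ r ^ i * s ^ (k - 1 - i) := by gcongr
    have h5 : 0 ≤ s ^ k := by positivity
    nlinarith [sub_pos.2 hsr]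
  rw [← geom_sum₂_mul, norm_mul]
  refine mul_le_mul_of_nonneg_right (h1.trans ?_) (norm_nonneg _)
  rwa [le_div_iff₀ (sub_pos.2 hsr)]

theorem ConvOn.lipschitz {h : MvPowerSeries (Fin 2) ℂ} {r s : ℝ} (H : ConvOn r h) (hsr : s < r) :
    ∃ C : ℝ, 0 ≤ C ∧ ∀ U V : Fin 2 → ℂ, (∀ i, ‖U i‖ ≤ s) → (∀ i, ‖V i‖ ≤ s) →
      ‖evalSeries h U - evalSeries h V‖ ≤ C * (‖U 0 - V 0‖ + ‖U 1 - V 1‖) := by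
  by_cases hs : 0 ≤ s
  swap
  · exact ⟨0, le_rfl, fun U V hU => absurd ((norm_nonneg _).trans (hU 0)) hs⟩
  have hr : 0 ≤ r := hs.trans hsr.le
  refine ⟨(∑' a : Fin 2 →₀ ℕ, ‖MvPowerSeries.coeff a h‖ * r ^ a.degree) / (r - s),
    div_nonneg (tsum_nonneg fun _ => by positivity) (sub_nonneg.2 hsr.le), fun U V hU hV => ?_⟩
  have hU' : ∀ i, ‖U i‖ ≤ r := fun i => (hU i).trans hsr.le
  have hV' : ∀ i, ‖V i‖ ≤ r := fun i => (hV i).trans hsr.le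
  rw [evalSeries, evalSeries, ← (H.summable hU').tsum_sub (H.summable hV'), div_mul_eq_mul_div,
    mul_div_assoc]
  refine tsum_of_norm_bounded ((Summable.hasSum H).mul_right _) fun a => ?_
  rw [← mul_sub, norm_mul, mul_assoc]
  refine mul_le_mul_of_nonneg_left ?_ (norm_nonneg _)
  rw [Fin.prod_univ_two, Fin.prod_univ_two, Finsupp.degree_eq_sum, Fin.sum_univ_two, pow_add]
  have e : U 0 ^ a 0 * U 1 ^ a 1 - V 0 ^ a 0 * V 1 ^ a 1 =
    (U 0 ^ a 0 - V 0 ^ a 0) * U 1 ^ a 1 + V 0 ^ a 0 * (U 1 ^ a 1 - V 1 ^ a 1) := by ring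
  rw [e]
  refine (norm_add_le _ _).trans ?_
  rw [norm_mul, norm_mul, norm_pow, norm_pow (V 0)]
  have h0 := norm_pow_sub_pow_le' (hU 0) (hV 0) hsr (a 0)
  have h1 := norm_pow_sub_pow_le' (hU 1) (hV 1) hsr (a 1)
  have h2 : ‖U 1‖ ^ a 1 ≤ r ^ a 1 := pow_le_pow_left₀ (norm_nonneg _) (hU' 1) _
  have h3 : ‖V 0‖ ^ a 0 ≤ r ^ a 0 := pow_le_pow_left₀ (norm_nonneg _) (hV' 0) _
  have hrs : 0 < r - s := sub_pos.2 hsr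
  calc _ ≤ (r ^ a 0 / (r - s) * ‖U 0 - V 0‖) * r ^ a 1 +
        r ^ a 0 * (r ^ a 1 / (r - s) * ‖U 1 - V 1‖) := by gcongr
    _ = _ := by ring

theorem ConvOn.continuousAt {h : MvPowerSeries (Fin 2) ℂ} {r : ℝ} (H : ConvOn r h)
    {U : Fin 2 → ℂ} (hU : ∀ i, ‖U i‖ < r) : ContinuousAt (evalSeries h) U := by
  obtain ⟨s, hs, hsr⟩ : ∃ s, (∀ i, ‖U i‖ < s) ∧ s < r := by
    obtain ⟨s, h1, h2⟩ := exists_between (max_lt (hU 0) (hU 1))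
    refine ⟨s, fun i => ?_, h2⟩
    fin_cases i
    · exact (le_max_left _ _).trans_lt h1
    · exact (le_max_right _ _).trans_lt h1
  obtain ⟨C, hC, hL⟩ := H.lipschitz hsr
  rw [ContinuousAt, tendsto_iff_norm_sub_tendsto_zero]
  have hev : ∀ᶠ V : Fin 2 → ℂ in 𝓝 U, ∀ i, ‖V i‖ < s := by
    rw [eventually_all]
    intro i
    have hc : Continuous fun V : Fin 2 → ℂ => ‖V i‖ := by fun_prop
    exact hc.continuousAt.eventually (gt_mem_nhds (hs i))
  have hlim : Tendsto (fun V : Fin 2 → ℂ => C * (‖V 0 - U 0‖ + ‖V 1 - U 1‖)) (𝓝 U) (𝓝 0) := by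
    have : Continuous (fun V : Fin 2 → ℂ => C * (‖V 0 - U 0‖ + ‖V 1 - U 1‖)) := by fun_prop
    simpa using this.tendsto U
  refine squeeze_zero' (Eventually.of_forall fun _ => norm_nonneg _) ?_ hlim
  filter_upwards [hev] with V hV
  exact hL V U (fun i => (hV i).le) (fun i => (hs i).le)

/-! ### Change of variables -/

theorem evalSeries_rescale (w : Fin 2 → ℂ) (h : MvPowerSeries (Fin 2) ℂ) (U : Fin 2 → ℂ) :
    evalSeries (MvPowerSeries.rescale w h) U = evalSeries h (w * U) := by
  refine tsum_congr fun a => ?_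
  rw [MvPowerSeries.coeff_rescale, Finsupp.prod_fintype _ _ (by simp)]
  simp only [Pi.mul_apply, mul_pow, Finset.prod_mul_distrib]
  ring

theorem ConvOn.rescale {h : MvPowerSeries (Fin 2) ℂ} {r : ℝ} (hr : 0 ≤ r) (H : ConvOn r h)
    {w : Fin 2 → ℂ} (hw : ∀ i, ‖w i‖ = 1) : ConvOn r (MvPowerSeries.rescale w h) := by
  refine H.of_norm_le hr fun a => ?_
  rw [MvPowerSeries.coeff_rescale, Finsupp.prod_fintype _ _ (by simp)]
  simp [hw]

theorem evalSeries_expand {n : ℕ} (hn : n ≠ 0) (h : MvPowerSeries (Fin 2) ℂ) (U : Fin 2 → ℂ) :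
    evalSeries (MvPowerSeries.expand n hn h) U = evalSeries h (fun i => U i ^ n) := by
  have hinj : Function.Injective fun a : Fin 2 →₀ ℕ => n • a := fun a b hab => by
    ext i
    have := DFunLike.congr_fun hab i
    simpa [hn] using this
  rw [evalSeries, ← hinj.tsum_eq]
  · refine tsum_congr fun a => ?_
    rw [MvPowerSeries.coeff_expand_smul]
    simp [pow_mul]
  · intro a ha
    by_contra hcon
    apply ha
    obtain ⟨i, hi⟩ : ∃ i, ¬ n ∣ a i := by
      by_contra! H
      choose b hb using H
      exact hcon ⟨Finsupp.equivFunOnFinite.symm b, by ext i; simp [hb i]⟩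
    simp [MvPowerSeries.coeff_expand_of_not_dvd n hn h hi]

/-- The power series `h / u ^ A`, for a power series `h` that is divisible by `u ^ A`. -/
def shift (A : Fin 2 →₀ ℕ) (h : MvPowerSeries (Fin 2) ℂ) : MvPowerSeries (Fin 2) ℂ :=
  fun a => MvPowerSeries.coeff (a + A) h

theorem coeff_shift (A : Fin 2 →₀ ℕ) (h : MvPowerSeries (Fin 2) ℂ) (a : Fin 2 →₀ ℕ) :
    MvPowerSeries.coeff a (shift A h) = MvPowerSeries.coeff (a + A) h := rfl

theorem ConvOn.shift {h : MvPowerSeries (Fin 2) ℂ} {r : ℝ} (hr : 0 < r) (H : ConvOn r h)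
    (A : Fin 2 →₀ ℕ) : ConvOn r (shift A h) := by
  have := (H.comp_injective (add_left_injective A)).mul_left (r ^ A.degree)⁻¹
  refine this.congr fun a => ?_
  rw [coeff_shift]
  simp only [Function.comp, map_add, pow_add]
  field_simp

theorem evalSeries_eq_mul_shift {A : Fin 2 →₀ ℕ} {h : MvPowerSeries (Fin 2) ℂ}
    (hA : ∀ a, MvPowerSeries.coeff a h ≠ 0 → A ≤ a) (U : Fin 2 → ℂ) :
    evalSeries h U = (∏ i, U i ^ A i) * evalSeries (shift A h) U := by
  rw [evalSeries, evalSeries, ← tsum_mul_left, ← (add_left_injective A).tsum_eq]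
  · refine tsum_congr fun a => ?_
    rw [coeff_shift]
    simp only [Finsupp.add_apply, pow_add, Finset.prod_mul_distrib]
    ring
  · intro a ha
    have : MvPowerSeries.coeff a h ≠ 0 := fun h0 => ha (by simp [h0])
    exact ⟨a - A, tsub_add_cancel_of_le (hA a this)⟩

/-- The power series `k` such that `h(u) = k(u₁ ^ d₁, u₂ ^ d₂)`, if there is one. -/
def contract (d : Fin 2 → ℕ) (h : MvPowerSeries (Fin 2) ℂ) : MvPowerSeries (Fin 2) ℂ :=
  fun a => MvPowerSeries.coeff (Finsupp.equivFunOnFinite.symm fun i => d i * a i) h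

theorem coeff_contract (d : Fin 2 → ℕ) (h : MvPowerSeries (Fin 2) ℂ) (a : Fin 2 →₀ ℕ) :
    MvPowerSeries.coeff a (contract d h) =
      MvPowerSeries.coeff (Finsupp.equivFunOnFinite.symm fun i => d i * a i) h := rfl

theorem injective_mul_exponents {d : Fin 2 → ℕ} (hd : ∀ i, d i ≠ 0) :
    Function.Injective fun a : Fin 2 →₀ ℕ =>
      (Finsupp.equivFunOnFinite.symm fun i => d i * a i : Fin 2 →₀ ℕ) := fun a b hab => by
  ext i
  have := DFunLike.congr_fun hab i
  simpa [hd i] using this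

/-- Contraction divides the exponents by at most `D`, which turns the radius `r` into `r ^ D`; the
condition `r ≤ 1` allows the different `d i` to be replaced by `D`. -/
theorem ConvOn.contract {h : MvPowerSeries (Fin 2) ℂ} {r : ℝ} (hr : 0 ≤ r) (hr1 : r ≤ 1)
    (H : ConvOn r h) {d : Fin 2 → ℕ} (hd : ∀ i, d i ≠ 0) {D : ℕ} (hD : ∀ i, d i ≤ D) :
    ConvOn (r ^ D) (contract d h) := by
  refine (H.comp_injective (injective_mul_exponents hd)).of_nonneg_of_le
    (fun _ => by positivity) (fun a => ?_)
  rw [coeff_contract]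
  refine mul_le_mul_of_nonneg_left ?_ (norm_nonneg _)
  rw [← pow_mul]
  refine pow_le_pow_of_le_one hr hr1 ?_
  simp only [Finsupp.degree_eq_sum, Finset.mul_sum]
  exact Finset.sum_le_sum fun i _ => by simpa using Nat.mul_le_mul_right _ (hD i)

theorem evalSeries_eq_contract {d : Fin 2 → ℕ} (hd : ∀ i, d i ≠ 0)
    {h : MvPowerSeries (Fin 2) ℂ} (H : ∀ a, MvPowerSeries.coeff a h ≠ 0 → ∀ i, d i ∣ a i)
    (U : Fin 2 → ℂ) : evalSeries h U = evalSeries (contract d h) (fun i => U i ^ d i) := by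
  rw [evalSeries, ← (injective_mul_exponents hd).tsum_eq]
  · refine tsum_congr fun a => ?_
    simp [coeff_contract, pow_mul]
  · intro a ha
    have h0 : MvPowerSeries.coeff a h ≠ 0 := fun h0 => ha (by simp [h0])
    choose b hb using H a h0
    exact ⟨Finsupp.equivFunOnFinite.symm b, by ext i; simp [hb i]⟩

section

/-! ### The action of roots of unity on fractional power series -/

/-- The group `μ_n × μ_n`. -/
abbrev Rots (n : ℕ) : Type := Fin 2 → rootsOfUnity n ℂ

variable {n : ℕ}

/-- The coordinates of an element of `μ_n × μ_n`, as complex numbers. -/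
def Rots.val (ω : Rots n) : Fin 2 → ℂ := fun i => ((ω i : ℂˣ) : ℂ)

theorem Rots.val_mul (ω θ : Rots n) : (ω * θ).val = ω.val * θ.val := by
  ext i; simp [Rots.val]

theorem Rots.val_one : (1 : Rots n).val = 1 := by
  ext i; simp [Rots.val]

theorem Rots.val_pow (ω : Rots n) (i : Fin 2) : ω.val i ^ n = 1 := by
  have := (mem_rootsOfUnity n (ω i : ℂˣ)).1 (ω i).2
  simpa [Rots.val] using congrArg Units.val this

theorem Rots.norm_val [NeZero n] (ω : Rots n) (i : Fin 2) : ‖ω.val i‖ = 1 :=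
  Complex.norm_eq_one_of_pow_eq_one (ω.val_pow i) (NeZero.ne n)

theorem Rots.val_ne_zero [NeZero n] (ω : Rots n) (i : Fin 2) : ω.val i ≠ 0 := by
  rw [← norm_ne_zero_iff, ω.norm_val]; exact one_ne_zero

/-- The action of `ω ∈ μ_n × μ_n` on power series, by `u_i ↦ ω_i u_i`. -/
def rot (ω : Rots n) : Puiseux n →+* Puiseux n :=
  (MvPowerSeries.rescale ω.val : MvPowerSeries (Fin 2) ℂ →+* MvPowerSeries (Fin 2) ℂ)

instance : MulSemiringAction (Rots n) (Puiseux n) where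
  smul ω h := rot ω h
  one_smul h := by
    change MvPowerSeries.rescale (1 : Rots n).val _ = _
    rw [Rots.val_one, MvPowerSeries.rescale_one]; rfl
  mul_smul ω θ h := by
    change MvPowerSeries.rescale (ω * θ).val _ =
      MvPowerSeries.rescale ω.val (MvPowerSeries.rescale θ.val _)
    rw [Rots.val_mul, mul_comm]
    exact (MvPowerSeries.rescale_rescale (σ := Fin 2) (R := ℂ) h θ.val ω.val).symm
  smul_zero ω := map_zero (rot ω)
  smul_add ω := map_add (rot ω)
  smul_one ω := map_one (rot ω)
  smul_mul ω := map_mul (rot ω)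

theorem toSeries_smul (ω : Rots n) (h : Puiseux n) :
    (ω • h).toSeries = MvPowerSeries.rescale ω.val h.toSeries := rfl

theorem coeff_smul (ω : Rots n) (h : Puiseux n) (a : Fin 2 →₀ ℕ) :
    MvPowerSeries.coeff a (ω • h).toSeries =
      (∏ i, ω.val i ^ a i) * MvPowerSeries.coeff a h.toSeries := by
  rw [toSeries_smul, MvPowerSeries.coeff_rescale, Finsupp.prod_fintype _ _ (by simp)]

instance : IsDomain (Puiseux n) :=
  have : IsDomain (MvPowerSeries (Fin 2) ℂ) := NoZeroDivisors.to_isDomain _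
  this

/-- This allows the product over the conjugates to be formed in a smaller ring: convergent series,
so that its coefficients converge, or series converging on a fixed polydisc, where evaluation at a
point is a ring homomorphism. -/
theorem exists_preimage_ofQuotientStabilizer {S : Type*} [CommRing S] (j : S →+* Puiseux n)
    {h : Puiseux n} (hS : ∀ ω : Rots n, ∃ s, j s = ω • h) :
    ∃ s : Rots n ⧸ MulAction.stabilizer (Rots n) h → S,
      ∀ q, j (s q) = MulAction.ofQuotientStabilizer (Rots n) h q := by
  refine ⟨fun q => (hS q.out).choose, fun q => ?_⟩
  rw [(hS q.out).choose_spec, ← MulAction.ofQuotientStabilizer_mk, QuotientGroup.out_eq']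

variable [NeZero n]

instance : Fintype (Rots n) := Fintype.ofFinite _

theorem toSeries_algebraMap (c : ConvSeries) : (algebraMap ConvSeries (Puiseux n) c).toSeries =
    MvPowerSeries.expand n (NeZero.ne n) (c : MvPowerSeries (Fin 2) ℂ) := rfl

theorem algebraMap_injective : Function.Injective (algebraMap ConvSeries (Puiseux n)) := by
  intro c d hcd
  ext a
  have := congrArg (fun h : Puiseux n => MvPowerSeries.coeff (n • a) h.toSeries) hcd
  simpa only [toSeries_algebraMap, MvPowerSeries.coeff_expand_smul] using this

theorem smul_algebraMap (ω : Rots n) (c : ConvSeries) :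
    ω • algebraMap ConvSeries (Puiseux n) c = algebraMap ConvSeries (Puiseux n) c := by
  change (ω • algebraMap ConvSeries (Puiseux n) c).toSeries =
    (algebraMap ConvSeries (Puiseux n) c).toSeries
  ext a
  rw [coeff_smul]
  by_cases h : ∀ i, n ∣ a i
  · rw [Finset.prod_eq_one, one_mul]
    intro i _
    obtain ⟨b, hb⟩ := h i
    rw [hb, pow_mul, ω.val_pow, one_pow]
  · push Not at h
    obtain ⟨i, hi⟩ := h
    rw [toSeries_algebraMap, MvPowerSeries.coeff_expand_of_not_dvd n _ _ hi, mul_zero]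

theorem exists_rot_pow_ne_one {a : Fin 2 → ℕ} {i : Fin 2} (hi : ¬ n ∣ a i) :
    ∃ ω : Rots n, ∏ j, ω.val j ^ a j ≠ 1 := by
  have hp := Complex.isPrimitiveRoot_exp n (NeZero.ne n)
  refine ⟨Pi.mulSingle i hp.toRootsOfUnity, ?_⟩
  rw [Finset.prod_eq_single i]
  · simp only [Rots.val, Pi.mulSingle_eq_same, hp.val_toRootsOfUnity_coe]
    rwa [ne_eq, hp.pow_eq_one_iff_dvd]
  · intro j _ hj
    simp [Rots.val, Pi.mulSingle_eq_of_ne hj]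
  · simp

/-- A monomial whose exponents are not all divisible by `n` is multiplied by a number different from
`1` by some rotation, so its coefficient in an invariant series is zero. Contracting the remaining
exponents keeps convergence. -/
theorem exists_algebraMap_eq {c : Puiseux n} (hc : IsConvergent c.toSeries)
    (H : ∀ ω : Rots n, ω • c = c) : ∃ d : ConvSeries, algebraMap ConvSeries (Puiseux n) d = c := by
  obtain ⟨r, hr, hcr⟩ := hc
  have h1 : ConvOn (min r 1) c.toSeries :=
    ConvOn.mono hcr (le_min hr.le zero_le_one) (min_le_left _ _)
  have h2 := h1.contract (le_min hr.le zero_le_one) (min_le_right _ _)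
    (d := fun _ => n) (fun _ => NeZero.ne n) (fun _ => le_rfl)
  refine ⟨⟨contract (fun _ => n) c.toSeries, _, pow_pos (lt_min hr zero_lt_one) n, h2⟩, ?_⟩
  change (MvPowerSeries.expand n (NeZero.ne n) (contract (fun _ => n) c.toSeries) :
    MvPowerSeries (Fin 2) ℂ) = c.toSeries
  ext a
  by_cases h : ∀ i, n ∣ a i
  · choose b hb using h
    have hab : a = n • (Finsupp.equivFunOnFinite.symm b) := by ext i; simp [hb i]
    rw [hab, MvPowerSeries.coeff_expand_smul, coeff_contract]
    congr 2
    ext i; simp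
  · push Not at h
    obtain ⟨i, hi⟩ := h
    rw [MvPowerSeries.coeff_expand_of_not_dvd n _ _ hi]
    obtain ⟨ω, hω⟩ := exists_rot_pow_ne_one hi
    have := coeff_smul ω c a
    rw [H ω] at this
    by_contra h0
    exact hω (mul_right_cancel₀ (Ne.symm h0) (by rw [← this, one_mul]))

theorem isConvergent_smul {h : Puiseux n} (hc : IsConvergent h.toSeries) (ω : Rots n) :
    IsConvergent (ω • h).toSeries := by
  obtain ⟨r, hr, H⟩ := hc
  exact ⟨r, hr, ConvOn.rescale hr.le H ω.norm_val⟩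

open Classical in
/-- A ring that contains all conjugates of `h` contains the coefficients of the product of
`X - ω h` over the distinct conjugates `ω h`. -/
theorem exists_lift_prodXSubSMul {S : Type*} [CommRing S] (j : S →+* Puiseux n) {h : Puiseux n}
    {s : Rots n ⧸ MulAction.stabilizer (Rots n) h → S}
    (hs : ∀ q, j (s q) = MulAction.ofQuotientStabilizer (Rots n) h q) :
    (∏ q, (X - C (s q))).map j = prodXSubSMul (Rots n) (Puiseux n) h := by
  rw [Polynomial.map_prod, prodXSubSMul]
  refine Finset.prod_congr (by congr) fun q _ => ?_
  simp [hs]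

/-- Galois descent: the coefficients of the product over the orbit are convergent and invariant, so
they come from `ℂ{x₁, x₂}`. A polynomial over `ℂ{x₁, x₂}` that kills `h` kills all conjugates, which
are distinct, so it is divisible by the product. -/
theorem exists_orbitPoly {h : Puiseux n} (hc : IsConvergent h.toSeries) :
    ∃ Q : ConvSeries[X], Q.Monic ∧
      Q.map (algebraMap ConvSeries (Puiseux n)) = prodXSubSMul (Rots n) (Puiseux n) h ∧
      aeval h Q = 0 ∧ ∀ F : ConvSeries[X], aeval h F = 0 → Q ∣ F := by
  classical
  -- Here `ConvSeries` plays the role of the convergent series in `u₁, u₂`; hence the inclusion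
  -- `ConvSeries.subtype` instead of the algebra map, which substitutes `x_i = u_i ^ n`.
  obtain ⟨s, hs⟩ := exists_preimage_ofQuotientStabilizer (n := n) (h := h)
    (show ConvSeries →+* Puiseux n from ConvSeries.subtype)
    fun ω => ⟨⟨_, isConvergent_smul hc ω⟩, rfl⟩
  have hQ' := exists_lift_prodXSubSMul _ hs
  have hcoeff : ∀ k, ∃ d : ConvSeries,
      algebraMap ConvSeries (Puiseux n) d = (prodXSubSMul (Rots n) (Puiseux n) h).coeff k := by
    intro k
    refine exists_algebraMap_eq ?_ fun ω => prodXSubSMul.coeff _ _ _ _ _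
    rw [← hQ', coeff_map]
    exact ((∏ q, (X - C (s q))).coeff k).2
  have hl : prodXSubSMul (Rots n) (Puiseux n) h ∈ lifts (algebraMap ConvSeries (Puiseux n)) := by
    rw [lifts_iff_coeff_lifts]
    exact hcoeff
  obtain ⟨Q, hQ, -, hQm⟩ := lifts_and_natDegree_eq_and_monic hl (prodXSubSMul.monic _ _ _)
  have hroot : ∀ F : ConvSeries[X], aeval h F = 0 → ∀ ω : Rots n, aeval (ω • h) F = 0 := by
    intro F hF ω
    have := congrArg (fun x => ω • x) hF
    simp only [smul_zero] at this
    rw [← this, aeval_def, aeval_def, eval₂_eq_sum_range, eval₂_eq_sum_range, Finset.smul_sum]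
    refine Finset.sum_congr rfl fun k _ => ?_
    rw [smul_mul', smul_pow', smul_algebraMap]
  refine ⟨Q, hQm, hQ, ?_, fun F hF => ?_⟩
  · rw [aeval_def, ← eval_map, hQ, prodXSubSMul.eval]
  · rcases eq_or_ne F 0 with rfl | hF0
    · exact dvd_zero _
    have hF0' : F.map (algebraMap ConvSeries (Puiseux n)) ≠ 0 := by
      rwa [Ne, Polynomial.map_eq_zero_iff algebraMap_injective]
    have hdvd : prodXSubSMul (Rots n) (Puiseux n) h ∣ F.map (algebraMap ConvSeries (Puiseux n)) := by
      classical
      have : prodXSubSMul (Rots n) (Puiseux n) h =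
          ((Finset.univ.val.map (MulAction.ofQuotientStabilizer (Rots n) h)).map
            fun x => X - C x).prod := by
        rw [prodXSubSMul, Finset.prod, Multiset.map_map]
        congr 1
      rw [this, Multiset.prod_X_sub_C_dvd_iff_le_roots hF0', Multiset.le_iff_subset]
      · intro x hx
        obtain ⟨q, -, rfl⟩ := Multiset.mem_map.1 hx
        rw [mem_roots hF0', IsRoot.def, eval_map, ← aeval_def]
        induction q using QuotientGroup.induction_on with
        | H ω => exact hroot F hF ω
      · exact Multiset.Nodup.map (MulAction.injective_ofQuotientStabilizer _ _)
          Finset.univ.nodup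
    rw [← modByMonic_eq_zero_iff_dvd hQm]
    apply Polynomial.map_injective _ (algebraMap_injective (n := n))
    rw [map_modByMonic _ hQm, Polynomial.map_zero, hQ,
      modByMonic_eq_zero_iff_dvd (prodXSubSMul.monic _ _ _)]
    exact hdvd

theorem map_eq_prodXSubSMul_of_irreducible {h : Puiseux n} (hc : IsConvergent h.toSeries)
    {f : ConvSeries[X]} (hf : f.Monic) (hirr : Irreducible f) (hroot : aeval h f = 0) :
    f.map (algebraMap ConvSeries (Puiseux n)) = prodXSubSMul (Rots n) (Puiseux n) h := by
  obtain ⟨Q, hQ, hQe, hQr, hQd⟩ := exists_orbitPoly hc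
  have hnu : ¬ IsUnit Q := by
    intro hu
    have h1 : Q = 1 := hQ.eq_one_of_isUnit hu
    rw [h1, map_one] at hQr
    exact one_ne_zero hQr
  have := (hirr.dvd_iff.1 (hQd f hroot)).resolve_left hnu
  rw [eq_of_monic_of_associated hf hQ this, hQe]

theorem map_minpoly_eq_prodXSubSMul {h : Puiseux n} (hc : IsConvergent h.toSeries) :
    (minpoly ConvSeries h).map (algebraMap ConvSeries (Puiseux n)) =
      prodXSubSMul (Rots n) (Puiseux n) h := by
  obtain ⟨Q, hQ, hQe, hQr, hQd⟩ := exists_orbitPoly hc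
  have hint : IsIntegral ConvSeries h := ⟨Q, hQ, by rwa [← aeval_def]⟩
  have h1 := hQd _ (minpoly.aeval ConvSeries h)
  have h2 : (minpoly ConvSeries h).natDegree ≤ Q.natDegree :=
    natDegree_le_natDegree (minpoly.min ConvSeries h hQ hQr)
  rw [eq_of_monic_of_dvd_of_natDegree_le hQ (minpoly.monic hint) h1 h2, hQe]

theorem prod_quotient_pow_card {G : Type*} [Group G] [Fintype G] (S : Subgroup G)
    [Fintype (G ⧸ S)] (F : G ⧸ S → ℂ) : (∏ q, F q) ^ Nat.card S = ∏ g : G, F g := by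
  classical
  rw [← Finset.prod_fiberwise_of_maps_to (t := Finset.univ) (g := fun g : G => (g : G ⧸ S))
    (fun _ _ => Finset.mem_univ _), ← Finset.prod_pow]
  refine Finset.prod_congr rfl fun q _ => ?_
  rw [Finset.prod_congr rfl (g := fun _ => F q) (fun g hg => by rw [(Finset.mem_filter.1 hg).2]),
    Finset.prod_const]
  congr 1
  have := QuotientGroup.card_preimage_mk S {q}
  simp only [Nat.card_unique, mul_one] at this
  rw [← this]
  exact ((Nat.card_eq_fintype_card (α := {g : G // (g : G ⧸ S) = q})).trans
    (Fintype.card_subtype _))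

/-- Taking the power avoids representatives of the cosets of the stabilizer: in the product over the
whole group each distinct conjugate occurs as often as the stabilizer has elements. -/
theorem evalPoly_pow_card_stabilizer {h : Puiseux n} {r : ℝ} (hr : 0 ≤ r)
    (hc : ConvOn r h.toSeries) {P : ConvSeries[X]} (hP : P.map (algebraMap ConvSeries (Puiseux n)) =
      prodXSubSMul (Rots n) (Puiseux n) h) {U : Fin 2 → ℂ} (hU : ∀ i, ‖U i‖ ≤ r) {p : Fin 3 → ℂ}
    (h0 : p 0 = U 0 ^ n) (h1 : p 1 = U 1 ^ n) :
    evalPoly P p ^ Nat.card (MulAction.stabilizer (Rots n) h) =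
      ∏ ω : Rots n, (p 2 - evalSeries h.toSeries (ω.val * U)) := by
  classical
  set j : convRing r hr →+* Puiseux n := (convRing r hr).subtype with hj
  have hjinj : Function.Injective j := Subtype.val_injective
  obtain ⟨s, hs⟩ := exists_preimage_ofQuotientStabilizer (n := n) (h := h) j
    fun ω => ⟨⟨_, ConvOn.rescale hr hc ω.norm_val⟩, rfl⟩
  have hQ := exists_lift_prodXSubSMul _ hs
  set Q : (convRing r hr)[X] := ∏ q, (X - C (s q)) with hQe
  have hdeg : P.natDegree = Q.natDegree := by
    rw [← natDegree_map_eq_of_injective (algebraMap_injective (n := n)), hP, ← hQ,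
      natDegree_map_eq_of_injective hjinj]
  have hev : evalPoly P p = Q.eval₂ (evalHom r hr U hU) (p 2) := by
    rw [evalPoly, eval₂_eq_sum_range, hdeg]
    refine Finset.sum_congr rfl fun k _ => ?_
    congr 1
    have e1 : ((Q.coeff k : convRing r hr) : MvPowerSeries (Fin 2) ℂ) =
        MvPowerSeries.expand n (NeZero.ne n) (P.coeff k : MvPowerSeries (Fin 2) ℂ) := by
      have := congrArg (fun F : (Puiseux n)[X] => F.coeff k) (hQ.trans hP.symm)
      simp only [coeff_map] at this
      exact this
    change _ = evalSeries ((Q.coeff k : convRing r hr) : MvPowerSeries (Fin 2) ℂ) U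
    rw [e1, evalSeries_expand, h0, h1]
    congr 1
    ext i; fin_cases i <;> rfl
  rw [hev, hQe, eval₂_finsetProd, prod_quotient_pow_card]
  refine Finset.prod_congr rfl fun ω _ => ?_
  rw [eval₂_sub, eval₂_X, eval₂_C]
  congr 1
  rw [← evalSeries_rescale]
  have h3 : ((s (ω : Rots n ⧸ MulAction.stabilizer (Rots n) h) : convRing r hr) :
      MvPowerSeries (Fin 2) ℂ) = MvPowerSeries.rescale ω.val h.toSeries := hs ω
  change evalSeries ((s (ω : Rots n ⧸ MulAction.stabilizer (Rots n) h) : convRing r hr) :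
      MvPowerSeries (Fin 2) ℂ) U = _
  rw [h3]

end

section

variable {n : ℕ}

/-! ### Lattices and characters -/

/-- The vector `a / n` of `ℚ²`. -/
def vec (n : ℕ) (a : Fin 2 →₀ ℕ) : Fin 2 → ℚ := fun i => (a i : ℚ) / n

/-- The vector `z / n` of `ℚ²`, as a homomorphism in `z ∈ ℤ²`. -/
def zvec (n : ℕ) : (Fin 2 → ℤ) →+ (Fin 2 → ℚ) where
  toFun z i := (z i : ℚ) / n
  map_zero' := by ext; simp
  map_add' x y := by ext; simp [add_div]

theorem zvec_apply (z : Fin 2 → ℤ) (i : Fin 2) : zvec n z i = (z i : ℚ) / n := rfl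

/-- A vector of natural numbers seen as a vector of integers. -/
def toInt (a : Fin 2 →₀ ℕ) : Fin 2 → ℤ := fun i => a i

theorem zvec_toInt (a : Fin 2 →₀ ℕ) : zvec n (toInt a) = vec n a := by
  ext i; simp [zvec_apply, toInt, vec]

theorem vec_nonneg (a : Fin 2 →₀ ℕ) : 0 ≤ vec n a := fun i => by
  change (0 : ℚ) ≤ (a i : ℚ) / n
  positivity

theorem vec_le_vec [NeZero n] {a b : Fin 2 →₀ ℕ} : vec n a ≤ vec n b ↔ a ≤ b := by
  have hn : (0 : ℚ) < n := by exact_mod_cast Nat.pos_of_ne_zero (NeZero.ne n)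
  simp only [Pi.le_def, Finsupp.le_def, vec]
  refine forall_congr' fun i => ?_
  rw [div_le_div_iff_of_pos_right hn, Nat.cast_le]

/-- The character of `ℤ²` defined by `ω ∈ μ_n × μ_n`. -/
def Rots.char (ω : Rots n) (z : Fin 2 → ℤ) : ℂˣ := ∏ i, (ω i : ℂˣ) ^ z i

theorem Rots.char_add (ω : Rots n) (x y : Fin 2 → ℤ) : ω.char (x + y) = ω.char x * ω.char y := by
  simp [Rots.char, zpow_add, Finset.prod_mul_distrib]

theorem Rots.char_zsmul (ω : Rots n) (k : ℤ) (y : Fin 2 → ℤ) : ω.char (k • y) = ω.char y ^ k := by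
  simp only [Rots.char, Pi.smul_apply, smul_eq_mul, ← Finset.prod_zpow]
  exact Finset.prod_congr rfl fun i _ => by rw [mul_comm, zpow_mul]

theorem Rots.char_mul (ω θ : Rots n) (x : Fin 2 → ℤ) : (ω * θ).char x = ω.char x * θ.char x := by
  simp [Rots.char, mul_zpow, Finset.prod_mul_distrib]

theorem Rots.char_one (x : Fin 2 → ℤ) : (1 : Rots n).char x = 1 := by
  simp [Rots.char]

theorem Rots.char_toInt (ω : Rots n) (a : Fin 2 →₀ ℕ) :
    ((ω.char (toInt a) : ℂˣ) : ℂ) = ∏ i, ω.val i ^ a i := by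
  simp [Rots.char, toInt, Rots.val]

/-- The characters that are trivial on `M_j`. -/
def charKer (n : ℕ) (lam : ℕ → Fin 2 → ℚ) (j : ℕ) : Subgroup (Rots n) where
  carrier := {ω | ∀ z, zvec n z ∈ latM lam j → ω.char z = 1}
  mul_mem' {ω θ} h1 h2 z hz := by rw [Rots.char_mul, h1 z hz, h2 z hz, one_mul]
  one_mem' z _ := Rots.char_one z
  inv_mem' {ω} h z hz := by
    have : ω⁻¹.char z * ω.char z = 1 := by rw [← Rots.char_mul, inv_mul_cancel, Rots.char_one]
    rwa [h z hz, mul_one] at this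

variable {lam : ℕ → Fin 2 → ℚ}

theorem mem_charKer {j : ℕ} {ω : Rots n} :
    ω ∈ charKer n lam j ↔ ∀ z, zvec n z ∈ latM lam j → ω.char z = 1 := Iff.rfl

theorem prod_val_pow_eq_one {j : ℕ} {ω : Rots n} (hω : ω ∈ charKer n lam j) {a : Fin 2 →₀ ℕ}
    (ha : vec n a ∈ latM lam j) : ∏ i, ω.val i ^ a i = 1 := by
  rw [← Rots.char_toInt, hω _ (by rwa [zvec_toInt]), Units.val_one]

theorem latM_mono {i j : ℕ} (h : i ≤ j) : latM lam i ≤ latM lam j :=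
  AddSubgroup.closure_mono (Set.union_subset_union_right _
    (Set.image_mono (Set.Icc_subset_Icc_right h)))

theorem charKer_anti {i j : ℕ} (h : i ≤ j) : charKer n lam j ≤ charKer n lam i :=
  fun _ hω z hz => hω z (latM_mono h hz)

theorem lam_mem_latM {j : ℕ} (hj : 1 ≤ j) : lam j ∈ latM lam j :=
  AddSubgroup.subset_closure (Or.inr ⟨j, ⟨hj, le_rfl⟩, rfl⟩)

theorem latM_succ (j : ℕ) :
    latM lam (j + 1) = latM lam j ⊔ AddSubgroup.zmultiples (lam (j + 1)) := by
  rw [latM, latM, AddSubgroup.zmultiples_eq_closure, ← AddSubgroup.closure_union, Set.union_assoc]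
  congr 2
  ext v
  simp only [Set.mem_image, Set.mem_Icc, Set.mem_union, Set.mem_singleton_iff]
  constructor
  · rintro ⟨i, ⟨h1, h2⟩, rfl⟩
    rcases Nat.lt_or_ge j i with h | h
    · exact Or.inr (by rw [show i = j + 1 by omega])
    · exact Or.inl ⟨i, ⟨h1, h⟩, rfl⟩
  · rintro (⟨i, ⟨h1, h2⟩, rfl⟩ | rfl)
    · exact ⟨i, ⟨h1, by omega⟩, rfl⟩
    · exact ⟨j + 1, ⟨by omega, le_rfl⟩, rfl⟩

theorem mem_latM_succ {j : ℕ} {v : Fin 2 → ℚ} :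
    v ∈ latM lam (j + 1) ↔ ∃ k : ℤ, v - k • lam (j + 1) ∈ latM lam j := by
  rw [latM_succ, AddSubgroup.mem_sup]
  constructor
  · rintro ⟨y, hy, z, hz, rfl⟩
    obtain ⟨k, rfl⟩ := AddSubgroup.mem_zmultiples_iff.1 hz
    exact ⟨k, by simpa using hy⟩
  · rintro ⟨k, hk⟩
    exact ⟨_, hk, _, AddSubgroup.mem_zmultiples_iff.2 ⟨k, rfl⟩, by simp⟩

/-- If the `i`-th coordinates of `λ₁, …, λ_j` vanish, those of the elements of `M_j` are integers. -/
theorem exists_int_of_mem_latM {j : ℕ} {i : Fin 2} (H : ∀ k, 1 ≤ k → k ≤ j → lam k i = 0)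
    {v : Fin 2 → ℚ} (hv : v ∈ latM lam j) : ∃ k : ℤ, v i = k := by
  induction hv using AddSubgroup.closure_induction with
  | mem x hx =>
    rcases hx with ⟨l, rfl⟩ | ⟨k, ⟨h1, h2⟩, rfl⟩
    · by_cases h : i = l
      · subst h; exact ⟨1, by simp⟩
      · exact ⟨0, by simp [Pi.single_eq_of_ne h]⟩
    · exact ⟨0, by simp [H k h1 h2]⟩
  | zero => exact ⟨0, by simp⟩
  | add x y _ _ hx hy =>
    obtain ⟨a, ha⟩ := hx
    obtain ⟨b, hb⟩ := hy
    exact ⟨a + b, by simp [ha, hb]⟩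
  | neg x _ hx =>
    obtain ⟨a, ha⟩ := hx
    exact ⟨-a, by simp [ha]⟩

theorem int_mem_latM (j : ℕ) (z : Fin 2 → ℤ) : (fun i => (z i : ℚ)) ∈ latM lam j := by
  have : (fun i => (z i : ℚ)) = ∑ i, z i • (Pi.single i (1 : ℚ) : Fin 2 → ℚ) := by
    ext i
    fin_cases i <;> simp [Fin.sum_univ_two]
  rw [this]
  exact sum_mem fun i _ => zsmul_mem (single_mem_latM lam j i) _

theorem mem_charKer_succ {j : ℕ} {A : Fin 2 →₀ ℕ} (hA : vec n A = lam (j + 1)) {ω : Rots n} :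
    ω ∈ charKer n lam (j + 1) ↔ ω ∈ charKer n lam j ∧ ω.char (toInt A) = 1 := by
  constructor
  · intro h
    refine ⟨charKer_anti (Nat.le_succ j) h, h _ ?_⟩
    rw [zvec_toInt, hA]
    exact lam_mem_latM (by omega)
  · rintro ⟨h1, h2⟩ z hz
    obtain ⟨k, hk⟩ := mem_latM_succ.1 hz
    have e : zvec n z - k • lam (j + 1) = zvec n (z - k • toInt A) := by
      rw [map_sub, map_zsmul, zvec_toInt, hA]
    rw [e] at hk
    have := h1 _ hk
    rw [show z = (z - k • toInt A) + k • toInt A by abel, Rots.char_add, this, Rots.char_zsmul, h2]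
    simp

/-- The values at `A / n` of the characters that are trivial on `M_j`. -/
def charHom (n : ℕ) (lam : ℕ → Fin 2 → ℚ) (j : ℕ) (A : Fin 2 →₀ ℕ) : charKer n lam j →* ℂˣ where
  toFun ω := (ω : Rots n).char (toInt A)
  map_one' := Rots.char_one _
  map_mul' _ _ := Rots.char_mul _ _ _

theorem ker_charHom {j : ℕ} {A : Fin 2 →₀ ℕ} (hA : vec n A = lam (j + 1)) :
    (charHom n lam j A).ker = (charKer n lam (j + 1)).subgroupOf (charKer n lam j) := by
  ext ω
  rw [Subgroup.mem_subgroupOf, MonoidHom.mem_ker, mem_charKer_succ hA]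
  exact (and_iff_right ω.2).symm

variable [NeZero n]

theorem cast_ne_zero_of_neZero : (n : ℚ) ≠ 0 := Nat.cast_ne_zero.2 (NeZero.ne n)

theorem charKer_zero : charKer n lam 0 = ⊤ := by
  rw [eq_top_iff]
  intro ω _ z hz
  have H := fun i => exists_int_of_mem_latM (lam := lam) (j := 0) (i := i)
    (fun k h1 h2 => by omega) hz
  rw [Rots.char, Finset.prod_eq_one]
  intro i _
  obtain ⟨k, hk⟩ := H i
  rw [zvec_apply, div_eq_iff cast_ne_zero_of_neZero] at hk
  have hk' : z i = n * k := by rw [mul_comm]; exact_mod_cast hk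
  rw [hk', zpow_mul, zpow_natCast, (mem_rootsOfUnity n _).1 (ω i).2, one_zpow]

/-- Duality: a vector on which all the characters that are trivial on `M_j` vanish is in `M_j`. -/
theorem zvec_mem_latM_of_char_eq_one {j : ℕ} {z : Fin 2 → ℤ}
    (H : ∀ ω ∈ charKer n lam j, ω.char z = 1) : zvec n z ∈ latM lam j := by
  set K : AddSubgroup (Fin 2 → ℤ) := (latM lam j).comap (zvec n) with hK
  -- As `n ℤ²` lies in `K`, the quotient `ℤ² / K` is finite and its characters take values in `μ_n`;
  -- each of them is therefore given by an element of `μ_n × μ_n`.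
  have hnK : ∀ y : Fin 2 → ℤ, (n : ℤ) • y ∈ K := by
    intro y
    rw [hK, AddSubgroup.mem_comap]
    convert int_mem_latM (lam := lam) j y using 1
    ext i
    rw [zvec_apply]
    simp [cast_ne_zero_of_neZero (n := n)]
  have hfin : Finite ((Fin 2 → ℤ) ⧸ K) := by
    refine Finite.of_surjective (α := Fin 2 → Fin n)
      (fun y => QuotientAddGroup.mk (fun i => ((y i : ℕ) : ℤ))) fun q => ?_
    induction q using QuotientAddGroup.induction_on with
    | H x =>
      have hn : (0 : ℤ) < n := by exact_mod_cast Nat.pos_of_ne_zero (NeZero.ne n)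
      refine ⟨fun i => ⟨(x i % n).toNat, ?_⟩, ?_⟩
      · have := Int.emod_lt_of_pos (x i) hn
        have := Int.emod_nonneg (x i) hn.ne'
        omega
      · rw [QuotientAddGroup.eq]
        convert hnK (fun i => x i / n) using 1
        ext i
        have h1 := Int.emod_nonneg (x i) hn.ne'
        have h2 := Int.emod_add_mul_ediv (x i) n
        simp only [Pi.add_apply, Pi.neg_apply, Int.toNat_of_nonneg h1, Pi.smul_apply, smul_eq_mul]
        linarith
  by_contra hz
  have hne : (QuotientAddGroup.mk z : (Fin 2 → ℤ) ⧸ K) ≠ 0 := by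
    rwa [Ne, QuotientAddGroup.eq_zero_iff]
  -- Characters of a finite abelian group separate its elements.
  obtain ⟨ψ, hψ⟩ := AddChar.exists_apply_ne_zero.2 hne
  set φ : Multiplicative (Fin 2 → ℤ) →* ℂ :=
    ψ.toMonoidHom.comp (QuotientAddGroup.mk' K).toMultiplicative with hφ
  have hφu : ∀ y, IsUnit (φ y) := fun y =>
    (Group.isUnit y).map φ
  set φ' : Multiplicative (Fin 2 → ℤ) →* ℂˣ := φ.toHomUnits with hφ'
  have hφK : ∀ y ∈ K, φ' (Multiplicative.ofAdd y) = 1 := by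
    intro y hy
    ext
    change ψ (QuotientAddGroup.mk y) = 1
    rw [(QuotientAddGroup.eq_zero_iff y).2 hy, AddChar.map_zero_eq_one]
  let ω : Rots n := fun i => ⟨φ' (Multiplicative.ofAdd (Pi.single i 1)), by
    rw [mem_rootsOfUnity, ← map_pow, ← ofAdd_nsmul]
    apply hφK
    have := hnK (Pi.single i 1)
    rwa [natCast_zsmul] at this⟩
  have hω : ∀ y, ω.char y = φ' (Multiplicative.ofAdd y) := by
    intro y
    have e : y = y 0 • (Pi.single 0 1 : Fin 2 → ℤ) + y 1 • (Pi.single 1 1 : Fin 2 → ℤ) := by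
      ext i; fin_cases i <;> simp
    conv_rhs => rw [e, ofAdd_add, map_mul, ofAdd_zsmul, ofAdd_zsmul, map_zpow, map_zpow]
    rw [Rots.char, Fin.prod_univ_two]
  have h1 := H ω fun y hy => by rw [hω]; exact hφK y hy
  rw [hω] at h1
  exact hψ (congrArg Units.val h1)

/-- The integers `k` with `k λ_{j+1} ∈ M_j` form a subgroup of `ℤ`. Since `M_{j+1} = M_j + ℤ
λ_{j+1}`, its index is `n_{j+1}`. -/
theorem zsmul_mem_latM_iff (j : ℕ) (k : ℤ) :
    k • lam (j + 1) ∈ latM lam j ↔ (idx lam (j + 1) : ℤ) ∣ k := by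
  set K : AddSubgroup ℤ := (latM lam j).comap (zmultiplesHom _ (lam (j + 1))) with hK
  have h1 : idx lam (j + 1) = K.index := by
    rw [idx, if_neg (by omega), Nat.add_sub_cancel, latM_succ, AddSubgroup.relIndex_sup_left,
      hK, AddSubgroup.index_comap]
    congr 1
  obtain ⟨d, hd⟩ := Int.subgroup_cyclic K
  have h2 : K = AddSubgroup.zmultiples d := by rw [hd, AddSubgroup.zmultiples_eq_closure]
  have h3 : k • lam (j + 1) ∈ latM lam j ↔ k ∈ K := by
    rw [hK, AddSubgroup.mem_comap]; rfl
  rw [h3, h1, h2, Int.index_zmultiples, Int.mem_zmultiples_iff, Int.natAbs_dvd]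

theorem card_ker_charHom {j : ℕ} {A : Fin 2 →₀ ℕ} (hA : vec n A = lam (j + 1)) :
    Nat.card (charHom n lam j A).ker = Nat.card (charKer n lam (j + 1)) := by
  rw [ker_charHom hA]
  exact Nat.card_congr (Subgroup.subgroupOfEquivOfLe (charKer_anti (Nat.le_succ j))).toEquiv

theorem pow_eq_one_on_range_charHom_iff {j : ℕ} {A : Fin 2 →₀ ℕ} (hA : vec n A = lam (j + 1))
    (k : ℕ) : (∀ x ∈ (charHom n lam j A).range, x ^ k = 1) ↔ idx lam (j + 1) ∣ k := by
  rw [← Int.natCast_dvd_natCast, ← zsmul_mem_latM_iff, ← hA, ← zvec_toInt, ← map_zsmul]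
  constructor
  · intro H
    refine zvec_mem_latM_of_char_eq_one fun ω hω => ?_
    rw [Rots.char_zsmul, zpow_natCast]
    exact H _ ⟨⟨ω, hω⟩, rfl⟩
  · rintro H _ ⟨ω, rfl⟩
    have := ω.2 _ H
    rwa [Rots.char_zsmul, zpow_natCast] at this

theorem idx_dvd_card_range_charHom {j : ℕ} {A : Fin 2 →₀ ℕ} (hA : vec n A = lam (j + 1)) :
    idx lam (j + 1) ∣ Nat.card (charHom n lam j A).range := by
  rw [← pow_eq_one_on_range_charHom_iff hA]
  intro x hx
  have := pow_card_eq_one' (x := (⟨x, hx⟩ : (charHom n lam j A).range))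
  simpa using congrArg Subtype.val this

theorem idx_pos {j : ℕ} {A : Fin 2 →₀ ℕ} (hA : vec n A = lam (j + 1)) : 0 < idx lam (j + 1) := by
  have hfin : Finite (charHom n lam j A).range := Set.finite_range (charHom n lam j A)
  exact Nat.pos_of_dvd_of_pos (idx_dvd_card_range_charHom hA) Nat.card_pos

/-- By duality `k` kills the range exactly when `k λ_{j+1} ∈ M_j`, that is, when `n_{j+1}` divides
`k`. So the range lies in `μ_{n_{j+1}}`, and its order, which kills it, is a multiple of `n_{j+1}`.
-/
theorem range_charHom {j : ℕ} {A : Fin 2 →₀ ℕ} (hA : vec n A = lam (j + 1)) :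
    (charHom n lam j A).range = rootsOfUnity (idx lam (j + 1)) ℂ := by
  have hfin : Finite (charHom n lam j A).range := Set.finite_range (charHom n lam j A)
  have : NeZero (idx lam (j + 1)) := ⟨(idx_pos hA).ne'⟩
  have h2 : (charHom n lam j A).range ≤ rootsOfUnity (idx lam (j + 1)) ℂ := fun x hx => by
    rw [mem_rootsOfUnity]
    exact (pow_eq_one_on_range_charHom_iff hA _).2 dvd_rfl x hx
  refine Subgroup.eq_of_le_of_card_ge h2 ?_
  rw [Complex.card_rootsOfUnity]
  exact Nat.le_of_dvd Nat.card_pos (idx_dvd_card_range_charHom hA)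

theorem card_charKer {j : ℕ} {A : Fin 2 →₀ ℕ} (hA : vec n A = lam (j + 1)) :
    Nat.card (charKer n lam j) = idx lam (j + 1) * Nat.card (charKer n lam (j + 1)) := by
  have : NeZero (idx lam (j + 1)) := ⟨(idx_pos hA).ne'⟩
  rw [← card_ker_charHom hA, ← Subgroup.index_mul_card (charHom n lam j A).ker,
    Subgroup.index_ker, range_charHom hA, Complex.card_rootsOfUnity]

-- The values at `A` run through the `n_{j+1}`-th roots of unity, each taken once for every element
-- of the kernel, which is the next group `G_{j+1}`. Grouping the factors gives the factorization of
-- `x ^ n_{j+1} - y ^ n_{j+1}`.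
open Classical in
theorem prod_charKer_sub_mul {j : ℕ} {A : Fin 2 →₀ ℕ} (hA : vec n A = lam (j + 1)) (x y : ℂ) :
    ∏ ω : charKer n lam j, (x - ((charHom n lam j A ω : ℂˣ) : ℂ) * y) =
      (x ^ idx lam (j + 1) - y ^ idx lam (j + 1)) ^ Nat.card (charKer n lam (j + 1)) := by
  have : NeZero (idx lam (j + 1)) := ⟨(idx_pos hA).ne'⟩
  have h1 := prod_quotient_pow_card (charHom n lam j A).ker
    (fun q => x - ((((QuotientGroup.quotientKerEquivRange (charHom n lam j A)) q :
      (charHom n lam j A).range) : ℂˣ) : ℂ) * y)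
  rw [card_ker_charHom hA] at h1
  refine Eq.trans ?_ (h1.symm.trans ?_)
  · exact Finset.prod_congr rfl fun ω _ => rfl
  congr 1
  have hprim := Complex.isPrimitiveRoot_exp (idx lam (j + 1)) (NeZero.ne _)
  rw [hprim.pow_sub_pow_eq_prod_sub_mul x y (idx_pos hA)]
  refine Finset.prod_nbij (fun q => ((((QuotientGroup.quotientKerEquivRange (charHom n lam j A)) q :
      (charHom n lam j A).range) : ℂˣ) : ℂ)) ?_ ?_ ?_ fun _ _ => rfl
  · intro q _
    rw [mem_nthRootsFinset (idx_pos hA)]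
    have h2 := (pow_eq_one_on_range_charHom_iff hA _).2 dvd_rfl _
      (QuotientGroup.quotientKerEquivRange (charHom n lam j A) q).2
    simpa using congrArg Units.val h2
  · intro q _ q' _ hqq
    exact (QuotientGroup.quotientKerEquivRange (charHom n lam j A)).injective
      (Subtype.ext (Units.ext hqq))
  · intro z hz
    rw [Finset.mem_coe, mem_nthRootsFinset (idx_pos hA)] at hz
    obtain ⟨u, rfl⟩ : IsUnit z := IsUnit.of_pow_eq_one hz (NeZero.ne _)
    have hu : u ∈ (charHom n lam j A).range := by
      rw [range_charHom hA, mem_rootsOfUnity]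
      exact Units.ext (by simpa using hz)
    exact ⟨(QuotientGroup.quotientKerEquivRange (charHom n lam j A)).symm ⟨u, hu⟩, by simp,
      by simp⟩

end

variable {n : ℕ} [NeZero n]

/-! ### Consequences of the conditions on the characteristic exponents -/

theorem coeffAt_vec (ζ : Puiseux n) (a : Fin 2 →₀ ℕ) :
    ζ.coeffAt (vec n a) = MvPowerSeries.coeff a ζ.toSeries := by
  have h : ∃ b : Fin 2 →₀ ℕ, ∀ i, (b i : ℚ) = n * vec n a i :=
    ⟨a, fun i => by rw [vec, mul_div_cancel₀ _ cast_ne_zero_of_neZero]⟩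
  rw [Puiseux.coeffAt, dif_pos h]
  congr 2
  ext i
  have := h.choose_spec i
  rw [vec, mul_div_cancel₀ _ cast_ne_zero_of_neZero] at this
  exact_mod_cast this

theorem exists_vec_of_coeffAt_ne_zero {ζ : Puiseux n} {u : Fin 2 → ℚ} (h : ζ.coeffAt u ≠ 0) :
    ∃ a : Fin 2 →₀ ℕ, vec n a = u := by
  rw [Puiseux.coeffAt] at h
  split_ifs at h with h1
  · obtain ⟨a, ha⟩ := h1
    refine ⟨a, ?_⟩
    ext i
    rw [vec, ha i, mul_div_cancel_left₀ _ cast_ne_zero_of_neZero]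
  · exact absurd rfl h

namespace IsCharExponents

variable {ζ : Puiseux n} {g : ℕ} {lam : ℕ → Fin 2 → ℚ} (H : IsCharExponents ζ g lam)
include H

theorem exists_vec {k : ℕ} (hk : k ≤ g) : ∃ A : Fin 2 →₀ ℕ, vec n A = lam k := by
  rcases Nat.eq_zero_or_pos k with rfl | h
  · exact ⟨0, by rw [H.lam_zero]; ext i; simp [vec]⟩
  · exact exists_vec_of_coeffAt_ne_zero (H.coeff_ne_zero k h hk)

theorem nonneg {k : ℕ} (hk : k ≤ g) : 0 ≤ lam k := by
  obtain ⟨A, hA⟩ := H.exists_vec hk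
  rw [← hA]; exact vec_nonneg A

theorem mono_le {j k : ℕ} (hjk : j ≤ k) (hk : k ≤ g) : lam j ≤ lam k := by
  induction k, hjk using Nat.le_induction with
  | base => exact le_rfl
  | succ k hjk ih => exact (ih (by omega)).trans (H.mono k (by omega))

theorem coord_eq_zero {i : Fin 2} {j k : ℕ} (hjk : j ≤ k) (hk : k ≤ g) (h : lam k i = 0) :
    lam j i = 0 :=
  le_antisymm (h ▸ H.mono_le hjk hk i) (H.nonneg (hjk.trans hk) i)

/-- Take the first index whose successor exponent is not below `a / n`. The defining condition of
the characteristic exponents applies at that index, which is at most `k`. -/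
theorem vec_mem_latM_of_not_le {a : Fin 2 →₀ ℕ} (ha : MvPowerSeries.coeff a ζ.toSeries ≠ 0)
    {k : ℕ} (hk : k < g) (hle : ¬ lam (k + 1) ≤ vec n a) : vec n a ∈ latM lam k := by
  classical
  have hex : ∃ j, ¬ lam (j + 1) ≤ vec n a := ⟨k, hle⟩
  have h1 : Nat.find hex ≤ k := Nat.find_min' hex hle
  have h2 : lam (Nat.find hex) ≤ vec n a := by
    rcases Nat.eq_zero_or_pos (Nat.find hex) with h | h
    · rw [h, H.lam_zero]; exact vec_nonneg a
    · have := Nat.find_min hex (m := Nat.find hex - 1) (by omega)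
      rw [not_not, Nat.sub_add_cancel h] at this
      exact this
  rw [← coeffAt_vec] at ha
  exact latM_mono h1 (H.mem_latM _ ha _ (by omega) h2 fun _ => Nat.find_spec hex)

theorem vec_mem_latM {a : Fin 2 →₀ ℕ} (ha : MvPowerSeries.coeff a ζ.toSeries ≠ 0) :
    vec n a ∈ latM lam g := by
  by_cases h : lam g ≤ vec n a
  · rw [← coeffAt_vec] at ha
    exact H.mem_latM _ ha g le_rfl h fun h => absurd h (lt_irrefl _)
  · rcases Nat.eq_zero_or_pos g with h0 | h0
    · rw [h0, H.lam_zero] at h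
      exact absurd (vec_nonneg a) h
    · obtain ⟨k, rfl⟩ : ∃ k, g = k + 1 := ⟨g - 1, by omega⟩
      exact latM_mono (Nat.le_succ k) (H.vec_mem_latM_of_not_le ha (Nat.lt_succ_self k) h)

theorem two_le_idx {k : ℕ} (hk : k < g) : 2 ≤ idx lam (k + 1) := by
  obtain ⟨A, hA⟩ := H.exists_vec (k := k + 1) hk
  have h0 := idx_pos hA
  have h1 : idx lam (k + 1) ≠ 1 := fun h => by
    have := (zsmul_mem_latM_iff (lam := lam) k 1).2 (by rw [h]; simp)
    rw [one_zsmul] at this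
    exact H.not_mem_latM k hk this
  omega

theorem card_charKer_eq {k : ℕ} (hk : k ≤ g) :
    Nat.card (charKer n lam k) =
      (∏ j ∈ Finset.Ioc k g, idx lam j) * Nat.card (charKer n lam g) := by
  obtain ⟨d, rfl⟩ := Nat.exists_eq_add_of_le hk
  clear hk
  induction d generalizing k with
  | zero => simp
  | succ d ih =>
    obtain ⟨A, hA⟩ := H.exists_vec (k := k + 1) (by omega)
    have e : k + (d + 1) = (k + 1) + d := by omega
    rw [card_charKer hA]
    have h1 : Finset.Ioc k (k + (d + 1)) = insert (k + 1) (Finset.Ioc (k + 1) (k + 1 + d)) := by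
      ext x; simp only [Finset.mem_Ioc, Finset.mem_insert]; omega
    rw [h1, Finset.prod_insert (by simp), e, ih (k := k + 1) (e ▸ H), mul_assoc]

/-- An `ω` that fixes `ζ` must fix the monomials at `λ_1, …, λ_g`, whose coefficients are nonzero;
this puts it successively into the groups attached to `M_1, …, M_g`. -/
theorem stabilizer_eq : MulAction.stabilizer (Rots n) ζ = charKer n lam g := by
  ext ω
  rw [MulAction.mem_stabilizer_iff]
  constructor
  · intro hω
    have h1 : ∀ k, k ≤ g → ω ∈ charKer n lam k := by
      intro k
      induction k with
      | zero => intro _; rw [charKer_zero]; trivial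
      | succ k ih =>
        intro hk
        obtain ⟨A, hA⟩ := H.exists_vec hk
        rw [mem_charKer_succ hA]
        refine ⟨ih (by omega), ?_⟩
        have h2 := H.coeff_ne_zero (k + 1) (by omega) hk
        rw [← hA, coeffAt_vec] at h2
        have h3 := coeff_smul ω ζ A
        rw [hω, ← Rots.char_toInt] at h3
        ext
        exact (mul_right_cancel₀ h2 (by rw [← h3, Units.val_one, one_mul]))
    exact h1 g le_rfl
  · intro hω
    change (ω • ζ).toSeries = ζ.toSeries
    ext a
    rw [coeff_smul]
    by_cases ha : MvPowerSeries.coeff a ζ.toSeries = 0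
    · rw [ha, mul_zero]
    · rw [prod_val_pow_eq_one hω (H.vec_mem_latM ha), one_mul]

/-- The conjugates `ω ζ` and `ζ`, where `ω` is trivial on `M_k` and not on `M_{k+1}`, differ by
`u ^ A` times a unit, where `A = n λ_{k+1}`. -/
theorem smul_sub_factor {r : ℝ} (hr : 0 < r) (hc : ConvOn r ζ.toSeries) {k : ℕ} (hk : k < g)
    {A : Fin 2 →₀ ℕ} (hA : vec n A = lam (k + 1)) {ω : Rots n} (h1 : ω ∈ charKer n lam k)
    (h2 : ω ∉ charKer n lam (k + 1)) :
    ∃ h : MvPowerSeries (Fin 2) ℂ, ConvOn r h ∧ evalSeries h 0 ≠ 0 ∧ ∀ U : Fin 2 → ℂ,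
      (∀ i, ‖U i‖ ≤ r) → evalSeries ζ.toSeries (ω.val * U) - evalSeries ζ.toSeries U =
        (∏ i, U i ^ A i) * evalSeries h U := by
  have hcω : ConvOn r (MvPowerSeries.rescale ω.val ζ.toSeries) := hc.rescale hr.le ω.norm_val
  have hcs := hcω.sub hr.le hc
  have hcoeff : ∀ a, MvPowerSeries.coeff a (MvPowerSeries.rescale ω.val ζ.toSeries - ζ.toSeries) =
      ((∏ i, ω.val i ^ a i) - 1) * MvPowerSeries.coeff a ζ.toSeries := by
    intro a
    rw [map_sub, ← toSeries_smul, coeff_smul, sub_mul, one_mul]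
  refine ⟨shift A (MvPowerSeries.rescale ω.val ζ.toSeries - ζ.toSeries), hcs.shift hr A, ?_, ?_⟩
  · rw [evalSeries_at_zero, ← MvPowerSeries.coeff_zero_eq_constantCoeff_apply, coeff_shift,
      zero_add, hcoeff]
    refine mul_ne_zero ?_ ?_
    · rw [sub_ne_zero, ← Rots.char_toInt]
      intro h
      exact h2 ((mem_charKer_succ hA).2 ⟨h1, Units.ext (by rw [h, Units.val_one])⟩)
    · rw [← coeffAt_vec, hA]
      exact H.coeff_ne_zero (k + 1) (by omega) hk
  · intro U hU
    rw [← evalSeries_eq_mul_shift, evalSeries_sub hcω hc hU, evalSeries_rescale]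
    intro a ha
    rw [hcoeff] at ha
    by_contra hle
    rw [← vec_le_vec (n := n), hA] at hle
    -- A monomial of `ζ` that is not divisible by `u ^ A` has its exponent in `M_k`; it is fixed by
    -- `ω` and cancels in the difference.
    exact ha (by rw [prod_val_pow_eq_one h1 (H.vec_mem_latM_of_not_le (right_ne_zero_of_mul ha) hk hle),
      sub_self, zero_mul])

end IsCharExponents

namespace QOSurface
variable (X : QOSurface n)

open Classical in
theorem coeff_trunc (j : ℕ) (a : Fin 2 →₀ ℕ) :
    MvPowerSeries.coeff a (X.trunc j).toSeries =
      if j < X.g ∧ X.lam (j + 1) ≤ vec n a then 0 else MvPowerSeries.coeff a X.ζ.toSeries := rfl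

theorem coeff_trunc_ne_zero {j : ℕ} {a : Fin 2 →₀ ℕ}
    (h : MvPowerSeries.coeff a (X.trunc j).toSeries ≠ 0) :
    MvPowerSeries.coeff a X.ζ.toSeries ≠ 0 ∧ (j < X.g → ¬ X.lam (j + 1) ≤ vec n a) := by
  classical
  rw [coeff_trunc] at h
  split_ifs at h with h1
  · exact absurd rfl h
  · exact ⟨h, fun h2 h3 => h1 ⟨h2, h3⟩⟩

theorem trunc_g : (X.trunc X.g).toSeries = X.ζ.toSeries := by
  classical
  ext a
  rw [coeff_trunc, if_neg (by simp)]

theorem convOn_trunc {r : ℝ} (hr : 0 ≤ r) (hc : ConvOn r X.ζ.toSeries) (j : ℕ) :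
    ConvOn r (X.trunc j).toSeries := by
  classical
  refine hc.of_norm_le hr fun a => ?_
  rw [coeff_trunc]
  split_ifs
  · simp
  · exact le_rfl

theorem charExponents_trunc {j : ℕ} (hj : j ≤ X.g) : IsCharExponents (X.trunc j) j X.lam where
  lam_zero := X.charExponents.lam_zero
  mono k hk := X.charExponents.mono k (by omega)
  coeff_ne_zero k h1 h2 := by
    classical
    have h3 := X.charExponents.coeff_ne_zero k h1 (by omega)
    obtain ⟨A, hA⟩ := exists_vec_of_coeffAt_ne_zero h3
    rw [← hA, coeffAt_vec] at h3 ⊢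
    rw [coeff_trunc, if_neg]
    · exact h3
    -- The truncation cannot remove the term at `λ_k`: otherwise `λ_{j+1} ≤ λ_k ≤ λ_{j+1}`, and
    -- `λ_{j+1}` would lie in `M_j`.
    · rintro ⟨h4, h5⟩
      rw [hA] at h5
      have h6 : X.lam (j + 1) = X.lam k :=
        le_antisymm h5 (X.charExponents.mono_le (by omega) (by omega))
      exact X.charExponents.not_mem_latM j h4 (h6 ▸ latM_mono h2 (lam_mem_latM h1))
  mem_latM mu hmu k hk h1 h2 := by
    obtain ⟨a, rfl⟩ := exists_vec_of_coeffAt_ne_zero hmu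
    rw [coeffAt_vec] at hmu
    obtain ⟨h3, h4⟩ := X.coeff_trunc_ne_zero hmu
    rw [← coeffAt_vec] at h3
    refine X.charExponents.mem_latM _ h3 k (by omega) h1 fun h5 => ?_
    rcases Nat.lt_or_ge k j with h6 | h6
    · exact h2 h6
    · obtain rfl : k = j := by omega
      exact h4 h5
  not_mem_latM k hk := X.charExponents.not_mem_latM k (by omega)

/-- `ζ_k - ζ_j` for `j < k` only has exponents `≥ λ_{j+1}`, and its coefficients are
those of `ζ_k`. -/
theorem coeff_trunc_sub {j k : ℕ} (hjk : j ≤ k) {a : Fin 2 →₀ ℕ}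
    (h : MvPowerSeries.coeff a ((X.trunc k).toSeries - (X.trunc j).toSeries) ≠ 0) :
    j < X.g ∧ X.lam (j + 1) ≤ vec n a ∧ MvPowerSeries.coeff a (X.trunc k).toSeries ≠ 0 := by
  classical
  rw [map_sub, coeff_trunc, coeff_trunc] at h
  rw [coeff_trunc]
  by_cases h1 : j < X.g ∧ X.lam (j + 1) ≤ vec n a
  · rw [if_pos h1, sub_zero] at h
    exact ⟨h1.1, h1.2, h⟩
  · rw [if_neg h1] at h
    have h2 : ¬ (k < X.g ∧ X.lam (k + 1) ≤ vec n a) := by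
      rintro ⟨h3, h4⟩
      exact h1 ⟨by omega, (X.charExponents.mono_le (by omega) (by omega)).trans h4⟩
    rw [if_neg h2, sub_self] at h
    exact absurd rfl h

theorem coeff_trunc_sub_lam {j k : ℕ} (hjk : j < k) (hk : k ≤ X.g) {A : Fin 2 →₀ ℕ}
    (hA : vec n A = X.lam (j + 1)) :
    MvPowerSeries.coeff A ((X.trunc k).toSeries - (X.trunc j).toSeries) ≠ 0 := by
  classical
  rw [map_sub, coeff_trunc (j := j), if_pos ⟨by omega, hA.ge⟩, sub_zero, ← coeffAt_vec, hA]
  exact (X.charExponents_trunc hk).coeff_ne_zero _ (by omega) hjk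

/-- At the origin a Weierstrass polynomial reduces to `z ^ n`. -/
theorem constantCoeff_ζ : MvPowerSeries.constantCoeff X.ζ.toSeries = 0 := by
  have h := X.root
  have hn : n ≠ 0 := NeZero.ne n
  rw [aeval_def, eval₂_eq_sum_range, X.natDegree_eq, Finset.sum_range_succ] at h
  have h1 := congrArg (fun x : Puiseux n => MvPowerSeries.constantCoeff x.toSeries) h
  have hX : X.f.coeff n = 1 := by
    have := X.monic.coeff_natDegree
    rwa [X.natDegree_eq] at this
  let φ : Puiseux n →+* ℂ := (MvPowerSeries.constantCoeff (σ := Fin 2) (R := ℂ))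
  have h2 : φ X.ζ ^ n = 0 := by
    have h3 := congrArg φ h
    rw [map_add, map_sum, hX, map_one, one_mul, map_pow, map_zero, Finset.sum_eq_zero, zero_add]
      at h3
    · exact h3
    · intro k hk
      rw [map_mul]
      have h4 : φ (algebraMap ConvSeries (Puiseux n) (X.f.coeff k)) = 0 := by
        change MvPowerSeries.constantCoeff (MvPowerSeries.expand n (NeZero.ne n)
          (X.f.coeff k : MvPowerSeries (Fin 2) ℂ)) = 0
        rw [MvPowerSeries.constantCoeff_expand]
        exact X.weierstrass k (Finset.mem_range.1 hk)
      rw [h4, zero_mul]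
  exact pow_eq_zero_iff hn |>.1 h2

theorem constantCoeff_trunc (j : ℕ) :
    MvPowerSeries.constantCoeff (X.trunc j).toSeries = 0 := by
  classical
  rw [← MvPowerSeries.coeff_zero_eq_constantCoeff_apply, coeff_trunc]
  split_ifs
  · rfl
  · rw [MvPowerSeries.coeff_zero_eq_constantCoeff_apply, X.constantCoeff_ζ]

theorem evalPoly_f_pow {r : ℝ} (hr : 0 < r) (hc : ConvOn r X.ζ.toSeries) {U : Fin 2 → ℂ}
    (hU : ∀ i, ‖U i‖ ≤ r) {p : Fin 3 → ℂ} (h0 : p 0 = U 0 ^ n) (h1 : p 1 = U 1 ^ n) :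
    evalPoly X.f p ^ Nat.card (charKer n X.lam X.g) =
      ∏ ω : Rots n, (p 2 - evalSeries X.ζ.toSeries (ω.val * U)) := by
  rw [← X.charExponents.stabilizer_eq]
  exact evalPoly_pow_card_stabilizer hr.le hc
    (map_eq_prodXSubSMul_of_irreducible ⟨r, hr, hc⟩ X.monic X.irreducible X.root) hU h0 h1

theorem evalPoly_semiRoot_pow {r : ℝ} (hr : 0 < r) (hc : ConvOn r X.ζ.toSeries) {j : ℕ}
    (hj : j ≤ X.g) {U : Fin 2 → ℂ}
    (hU : ∀ i, ‖U i‖ ≤ r) {p : Fin 3 → ℂ} (h0 : p 0 = U 0 ^ n) (h1 : p 1 = U 1 ^ n) :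
    evalPoly (X.semiRoot j) p ^ Nat.card (charKer n X.lam j) =
      ∏ ω : Rots n, (p 2 - evalSeries (X.trunc j).toSeries (ω.val * U)) := by
  rw [← (X.charExponents_trunc hj).stabilizer_eq]
  have hct := X.convOn_trunc hr.le hc j
  exact evalPoly_pow_card_stabilizer hr.le hct
    (map_minpoly_eq_prodXSubSMul ⟨r, hr, hct⟩) hU h0 h1

end QOSurface

/-! ### Regular points of the surfaces `X⁽ʲ⁾` -/

/-- Moving by `τ ^ n` keeps the `n`-th roots of the coordinates under control. The bound on `‖F‖ ^
N` is one power of `τ` better than the power `τ ^ (n N)` that a nonzero partial derivative would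
produce. -/
theorem fderiv_eq_zero_of_norm_pow_le {F : (Fin 3 → ℂ) → ℂ} {p : Fin 3 → ℂ} (h0 : F p = 0)
    {N : ℕ} (hN : N ≠ 0) (h : ∀ i : Fin 3, ∃ C : ℝ, ∀ᶠ τ : ℝ in 𝓝[>] 0,
      ‖F (p + ((τ : ℂ) ^ n) • Pi.single i 1)‖ ^ N ≤ C * τ ^ (n * N + 1)) : fderiv ℂ F p = 0 := by
  by_cases hd : DifferentiableAt ℂ F p
  swap
  -- The default value of `fderiv` makes a separate proof of differentiability unnecessary.
  · exact fderiv_zero_of_not_differentiableAt hd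
  have key : ∀ i : Fin 3, fderiv ℂ F p (Pi.single i 1) = 0 := by
    intro i
    obtain ⟨C, hC⟩ := h i
    have h1 : HasDerivAt (fun t : ℂ => F (p + t • Pi.single i 1))
      (fderiv ℂ F p (Pi.single i 1)) 0 := hd.hasFDerivAt.hasLineDerivAt _
    have h2 := h1.tendsto_slope_zero
    simp only [zero_add, zero_smul, add_zero, h0, sub_zero, smul_eq_mul] at h2
    have hn : n ≠ 0 := NeZero.ne n
    have h3 : Tendsto (fun τ : ℝ => (τ : ℂ) ^ n) (𝓝[>] 0) (𝓝[≠] 0) := by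
      refine tendsto_nhdsWithin_iff.2 ⟨?_, ?_⟩
      · have : Continuous fun τ : ℝ => (τ : ℂ) ^ n := by fun_prop
        have h4 := this.tendsto 0
        simp only [Complex.ofReal_zero, zero_pow hn] at h4
        exact h4.mono_left nhdsWithin_le_nhds
      · filter_upwards [self_mem_nhdsWithin] with τ hτ
        exact pow_ne_zero _ (Complex.ofReal_ne_zero.2 (ne_of_gt hτ))
    have h4 := ((h2.comp h3).norm).pow N
    have h5 : Tendsto (fun τ : ℝ => ‖((τ : ℂ) ^ n)⁻¹ * F (p + ((τ : ℂ) ^ n) • Pi.single i 1)‖ ^ N)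
        (𝓝[>] 0) (𝓝 0) := by
      have hlim : Tendsto (fun τ : ℝ => C * τ) (𝓝[>] 0) (𝓝 0) := by
        have : Continuous fun τ : ℝ => C * τ := by fun_prop
        have := this.tendsto 0
        simp only [mul_zero] at this
        exact this.mono_left nhdsWithin_le_nhds
      refine squeeze_zero' (Eventually.of_forall fun _ => by positivity) ?_ hlim
      filter_upwards [hC, self_mem_nhdsWithin] with τ hτ hτ0
      have hτ0' : (0 : ℝ) < τ := hτ0
      rw [norm_mul, mul_pow, norm_inv, norm_pow, Complex.norm_real, Real.norm_of_nonneg hτ0'.le,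
        inv_pow, ← pow_mul, inv_mul_le_iff₀ (by positivity)]
      calc _ ≤ _ := hτ
        _ = _ := by rw [pow_succ]; ring
    have h6 := tendsto_nhds_unique h4 h5
    exact norm_eq_zero.1 ((pow_eq_zero_iff hN).1 h6)
  ext v
  have hv : v = ∑ i, v i • (Pi.single i 1 : Fin 3 → ℂ) := by
    ext k
    simp [Finset.sum_apply, Pi.single_apply]
  rw [hv, map_sum]
  simp [key]

/-- Only the monomials that occur in `h` have to be bounded, so gaps in the support of a series
translate into vanishing orders. -/
theorem norm_evalSeries_le_of_terms {h : MvPowerSeries (Fin 2) ℂ} {r : ℝ} (H : ConvOn r h) :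
    ∃ C : ℝ, 0 ≤ C ∧ ∀ (U : Fin 2 → ℂ) (ρ : ℝ), 0 ≤ ρ →
      (∀ a, MvPowerSeries.coeff a h ≠ 0 → ‖∏ i, U i ^ a i‖ ≤ r ^ a.degree * ρ) →
      ‖evalSeries h U‖ ≤ C * ρ := by
  refine ⟨max 0 (∑' a : Fin 2 →₀ ℕ, ‖MvPowerSeries.coeff a h‖ * r ^ a.degree),
    le_max_left _ _, fun U ρ hρ hU => ?_⟩
  refine le_trans ?_ (mul_le_mul_of_nonneg_right (le_max_right _ _) hρ)
  refine tsum_of_norm_bounded ((Summable.hasSum H).mul_right ρ) fun a => ?_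
  rcases eq_or_ne (MvPowerSeries.coeff a h) 0 with h0 | h0
  · simp [h0]
  · rw [norm_mul, mul_assoc]
    exact mul_le_mul_of_nonneg_left (hU a h0) (norm_nonneg _)

theorem norm_prod_pow_le_of_le {U : Fin 2 → ℂ} {r : ℝ} (hr : 0 < r) (hU : ∀ i, ‖U i‖ ≤ r)
    {a : Fin 2 →₀ ℕ} {i : Fin 2} {M : ℕ} (ha : M ≤ a i) :
    ‖∏ i, U i ^ a i‖ ≤ r ^ a.degree * (‖U i‖ / r) ^ M := by
  have h1 : ∀ l, ‖U l‖ ^ a l ≤ r ^ a l := fun l => pow_le_pow_left₀ (norm_nonneg _) (hU l) _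
  have h2 : ‖U i‖ ^ a i ≤ r ^ a i * (‖U i‖ / r) ^ M := by
    have e : ‖U i‖ ^ a i = r ^ a i * (‖U i‖ / r) ^ a i := by
      rw [← mul_pow, mul_div_cancel₀ _ hr.ne']
    rw [e]
    refine mul_le_mul_of_nonneg_left ?_ (by positivity)
    exact pow_le_pow_of_le_one (by positivity) ((div_le_one hr).2 (hU i)) ha
  rw [norm_prod, Finsupp.degree_eq_sum, ← Finset.prod_pow_eq_pow_sum,
    ← Finset.mul_prod_erase _ _ (Finset.mem_univ i), ← Finset.mul_prod_erase _ _ (Finset.mem_univ i)]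
  rw [norm_pow, mul_right_comm]
  refine mul_le_mul h2 (Finset.prod_le_prod (fun _ _ => norm_nonneg _) fun l _ => ?_)
    (Finset.prod_nonneg fun _ _ => norm_nonneg _) (by positivity)
  rw [norm_pow]; exact h1 l

namespace QOSurface
variable (X : QOSurface n)

theorem exists_int_of_mem_latM' {j : ℕ} (hj : j ≤ X.g) {v : Fin 2 → ℚ} (hv : v ∈ latM X.lam j) :
    ∃ z, zvec n z = v := by
  induction hv using AddSubgroup.closure_induction with
  | mem x hx =>
    rcases hx with ⟨l, rfl⟩ | ⟨k, ⟨h1, h2⟩, rfl⟩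
    · refine ⟨Pi.single l n, ?_⟩
      ext i
      rw [zvec_apply]
      by_cases h : i = l
      · subst h; simp [cast_ne_zero_of_neZero (n := n)]
      · simp [Pi.single_eq_of_ne h]
    · obtain ⟨A, hA⟩ := X.charExponents.exists_vec (h2.trans hj)
      exact ⟨toInt A, by rw [zvec_toInt, hA]⟩
  | zero => exact ⟨0, map_zero _⟩
  | add x y _ _ hx hy =>
    obtain ⟨a, rfl⟩ := hx
    obtain ⟨b, rfl⟩ := hy
    exact ⟨a + b, map_add _ _ _⟩
  | neg x _ hx =>
    obtain ⟨a, rfl⟩ := hx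
    exact ⟨-a, map_neg _ _⟩

/-- The vector `n u` of natural numbers, for `u` in `σ^∨ ∩ M_j`. -/
def natOf (n : ℕ) (u : Fin 2 → ℚ) : Fin 2 →₀ ℕ :=
  Finsupp.equivFunOnFinite.symm fun i => ⌊(n : ℚ) * u i⌋₊

theorem natOf_vec (a : Fin 2 →₀ ℕ) : natOf n (vec n a) = a := by
  ext i
  simp only [natOf, Finsupp.equivFunOnFinite_symm_apply_apply, vec]
  rw [mul_div_cancel₀ _ cast_ne_zero_of_neZero, Nat.floor_natCast]

theorem vec_natOf {j : ℕ} (hj : j ≤ X.g) (u : X.dualSemigroup j) :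
    vec n (natOf n (u : Fin 2 → ℚ)) = u := by
  obtain ⟨z, hz⟩ := X.exists_int_of_mem_latM' hj u.2.1
  have h : ∃ a : Fin 2 →₀ ℕ, vec n a = (u : Fin 2 → ℚ) := by
    refine ⟨Finsupp.equivFunOnFinite.symm fun i => (z i).toNat, ?_⟩
    rw [← hz]
    ext i
    have h0 : 0 ≤ z i := by
      have := u.2.2 i
      rw [← hz, zvec_apply] at this
      have hn : (0 : ℚ) < n := by exact_mod_cast Nat.pos_of_ne_zero (NeZero.ne n)
      have h2 : (0 : ℚ) ≤ z i := by
        simpa using (le_div_iff₀ hn).1 this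
      exact_mod_cast h2
    simp only [vec, Finsupp.equivFunOnFinite_symm_apply_apply, zvec_apply]
    congr 1
    exact_mod_cast Int.toNat_of_nonneg h0
  obtain ⟨a, ha⟩ := h
  rw [← ha, natOf_vec]

/-- The point of the toric variety at which `x_i ^ (1/n)` takes the value `U_i`. -/
def toricPoint {j : ℕ} (hj : j ≤ X.g) (U : Fin 2 → ℂ) : X.ToricPoint j where
  toFun u := ∏ i, U i ^ natOf n (u.toAdd : Fin 2 → ℚ) i
  map_one' := by
    refine Finset.prod_eq_one fun i _ => ?_
    simp [natOf]
  map_mul' u w := by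
    rw [← Finset.prod_mul_distrib]
    refine Finset.prod_congr rfl fun i _ => ?_
    rw [← pow_add]
    congr 1
    have h : ∀ x : X.dualSemigroup j, ((natOf n (x : Fin 2 → ℚ) i : ℕ) : ℚ) = n * (x : Fin 2 → ℚ) i := by
      intro x
      have := congrFun (X.vec_natOf hj x) i
      rw [vec, div_eq_iff cast_ne_zero_of_neZero] at this
      rw [this, mul_comm]
    have h3 := h (u.toAdd + w.toAdd)
    have h4 : (((u.toAdd + w.toAdd : X.dualSemigroup j)) : Fin 2 → ℚ) i =
      (u.toAdd : Fin 2 → ℚ) i + (w.toAdd : Fin 2 → ℚ) i := rfl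
    rw [h4, mul_add, ← h, ← h] at h3
    exact_mod_cast h3

theorem monomialAt_toricPoint {j : ℕ} (hj : j ≤ X.g) (U : Fin 2 → ℂ) (u : X.dualSemigroup j) :
    X.monomialAt (X.toricPoint hj U) u = ∏ i, U i ^ natOf n (u : Fin 2 → ℚ) i := rfl

theorem coordAt_toricPoint {j : ℕ} (hj : j ≤ X.g) (U : Fin 2 → ℂ) (i : Fin 2) :
    X.coordAt (X.toricPoint hj U) i = U i ^ n := by
  rw [coordAt, monomialAt_toricPoint, Finset.prod_eq_single i]
  · simp [natOf]
  · intro l _ hl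
    simp [natOf, Pi.single_eq_of_ne hl]
  · simp

theorem toricPoint_mem_orbit {j : ℕ} (hj : j ≤ X.g) {U : Fin 2 → ℂ} {v : Fin 2 → ℝ}
    (h : ∀ i, U i = 0 ↔ v i ≠ 0) : X.toricPoint hj U ∈ X.orbit j v := by
  intro u
  rw [monomialAt_toricPoint, Finset.prod_ne_zero_iff]
  refine ⟨fun H i hi => ?_, fun H i _ => ?_⟩
  · have h1 := H i (Finset.mem_univ i)
    rw [(h i).2 hi] at h1
    have h2 : natOf n (u : Fin 2 → ℚ) i = 0 := by
      by_contra h3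
      exact h1 (zero_pow h3)
    rw [← X.vec_natOf hj u, vec, h2]
    simp
  · by_cases hi : v i = 0
    · exact pow_ne_zero _ fun h0 => ((h i).1 h0) hi
    · have h2 : natOf n (u : Fin 2 → ℚ) i = 0 := by
        simp [natOf, H i hi]
      rw [h2, pow_zero]
      exact one_ne_zero

theorem normalization_toricPoint {j : ℕ} (hj : j ≤ X.g) (U : Fin 2 → ℂ) :
    X.normalization j (X.toricPoint hj U) =
      ![U 0 ^ n, U 1 ^ n, evalSeries (X.trunc j).toSeries U] := by
  rw [normalization, coordAt_toricPoint, coordAt_toricPoint]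
  congr 3
  have hinj : Function.Injective fun u : X.dualSemigroup j => natOf n (u : Fin 2 → ℚ) := by
    intro u w huw
    ext1
    rw [← X.vec_natOf hj u, ← X.vec_natOf hj w]
    exact congrArg (vec n) huw
  rw [evalSeries, ← hinj.tsum_eq]
  · refine tsum_congr fun u => ?_
    rw [monomialAt_toricPoint]
    congr 1
    conv_lhs => rw [← X.vec_natOf hj u]
    rw [coeffAt_vec]
  · intro a ha
    have h0 : MvPowerSeries.coeff a (X.trunc j).toSeries ≠ 0 := fun h0 => ha (by simp [h0])
    exact ⟨⟨vec n a, (X.charExponents_trunc hj).vec_mem_latM h0, vec_nonneg a⟩, natOf_vec a⟩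

/-- The factors indexed by `K` contribute `τ ^ (M |K|)` and the others are bounded. The requirement
on `M |K|` yields `τ ^ (2 n |G_j|)`, which is at least as small as `τ ^ (n |G_j| + 1)`. -/
theorem norm_evalPoly_semiRoot_pow_le {r : ℝ} (hr : 0 < r) (hc : ConvOn r X.ζ.toSeries) {j : ℕ}
    (hj : j ≤ X.g) {U : ℝ → Fin 2 → ℂ} {p : ℝ → Fin 3 → ℂ}
    (hU : ∀ᶠ τ in 𝓝[>] 0, ∀ i, ‖U τ i‖ ≤ r)
    (hp : ∀ᶠ τ in 𝓝[>] 0, p τ 0 = U τ 0 ^ n ∧ p τ 1 = U τ 1 ^ n)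
    {B : ℝ} (hB : ∀ᶠ τ in 𝓝[>] 0, ‖p τ 2‖ ≤ B) {K : Subgroup (Rots n)} {C : ℝ} {M : ℕ}
    (hK : ∀ ω ∈ K, ∀ᶠ τ : ℝ in 𝓝[>] 0,
      ‖p τ 2 - evalSeries (X.trunc j).toSeries (ω.val * U τ)‖ ≤ C * τ ^ M)
    (hM : 2 * n * Nat.card (charKer n X.lam j) ≤ M * Nat.card K) :
    ∃ C' : ℝ, ∀ᶠ τ : ℝ in 𝓝[>] 0, ‖evalPoly (X.semiRoot j) (p τ)‖ ^ Nat.card (charKer n X.lam j) ≤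
      C' * τ ^ (n * Nat.card (charKer n X.lam j) + 1) := by
  classical
  obtain ⟨D, hD0, hD⟩ := (X.convOn_trunc hr.le hc j).exists_bound
  set N := Nat.card (charKer n X.lam j) with hN
  have hNpos : 0 < N := Nat.card_pos
  have hn : 0 < n := Nat.pos_of_ne_zero (NeZero.ne n)
  set E := max (max C (B + D)) 1 with hE
  have hE1 : 1 ≤ E := le_max_right _ _
  refine ⟨E ^ Fintype.card (Rots n), ?_⟩
  have hK' : ∀ᶠ τ : ℝ in 𝓝[>] 0, ∀ ω ∈ K,
      ‖p τ 2 - evalSeries (X.trunc j).toSeries (ω.val * U τ)‖ ≤ C * τ ^ M := by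
    rw [eventually_all]
    intro ω
    by_cases hω : ω ∈ K
    · simpa [hω] using hK ω hω
    · simp [hω]
  have hlt : ∀ᶠ τ : ℝ in 𝓝[>] 0, τ < 1 := nhdsWithin_le_nhds (gt_mem_nhds one_pos)
  filter_upwards [hU, hp, hB, hK', self_mem_nhdsWithin, hlt] with τ h1 h2 h3 h4 h5 h6
  have h5' : (0 : ℝ) < τ := h5
  rw [← norm_pow, X.evalPoly_semiRoot_pow hr hc hj h1 h2.1 h2.2, norm_prod]
  calc ∏ ω : Rots n, ‖p τ 2 - evalSeries (X.trunc j).toSeries (ω.val * U τ)‖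
      ≤ ∏ ω : Rots n, (E * if ω ∈ K then τ ^ M else 1) := by
        refine Finset.prod_le_prod (fun _ _ => norm_nonneg _) fun ω _ => ?_
        split_ifs with hω
        · refine (h4 ω hω).trans (mul_le_mul_of_nonneg_right ?_ (by positivity))
          exact (le_max_left _ _).trans (le_max_left _ _)
        · rw [mul_one]
          refine (norm_sub_le _ _).trans ((add_le_add h3 (hD _ fun i => ?_)).trans
            ((le_max_right _ _).trans (le_max_left _ _)))
          rw [Pi.mul_apply, norm_mul, ω.norm_val, one_mul]
          exact h1 i
    _ = E ^ Fintype.card (Rots n) * (τ ^ M) ^ Nat.card K := by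
        rw [Finset.prod_mul_distrib, Finset.prod_const, Finset.card_univ, Finset.prod_ite,
          Finset.prod_const, Finset.prod_const_one, mul_one]
        congr 2
        rw [Nat.card_eq_fintype_card]
        exact (Fintype.card_subtype _).symm
    _ ≤ E ^ Fintype.card (Rots n) * τ ^ (n * N + 1) := by
        rw [← pow_mul]
        refine mul_le_mul_of_nonneg_left ?_ (by positivity)
        refine pow_le_pow_of_le_one h5'.le h6.le (le_trans ?_ hM)
        nlinarith [Nat.mul_pos hn hNpos]

end QOSurface

theorem eventually_pos_lt {b : ℝ} (hb : 0 < b) : ∀ᶠ τ : ℝ in 𝓝[>] 0, 0 < τ ∧ τ < b :=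
  (eventually_mem_nhdsWithin (s := Set.Ioi (0 : ℝ))).and (nhdsWithin_le_nhds (gt_mem_nhds hb))

/-- Used to move a nonzero coordinate `c ^ n` by `τ ^ n`: away from zero the root moves by `O(τ ^
n)`, because `c' ^ n - c ^ n ≥ (c' - c) c ^ (n - 1)`. -/
theorem exists_nat_root_sub_le {c τ : ℝ} (hc : 0 < c) (hτ : 0 ≤ τ) :
    ∃ c' : ℝ, c ≤ c' ∧ c' ^ n = c ^ n + τ ^ n ∧ c' - c ≤ τ ^ n / c ^ (n - 1) := by
  have hn : n ≠ 0 := NeZero.ne n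
  refine ⟨(c ^ n + τ ^ n) ^ ((n : ℝ)⁻¹), ?_, ?_, ?_⟩
  · calc c = (c ^ n) ^ ((n : ℝ)⁻¹) := (Real.pow_rpow_inv_natCast hc.le hn).symm
      _ ≤ _ := Real.rpow_le_rpow (by positivity) (by linarith [pow_nonneg hτ n]) (by positivity)
  · exact Real.rpow_inv_natCast_pow (by positivity) hn
  · have h1 : c ≤ (c ^ n + τ ^ n) ^ ((n : ℝ)⁻¹) := by
      calc c = (c ^ n) ^ ((n : ℝ)⁻¹) := (Real.pow_rpow_inv_natCast hc.le hn).symm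
        _ ≤ _ := Real.rpow_le_rpow (by positivity) (by linarith [pow_nonneg hτ n]) (by positivity)
    have h2 : ((c ^ n + τ ^ n) ^ ((n : ℝ)⁻¹)) ^ n = c ^ n + τ ^ n :=
      Real.rpow_inv_natCast_pow (by positivity) hn
    set c' := (c ^ n + τ ^ n) ^ ((n : ℝ)⁻¹)
    rw [le_div_iff₀ (by positivity)]
    have h3 : c' ^ n = c' * c' ^ (n - 1) := by rw [← pow_succ']; congr 1; omega
    have h4 : c ^ n = c * c ^ (n - 1) := by rw [← pow_succ']; congr 1; omega
    have h5 : c ^ (n - 1) ≤ c' ^ (n - 1) := pow_le_pow_left₀ hc.le h1 _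
    have h6 : c' * c ^ (n - 1) ≤ c' * c' ^ (n - 1) :=
      mul_le_mul_of_nonneg_left h5 (hc.le.trans h1)
    linarith

theorem IsCharExponents.prod_idx_pos {ζ : Puiseux n} {g : ℕ} {lam : ℕ → Fin 2 → ℚ}
    (H : IsCharExponents ζ g lam) (k : ℕ) : 0 < ∏ l ∈ Finset.Ioc k g, idx lam l := by
  refine Finset.prod_pos fun l hl => ?_
  rw [Finset.mem_Ioc] at hl
  obtain ⟨m, rfl⟩ : ∃ m, l = m + 1 := ⟨l - 1, by omega⟩
  have := H.two_le_idx (k := m) (by omega)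
  omega

theorem IsCharExponents.two_le_prod_idx {ζ : Puiseux n} {g : ℕ} {lam : ℕ → Fin 2 → ℚ}
    (H : IsCharExponents ζ g lam) {k : ℕ} (hk : k < g) : 2 ≤ ∏ l ∈ Finset.Ioc k g, idx lam l :=
  (H.two_le_idx hk).trans (Nat.le_of_dvd (H.prod_idx_pos k)
    (Finset.dvd_prod_of_mem _ (Finset.mem_Ioc.2 ⟨by omega, hk⟩)))

namespace QOSurface
variable (X : QOSurface n)

/-- Singularity is tested by perturbing each of the three coordinates by `τ ^ n`. It holds if a
large enough group of conjugates stays within `O(τ ^ M)` of the last coordinate under every such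
perturbation. -/
theorem isSingularPoint_of_directions {r : ℝ} (hr : 0 < r) (hc : ConvOn r X.ζ.toSeries) {j : ℕ}
    (hj : j ≤ X.g) {U₀ : Fin 2 → ℂ} (hU₀ : ∀ i, ‖U₀ i‖ ≤ r) {p : Fin 3 → ℂ}
    (hp : ∀ m : Fin 2, p m.castSucc = U₀ m ^ n) (hp2 : p 2 = evalSeries (X.trunc j).toSeries U₀)
    {K : Subgroup (Rots n)} {M : ℕ}
    (hM : 2 * n * Nat.card (charKer n X.lam j) ≤ M * Nat.card K)
    (hdir : ∀ i : Fin 3, ∃ (U : ℝ → Fin 2 → ℂ) (C : ℝ), ∀ᶠ τ : ℝ in 𝓝[>] 0,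
      (∀ m, ‖U τ m‖ ≤ r) ∧
      (∀ m : Fin 2, (p + ((τ : ℂ) ^ n) • Pi.single i 1 : Fin 3 → ℂ) m.castSucc = U τ m ^ n) ∧
      ∀ ω ∈ K, ‖(p + ((τ : ℂ) ^ n) • Pi.single i 1 : Fin 3 → ℂ) 2 -
        evalSeries (X.trunc j).toSeries (ω.val * U τ)‖ ≤ C * τ ^ M) :
    IsSingularPoint (X.semiRoot j) p := by
  have hN : Nat.card (charKer n X.lam j) ≠ 0 := Nat.card_pos.ne'
  have h0 : evalPoly (X.semiRoot j) p = 0 := by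
    rw [← pow_eq_zero_iff hN, X.evalPoly_semiRoot_pow hr hc hj hU₀ (hp 0) (hp 1)]
    refine Finset.prod_eq_zero (Finset.mem_univ 1) ?_
    rw [Rots.val_one, one_mul, hp2, sub_self]
  refine ⟨h0, fderiv_eq_zero_of_norm_pow_le (n := n) h0 hN fun i => ?_⟩
  obtain ⟨U, C, hU⟩ := hdir i
  refine X.norm_evalPoly_semiRoot_pow_le hr hc hj (U := U) (B := ‖p 2‖ + 1) (K := K) (C := C)
    (M := M) (hU.mono fun τ h => h.1) (hU.mono fun τ h => ⟨h.2.1 0, h.2.1 1⟩) ?_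
    (fun ω hω => hU.mono fun τ h => h.2.2 ω hω) hM
  filter_upwards [eventually_pos_lt one_pos] with τ hτ
  refine (norm_add_le _ _).trans (add_le_add le_rfl ?_)
  rw [Pi.smul_apply, smul_eq_mul, norm_mul, norm_pow, Complex.norm_real,
    Real.norm_of_nonneg hτ.1.le]
  have h1 : ‖(Pi.single i 1 : Fin 3 → ℂ) 2‖ ≤ 1 := by
    rw [Pi.single_apply]; split_ifs <;> simp
  exact mul_le_one₀ (pow_le_one₀ hτ.1.le hτ.2.le) (norm_nonneg _) h1

/-- `2 n |G_j| ≤ min (n, n λ_h^{(i)}) |G_{h-1}|` unless the surface `X⁽ʲ⁾` is regular along the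
curve `x_i = 0`. -/
theorem two_mul_card_le {j k : ℕ} (hj : j ≤ X.g) (hk : k < j) {i : Fin 2}
    (h0 : X.lam k i = 0) {A : Fin 2 →₀ ℕ} (hA : vec n A = X.lam (k + 1)) (hAi : A i ≠ 0)
    (hspec : ¬ (k + 1 = j ∧ (idx X.lam j : ℚ) * X.lam j i = 1)) :
    2 * n * Nat.card (charKer n X.lam j) ≤ min n (A i) * Nat.card (charKer n X.lam k) := by
  have hHj := X.charExponents_trunc hj
  have h2 := hHj.two_le_idx (k := k) hk
  have hcard := card_charKer hA
  have hcard' := hHj.card_charKer_eq (k := k + 1) hk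
  set N := Nat.card (charKer n X.lam j)
  have hN : 0 < N := Nat.card_pos
  rw [hcard, hcard']
  set P := ∏ l ∈ Finset.Ioc (k + 1) j, idx X.lam l with hP
  have hPpos : 1 ≤ P := hHj.prod_idx_pos _
  -- The `i`-th coordinates of the elements of `M_k` are integers, and `n_{k+1} λ_{k+1}` lies in
  -- `M_k`. Hence `n_{k+1} A_i = q n` with an integer `q ≥ 1`, and `|G_k| = n_{k+1} P |G_j|`.
  have hint : ∃ q : ℤ, (idx X.lam (k + 1) : ℚ) * X.lam (k + 1) i = q := by
    have h3 := (zsmul_mem_latM_iff (lam := X.lam) k (idx X.lam (k + 1))).2 dvd_rfl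
    obtain ⟨q, hq⟩ := exists_int_of_mem_latM (i := i) (fun l h1 h2 =>
      X.charExponents.coord_eq_zero h2 (by omega) h0) h3
    exact ⟨q, by simpa using hq⟩
  obtain ⟨q, hq⟩ := hint
  rw [← hA, vec, mul_div_assoc', div_eq_iff cast_ne_zero_of_neZero] at hq
  have hq' : (idx X.lam (k + 1) * A i : ℤ) = q * n := by exact_mod_cast hq
  have hqpos : 0 < q := by
    have h4 : (0 : ℤ) < idx X.lam (k + 1) * A i := by positivity
    have hn : (0 : ℤ) < n := by exact_mod_cast Nat.pos_of_ne_zero (NeZero.ne n)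
    rw [hq'] at h4
    exact pos_of_mul_pos_left h4 hn.le
  lift q to ℕ using hqpos.le
  have hq'' : idx X.lam (k + 1) * A i = q * n := by exact_mod_cast hq'
  have hq1 : 1 ≤ q := by exact_mod_cast hqpos
  -- Both `q` and `P` are equal to `1` only in the excluded case: `P = 1` forces `k + 1 = j`, and
  -- then `q = n_j λ_j^{(i)}`.
  have hqP : 2 ≤ q * P := by
    rcases Nat.lt_or_ge (k + 1) j with h | h
    · have h5 : 2 ≤ P := hHj.two_le_prod_idx h
      nlinarith
    · have hkj : k + 1 = j := by omega
      have : q ≠ 1 := by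
        rintro rfl
        refine hspec ⟨hkj, ?_⟩
        rw [← hkj, ← hA, vec, mul_div_assoc', div_eq_iff cast_ne_zero_of_neZero]
        exact_mod_cast hq''
      nlinarith [show 2 ≤ q by omega]
  rcases min_choice n (A i) with h | h
  · rw [h]
    have : 2 * 1 ≤ idx X.lam (k + 1) * P := Nat.mul_le_mul h2 hPpos
    calc 2 * n * N = n * ((2 * 1) * N) := by ring
      _ ≤ n * ((idx X.lam (k + 1) * P) * N) := by gcongr
      _ = _ := by ring
  · rw [h]
    calc 2 * n * N = 2 * (n * N) := by ring
      _ ≤ (q * P) * (n * N) := Nat.mul_le_mul_right _ hqP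
      _ = (q * n) * (P * N) := by ring
      _ = _ := by rw [← hq'']; ring

/-- The origin is a singular point of `X⁽ʲ⁾` for `j ≥ 1`. -/
theorem isSingularPoint_zero {r : ℝ} (hr : 0 < r) (hc : ConvOn r X.ζ.toSeries) {j : ℕ}
    (hj1 : 1 ≤ j) (hj : j ≤ X.g) :
    IsSingularPoint (X.semiRoot j) ![0, 0, evalSeries (X.trunc j).toSeries 0] := by
  have hn : n ≠ 0 := NeZero.ne n
  have hHj := X.charExponents_trunc hj
  have hz : evalSeries (X.trunc j).toSeries 0 = 0 := by
    rw [evalSeries_at_zero, X.constantCoeff_trunc]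
  -- Pure powers of one variable in `ζ_j` have exponent at least `1`. Either the exponent is
  -- integral, or it dominates `λ_1`, which then lies on an axis; this must be the first axis by the
  -- lexicographic condition, and the normalization gives `λ_1^{(1)} ≥ 1`.
  have hsupp : ∀ m : Fin 2, ∀ a, MvPowerSeries.coeff a (X.trunc j).toSeries ≠ 0 →
      (∀ l, l ≠ m → a l = 0) → n ≤ a m := by
    intro m a ha hal
    have ham : a m ≠ 0 := by
      intro h0
      have : a = 0 := by
        ext l
        by_cases h : l = m
        · rw [h, h0]; rfl
        · rw [hal l h]; rfl
      rw [this, MvPowerSeries.coeff_zero_eq_constantCoeff_apply, X.constantCoeff_trunc] at ha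
      exact ha rfl
    by_cases hle : X.lam 1 ≤ vec n a
    · have h1 : ∀ l, l ≠ m → X.lam 1 l = 0 := fun l hl =>
        le_antisymm (by simpa [vec, hal l hl] using hle l) (hHj.nonneg hj1 l)
      have hm : m = 0 := by
        by_contra hm
        have h2 : X.lam 1 0 = 0 := h1 0 (Ne.symm hm)
        have h3 := X.lex 1 le_rfl X.one_le_g (fun i h4 h5 => by omega)
        rw [h2] at h3
        have h4 : X.lam 1 = 0 := by
          ext l
          fin_cases l
          · exact h2
          · exact le_antisymm h3 (hHj.nonneg hj1 1)
        exact hHj.not_mem_latM 0 hj1 (by rw [zero_add, h4]; exact zero_mem _)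
      subst hm
      have h2 := X.normalized
      have h3 : 1 ≤ X.lam 1 0 := by
        by_contra h4
        exact h2 ⟨h1 1 (by decide), not_le.1 h4⟩
      have h4 := h3.trans (hle 0)
      rw [vec, le_div_iff₀ (by exact_mod_cast Nat.pos_of_ne_zero hn), one_mul] at h4
      exact_mod_cast h4
    · have h1 := hHj.vec_mem_latM_of_not_le ha (k := 0) hj1 hle
      obtain ⟨q, hq⟩ := exists_int_of_mem_latM (i := m) (fun l h1 h2 => by omega) h1
      rw [vec, div_eq_iff cast_ne_zero_of_neZero] at hq
      have hq' : (a m : ℤ) = q * n := by exact_mod_cast hq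
      have : (n : ℤ) ∣ a m := ⟨q, by rw [hq', mul_comm]⟩
      exact Nat.le_of_dvd (Nat.pos_of_ne_zero ham) (by exact_mod_cast this)
  obtain ⟨D, hD0, hD⟩ := norm_evalSeries_le_of_terms (X.convOn_trunc hr.le hc j)
  -- On the coordinate axes all conjugates of `ζ_j` are `O(τ ^ n)`, so the whole group can be used
  -- with `M = n`; what is needed is that it has at least `2 |G_j|` elements, which holds as `j ≥
  -- 1`.
  refine X.isSingularPoint_of_directions hr hc hj (U₀ := 0) (K := ⊤) (M := n) (fun i => by simp [hr.le])
    (fun m => by fin_cases m <;> simp [hn]) rfl ?_ fun i => ?_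
  · obtain ⟨A, hA⟩ := hHj.exists_vec hj1
    have h1 := hHj.card_charKer_eq (k := 0) (Nat.zero_le _)
    rw [charKer_zero] at h1
    rw [h1]
    have h2 := hHj.two_le_idx (k := 0) hj1
    have h3 := hHj.two_le_prod_idx hj1
    calc 2 * n * Nat.card (charKer n X.lam j) = n * (2 * Nat.card (charKer n X.lam j)) := by ring
      _ ≤ _ := by gcongr
  · induction i using Fin.lastCases with
    | last =>
      refine ⟨fun _ => 0, 1, ?_⟩
      filter_upwards [eventually_pos_lt one_pos] with τ hτ
      refine ⟨fun m => by simp [hr.le], fun m => by fin_cases m <;> simp [hn, Fin.last], fun ω _ => ?_⟩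
      rw [mul_zero, hz]
      simp [Fin.last, abs_of_pos hτ.1]
    | cast m =>
      refine ⟨fun τ => Pi.single m (τ : ℂ), D * (r⁻¹) ^ n, ?_⟩
      filter_upwards [eventually_pos_lt hr] with τ hτ
      refine ⟨fun l => ?_, fun l => ?_, fun ω _ => ?_⟩
      · rw [Pi.single_apply]; split_ifs
        · simp [abs_of_pos hτ.1, hτ.2.le]
        · simp [hr.le]
      · by_cases h : l = m
        · subst h; fin_cases l <;> simp
        · fin_cases l <;> fin_cases m <;> simp_all
      · have e1 : (![0, 0, evalSeries (X.trunc j).toSeries 0] +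
            ((τ : ℂ) ^ n) • Pi.single m.castSucc 1 : Fin 3 → ℂ) 2 = 0 := by
          fin_cases m <;> simp [hz]
        rw [e1, zero_sub, norm_neg]
        have e2 : D * r⁻¹ ^ n * τ ^ n = D * (τ / r) ^ n := by
          rw [div_pow, inv_pow]; ring
        rw [e2]
        refine hD _ _ (by have := hτ.1; positivity) fun a ha => ?_
        by_cases hal : ∀ l, l ≠ m → a l = 0
        · have h1 := norm_prod_pow_le_of_le hr (U := ω.val * Pi.single m (τ : ℂ)) (i := m)
            (fun l => ?_) (hsupp m a ha hal)
          · simpa [ω.norm_val, abs_of_pos hτ.1] using h1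
          · rw [Pi.mul_apply, norm_mul, ω.norm_val, one_mul, Pi.single_apply]; split_ifs
            · simp [abs_of_pos hτ.1, hτ.2.le]
            · simp [hr.le]
        · push Not at hal
          obtain ⟨l, hl, hal⟩ := hal
          rw [Finset.prod_eq_zero (Finset.mem_univ l), norm_zero]
          · have := hτ.1; positivity
          · simp [Pi.single_eq_of_ne hl, hal]

/-- The generic points of the curve `x_i = 0` are singular points of `X⁽ʲ⁾` unless
`λ_j^{(i)} = 0` or `λ_{j-1}^{(i)} = 0` and `λ_j^{(i)} = 1 / n_j`. -/
theorem isSingularPoint_curve {r : ℝ} (hr : 0 < r) (hc : ConvOn r X.ζ.toSeries) {j k : ℕ}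
    (hj : j ≤ X.g) (hk : k < j) {i l : Fin 2} (hil : l ≠ i) (h0 : X.lam k i = 0)
    (hki : X.lam (k + 1) i ≠ 0)
    (hspec : ¬ (k + 1 = j ∧ (idx X.lam j : ℚ) * X.lam j i = 1)) {U₀ : Fin 2 → ℂ} {c : ℝ}
    (hc0 : 0 < c) (hcr : c < r / 2) (hUi : U₀ i = 0) (hUl : U₀ l = c) :
    IsSingularPoint (X.semiRoot j) ![U₀ 0 ^ n, U₀ 1 ^ n, evalSeries (X.trunc j).toSeries U₀] := by
  classical
  have hn : n ≠ 0 := NeZero.ne n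
  have hHj := X.charExponents_trunc hj
  have hct := X.convOn_trunc hr.le hc j
  have hil' : ∀ m : Fin 2, m = i ∨ m = l := by
    intro m; omega
  obtain ⟨A, hA⟩ := hHj.exists_vec (k := k + 1) hk
  have hAi : A i ≠ 0 := by
    intro h
    apply hki
    rw [← hA, vec, h]; simp
  set M := min n (A i) with hM
  have hM0 : M ≠ 0 := by omega
  have hU₀ : ∀ m, ‖U₀ m‖ ≤ r / 2 := by
    intro m
    rcases hil' m with rfl | rfl
    · rw [hUi, norm_zero]; positivity
    · rw [hUl]; simp [abs_of_pos hc0, hcr.le]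
  obtain ⟨L, hL0, hL⟩ := hct.lipschitz (s := r / 2) (by linarith)
  -- comparison of `ω ζ_j` with the restriction of `ζ_j` to `x_i = 0`
  have hE : ∃ C : ℝ, 0 ≤ C ∧ ∀ ω ∈ charKer n X.lam k, ∀ U : Fin 2 → ℂ, (∀ m, ‖U m‖ ≤ r) →
      ‖evalSeries (X.trunc j).toSeries (Function.update U i 0) -
        evalSeries (X.trunc j).toSeries (ω.val * U)‖ ≤ C * ‖U i‖ ^ M := by
    let h₀ : MvPowerSeries (Fin 2) ℂ := fun a =>
      if a i = 0 then MvPowerSeries.coeff a (X.trunc j).toSeries else 0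
    have hh₀ : ∀ a, MvPowerSeries.coeff a h₀ =
      if a i = 0 then MvPowerSeries.coeff a (X.trunc j).toSeries else 0 := fun a => rfl
    have hch₀ : ConvOn r h₀ := hct.of_norm_le hr.le fun a => by
      rw [hh₀]; split_ifs <;> simp
    have hev : ∀ U : Fin 2 → ℂ, evalSeries (X.trunc j).toSeries (Function.update U i 0) =
        evalSeries h₀ U := by
      intro U
      refine tsum_congr fun a => ?_
      rw [hh₀]
      split_ifs with h
      · congr 1
        refine Finset.prod_congr rfl fun m _ => ?_
        by_cases hm : m = i
        · subst hm; rw [h, pow_zero, pow_zero]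
        · rw [Function.update_of_ne hm]
      · rw [Finset.prod_eq_zero (Finset.mem_univ i) (by simp [h]), mul_zero, zero_mul]
    have hω : ∀ ω : Rots n, ∃ C : ℝ, 0 ≤ C ∧ (ω ∈ charKer n X.lam k →
        ∀ U : Fin 2 → ℂ, (∀ m, ‖U m‖ ≤ r) →
        ‖evalSeries (X.trunc j).toSeries (Function.update U i 0) -
        evalSeries (X.trunc j).toSeries (ω.val * U)‖ ≤ C * ‖U i‖ ^ M) := by
      intro ω
      have hcω : ConvOn r (MvPowerSeries.rescale ω.val (X.trunc j).toSeries) :=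
        hct.rescale hr.le ω.norm_val
      obtain ⟨D, hD0, hD⟩ := norm_evalSeries_le_of_terms (hch₀.sub hr.le hcω)
      refine ⟨D * r⁻¹ ^ M, by positivity, fun hωK U hU => ?_⟩
      rw [hev, ← evalSeries_rescale, ← evalSeries_sub hch₀ hcω hU, mul_assoc, ← mul_pow,
        inv_mul_eq_div]
      refine hD U _ (by positivity) fun a ha => ?_
      have hcoeff : MvPowerSeries.coeff a (h₀ - MvPowerSeries.rescale ω.val (X.trunc j).toSeries) =
          (if a i = 0 then MvPowerSeries.coeff a (X.trunc j).toSeries else 0) -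
            (∏ m, ω.val m ^ a m) * MvPowerSeries.coeff a (X.trunc j).toSeries := by
        rw [map_sub, hh₀, ← toSeries_smul, coeff_smul]
      rw [hcoeff] at ha
      have ha0 : MvPowerSeries.coeff a (X.trunc j).toSeries ≠ 0 := by
        intro h; rw [h] at ha; simp at ha
      have hkM : ∀ {v}, v ∈ latM X.lam k → ∃ q : ℤ, v i = q := fun hv =>
        exists_int_of_mem_latM (fun m h1 h2 => X.charExponents.coord_eq_zero h2 (by omega) h0) hv
      refine norm_prod_pow_le_of_le hr hU ?_
      by_cases hai : a i = 0
      · exfalso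
        have hle : ¬ X.lam (k + 1) ≤ vec n a := by
          intro hle
          have := hle i
          rw [vec, hai] at this
          simp only [Nat.cast_zero, zero_div] at this
          exact hki (le_antisymm this (hHj.nonneg hk i))
        rw [if_pos hai, prod_val_pow_eq_one hωK (hHj.vec_mem_latM_of_not_le ha0 hk hle), one_mul,
          sub_self] at ha
        exact ha rfl
      · by_cases hle : X.lam (k + 1) ≤ vec n a
        · rw [← hA, vec_le_vec] at hle
          exact (min_le_right _ _).trans (hle i)
        · obtain ⟨q, hq⟩ := hkM (hHj.vec_mem_latM_of_not_le ha0 hk hle)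
          rw [vec, div_eq_iff cast_ne_zero_of_neZero] at hq
          have hq' : (a i : ℤ) = q * n := by exact_mod_cast hq
          have : (n : ℤ) ∣ a i := ⟨q, by rw [hq', mul_comm]⟩
          exact (min_le_left _ _).trans
            (Nat.le_of_dvd (Nat.pos_of_ne_zero hai) (by exact_mod_cast this))
    choose C hC0 hC using hω
    refine ⟨∑ ω, C ω, Finset.sum_nonneg fun ω _ => hC0 ω, fun ω hωK U hU => ?_⟩
    refine (hC ω hωK U hU).trans (mul_le_mul_of_nonneg_right ?_ (by positivity))
    exact Finset.single_le_sum (f := C) (fun ω _ => hC0 ω) (Finset.mem_univ ω)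
  obtain ⟨C, hC0, hC⟩ := hE
  have hpow : ∀ τ : ℝ, 0 < τ → τ < 1 → τ ^ n ≤ τ ^ M := fun τ h1 h2 =>
    pow_le_pow_of_le_one h1.le h2.le (min_le_left _ _)
  have hupd : Function.update U₀ i 0 = U₀ := by rw [← hUi, Function.update_eq_self]
  refine X.isSingularPoint_of_directions hr hc hj (U₀ := U₀) (K := charKer n X.lam k) (M := M)
    (fun m => (hU₀ m).trans (by linarith)) (fun m => by fin_cases m <;> rfl) rfl
    (X.two_mul_card_le hj hk h0 hA hAi hspec) fun s => ?_
  set z₀ := evalSeries (X.trunc j).toSeries U₀ with hz₀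
  induction s using Fin.lastCases with
  | last =>
    refine ⟨fun _ => U₀, 1, ?_⟩
    filter_upwards [eventually_pos_lt one_pos] with τ hτ
    refine ⟨fun m => (hU₀ m).trans (by linarith), fun m => by fin_cases m <;> simp [Fin.last],
      fun ω hω => ?_⟩
    have h1 := hC ω hω U₀ fun m => (hU₀ m).trans (by linarith)
    rw [hupd, hUi, norm_zero, zero_pow hM0, mul_zero] at h1
    have h2 : evalSeries (X.trunc j).toSeries (ω.val * U₀) = z₀ :=
      (sub_eq_zero.1 (norm_eq_zero.1 (le_antisymm h1 (norm_nonneg _)))).symm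
    rw [h2, one_mul]
    refine le_trans (le_of_eq ?_) (hpow τ hτ.1 hτ.2)
    simp [Fin.last, abs_of_pos hτ.1]
  | cast m =>
    have e2 : ∀ τ : ℝ, (![U₀ 0 ^ n, U₀ 1 ^ n, z₀] +
        ((τ : ℂ) ^ n) • Pi.single m.castSucc 1 : Fin 3 → ℂ) 2 = z₀ := by
      intro τ
      fin_cases m <;> simp
    have e1 : ∀ (τ : ℝ) (y : ℂ) (_ : y ^ n = U₀ m ^ n + τ ^ n) (q : Fin 2),
        (![U₀ 0 ^ n, U₀ 1 ^ n, z₀] +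
        ((τ : ℂ) ^ n) • Pi.single m.castSucc 1 : Fin 3 → ℂ) q.castSucc =
          Function.update U₀ m y q ^ n := by
      intro τ y hy q
      by_cases h : q = m
      · subst h; rw [Function.update_self, hy]; fin_cases q <;> simp
      · rw [Function.update_of_ne h]
        fin_cases q <;> fin_cases m <;> simp_all
    rcases hil' m with hm | hm
    · subst hm
      refine ⟨fun τ => Function.update U₀ m (τ : ℂ), C, ?_⟩
      filter_upwards [eventually_pos_lt hr] with τ hτ
      have hUr : ∀ q, ‖Function.update U₀ m (τ : ℂ) q‖ ≤ r := by
        intro q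
        by_cases h : q = m
        · subst h; simp [abs_of_pos hτ.1, hτ.2.le]
        · rw [Function.update_of_ne h]; exact (hU₀ q).trans (by linarith)
      refine ⟨hUr, e1 τ _ (by rw [hUi, zero_pow hn, zero_add]), fun ω hω => ?_⟩
      rw [e2]
      have := hC ω hω _ hUr
      rw [Function.update_idem, hupd, Function.update_self] at this
      simpa [abs_of_pos hτ.1] using this
    · subst hm
      have hroot : ∀ τ : ℝ, ∃ c' : ℝ, 0 < τ → (c ≤ c' ∧ c' ^ n = c ^ n + τ ^ n ∧
          c' - c ≤ τ ^ n / c ^ (n - 1)) := by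
        intro τ
        by_cases hτ : 0 < τ
        · obtain ⟨c', h⟩ := exists_nat_root_sub_le (n := n) hc0 hτ.le
          exact ⟨c', fun _ => h⟩
        · exact ⟨0, fun h => absurd h hτ⟩
      choose c' hc' using hroot
      refine ⟨fun τ => Function.update U₀ m (c' τ : ℂ), L / c ^ (n - 1), ?_⟩
      have hsmall : ∀ᶠ τ : ℝ in 𝓝[>] 0, τ ^ n / c ^ (n - 1) < r / 2 - c := by
        have h1 : Continuous fun τ : ℝ => τ ^ n / c ^ (n - 1) := by fun_prop
        have h2 := h1.tendsto 0
        rw [zero_pow hn, zero_div] at h2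
        exact (h2.mono_left nhdsWithin_le_nhds).eventually (gt_mem_nhds (by linarith))
      filter_upwards [eventually_pos_lt one_pos, hsmall] with τ hτ hτs
      obtain ⟨h1, h2, h3⟩ := hc' τ hτ.1
      have hUr : ∀ q, ‖Function.update U₀ m (c' τ : ℂ) q‖ ≤ r / 2 := by
        intro q
        by_cases h : q = m
        · subst h
          rw [Function.update_self, Complex.norm_real, Real.norm_of_nonneg (hc0.le.trans h1)]
          linarith
        · rw [Function.update_of_ne h]; exact hU₀ q
      refine ⟨fun q => (hUr q).trans (by linarith), e1 τ _ ?_, fun ω hω => ?_⟩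
      · rw [hUl]; exact_mod_cast h2
      · rw [e2]
        have h4 := hC ω hω _ fun q => (hUr q).trans (by linarith)
        have h5 : Function.update U₀ m (c' τ : ℂ) i = 0 := by
          rw [Function.update_of_ne hil.symm, hUi]
        have h6 : Function.update (Function.update U₀ m (c' τ : ℂ)) i 0 =
            Function.update U₀ m (c' τ : ℂ) := by
          conv_rhs => rw [← Function.update_eq_self i (Function.update U₀ m (c' τ : ℂ)), h5]
        rw [h5, norm_zero, zero_pow hM0, mul_zero, h6] at h4
        have h7 : evalSeries (X.trunc j).toSeries (ω.val * Function.update U₀ m (c' τ : ℂ)) =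
            evalSeries (X.trunc j).toSeries (Function.update U₀ m (c' τ : ℂ)) :=
          (sub_eq_zero.1 (norm_eq_zero.1 (le_antisymm h4 (norm_nonneg _)))).symm
        rw [h7]
        refine (hL U₀ _ hU₀ hUr).trans ?_
        have h8 : ‖U₀ 0 - Function.update U₀ m (c' τ : ℂ) 0‖ +
            ‖U₀ 1 - Function.update U₀ m (c' τ : ℂ) 1‖ = c' τ - c := by
          have h9 : ‖(c : ℂ) - c' τ‖ = c' τ - c := by
            rw [← Complex.ofReal_sub, Complex.norm_real, Real.norm_eq_abs, abs_sub_comm,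
              abs_of_nonneg (by linarith)]
          fin_cases m
          · simp only [Fin.zero_eta, Fin.isValue] at hUl ⊢
            simp [hUl, h9]
          · simp only [Fin.mk_one, Fin.isValue] at hUl ⊢
            simp [hUl, h9]
        rw [h8, div_mul_eq_mul_div, mul_div_assoc]
        refine mul_le_mul_of_nonneg_left (h3.trans ?_) hL0
        exact div_le_div_of_nonneg_right (hpow τ hτ.1 hτ.2) (by positivity)

/-- The vectors of `σ_Reg,j` for `j ≥ 1`. -/
theorem exists_of_mem_sigmaReg {j : ℕ} (hj1 : 1 ≤ j) (hj : j ≤ X.g) {v : Fin 2 → ℝ}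
    (hv : v ∈ X.sigmaReg j) (hv0 : v ≠ 0) :
    ∃ i : Fin 2, (∀ l, l ≠ i → v l = 0) ∧ (X.lam j i = 0 ∨
      (X.lam (j - 1) i = 0 ∧ (idx X.lam j : ℚ) * X.lam j i = 1)) := by
  obtain ⟨r, hr, hc⟩ := X.convergent
  have hn : n ≠ 0 := NeZero.ne n
  obtain ⟨hv1, δ, hδ, hreg⟩ := hv
  have hreg' : ∀ U : Fin 2 → ℂ, (∀ i, U i = 0 ↔ v i ≠ 0) → (∀ i, ‖U i ^ n‖ < δ) →
      ¬ IsSingularPoint (X.semiRoot j) ![U 0 ^ n, U 1 ^ n, evalSeries (X.trunc j).toSeries U] := by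
    intro U h1 h2
    have := hreg _ (X.toricPoint_mem_orbit hj h1) (fun i => by
      rw [X.coordAt_toricPoint]; exact h2 i)
    rwa [X.normalization_toricPoint] at this
  by_cases hall : ∀ i, v i ≠ 0
  · exfalso
    -- The orbit of the interior of `σ` is the distinguished point, over the singular origin; so `v`
    -- lies on a coordinate ray.
    refine hreg' 0 (fun i => by simp [hall i]) (fun i => by simp [hn, hδ]) ?_
    have := X.isSingularPoint_zero hr hc hj1 hj
    simpa [hn] using this
  · push Not at hall
    obtain ⟨l, hl⟩ := hall
    obtain ⟨i, hi⟩ : ∃ i, v i ≠ 0 := by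
      by_contra! h
      exact hv0 (funext h)
    have hil : l ≠ i := by rintro rfl; exact hi hl
    refine ⟨i, fun m hm => ?_, ?_⟩
    · have : m = l := by omega
      rw [this, hl]
    · by_contra! hcon
      obtain ⟨h1, h2⟩ := hcon
      classical
      -- The index `k` for which `λ_{k+1}` is the first exponent that involves `x_i`; the conjugates
      -- in `G_k` come together along `x_i = 0`.
      have hex : ∃ k, X.lam (k + 1) i ≠ 0 := ⟨j - 1, by rwa [Nat.sub_add_cancel hj1]⟩
      have hk1 : Nat.find hex ≤ j - 1 :=
        Nat.find_min' hex (by rwa [Nat.sub_add_cancel hj1])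
      have hk2 : X.lam (Nat.find hex) i = 0 := by
        rcases Nat.eq_zero_or_pos (Nat.find hex) with h | h
        · rw [h, X.charExponents.lam_zero]; rfl
        · have := Nat.find_min hex (m := Nat.find hex - 1) (by omega)
          rwa [not_not, Nat.sub_add_cancel h] at this
      obtain ⟨c, hc0, hcr, hcδ⟩ : ∃ c : ℝ, 0 < c ∧ c < r / 2 ∧ c ^ n < δ := by
        have h3 : Continuous fun c : ℝ => c ^ n := by fun_prop
        have h4 := h3.tendsto 0
        rw [zero_pow hn] at h4
        obtain ⟨c, h5, h6⟩ := ((h4.mono_left nhdsWithin_le_nhds).eventually (gt_mem_nhds hδ)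
          |>.and (eventually_pos_lt (half_pos hr))).exists
        exact ⟨c, h6.1, h6.2, h5⟩
      have hU1 : Function.update (fun _ : Fin 2 => (c : ℂ)) i 0 i = 0 := by simp
      have hU2 : Function.update (fun _ : Fin 2 => (c : ℂ)) i 0 l = c := by
        rw [Function.update_of_ne hil]
      have him : ∀ m : Fin 2, m = i ∨ m = l := fun m => by omega
      refine hreg' (Function.update (fun _ => (c : ℂ)) i 0) (fun m => ?_) (fun m => ?_)
        (X.isSingularPoint_curve hr hc hj (k := Nat.find hex) (by omega) hil hk2
          (Nat.find_spec hex) ?_ hc0 hcr hU1 hU2)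
      · rcases him m with rfl | rfl
        · simp [hi]
        · rw [hU2]; simp [hl, hc0.ne']
      · rcases him m with rfl | rfl
        · simp [hn, hδ]
        · rw [hU2]; simpa [abs_of_pos hc0] using hcδ
      · rintro ⟨h3, h4⟩
        refine h2 ?_ h4
        rw [← h3, Nat.add_sub_cancel]
        exact hk2

end QOSurface

/-! ### Orders of analytic functions of one variable -/

theorem tendsto_ofReal_nhdsGT : Tendsto (fun t : ℝ => (t : ℂ)) (𝓝[>] 0) (𝓝 0) := by
  have := Complex.continuous_ofReal.tendsto 0
  rw [Complex.ofReal_zero] at this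
  exact this.mono_left nhdsWithin_le_nhds

theorem not_isBigO_rpow_of_lt {l : Filter ℝ} [l.NeBot] (hl : l ≤ 𝓝[>] 0) {a b : ℝ} (hab : a < b) :
    ¬ (fun t : ℝ => t ^ a) =O[l] (fun t : ℝ => t ^ b) := by
  intro h
  have hpos : ∀ᶠ t in l, 0 < t := hl self_mem_nhdsWithin
  have h1 : (fun t : ℝ => t ^ b) =o[l] (fun t : ℝ => t ^ a) := by
    refine isLittleO_of_tendsto' (hpos.mono fun t ht h0 => ?_) ?_
    · exact absurd h0 (Real.rpow_pos_of_pos ht a).ne'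
    · have h2 : Tendsto (fun t : ℝ => t ^ (b - a)) l (𝓝 0) := by
        have := (Real.continuousAt_rpow_const 0 (b - a) (Or.inr (sub_pos.2 hab).le)).tendsto
        rw [Real.zero_rpow (sub_pos.2 hab).ne'] at this
        exact this.mono_left (hl.trans nhdsWithin_le_nhds)
      refine h2.congr' (hpos.mono fun t ht => ?_)
      rw [Real.rpow_sub ht]
  have h3 := h.trans_isLittleO h1
  exact isLittleO_irrefl' (Eventually.frequently (hpos.mono fun t ht =>
    (norm_pos_iff.2 (Real.rpow_pos_of_pos ht a).ne').ne')) h3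

theorem rpow_isBigO_rpow {l : Filter ℝ} (hl : l ≤ 𝓝[>] 0) {a b : ℝ} (hab : a ≤ b) :
    (fun t : ℝ => t ^ b) =O[l] (fun t : ℝ => t ^ a) := by
  refine IsBigO.of_bound 1 ?_
  filter_upwards [hl (eventually_pos_lt one_pos)] with t ht
  rw [one_mul, Real.norm_of_nonneg (Real.rpow_nonneg ht.1.le _),
    Real.norm_of_nonneg (Real.rpow_nonneg ht.1.le _)]
  exact Real.rpow_le_rpow_of_exponent_ge ht.1 ht.2.le hab

/-- An analytic function is divisible by `t ^ k` as soon as it is `O(t ^ c)` on a sequence of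
positive reals tending to zero, for some `c > k - 1`. -/
theorem natCast_le_analyticOrderAt_of_isBigO {g : ℂ → ℂ} (hg : AnalyticAt ℂ g 0) {l : Filter ℝ}
    [l.NeBot] (hl : l ≤ 𝓝[>] 0) {c : ℝ}
    (h : (fun t : ℝ => g t) =O[l] (fun t : ℝ => t ^ c)) {k : ℕ} (hk : (k : ℝ) < c + 1) :
    (k : ℕ∞) ≤ analyticOrderAt g 0 := by
  by_contra hlt
  rw [not_le] at hlt
  have htop : analyticOrderAt g 0 ≠ ⊤ := ne_top_of_lt hlt
  obtain ⟨h', hh', hh0, hev⟩ := hg.analyticOrderAt_ne_top.1 htop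
  have hdk : analyticOrderNatAt g 0 < k := by
    rw [← Nat.cast_analyticOrderNatAt htop] at hlt
    exact_mod_cast hlt
  set d := analyticOrderNatAt g 0
  have hlt' : Tendsto (fun t : ℝ => (t : ℂ)) l (𝓝 0) := tendsto_ofReal_nhdsGT.mono_left hl
  have h1 : (fun t : ℝ => t ^ (d : ℝ)) =O[l] (fun t : ℝ => g t) := by
    have h2 : (fun _ : ℝ => (1 : ℂ)) =O[l] (fun t : ℝ => h' t) := by
      have h3 := hh'.continuousAt.tendsto.comp hlt'
      exact (isBigO_const_left_iff_pos_le_norm one_ne_zero).2 ⟨‖h' 0‖ / 2, by positivity, by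
        have := h3.norm.eventually (lt_mem_nhds (half_lt_self (norm_pos_iff.2 hh0)))
        exact this.mono fun t ht => ht.le⟩
    have h3 : (fun t : ℝ => (t : ℂ) ^ d * 1) =O[l] (fun t : ℝ => (t : ℂ) ^ d * h' t) :=
      (isBigO_refl _ _).mul h2
    refine (IsBigO.of_bound 1 ?_).trans (h3.congr' EventuallyEq.rfl ?_)
    · filter_upwards [hl (eventually_pos_lt one_pos)] with t ht
      rw [one_mul, mul_one, norm_pow, Complex.norm_real, Real.rpow_natCast, norm_pow]
    · filter_upwards [hlt'.eventually hev] with t ht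
      rw [ht, sub_zero, smul_eq_mul]
  refine not_isBigO_rpow_of_lt hl (a := d) (b := c) ?_ (h1.trans h)
  have : (d : ℝ) + 1 ≤ k := by exact_mod_cast hdk
  linarith

theorem isBigO_pow_of_le_analyticOrderAt {g : ℂ → ℂ} (hg : AnalyticAt ℂ g 0) {k : ℕ}
    (h : (k : ℕ∞) ≤ analyticOrderAt g 0) : g =O[𝓝 0] (fun t => t ^ k) := by
  obtain ⟨h', hh', hev⟩ := (natCast_le_analyticOrderAt hg).1 h
  have h1 : (fun t : ℂ => t ^ k * h' t) =O[𝓝 0] (fun t => t ^ k * 1) :=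
    (isBigO_refl _ _).mul (hh'.continuousAt.tendsto.isBigO_one ℂ)
  simp only [mul_one] at h1
  exact h1.congr' (hev.mono fun t ht => by simp [ht]) EventuallyEq.rfl

theorem isBigO_real_of_pow {g : ℂ → ℂ} {k : ℕ} (h : g =O[𝓝 0] (fun t => t ^ k)) {l : Filter ℝ}
    (hl : l ≤ 𝓝[>] 0) {c : ℝ} (hc : c ≤ k) :
    (fun t : ℝ => g t) =O[l] (fun t : ℝ => t ^ c) := by
  have h1 : (fun t : ℝ => g t) =O[l] (fun t : ℝ => (t : ℂ) ^ k) :=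
    h.comp_tendsto (tendsto_ofReal_nhdsGT.mono_left hl)
  refine h1.trans ((IsBigO.of_bound 1 ?_).trans (rpow_isBigO_rpow hl hc))
  filter_upwards with t
  rw [one_mul, norm_pow, Complex.norm_real, Real.rpow_natCast, norm_pow]

/-- Upgrade of a bound along a filter to a bound near `0`, for analytic functions. -/
theorem isBigO_pow_of_isBigO {g : ℂ → ℂ} (hg : AnalyticAt ℂ g 0) {l : Filter ℝ}
    [l.NeBot] (hl : l ≤ 𝓝[>] 0) {c : ℝ}
    (h : (fun t : ℝ => g t) =O[l] (fun t : ℝ => t ^ c)) {k : ℕ} (hk : (k : ℝ) < c + 1) :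
    g =O[𝓝 0] (fun t => t ^ k) :=
  isBigO_pow_of_le_analyticOrderAt hg (natCast_le_analyticOrderAt_of_isBigO hg hl h hk)

/-- The order of an analytic function is an integer that can be read off along any sequence tending
to zero. So estimates for one closest conjugate, valid along a subfilter only, become estimates near
zero. -/
theorem isBigO_rpow_of_isBigO {g : ℂ → ℂ} (hg : AnalyticAt ℂ g 0) {l : Filter ℝ}
    [l.NeBot] (hl : l ≤ 𝓝[>] 0) {c : ℝ}
    (h : (fun t : ℝ => g t) =O[l] (fun t : ℝ => t ^ c)) :
    (fun t : ℝ => g t) =O[𝓝[>] 0] (fun t : ℝ => t ^ c) := by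
  rcases lt_or_ge c 0 with hc | hc
  · have h1 : g =O[𝓝 0] (fun t => t ^ 0) :=
      isBigO_pow_of_le_analyticOrderAt hg (by simp)
    exact isBigO_real_of_pow h1 le_rfl (by simpa using hc.le)
  · exact isBigO_real_of_pow (isBigO_pow_of_isBigO hg hl h (Nat.ceil_lt_add_one hc)) le_rfl
      (Nat.le_ceil c)

theorem isBigO_pow_iff_iteratedDeriv {g : ℂ → ℂ} (hg : AnalyticAt ℂ g 0) {k : ℕ} :
    (fun t : ℝ => g t) =O[𝓝[>] 0] (fun t : ℝ => t ^ (k : ℝ)) ↔ ∀ i < k, iteratedDeriv i g 0 = 0 := by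
  rw [← natCast_le_analyticOrderAt_iff_iteratedDeriv_eq_zero hg]
  constructor
  · intro h
    exact natCast_le_analyticOrderAt_of_isBigO hg le_rfl h (by linarith)
  · intro h
    exact isBigO_real_of_pow (isBigO_pow_of_le_analyticOrderAt hg h) le_rfl le_rfl

/-- `h / h 0` is near `1`, where the principal logarithm is analytic; the factor `w` prescribes
which root is taken at `0`. -/
theorem exists_analytic_root {h : ℂ → ℂ} (hh : AnalyticAt ℂ h 0) {k : ℕ} (hk : k ≠ 0) {w : ℂ}
    (hw : w ^ k = h 0) (h0 : h 0 ≠ 0) :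
    ∃ v : ℂ → ℂ, AnalyticAt ℂ v 0 ∧ v 0 = w ∧ ∀ᶠ t in 𝓝 0, v t ^ k = h t := by
  have h1 : AnalyticAt ℂ (fun t => h t / h 0) 0 := hh.div analyticAt_const h0
  have h2 : AnalyticAt ℂ (fun t => Complex.log (h t / h 0)) 0 :=
    h1.clog (by rw [div_self h0]; exact Complex.one_mem_slitPlane)
  refine ⟨fun t => w * Complex.exp (Complex.log (h t / h 0) / k), ?_, ?_, ?_⟩
  · exact analyticAt_const.mul ((h2.div analyticAt_const (by exact_mod_cast hk)).cexp)
  · simp [div_self h0]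
  · filter_upwards [hh.continuousAt.eventually_ne h0] with t ht
    rw [mul_pow, ← Complex.exp_nat_mul, mul_div_cancel₀ _ (by exact_mod_cast hk),
      Complex.exp_log (div_ne_zero ht h0), hw, mul_div_cancel₀ _ h0]

/-! ### Families of analytic functions -/

/-- Uniform continuity on a compact set gives uniform convergence on a circle, and Cauchy's
estimates pass to the Taylor coefficients. This is how convergence of jets is obtained. -/
theorem tendsto_iteratedDeriv_of_continuousOn {F : ℝ → ℂ → ℂ} {s₀ ρ : ℝ} (hs : 0 < s₀)
    (hρ : 0 < ρ)
    (hF : ContinuousOn (Function.uncurry F) (Set.Icc 0 s₀ ×ˢ Metric.closedBall 0 ρ))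
    (hd : ∀ s ∈ Set.Icc 0 s₀, DifferentiableOn ℂ (F s) (Metric.ball 0 ρ)) (k : ℕ) :
    Tendsto (fun s => iteratedDeriv k (F s) 0) (𝓝[>] 0) (𝓝 (iteratedDeriv k (F 0) 0)) := by
  have hcomp : IsCompact (Set.Icc 0 s₀ ×ˢ Metric.closedBall (0 : ℂ) ρ) :=
    isCompact_Icc.prod (isCompact_closedBall _ _)
  have huc := hcomp.uniformContinuousOn_of_continuous hF
  rw [Metric.uniformContinuousOn_iff] at huc
  rw [Metric.tendsto_nhds]
  intro ε hε
  set K : ℝ := k.factorial / ρ ^ k with hK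
  have hKpos : 0 < K := by positivity
  obtain ⟨δ, hδ, H⟩ := huc (ε / (2 * K)) (by positivity)
  have hcont : ∀ s ∈ Set.Icc 0 s₀, ContinuousOn (F s) (Metric.closedBall 0 ρ) := by
    intro s hs'
    exact hF.comp (f := fun t : ℂ => (s, t)) (by fun_prop) fun t ht => ⟨hs', ht⟩
  have h0 : (0 : ℝ) ∈ Set.Icc 0 s₀ := ⟨le_rfl, hs.le⟩
  filter_upwards [eventually_pos_lt (lt_min hδ hs)] with s hs1
  have hsI : s ∈ Set.Icc 0 s₀ := ⟨hs1.1.le, hs1.2.le.trans (min_le_right _ _)⟩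
  have hball : ∀ s ∈ Set.Icc 0 s₀, ContDiffAt ℂ k (F s) 0 := fun s hs' =>
    ((hd s hs').analyticAt (Metric.isOpen_ball.mem_nhds (Metric.mem_ball_self hρ))).contDiffAt
  rw [dist_eq_norm, ← iteratedDeriv_fun_sub (hball s hsI) (hball 0 h0)]
  have hdc : DiffContOnCl ℂ (fun t => F s t - F 0 t) (Metric.ball 0 ρ) := by
    refine ⟨(hd s hsI).sub (hd 0 h0), ?_⟩
    rw [closure_ball _ hρ.ne']
    exact (hcont s hsI).sub (hcont 0 h0)
  have hb := Complex.norm_iteratedDeriv_le_of_forall_mem_sphere_norm_le (C := ε / (2 * K)) k hρ hdc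
    fun t ht => by
      have htm : t ∈ Metric.closedBall (0 : ℂ) ρ := Metric.sphere_subset_closedBall ht
      have := H (s, t) ⟨hsI, htm⟩ (0, t) ⟨h0, htm⟩ (by
        rw [Prod.dist_eq, dist_self, Real.dist_eq, sub_zero, abs_of_pos hs1.1]
        exact max_lt (hs1.2.trans_le (min_le_left _ _)) hδ)
      rw [dist_eq_norm] at this
      exact this.le
  refine hb.trans_lt ?_
  have : (k.factorial : ℝ) * (ε / (2 * K)) / ρ ^ k = ε / 2 := by
    rw [hK]; field_simp
  rw [this]
  linarith

/-! ### Fractional power series along curves -/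

/-- The value of the fractional power series `h` at `x_i = t ^ ν_i * u_i ^ n`, where
`u_i ^ d_i = y_i`, as a function of `t` and `y`. This makes sense if `n ∣ ∑ ν_i a_i` and `d_i ∣ a_i`
for all exponents `a` of `h`. -/
def evalCurve (n : ℕ) (ν d : Fin 2 → ℕ) (h : MvPowerSeries (Fin 2) ℂ) (t : ℂ) (y : Fin 2 → ℂ) : ℂ :=
  ∑' a : Fin 2 →₀ ℕ, MvPowerSeries.coeff a h * (t ^ ((∑ i, ν i * a i) / n) * ∏ i, y i ^ (a i / d i))

/-- The divisibility conditions on the exponents of `h` that are needed in `evalCurve`. -/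
structure CurveOK (n : ℕ) (ν d : Fin 2 → ℕ) (h : MvPowerSeries (Fin 2) ℂ) : Prop where
  dvd_n : ∀ i, d i ∣ n
  dvd_sum : ∀ a, MvPowerSeries.coeff a h ≠ 0 → n ∣ ∑ i, ν i * a i
  dvd : ∀ a, MvPowerSeries.coeff a h ≠ 0 → ∀ i, d i ∣ a i

variable {ν d : Fin 2 → ℕ} {h : MvPowerSeries (Fin 2) ℂ}

theorem CurveOK.d_ne_zero (H : CurveOK n ν d h) (i : Fin 2) : d i ≠ 0 := fun h0 =>
  NeZero.ne n (by simpa [h0] using H.dvd_n i)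

theorem CurveOK.term_eq (H : CurveOK n ν d h) {t τ : ℂ} {y u : Fin 2 → ℂ} (hτ : τ ^ n = t)
    (hu : ∀ i, u i ^ d i = y i) {a : Fin 2 →₀ ℕ} (ha : MvPowerSeries.coeff a h ≠ 0) :
    t ^ ((∑ i, ν i * a i) / n) * ∏ i, y i ^ (a i / d i) = ∏ i, (τ ^ ν i * u i) ^ a i := by
  rw [← hτ, ← pow_mul, Nat.mul_div_cancel' (H.dvd_sum a ha), ← Finset.prod_pow_eq_pow_sum,
    ← Finset.prod_mul_distrib]
  refine Finset.prod_congr rfl fun i _ => ?_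
  rw [← hu i, ← pow_mul, Nat.mul_div_cancel' (H.dvd a ha i), mul_pow, pow_mul]

/-- All quotients of exponents that occur are exact, so the value does not depend on the chosen
roots `τ` and `u`. A fractional series thus has an analytic restriction to the curve, although its
arguments `τ ^ ν_i u_i` need not be analytic in `t`. -/
theorem CurveOK.evalCurve_eq (H : CurveOK n ν d h) {t τ : ℂ} {y u : Fin 2 → ℂ} (hτ : τ ^ n = t)
    (hu : ∀ i, u i ^ d i = y i) :
    evalCurve n ν d h t y = evalSeries h (fun i => τ ^ ν i * u i) := by
  refine tsum_congr fun a => ?_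
  by_cases ha : MvPowerSeries.coeff a h = 0
  · rw [ha, zero_mul, zero_mul]
  · rw [H.term_eq hτ hu ha]

theorem CurveOK.norm_term_le (H : CurveOK n ν d h) {r : ℝ} (hr : 0 ≤ r) {t : ℂ} {y : Fin 2 → ℂ}
    (hy : ∀ i, ‖t‖ ^ ν i * ‖y i‖ ^ (n / d i) ≤ r ^ n) (a : Fin 2 →₀ ℕ) :
    ‖MvPowerSeries.coeff a h * (t ^ ((∑ i, ν i * a i) / n) * ∏ i, y i ^ (a i / d i))‖ ≤
      ‖MvPowerSeries.coeff a h‖ * r ^ a.degree := by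
  by_cases ha : MvPowerSeries.coeff a h = 0
  · simp [ha]
  have hn : n ≠ 0 := NeZero.ne n
  obtain ⟨τ, hτ⟩ := IsAlgClosed.exists_pow_nat_eq t (Nat.pos_of_ne_zero hn)
  choose u hu using fun i => IsAlgClosed.exists_pow_nat_eq (y i) (Nat.pos_of_ne_zero (H.d_ne_zero i))
  rw [H.term_eq hτ hu ha]
  refine QuasiOrdinary.norm_term_le (fun i => ?_) a
  rw [← pow_le_pow_iff_left₀ (norm_nonneg _) hr hn, norm_mul, norm_pow, mul_pow, ← pow_mul,
    mul_comm (ν i), pow_mul, ← norm_pow, hτ]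
  have : ‖u i‖ ^ n = ‖y i‖ ^ (n / d i) := by
    rw [← hu i, norm_pow, ← pow_mul, Nat.mul_div_cancel' (H.dvd_n i)]
  rw [this]
  exact hy i

theorem CurveOK.continuousOn (H : CurveOK n ν d h) {r : ℝ} (hr : 0 ≤ r) (hc : ConvOn r h)
    {S : Set (ℝ × ℂ)} {y : ℝ → ℂ → Fin 2 → ℂ}
    (hy : ∀ i, ContinuousOn (fun x : ℝ × ℂ => y x.1 x.2 i) S)
    (hS : ∀ x ∈ S, ∀ i, ‖x.2‖ ^ ν i * ‖y x.1 x.2 i‖ ^ (n / d i) ≤ r ^ n) :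
    ContinuousOn (fun x : ℝ × ℂ => evalCurve n ν d h x.2 (y x.1 x.2)) S := by
  refine continuousOn_tsum (fun a => ?_) hc fun a x hx => H.norm_term_le hr (hS x hx) a
  fun_prop

theorem CurveOK.differentiableOn (H : CurveOK n ν d h) {r : ℝ} (hr : 0 ≤ r) (hc : ConvOn r h)
    {S : Set ℂ} (hSo : IsOpen S) {y : ℂ → Fin 2 → ℂ}
    (hy : ∀ i, DifferentiableOn ℂ (fun t => y t i) S)
    (hS : ∀ t ∈ S, ∀ i, ‖t‖ ^ ν i * ‖y t i‖ ^ (n / d i) ≤ r ^ n) :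
    DifferentiableOn ℂ (fun t => evalCurve n ν d h t (y t)) S := by
  refine Complex.differentiableOn_tsum_of_summable_norm hc (fun a => ?_) hSo
    fun a t ht => H.norm_term_le hr (hS t ht) a
  fun_prop

/-! ### Estimates along branches -/

/-- `R` is a radius of convergence for all the power series in question, and `r` is so small that
the power series that are units do not vanish on the polydisc of radius `r`. -/
structure QOSurface.Good (X : QOSurface n) (R r : ℝ) : Prop where
  pos : 0 < r
  le_one : R ≤ 1
  lt_pow : r < R ^ n
  lt : r < R
  conv : ConvOn R X.ζ.toSeries
  convf : ∀ k, ConvOn R (X.f.coeff k : MvPowerSeries (Fin 2) ℂ)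
  lower : ∀ k < X.g, ∀ ω ∈ charKer n X.lam k, ω ∉ charKer n X.lam (k + 1) →
    ∀ A, vec n A = X.lam (k + 1) → ∃ c : ℝ, 0 < c ∧ ∀ U : Fin 2 → ℂ, (∀ i, ‖U i‖ ≤ r) →
      c * ‖∏ i, U i ^ A i‖ ≤ ‖evalSeries X.ζ.toSeries (ω.val * U) - evalSeries X.ζ.toSeries U‖
  unit : ∀ j k, j < k → k ≤ X.g → ∀ A, vec n A = X.lam (j + 1) → ∀ U : Fin 2 → ℂ,
    (∀ i, ‖U i‖ ≤ r) →
      evalSeries (shift A ((X.trunc k).toSeries - (X.trunc j).toSeries)) U ≠ 0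

theorem eventually_forall_norm_le {p : (Fin 2 → ℂ) → Prop} (h : ∀ᶠ U in 𝓝 0, p U) :
    ∀ᶠ r : ℝ in 𝓝[>] 0, ∀ U : Fin 2 → ℂ, (∀ i, ‖U i‖ ≤ r) → p U := by
  obtain ⟨δ, hδ, H⟩ := Metric.eventually_nhds_iff.1 h
  filter_upwards [eventually_pos_lt hδ] with r hr U hU
  refine H ?_
  rw [dist_zero_right]
  exact ((pi_norm_le_iff_of_nonneg hr.1.le).2 hU).trans_lt hr.2

theorem eventually_ne_zero_of_evalSeries {h : MvPowerSeries (Fin 2) ℂ} {r : ℝ} (hr : 0 < r)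
    (hc : ConvOn r h) (h0 : evalSeries h 0 ≠ 0) :
    ∃ c : ℝ, 0 < c ∧ ∀ᶠ U in 𝓝 (0 : Fin 2 → ℂ), c ≤ ‖evalSeries h U‖ := by
  refine ⟨‖evalSeries h 0‖ / 2, by positivity, ?_⟩
  have h1 := (hc.continuousAt (U := 0) (by simpa using hr)).norm
  exact (h1.eventually (lt_mem_nhds (half_lt_self (norm_pos_iff.2 h0)))).mono fun U hU => hU.le

theorem vec_injective : Function.Injective (vec n) := fun _ _ hab =>
  le_antisymm (vec_le_vec.1 hab.le) (vec_le_vec.1 hab.ge)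

/-- There are finitely many series and finitely many rotations, and each condition holds for all
small radii. The radius `R` of convergence is fixed first, and `r` is then chosen small with respect
to it. -/
theorem QOSurface.exists_good (X : QOSurface n) : ∃ R r : ℝ, X.Good R r := by
  classical
  have hev : ∀ h : MvPowerSeries (Fin 2) ℂ, IsConvergent h → ∀ᶠ R : ℝ in 𝓝[>] 0, ConvOn R h := by
    rintro h ⟨r, hr, H⟩
    filter_upwards [eventually_pos_lt hr] with R hR
    exact ConvOn.mono H hR.1.le hR.2.le
  have h1 := hev _ X.convergent
  have h2 : ∀ᶠ R : ℝ in 𝓝[>] 0, ∀ k ∈ Finset.range (n + 1),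
      ConvOn R (X.f.coeff k : MvPowerSeries (Fin 2) ℂ) :=
    (Filter.eventually_all_finset _).2 fun k _ => hev _ (X.f.coeff k).2
  obtain ⟨R, ⟨hR0, hR1⟩, hcz, hcf⟩ := ((eventually_pos_lt one_pos).and (h1.and h2)).exists
  have hcf' : ∀ k, ConvOn R (X.f.coeff k : MvPowerSeries (Fin 2) ℂ) := fun k => by
    by_cases hk : k ∈ Finset.range (n + 1)
    · exact hcf k hk
    · rw [coeff_eq_zero_of_natDegree_lt]
      · exact convOn_zero R
      · rw [X.natDegree_eq]; simpa using hk
  have h3 : ∀ᶠ r : ℝ in 𝓝[>] 0, ∀ k ∈ Finset.range X.g, ∀ ω ∈ (Finset.univ : Finset (Rots n)),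
      ω ∈ charKer n X.lam k → ω ∉ charKer n X.lam (k + 1) →
      ∀ A, vec n A = X.lam (k + 1) → ∃ c : ℝ, 0 < c ∧ ∀ U : Fin 2 → ℂ, (∀ i, ‖U i‖ ≤ r) →
        c * ‖∏ i, U i ^ A i‖ ≤
          ‖evalSeries X.ζ.toSeries (ω.val * U) - evalSeries X.ζ.toSeries U‖ := by
    refine (Filter.eventually_all_finset _).2 fun k hk => (Filter.eventually_all_finset _).2
      fun ω _ => ?_
    by_cases hω : ω ∈ charKer n X.lam k ∧ ω ∉ charKer n X.lam (k + 1)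
    swap
    · exact Eventually.of_forall fun _ a b => absurd ⟨a, b⟩ hω
    obtain ⟨A, hA⟩ := X.charExponents.exists_vec (Finset.mem_range.1 hk)
    obtain ⟨h, hc, h0, H⟩ := X.charExponents.smul_sub_factor hR0 hcz (Finset.mem_range.1 hk) hA
      hω.1 hω.2
    obtain ⟨c, hc0, hcU⟩ := eventually_ne_zero_of_evalSeries hR0 hc h0
    filter_upwards [eventually_forall_norm_le hcU, eventually_pos_lt hR0] with r hr hrR _ _ B hB
    obtain rfl : B = A := vec_injective (hB.trans hA.symm)
    refine ⟨c, hc0, fun U hU => ?_⟩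
    rw [H U fun i => (hU i).trans hrR.2.le, norm_mul, mul_comm]
    exact mul_le_mul_of_nonneg_left (hr U hU) (norm_nonneg _)
  have h4 : ∀ᶠ r : ℝ in 𝓝[>] 0, ∀ j ∈ Finset.range (X.g + 1), ∀ k ∈ Finset.range (X.g + 1),
      j < k → ∀ A, vec n A = X.lam (j + 1) → ∀ U : Fin 2 → ℂ, (∀ i, ‖U i‖ ≤ r) →
      evalSeries (shift A ((X.trunc k).toSeries - (X.trunc j).toSeries)) U ≠ 0 := by
    refine (Filter.eventually_all_finset _).2 fun j hj => (Filter.eventually_all_finset _).2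
      fun k hk => ?_
    by_cases hjk : j < k
    swap
    · exact Eventually.of_forall fun r a => absurd a hjk
    have hkg : k ≤ X.g := by simpa [Nat.lt_succ_iff] using hk
    obtain ⟨A, hA⟩ := X.charExponents.exists_vec (hjk.trans_le hkg : j + 1 ≤ X.g)
    have hc : ConvOn R (shift A ((X.trunc k).toSeries - (X.trunc j).toSeries)) :=
      ((X.convOn_trunc hR0.le hcz k).sub hR0.le (X.convOn_trunc hR0.le hcz j)).shift hR0 A
    obtain ⟨c, hc0, hcU⟩ := eventually_ne_zero_of_evalSeries hR0 hc (by
      rw [evalSeries_at_zero, ← MvPowerSeries.coeff_zero_eq_constantCoeff_apply, coeff_shift,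
        zero_add]
      exact X.coeff_trunc_sub_lam hjk hkg hA)
    filter_upwards [eventually_forall_norm_le hcU] with r hr _ B hB U hU
    obtain rfl : B = A := vec_injective (hB.trans hA.symm)
    exact norm_pos_iff.1 (hc0.trans_le (hr U hU))
  obtain ⟨r, hr1, hr2, hr3, hr4⟩ :=
    ((eventually_pos_lt (pow_pos hR0 n)).and ((eventually_pos_lt hR0).and (h3.and h4))).exists
  refine ⟨R, r, hr1.1, hR1.le, hr1.2, hr2.2, hcz, hcf', fun k hk ω a b => hr3 k
    (Finset.mem_range.2 hk) ω (Finset.mem_univ _) a b, fun j k hjk hk => hr4 j ?_ k ?_ hjk⟩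
  · exact Finset.mem_range.2 (by omega)
  · exact Finset.mem_range.2 (by omega)

/-- A curve `U` in the polydisc of radius `r` with `|U_i| ∼ t ^ (μ_i / n)`. -/
structure Branch (n : ℕ) (r : ℝ) (μ : Fin 2 → ℕ) (U : ℝ → Fin 2 → ℂ) : Prop where
  le : ∀ᶠ t in 𝓝[>] 0, ∀ i, ‖U t i‖ ≤ r
  theta : ∀ i, (fun t => U t i) =Θ[𝓝[>] 0] fun t => t ^ ((μ i : ℝ) / n)

theorem Branch.rot {r : ℝ} {μ : Fin 2 → ℕ} {U : ℝ → Fin 2 → ℂ} (H : Branch n r μ U) (ω : Rots n) :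
    Branch n r μ fun t => ω.val * U t := by
  constructor
  · filter_upwards [H.le] with t ht i
    rw [Pi.mul_apply, norm_mul, ω.norm_val, one_mul]
    exact ht i
  · intro i
    refine IsTheta.trans ?_ (H.theta i)
    refine IsTheta.of_norm_eventuallyEq_norm (Eventually.of_forall fun t => ?_)
    simp [ω.norm_val]

theorem Branch.prod_theta {r : ℝ} {μ : Fin 2 → ℕ} {U : ℝ → Fin 2 → ℂ} (H : Branch n r μ U)
    (A : Fin 2 →₀ ℕ) : (fun t => ∏ i, U t i ^ A i) =Θ[𝓝[>] 0]
      fun t => t ^ ((QOSurface.pair μ (vec n A) : ℚ) : ℝ) := by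
  have h1 := ((H.theta 0).pow (A 0)).mul ((H.theta 1).pow (A 1))
  simp only [Fin.prod_univ_two]
  refine h1.trans_eventuallyEq ?_
  filter_upwards [self_mem_nhdsWithin] with t ht
  rw [← Real.rpow_mul_natCast (le_of_lt ht), ← Real.rpow_mul_natCast (le_of_lt ht),
    ← Real.rpow_add ht]
  congr 1
  simp only [QOSurface.pair, vec, Fin.sum_univ_two]
  push_cast
  ring

theorem isBigO_evalSeries_of_le {r R : ℝ} (hR : 0 < R) (hrR : r ≤ R) {μ : Fin 2 → ℕ}
    {U : ℝ → Fin 2 → ℂ} (H : Branch n r μ U) {h : MvPowerSeries (Fin 2) ℂ} (hc : ConvOn R h)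
    {A : Fin 2 →₀ ℕ} (hA : ∀ a, MvPowerSeries.coeff a h ≠ 0 → A ≤ a) :
    (fun t => evalSeries h (U t)) =O[𝓝[>] 0]
      fun t => t ^ ((QOSurface.pair μ (vec n A) : ℚ) : ℝ) := by
  obtain ⟨C, hC0, hC⟩ := (hc.shift hR A).exists_bound
  refine IsBigO.trans (IsBigO.of_bound C ?_) (H.prod_theta A).1
  filter_upwards [H.le] with t ht
  rw [evalSeries_eq_mul_shift hA, norm_mul, mul_comm]
  exact mul_le_mul_of_nonneg_right (hC _ fun i => (ht i).trans hrR) (norm_nonneg _)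

namespace QOSurface
variable (X : QOSurface n) {R r : ℝ} {μ : Fin 2 → ℕ} {U : ℝ → Fin 2 → ℂ}

theorem Good.R_pos {X : QOSurface n} (hG : X.Good R r) : 0 < R := hG.pos.trans hG.lt

theorem Good.conv_trunc {X : QOSurface n} (hG : X.Good R r) (j : ℕ) :
    ConvOn R (X.trunc j).toSeries := X.convOn_trunc hG.R_pos.le hG.conv j

/-- `ζ_j` is a series of monomials in the lattice `M_j`. -/
theorem vec_mem_latM_trunc {j : ℕ} (hj : j ≤ X.g) {a : Fin 2 →₀ ℕ}
    (ha : MvPowerSeries.coeff a (X.trunc j).toSeries ≠ 0) : vec n a ∈ latM X.lam j :=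
  (X.charExponents_trunc hj).vec_mem_latM ha

theorem evalSeries_rot_trunc {j : ℕ} (hj : j ≤ X.g) {ω : Rots n} (hω : ω ∈ charKer n X.lam j)
    (V : Fin 2 → ℂ) :
    evalSeries (X.trunc j).toSeries (ω.val * V) = evalSeries (X.trunc j).toSeries V := by
  rw [← evalSeries_rescale]
  refine tsum_congr fun a => ?_
  rw [MvPowerSeries.coeff_rescale, Finsupp.prod_fintype _ _ (by simp)]
  by_cases ha : MvPowerSeries.coeff a (X.trunc j).toSeries = 0
  · simp [ha]
  · rw [prod_val_pow_eq_one hω (X.vec_mem_latM_trunc hj ha), one_mul]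

theorem trunc_sub_isBigO (hG : X.Good R r) (hU : Branch n r μ U) {j k : ℕ} (hjk : j < k)
    (hk : k ≤ X.g) : (fun t => evalSeries (X.trunc k).toSeries (U t) -
      evalSeries (X.trunc j).toSeries (U t)) =O[𝓝[>] 0]
        fun t => t ^ ((pair μ (X.lam (j + 1)) : ℚ) : ℝ) := by
  obtain ⟨A, hA⟩ := X.charExponents.exists_vec (hjk.trans_le hk : j + 1 ≤ X.g)
  rw [← hA]
  refine (isBigO_evalSeries_of_le hG.R_pos hG.lt.le hU
    ((hG.conv_trunc k).sub hG.R_pos.le (hG.conv_trunc j)) fun a ha => ?_).congr' ?_ EventuallyEq.rfl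
  · rw [← vec_le_vec (n := n), hA]
    exact (X.coeff_trunc_sub hjk.le ha).2.1
  · filter_upwards [hU.le] with t ht
    exact evalSeries_sub (hG.conv_trunc k) (hG.conv_trunc j) fun i => (ht i).trans hG.lt.le

theorem trunc_g_sub_isBigO (hG : X.Good R r) (hU : Branch n r μ U) {j : ℕ} (hj : j < X.g) :
    (fun t => evalSeries X.ζ.toSeries (U t) - evalSeries (X.trunc j).toSeries (U t)) =O[𝓝[>] 0]
        fun t => t ^ ((pair μ (X.lam (j + 1)) : ℚ) : ℝ) := by
  have := X.trunc_sub_isBigO hG hU hj le_rfl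
  rwa [trunc_g] at this

/-- Elements of `G_k` fix `ζ_k`, so only the tails `ζ - ζ_k` at the two conjugate points contribute.
-/
theorem rot_sub_isBigO (hG : X.Good R r) (hU : Branch n r μ U) {k : ℕ} (hk : k < X.g) {ω : Rots n}
    (hω : ω ∈ charKer n X.lam k) : (fun t => evalSeries X.ζ.toSeries (ω.val * U t) -
      evalSeries X.ζ.toSeries (U t)) =O[𝓝[>] 0]
        fun t => t ^ ((pair μ (X.lam (k + 1)) : ℚ) : ℝ) := by
  have h1 := X.trunc_g_sub_isBigO hG (hU.rot ω) hk
  have h2 := X.trunc_g_sub_isBigO hG hU hk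
  refine (h1.sub h2).congr_left fun t => ?_
  rw [X.evalSeries_rot_trunc hk.le hω]
  ring

theorem evalSeries_rot (V : Fin 2 → ℂ) {ω : Rots n} (hω : ω ∈ charKer n X.lam X.g) :
    evalSeries X.ζ.toSeries (ω.val * V) = evalSeries X.ζ.toSeries V := by
  have := X.evalSeries_rot_trunc le_rfl hω V
  rwa [trunc_g] at this

theorem isBigO_rot_sub (hG : X.Good R r) (hU : Branch n r μ U) {k : ℕ} (hk : k < X.g) {ω : Rots n}
    (h1 : ω ∈ charKer n X.lam k) (h2 : ω ∉ charKer n X.lam (k + 1)) :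
    (fun t => t ^ ((pair μ (X.lam (k + 1)) : ℚ) : ℝ)) =O[𝓝[>] 0]
      (fun t => evalSeries X.ζ.toSeries (ω.val * U t) - evalSeries X.ζ.toSeries (U t)) := by
  obtain ⟨A, hA⟩ := X.charExponents.exists_vec hk
  obtain ⟨c, hc, H⟩ := hG.lower k hk ω h1 h2 A hA
  rw [← hA]
  refine (hU.prod_theta A).2.trans (IsBigO.of_bound c⁻¹ ?_)
  filter_upwards [hU.le] with t ht
  rw [le_inv_mul_iff₀ hc]
  exact H _ ht

end QOSurface

/-! ### Products over the conjugates -/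

theorem prod_rpow_eventuallyEq {ι : Type*} {l : Filter ℝ} (hl : l ≤ 𝓝[>] 0) (s : Finset ι) (b : ℝ) :
    (fun t : ℝ => ∏ _i ∈ s, t ^ b) =ᶠ[l] fun t => t ^ (s.card * b) := by
  filter_upwards [hl self_mem_nhdsWithin] with t ht
  rw [Finset.prod_const, ← Real.rpow_mul_natCast (le_of_lt ht), mul_comm]

theorem rpow_mul_rpow_eventuallyEq {l : Filter ℝ} (hl : l ≤ 𝓝[>] 0) (a b : ℝ) :
    (fun t : ℝ => t ^ a * t ^ b) =ᶠ[l] fun t => t ^ (a + b) := by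
  filter_upwards [hl self_mem_nhdsWithin] with t ht
  rw [Real.rpow_add ht]

section
variable {ι : Type*} [DecidableEq ι] {l : Filter ℝ} {F : ι → ℝ → ℂ} {s u : Finset ι}
  {a b : ℝ}

theorem prod_isBigO_of_sdiff (hl : l ≤ 𝓝[>] 0) (hsu : s ⊆ u)
    (h1 : (fun t => ∏ i ∈ s, F i t) =O[l] fun t => t ^ a)
    (h2 : ∀ i ∈ u \ s, F i =O[l] fun t => t ^ b) :
    (fun t => ∏ i ∈ u, F i t) =O[l] fun t => t ^ (a + ((u.card : ℝ) - s.card) * b) := by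
  have h3 := (IsBigO.finsetProd h2).trans (prod_rpow_eventuallyEq hl (u \ s) b).isBigO
  have h4 := (h1.mul h3).trans (rpow_mul_rpow_eventuallyEq hl _ _).isBigO
  rw [Finset.card_sdiff_of_subset hsu, Nat.cast_sub (Finset.card_le_card hsu)] at h4
  refine h4.congr_left fun t => ?_
  rw [mul_comm]
  simpa using Finset.prod_sdiff (f := fun i => F i t) hsu

theorem prod_isBigO_of_superset (hl : l ≤ 𝓝[>] 0) (hsu : s ⊆ u)
    (h1 : (fun t => ∏ i ∈ u, F i t) =O[l] fun t => t ^ a)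
    (h2 : ∀ i ∈ u \ s, (fun t => t ^ b) =O[l] F i) :
    (fun t => ∏ i ∈ s, F i t) =O[l] fun t => t ^ (a - ((u.card : ℝ) - s.card) * b) := by
  have h3 := (prod_rpow_eventuallyEq hl (u \ s) b).symm.isBigO.trans (IsBigO.finsetProd h2)
  rw [Finset.card_sdiff_of_subset hsu, Nat.cast_sub (Finset.card_le_card hsu)] at h3
  have h4 : (fun t => t ^ (((u.card : ℝ) - s.card) * b) * ‖∏ i ∈ s, F i t‖) =O[l]
      fun t => t ^ a := by
    refine ((h3.mul (isBigO_refl (fun t => ∏ i ∈ s, F i t) l).norm_left).congr_right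
      fun t => ?_).trans h1
    simpa using Finset.prod_sdiff (f := fun i => F i t) hsu
  have h5 := ((isBigO_refl (fun t : ℝ => t ^ (-(((u.card : ℝ) - s.card) * b))) l).mul h4).trans
    (rpow_mul_rpow_eventuallyEq hl _ _).isBigO
  rw [neg_add_eq_sub] at h5
  refine IsBigO.of_norm_left (h5.congr' ?_ EventuallyEq.rfl)
  filter_upwards [hl self_mem_nhdsWithin] with t ht
  rw [← mul_assoc, ← Real.rpow_add ht, neg_add_cancel, Real.rpow_zero, one_mul]

end

theorem isBigO_rpow_of_pow {l : Filter ℝ} (hl : l ≤ 𝓝[>] 0) {f : ℝ → ℂ} {a : ℝ} {N : ℕ}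
    (hN : N ≠ 0) (h : (fun t => f t ^ N) =O[l] fun t => t ^ (N * a)) :
    f =O[l] fun t => t ^ a := by
  refine IsBigO.of_pow hN (h.trans (EventuallyEq.isBigO ?_))
  filter_upwards [hl self_mem_nhdsWithin] with t ht
  rw [mul_comm, Real.rpow_mul_natCast (le_of_lt ht), Pi.pow_apply]

namespace QOSurface

theorem pair_mono {μ : Fin 2 → ℕ} {u v : Fin 2 → ℚ} (h : u ≤ v) : pair μ u ≤ pair μ v :=
  Finset.sum_le_sum fun i _ => mul_le_mul_of_nonneg_left (h i) (by positivity)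

variable (X : QOSurface n) {R r : ℝ} {μ : Fin 2 → ℕ} {U : ℝ → Fin 2 → ℂ}

open Classical in
/-- The finite set of the elements of `μ_n × μ_n` that act trivially on `M_k`. -/
def K (k : ℕ) : Finset (Rots n) := Finset.univ.filter (· ∈ charKer n X.lam k)

theorem mem_K {k : ℕ} {ω : Rots n} : ω ∈ X.K k ↔ ω ∈ charKer n X.lam k := by simp [K]

theorem card_K (k : ℕ) : Nat.card (charKer n X.lam k) = (X.K k).card := by
  classical
  rw [K, Nat.card_eq_fintype_card, Fintype.card_subtype]

theorem K_anti {i j : ℕ} (h : i ≤ j) : X.K j ⊆ X.K i := fun _ hω =>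
  X.mem_K.2 (charKer_anti h (X.mem_K.1 hω))

theorem K_zero : X.K 0 = Finset.univ := by
  ext ω; simp [mem_K, charKer_zero]

theorem card_K_pos (k : ℕ) : 0 < (X.K k).card :=
  Finset.card_pos.2 ⟨1, X.mem_K.2 (one_mem _)⟩

open Classical in
theorem prod_K {M : Type*} [CommMonoid M] (k : ℕ) (F : Rots n → M) :
    ∏ ω : charKer n X.lam k, F ω = ∏ ω ∈ X.K k, F ω :=
  (Finset.prod_subtype (X.K k) (fun _ => X.mem_K) F).symm

/-- The contribution to the order of `f` of the conjugates of `ζ` that differ from `ζ` already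
in their first `k` characteristic terms. -/
def S (μ : Fin 2 → ℕ) : ℕ → ℚ
  | 0 => 0
  | k + 1 => S μ k + ((X.K k).card - (X.K (k + 1)).card) * pair μ (X.lam (k + 1))

/-- Sort the conjugates along `G_0 ⊇ G_1 ⊇ ⋯ ⊇ G_J`. Those leaving at step `k` contribute `⟨μ,
λ_{k+1}⟩` each, which adds up to `S_J`; the remaining `|G_J|` ones contribute `c` each. The
induction enlarges the product from `G_J` up to the full group. -/
theorem prod_isBigO {l : Filter ℝ} (hl : l ≤ 𝓝[>] 0) {F : Rots n → ℝ → ℂ} {J : ℕ} {c : ℝ}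
    (h1 : ∀ k < J, ∀ ω ∈ X.K k, ω ∉ X.K (k + 1) →
      F ω =O[l] fun t => t ^ ((pair μ (X.lam (k + 1)) : ℚ) : ℝ))
    (h2 : ∀ ω ∈ X.K J, F ω =O[l] fun t => t ^ c) :
    (fun t => ∏ ω, F ω t) =O[l] fun t => t ^ ((X.S μ J : ℚ) + (X.K J).card * c : ℝ) := by
  classical
  have H : ∀ i ≤ J, (fun t => ∏ ω ∈ X.K (J - i), F ω t) =O[l]
      fun t => t ^ (((X.S μ J : ℚ) : ℝ) - (X.S μ (J - i) : ℚ) + (X.K J).card * c) := by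
    intro i
    induction i with
    | zero =>
      intro _
      simp only [Nat.sub_zero, sub_self, zero_add]
      exact (IsBigO.finsetProd h2).trans (prod_rpow_eventuallyEq hl _ c).isBigO
    | succ i ih =>
      intro hi
      obtain ⟨k, hk⟩ : ∃ k, J - i = k + 1 := ⟨J - i - 1, by omega⟩
      have hk' : J - (i + 1) = k := by omega
      have := ih (by omega)
      rw [hk] at this
      rw [hk']
      have h3 := prod_isBigO_of_sdiff hl (X.K_anti k.le_succ) this
        (b := ((pair μ (X.lam (k + 1)) : ℚ) : ℝ)) fun ω hω => by
          rw [Finset.mem_sdiff] at hω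
          exact h1 k (by omega) ω hω.1 hω.2
      convert h3 using 3
      rw [S]
      push_cast
      ring
  have := H J le_rfl
  simpa [X.K_zero, S] using this

/-- The factors outside `G_k` are bounded below, hence they can be divided out of the full product;
their total exponent is `S_k`. -/
theorem prod_K_isBigO {l : Filter ℝ} (hl : l ≤ 𝓝[>] 0) {F : Rots n → ℝ → ℂ} {k : ℕ} {a : ℝ}
    (h1 : ∀ i < k, ∀ ω ∈ X.K i, ω ∉ X.K (i + 1) →
      (fun t => t ^ ((pair μ (X.lam (i + 1)) : ℚ) : ℝ)) =O[l] F ω)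
    (h2 : (fun t => ∏ ω, F ω t) =O[l] fun t => t ^ a) :
    (fun t => ∏ ω ∈ X.K k, F ω t) =O[l] fun t => t ^ (a - (X.S μ k : ℚ)) := by
  classical
  induction k with
  | zero => simpa [X.K_zero, S] using h2
  | succ k ih =>
    have := prod_isBigO_of_superset hl (X.K_anti k.le_succ) (ih fun i hi => h1 i (by omega))
      (b := ((pair μ (X.lam (k + 1)) : ℚ) : ℝ)) fun ω hω => by
        rw [Finset.mem_sdiff] at hω
        exact h1 k (by omega) ω hω.1 hω.2
    convert this using 3
    rw [S]
    push_cast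
    ring

/-! ### Jets of the surface and the conjugates of `ζ` -/

theorem evalPoly_f_pow_eventuallyEq (hG : X.Good R r) (hU : Branch n r μ U) {p : ℝ → Fin 3 → ℂ}
    (hp : ∀ᶠ t in 𝓝[>] 0, ∀ i : Fin 2, p t i.castSucc = U t i ^ n) :
    ∀ᶠ t in 𝓝[>] 0, evalPoly X.f (p t) ^ (X.K X.g).card =
      ∏ ω : Rots n, (p t 2 - evalSeries X.ζ.toSeries (ω.val * U t)) := by
  filter_upwards [hU.le, hp] with t h1 h2
  rw [← card_K]
  exact X.evalPoly_f_pow hG.R_pos hG.conv (fun i => (h1 i).trans hG.lt.le) (h2 0) (h2 1)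

/-- If `z` is within `t ^ c` of `ζ_J`, where `c` lies between `⟨μ, λ_J⟩` and `⟨μ, λ_{J+1}⟩`, then
the distance of `z` to each conjugate is at most of the order that the first differing
characteristic term, or `c`, allows. Multiplying these bounds controls a power of `f`. -/
theorem isBigO_evalPoly (hG : X.Good R r) (hU : Branch n r μ U) {p : ℝ → Fin 3 → ℂ}
    (hp : ∀ᶠ t in 𝓝[>] 0, ∀ i : Fin 2, p t i.castSucc = U t i ^ n) {J : ℕ} (hJ : J ≤ X.g)
    {c M : ℝ} (hz : (fun t => p t 2 - evalSeries (X.trunc J).toSeries (U t)) =O[𝓝[>] 0]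
      fun t => t ^ c)
    (hq : ((pair μ (X.lam J) : ℚ) : ℝ) ≤ c)
    (hc : J < X.g → c ≤ ((pair μ (X.lam (J + 1)) : ℚ) : ℝ))
    (hS : ((X.K X.g).card : ℝ) * M ≤ (X.S μ J : ℚ) + (X.K J).card * c) :
    (fun t => evalPoly X.f (p t)) =O[𝓝[>] 0] fun t => t ^ M := by
  have hz' : (fun t => p t 2 - evalSeries X.ζ.toSeries (U t)) =O[𝓝[>] 0] fun t => t ^ c := by
    rcases hJ.eq_or_lt with rfl | hlt
    · rwa [trunc_g] at hz
    · have := (X.trunc_g_sub_isBigO hG hU hlt).trans (rpow_isBigO_rpow le_rfl (hc hlt))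
      exact (hz.sub this).congr_left fun t => by ring
  have hz2 : ∀ ω : Rots n, ∀ a : ℝ, a ≤ c → (fun t => evalSeries X.ζ.toSeries (ω.val * U t) -
      evalSeries X.ζ.toSeries (U t)) =O[𝓝[>] 0] (fun t => t ^ a) →
      (fun t => p t 2 - evalSeries X.ζ.toSeries (ω.val * U t)) =O[𝓝[>] 0] (fun t => t ^ a) :=
    fun ω a ha h => ((hz'.trans (rpow_isBigO_rpow le_rfl ha)).sub h).congr_left fun t => by ring
  refine isBigO_rpow_of_pow le_rfl (X.card_K_pos X.g).ne' ?_
  refine IsBigO.congr' ?_ ((X.evalPoly_f_pow_eventuallyEq hG hU hp).mono fun t ht => ht.symm)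
    EventuallyEq.rfl
  refine (X.prod_isBigO (μ := μ) (J := J) (c := c) le_rfl (fun k hk ω h1 h2 => ?_)
    fun ω hω => ?_).trans (rpow_isBigO_rpow le_rfl hS)
  · refine hz2 ω _ (le_trans ?_ hq) (X.rot_sub_isBigO hG hU (hk.trans_le hJ) (X.mem_K.1 h1))
    exact_mod_cast pair_mono (X.charExponents.mono_le hk hJ)
  · rcases hJ.eq_or_lt with rfl | hlt
    · simpa only [X.evalSeries_rot _ (X.mem_K.1 hω)] using hz'
    · exact hz2 ω c le_rfl ((X.rot_sub_isBigO hG hU hlt (X.mem_K.1 hω)).trans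
        (rpow_isBigO_rpow le_rfl (hc hlt)))

/-- Along a suitable filter, some conjugate of `ζ` is closest to the last coordinate of a jet, and
then the bound for `f` gives bounds for the partial products of its factors. -/
theorem exists_closest_conjugate (hG : X.Good R r) (hU : Branch n r μ U) {p : ℝ → Fin 3 → ℂ}
    (hp : ∀ᶠ t in 𝓝[>] 0, ∀ i : Fin 2, p t i.castSucc = U t i ^ n)
    {M : ℝ} (hf : (fun t => evalPoly X.f (p t)) =O[𝓝[>] 0] fun t => t ^ M) :
    ∃ (l : Filter ℝ) (θ : Rots n), l.NeBot ∧ l ≤ 𝓝[>] 0 ∧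
      (∀ ω : Rots n, ∀ᶠ t in l, ‖p t 2 - evalSeries X.ζ.toSeries (θ.val * U t)‖ ≤
        ‖p t 2 - evalSeries X.ζ.toSeries (ω.val * (θ.val * U t))‖) ∧
      ∀ k ≤ X.g, (fun t => ∏ ω ∈ X.K k, (p t 2 -
        evalSeries X.ζ.toSeries (ω.val * (θ.val * U t)))) =O[l]
          fun t => t ^ ((X.K X.g).card * M - (X.S μ k : ℚ)) := by
  classical
  set F : Rots n → ℝ → ℂ := fun ω t => p t 2 - evalSeries X.ζ.toSeries (ω.val * U t) with hF
  have h1 : ∀ t, ∃ θ : Rots n, ∀ ω : Rots n, ‖F θ t‖ ≤ ‖F ω t‖ := fun t => by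
    obtain ⟨θ, -, hθ⟩ := Finset.exists_min_image Finset.univ (fun ω : Rots n => ‖F ω t‖)
      Finset.univ_nonempty
    exact ⟨θ, fun ω => hθ ω (Finset.mem_univ _)⟩
  choose θ hθ using h1
  -- The closest conjugate may change with `t`. There are finitely many, so one of them is closest
  -- for a set of `t` accumulating at `0`, and the filter is restricted to that set.
  obtain ⟨θ₀, hθ₀⟩ : ∃ θ₀, ∃ᶠ t in 𝓝[>] (0 : ℝ), θ t = θ₀ := by
    by_contra! H
    have h2 : ∀ᶠ t in 𝓝[>] (0 : ℝ), ∀ θ₀, θ t ≠ θ₀ :=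
      eventually_all.2 fun θ₀ => H θ₀
    obtain ⟨t, ht⟩ := h2.exists
    exact ht _ rfl
  have hl : 𝓝[>] (0 : ℝ) ⊓ 𝓟 {t | θ t = θ₀} ≤ 𝓝[>] 0 := inf_le_left
  have hFF : ∀ (ω : Rots n) t, p t 2 - evalSeries X.ζ.toSeries (ω.val * (θ₀.val * U t)) =
      F (ω * θ₀) t := fun ω t => by simp only [hF, Rots.val_mul, mul_assoc]
  have hmin : ∀ ω : Rots n, ∀ᶠ t in 𝓝[>] (0 : ℝ) ⊓ 𝓟 {t | θ t = θ₀}, ‖F θ₀ t‖ ≤ ‖F ω t‖ := by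
    intro ω
    filter_upwards [(inf_le_right : 𝓝[>] (0 : ℝ) ⊓ 𝓟 {t | θ t = θ₀} ≤ _) (mem_principal_self _)]
      with t ht
    rw [← show θ t = θ₀ from ht]
    exact hθ t ω
  refine ⟨𝓝[>] 0 ⊓ 𝓟 {t | θ t = θ₀}, θ₀, frequently_mem_iff_neBot.1 hθ₀, hl, fun ω => ?_,
    fun k hk => ?_⟩
  · filter_upwards [hmin (ω * θ₀)] with t ht
    rw [hFF]
    exact ht
  · simp only [hFF]
    refine X.prod_K_isBigO (μ := μ) (F := fun ω t => F (ω * θ₀) t) hl (fun i hi ω hω1 hω2 => ?_) ?_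
    · refine ((X.isBigO_rot_sub hG (hU.rot θ₀) (hi.trans_le hk) (X.mem_K.1 hω1)
        fun h => hω2 (X.mem_K.2 h)).mono hl).trans ?_
      -- Two conjugates are at most as far apart as the sum of their distances to `z`, and the
      -- closer one has the smaller distance. So the distance between them is at most twice the
      -- larger one.
      refine IsBigO.of_bound 2 ?_
      filter_upwards [hmin (ω * θ₀)] with t ht
      have : evalSeries X.ζ.toSeries (ω.val * (θ₀.val * U t)) -
          evalSeries X.ζ.toSeries (θ₀.val * U t) = F θ₀ t - F (ω * θ₀) t := by
        rw [← hFF, hF]; ring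
      rw [this]
      refine (norm_sub_le _ _).trans ?_
      linarith
    · have h3 : (fun t => evalPoly X.f (p t) ^ (X.K X.g).card) =O[𝓝[>] 0]
          fun t => t ^ ((X.K X.g).card * M) := by
        refine (hf.pow (X.K X.g).card).trans (EventuallyEq.isBigO ?_)
        filter_upwards [self_mem_nhdsWithin] with t ht
        rw [← Real.rpow_mul_natCast (le_of_lt ht), mul_comm]
      refine (h3.mono hl).congr' ?_ EventuallyEq.rfl
      filter_upwards [hl (X.evalPoly_f_pow_eventuallyEq hG hU hp)] with t ht
      rw [ht]
      exact (Fintype.prod_equiv (Equiv.mulRight θ₀) _ _ fun ω => rfl).symm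

/-- The smallest factor is at most the geometric mean of the factors. -/
theorem isBigO_of_prod_K {l : Filter ℝ} (hl : l ≤ 𝓝[>] 0) {z : ℝ → ℂ} {k : ℕ} {a : ℝ}
    (hmin : ∀ ω : Rots n, ∀ᶠ t in l, ‖z t - evalSeries X.ζ.toSeries (U t)‖ ≤
        ‖z t - evalSeries X.ζ.toSeries (ω.val * U t)‖)
    (hprod : (fun t => ∏ ω ∈ X.K k, (z t - evalSeries X.ζ.toSeries (ω.val * U t))) =O[l]
      fun t => t ^ ((X.K k).card * a)) :
    (fun t => z t - evalSeries X.ζ.toSeries (U t)) =O[l] fun t => t ^ a := by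
  refine isBigO_rpow_of_pow hl (X.card_K_pos k).ne' (IsBigO.trans (IsBigO.of_bound 1 ?_) hprod)
  filter_upwards [eventually_all.2 hmin] with t ht
  rw [one_mul, norm_prod, norm_pow, ← Finset.prod_const]
  exact Finset.prod_le_prod (fun _ _ => norm_nonneg _) fun ω _ => ht ω

end QOSurface

/-! ### The indices `j(m, ν)` and `j'(m, ν)` -/

namespace QOSurface
variable (X : QOSurface n) {ν : Fin 2 → ℕ} {m : ℕ}

theorem pair_add (ν : Fin 2 → ℕ) (u v : Fin 2 → ℚ) : pair ν (u + v) = pair ν u + pair ν v := by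
  simp [pair, mul_add, Finset.sum_add_distrib]

theorem pair_sub (ν : Fin 2 → ℕ) (u v : Fin 2 → ℚ) : pair ν (u - v) = pair ν u - pair ν v := by
  simp [pair, mul_sub, Finset.sum_sub_distrib]

theorem pair_smul (ν : Fin 2 → ℕ) (c : ℚ) (u : Fin 2 → ℚ) : pair ν (c • u) = c * pair ν u := by
  simp only [pair, Pi.smul_apply, smul_eq_mul, Finset.mul_sum]
  exact Finset.sum_congr rfl fun _ _ => by ring

theorem pair_zero (ν : Fin 2 → ℕ) : pair ν 0 = 0 := by simp [pair]

/-- The rational number `l_i(ν)`, for `i ≤ g`. -/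
def lq (i : ℕ) (ν : Fin 2 → ℕ) : ℚ := X.nn i * X.e i * pair ν (gam X.lam i)

theorem l_of_le {i : ℕ} (hi : i ≤ X.g) : X.l i ν = (X.lq i ν : ℚ) := if_pos hi

theorem e_eq {i : ℕ} (hi : i < X.g) : X.e i = X.nn (i + 1) * X.e (i + 1) := by
  rw [e, e, ← Finset.insert_Ioc_add_one_left_eq_Ioc hi, Finset.prod_insert (by simp)]

theorem e_pos (i : ℕ) : 0 < X.e i := X.charExponents.prod_idx_pos i

theorem card_K_eq {k : ℕ} (hk : k ≤ X.g) : (X.K k).card = X.e k * (X.K X.g).card := by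
  have := X.charExponents.card_charKer_eq hk
  rwa [card_K, card_K] at this

theorem lq_zero : X.lq 0 ν = 0 := by simp [lq, gam, pair_zero]

/-- This eliminates the `γ_i`: the increments of `l_i` are those of `⟨ν, λ_i⟩` weighted by `e_i`. -/
theorem lq_succ {i : ℕ} (hi : i < X.g) : X.lq (i + 1) ν =
    X.lq i ν + X.e i * (pair ν (X.lam (i + 1)) - pair ν (X.lam i)) := by
  have h := congrArg (Nat.cast : ℕ → ℚ) (X.e_eq hi)
  push_cast at h
  rw [lq, lq, ← h, gam, pair_sub, pair_add, pair_smul, nn]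
  ring

/-- Links the combinatorial `l_i(ν)` with the exponents in the product estimates: up to the factor
`|G_g|`, it is the order produced when `z - ζ` has order `⟨ν, λ_i⟩`. -/
theorem card_mul_lq {i : ℕ} (hi : i ≤ X.g) : (X.K X.g).card * X.lq i ν =
    X.S ν i + (X.K i).card * pair ν (X.lam i) := by
  induction i with
  | zero => simp [lq_zero, S, X.charExponents.lam_zero, pair_zero]
  | succ i ih =>
    have h := congrArg (Nat.cast : ℕ → ℚ) (X.card_K_eq (i.le_succ.trans hi))
    push_cast at h
    rw [X.lq_succ hi, mul_add, ih (i.le_succ.trans hi), S, h]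
    ring

theorem lq_mono {i k : ℕ} (hik : i ≤ k) (hk : k ≤ X.g) : X.lq i ν ≤ X.lq k ν := by
  induction k, hik using Nat.le_induction with
  | base => exact le_rfl
  | succ k _ ih =>
    refine (ih (k.le_succ.trans hk)).trans ?_
    rw [X.lq_succ hk]
    have : pair ν (X.lam k) ≤ pair ν (X.lam (k + 1)) := pair_mono (X.charExponents.mono _ hk)
    have h2 : (0 : ℚ) ≤ X.e k := by positivity
    nlinarith

theorem gam_mem_latM (i : ℕ) : gam X.lam i ∈ latM X.lam i := by
  induction i with
  | zero => exact zero_mem _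
  | succ i ih =>
    rw [gam]
    refine sub_mem (add_mem ?_ (lam_mem_latM (by omega))) ?_
    · rw [Nat.cast_smul_eq_nsmul]
      exact latM_mono i.le_succ (nsmul_mem ih _)
    · rcases Nat.eq_zero_or_pos i with rfl | hi
      · rw [X.charExponents.lam_zero]; exact zero_mem _
      · exact latM_mono i.le_succ (lam_mem_latM hi)

theorem idx_smul_gam_mem_latM (i : ℕ) :
    (idx X.lam (i + 1) : ℚ) • gam X.lam (i + 1) ∈ latM X.lam i := by
  have h1 : idx X.lam (i + 1) • X.lam (i + 1) ∈ latM X.lam i := by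
    have := (zsmul_mem_latM_iff (lam := X.lam) i (idx X.lam (i + 1))).2 dvd_rfl
    rwa [natCast_zsmul] at this
  rw [Nat.cast_smul_eq_nsmul, gam, nsmul_sub, nsmul_add]
  refine sub_mem (add_mem (nsmul_mem ?_ _) h1) (nsmul_mem ?_ _)
  · rw [Nat.cast_smul_eq_nsmul]
    exact nsmul_mem (X.gam_mem_latM i) _
  · rcases Nat.eq_zero_or_pos i with rfl | hi
    · rw [X.charExponents.lam_zero]; exact zero_mem _
    · exact lam_mem_latM hi

theorem MemN.mono {X : QOSurface n} {i k : ℕ} (hik : i ≤ k) (h : X.MemN k ν) : X.MemN i ν :=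
  fun u hu => h u (latM_mono hik hu)

/-- Since `n_{i+1} γ_{i+1}` lies already in `M_i`, membership in `N_i` suffices. This gains one
index, which is needed for `l_{J+1}`, where `ν` may fail to lie in `N_{J+1}`. -/
theorem exists_lq_succ_eq {i : ℕ} (h : X.MemN i ν) : ∃ z : ℤ, X.lq (i + 1) ν = z := by
  obtain ⟨z, hz⟩ := h _ (X.idx_smul_gam_mem_latM i)
  refine ⟨X.e (i + 1) * z, ?_⟩
  rw [pair_smul] at hz
  push_cast
  rw [← hz, lq, nn]
  ring

theorem exists_lq_eq {i : ℕ} (h : X.MemN i ν) : ∃ z : ℤ, X.lq i ν = z := by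
  rcases Nat.eq_zero_or_pos i with rfl | hi
  · exact ⟨0, by simp [lq_zero]⟩
  · obtain ⟨i, rfl⟩ := Nat.exists_eq_succ_of_ne_zero hi.ne'
    exact X.exists_lq_succ_eq (h.mono i.le_succ)

/-- The properties of the integers `J = j(m, ν)` and `j = j'(m, ν)` that matter. -/
structure Levels (m : ℕ) (ν : Fin 2 → ℕ) (J j : ℕ) : Prop where
  le_g : J ≤ X.g
  memN : X.MemN J ν
  one_le : 1 ≤ j
  le : j ≤ J
  lower : X.S ν J + (X.K J).card * pair ν (X.lam J) ≤ (X.K X.g).card * m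
  upper : J < X.g → ((X.K X.g).card * (m + 1) : ℚ) ≤ X.S ν J + (X.K J).card * pair ν (X.lam (J + 1))
  lower_of_lt : ∀ k < J, X.S ν k + (X.K k).card * pair ν (X.lam (k + 1)) ≤ (X.K X.g).card * m
  upper_of_lt : j < J →
    ((X.K X.g).card * (m + 1) : ℚ) ≤ X.S ν J + (X.K J).card * (pair ν (X.lam J) + 1)
  pair_eq : ∀ k, j ≤ k → k < J → pair ν (X.lam (k + 1)) = pair ν (X.lam J)

theorem iIdx_le : X.iIdx ν ≤ X.g + 1 := by
  unfold iIdx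
  split_ifs with h
  · exact le_rfl
  · have hne : {i | 1 ≤ i ∧ i ≤ X.g ∧ ¬ X.MemN i ν}.Nonempty := ⟨X.g, X.one_le_g, le_rfl, h⟩
    exact (Nat.sInf_mem hne).2.1.trans (Nat.le_succ _)

theorem one_le_iIdx : 1 ≤ X.iIdx ν := by
  unfold iIdx
  split_ifs with h
  · omega
  · have hne : {i | 1 ≤ i ∧ i ≤ X.g ∧ ¬ X.MemN i ν}.Nonempty := ⟨X.g, X.one_le_g, le_rfl, h⟩
    exact (Nat.sInf_mem hne).1

theorem memN_of_lt_iIdx (h1 : X.MemN 1 ν) {i : ℕ} (hi : i < X.iIdx ν) : X.MemN i ν := by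
  by_cases hg : X.MemN X.g ν
  · exact hg.mono (Nat.lt_succ_iff.1 (hi.trans_le X.iIdx_le))
  rcases Nat.eq_zero_or_pos i with rfl | h0
  · exact h1.mono zero_le_one
  by_contra hcon
  have h2 : i ≤ X.g := Nat.lt_succ_iff.1 (hi.trans_le X.iIdx_le)
  unfold iIdx at hi
  rw [if_neg hg] at hi
  exact Nat.notMem_of_lt_sInf hi ⟨h0, h2, hcon⟩

theorem mIdx_mem : 1 ≤ X.mIdx ν ∧ X.mIdx ν ≤ X.g := by
  have hne : {i | 1 ≤ i ∧ i ≤ X.g ∧ (i < X.g → X.nn i * pair ν (gam X.lam i) <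
      pair ν (gam X.lam (i + 1)))}.Nonempty := ⟨X.g, X.one_le_g, le_rfl, fun h => (lt_irrefl _ h).elim⟩
  exact ⟨(Nat.sInf_mem hne).1, (Nat.sInf_mem hne).2.1⟩

theorem exists_greatest {p : ℕ → Prop} {a b : ℕ} (ha : p a) (hab : a ≤ b) :
    ∃ k, a ≤ k ∧ k ≤ b ∧ p k ∧ ∀ i, k < i → i ≤ b → ¬ p i := by
  classical
  exact ⟨Nat.findGreatest p b, Nat.le_findGreatest hab ha, Nat.findGreatest_le b,
    Nat.findGreatest_spec hab ha, fun i h1 h2 => Nat.findGreatest_is_greatest h1 h2⟩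

theorem jIdx_mem (hlt : (m : WithTop ℚ) < X.l (X.iIdx ν) ν) : X.jIdx m ν < X.iIdx ν ∧
    X.l (X.jIdx m ν) ν ≤ (m : WithTop ℚ) ∧ (m : WithTop ℚ) < X.l (X.jIdx m ν + 1) ν := by
  have h1 := X.one_le_iIdx (ν := ν)
  obtain ⟨k, -, hk, hkm, hk2⟩ := exists_greatest (p := fun k => X.l k ν ≤ (m : WithTop ℚ))
    (a := 0) (b := X.iIdx ν - 1)
    (by rw [l_of_le _ (Nat.zero_le _), lq_zero]; exact_mod_cast Nat.zero_le m) (Nat.zero_le _)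
  have hne : {j | j < X.iIdx ν ∧ X.l j ν ≤ (m : WithTop ℚ) ∧
      (m : WithTop ℚ) < X.l (j + 1) ν}.Nonempty := by
    refine ⟨k, by omega, hkm, ?_⟩
    rcases (show k + 1 = X.iIdx ν ∨ k + 1 ≤ X.iIdx ν - 1 by omega) with h | h
    · rwa [h]
    · exact not_le.1 (hk2 _ k.lt_succ_self h)
  exact Nat.sSup_mem hne ⟨X.iIdx ν, fun j hj => hj.1.le⟩

theorem natCast_withTop (m : ℕ) : (m : WithTop ℚ) = ((m : ℚ) : WithTop ℚ) := rfl

theorem add_one_le_of_lt {x : ℚ} {z : ℤ} (hx : x = z) (h : (m : ℚ) < x) : (m : ℚ) + 1 ≤ x := by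
  subst hx
  have : (m : ℤ) < z := by exact_mod_cast h
  exact_mod_cast this

/-- The condition defining `L_m^<` provides an index `M = m(ν) ≥ 1` with `l_M + e_M ≤ m`, so `j'(m,
ν)` is the largest index up to `J` with this inequality. All the rest follows from monotonicity of
the `l_i` and integrality of the `l_i` and of `⟨ν, λ_i⟩`, due to `ν ∈ N_J`. -/
theorem levels_of_mem_Llt (hν : ν ∈ X.Llt m) : X.Levels m ν (X.jIdx m ν) (X.jIdx' m ν) := by
  obtain ⟨⟨-, hN1, -, -⟩, hm1, hm2⟩ := hν
  obtain ⟨hJi, hJ1, hJ2⟩ := X.jIdx_mem hm2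
  have hJg : X.jIdx m ν ≤ X.g := Nat.lt_succ_iff.1 (hJi.trans_le X.iIdx_le)
  have hmem := X.memN_of_lt_iIdx hN1 hJi
  obtain ⟨hM1, hMg⟩ := X.mIdx_mem (ν := ν)
  set M := X.mIdx ν
  have hj'def : X.jIdx' m ν = sSup {j | j ≤ X.jIdx m ν ∧
    X.l j ν + (X.e j : WithTop ℚ) ≤ (m : WithTop ℚ) ∧
    (m : WithTop ℚ) < X.l (j + 1) ν + (X.e (j + 1) : WithTop ℚ)} := rfl
  set J := X.jIdx m ν
  have hlqJ : X.lq J ν ≤ m := by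
    rw [l_of_le _ hJg, natCast_withTop, WithTop.coe_le_coe] at hJ1
    exact hJ1
  have hlqM : X.lq M ν + X.e M ≤ m := by
    rw [l_of_le _ hMg, natCast_withTop, natCast_withTop, ← WithTop.coe_add,
      WithTop.coe_le_coe] at hm1
    exact hm1
  have heM : (0 : ℚ) < X.e M := by exact_mod_cast X.e_pos M
  -- If `J < M`, then `l_{J+1} ≤ l_M ≤ m` would contradict the choice of `J`.
  have hMJ : M ≤ J := by
    by_contra hcon
    have hJ1g : J + 1 ≤ X.g := by omega
    rw [l_of_le _ hJ1g, natCast_withTop, WithTop.coe_lt_coe] at hJ2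
    have := X.lq_mono (ν := ν) (show J + 1 ≤ M by omega) hMg
    linarith
  obtain ⟨k, hMk, hkJ, hkm, hk2⟩ := exists_greatest
    (p := fun k => X.lq k ν + X.e k ≤ (m : ℚ)) hlqM hMJ
  have hlcoe : ∀ i ≤ X.g, (X.l i ν + (X.e i : WithTop ℚ)) = ((X.lq i ν + X.e i : ℚ) : WithTop ℚ) :=
    fun i hi => by rw [l_of_le _ hi, natCast_withTop, ← WithTop.coe_add]
  have hset : ∀ i, i ∈ {j | j ≤ J ∧
    X.l j ν + (X.e j : WithTop ℚ) ≤ (m : WithTop ℚ) ∧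
    (m : WithTop ℚ) < X.l (j + 1) ν + (X.e (j + 1) : WithTop ℚ)} → i ≤ k := by
    rintro i ⟨hi1, hi2, -⟩
    by_contra hcon
    rw [hlcoe i (hi1.trans hJg), natCast_withTop, WithTop.coe_le_coe] at hi2
    exact hk2 i (not_le.1 hcon) hi1 hi2
  have hkmem : k ∈ {j | j ≤ J ∧
    X.l j ν + (X.e j : WithTop ℚ) ≤ (m : WithTop ℚ) ∧
    (m : WithTop ℚ) < X.l (j + 1) ν + (X.e (j + 1) : WithTop ℚ)} := by
    refine ⟨hkJ, ?_, ?_⟩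
    · rw [hlcoe k (hkJ.trans hJg), natCast_withTop, WithTop.coe_le_coe]
      exact hkm
    · rcases hkJ.lt_or_eq with hlt | heq
      · rw [hlcoe _ (hlt.trans_le hJg), natCast_withTop, WithTop.coe_lt_coe]
        exact not_le.1 (hk2 _ k.lt_succ_self hlt)
      · rw [heq]
        refine hJ2.trans_le (le_add_of_nonneg_right ?_)
        rw [natCast_withTop]
        exact_mod_cast Nat.zero_le _
  have hj' : X.jIdx' m ν = k := by
    rw [hj'def]
    exact le_antisymm (csSup_le ⟨k, hkmem⟩ hset) (le_csSup ⟨k, hset⟩ hkmem)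
  rw [hj']
  have hN : (0 : ℚ) < (X.K X.g).card := by exact_mod_cast X.card_K_pos X.g
  have hstep : ∀ i < X.g, (X.K X.g).card * X.lq (i + 1) ν =
      X.S ν i + (X.K i).card * pair ν (X.lam (i + 1)) := fun i hi => by
    rw [X.card_mul_lq hi, S]; ring
  refine ⟨hJg, hmem, hM1.trans hMk, hkJ, ?_, fun hJlt => ?_, fun i hi => ?_, fun hlt => ?_, ?_⟩
  · rw [← X.card_mul_lq hJg]
    exact mul_le_mul_of_nonneg_left hlqJ hN.le
  · rw [← hstep J hJlt]
    rw [l_of_le _ hJlt, natCast_withTop, WithTop.coe_lt_coe] at hJ2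
    -- The strict inequality `m < l_{J+1}` between integers improves to `m + 1 ≤ l_{J+1}`.
    obtain ⟨z, hz⟩ := X.exists_lq_succ_eq hmem
    exact mul_le_mul_of_nonneg_left (add_one_le_of_lt hz hJ2) hN.le
  · rw [← hstep i (hi.trans_le hJg)]
    exact mul_le_mul_of_nonneg_left ((X.lq_mono hi hJg).trans hlqJ) hN.le
  · have h1 := X.card_mul_lq (ν := ν) hJg
    have h2 := congrArg (Nat.cast : ℕ → ℚ) (X.card_K_eq hJg)
    push_cast at h2
    obtain ⟨z, hz⟩ := X.exists_lq_eq hmem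
    have h3 := add_one_le_of_lt (m := m) (x := X.lq J ν + X.e J) (z := z + X.e J)
      (by rw [hz]; push_cast; ring) (not_le.1 (hk2 J hlt le_rfl))
    have h4 := mul_le_mul_of_nonneg_left h3 hN.le
    rw [mul_add _ (X.lq J ν), h1] at h4
    rw [h2] at h4 ⊢
    linarith
  -- If `⟨ν, λ_i⟩ < ⟨ν, λ_{i+1}⟩` for some `i` strictly between `j'` and `J`, these integers differ
  -- by at least `1`. Then `m ≥ l_J ≥ l_{i+1} ≥ l_i + e_i`, contrary to the maximality of `j'`.
  · have hint : ∀ i, k < i → i < J → pair ν (X.lam (i + 1)) = pair ν (X.lam i) := by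
      intro i hki hiJ
      have h1 : pair ν (X.lam i) ≤ pair ν (X.lam (i + 1)) :=
        pair_mono (X.charExponents.mono _ (hiJ.trans_le hJg))
      refine le_antisymm ?_ h1
      by_contra hcon
      rw [not_le] at hcon
      obtain ⟨a, ha⟩ := (hmem.mono hiJ.le) _ (lam_mem_latM (by omega : 1 ≤ i))
      obtain ⟨b, hb⟩ := (hmem.mono hiJ) _ (lam_mem_latM (by omega : 1 ≤ i + 1))
      have h2 : pair ν (X.lam i) + 1 ≤ pair ν (X.lam (i + 1)) := by
        rw [ha, hb] at hcon ⊢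
        have : a < b := by exact_mod_cast hcon
        exact_mod_cast this
      have h3 := X.lq_succ (ν := ν) (hiJ.trans_le hJg)
      have h4 := X.lq_mono (ν := ν) (show i + 1 ≤ J from hiJ) hJg
      have h5 := not_le.1 (hk2 i hki hiJ.le)
      have h6 : (0 : ℚ) ≤ X.e i := by positivity
      nlinarith
    intro i hki hiJ
    have : ∀ d, i + 1 + d ≤ J → pair ν (X.lam (i + 1 + d)) = pair ν (X.lam (i + 1)) := by
      intro d
      induction d with
      | zero => intro _; rfl
      | succ d ih =>
        intro hd
        rw [← ih (by omega)]
        exact hint (i + 1 + d) (by omega) (by omega)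
    have h7 := this (J - (i + 1)) (by omega)
    rw [show i + 1 + (J - (i + 1)) = J by omega] at h7
    exact h7.symm

end QOSurface

/-! ### Jets of analytic curves -/

/-- The `m`-jet of a curve in `ℂ³`. -/
def jetOf (m : ℕ) (F : Fin 3 → ℂ → ℂ) : Jet m := fun i k =>
  iteratedDeriv k (F i) 0 / (Nat.factorial k : ℂ)

theorem analyticAt_curve {m : ℕ} (γ : Jet m) (i : Fin 3) (t : ℂ) :
    AnalyticAt ℂ (fun t => γ.curve t i) t := by
  unfold Jet.curve
  fun_prop

theorem iteratedDeriv_sum_pow {m : ℕ} (a : Fin (m + 1) → ℂ) (k : ℕ) :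
    iteratedDeriv k (fun t : ℂ => ∑ j : Fin (m + 1), a j * t ^ (j : ℕ)) 0 =
      ∑ j : Fin (m + 1), a j * (if k = (j : ℕ) then ((j : ℕ).factorial : ℂ) else 0) := by
  classical
  have : ∀ s : Finset (Fin (m + 1)), iteratedDeriv k (fun t : ℂ => ∑ j ∈ s, a j * t ^ (j : ℕ)) 0 =
      ∑ j ∈ s, a j * (if k = (j : ℕ) then ((j : ℕ).factorial : ℂ) else 0) := by
    intro s
    induction s using Finset.induction_on with
    | empty => simp
    | insert j s hj ih =>
      simp only [Finset.sum_insert hj]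
      rw [iteratedDeriv_fun_add (by fun_prop) (by fun_prop), ih, iteratedDeriv_const_mul_field,
        iteratedDeriv_fun_pow_zero]
      push_cast
      rfl
  exact this Finset.univ

theorem iteratedDeriv_curve {m : ℕ} (γ : Jet m) (i : Fin 3) (k : Fin (m + 1)) :
    iteratedDeriv k (fun t => γ.curve t i) 0 = γ i k * (Nat.factorial k : ℂ) := by
  unfold Jet.curve
  rw [iteratedDeriv_sum_pow, Finset.sum_eq_single k]
  · simp
  · intro j _ hj
    rw [if_neg fun h => hj (Fin.ext h.symm), mul_zero]
  · simp

theorem jetOf_curve {m : ℕ} (γ : Jet m) (i : Fin 3) (k : Fin (m + 1)) :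
    iteratedDeriv k (fun t => γ.curve t i) 0 / (Nat.factorial k : ℂ) = γ i k := by
  rw [iteratedDeriv_curve, mul_div_cancel_right₀]
  exact_mod_cast Nat.factorial_ne_zero _

theorem curve_jetOf_sub_isBigO {m : ℕ} {F : Fin 3 → ℂ → ℂ} (hF : ∀ i, AnalyticAt ℂ (F i) 0)
    (i : Fin 3) : (fun t : ℝ => (jetOf m F).curve t i - F i t) =O[𝓝[>] 0]
      fun t => t ^ ((m + 1 : ℕ) : ℝ) := by
  refine (isBigO_pow_iff_iteratedDeriv (g := fun t => (jetOf m F).curve t i - F i t)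
    ((analyticAt_curve _ i 0).sub (hF i))).2 fun k hk => ?_
  rw [iteratedDeriv_fun_sub (analyticAt_curve _ i 0).contDiffAt (hF i).contDiffAt,
    iteratedDeriv_curve _ i ⟨k, hk⟩, jetOf, div_mul_cancel₀, sub_self]
  exact_mod_cast Nat.factorial_ne_zero _

theorem analyticAt_evalSeries {h : MvPowerSeries (Fin 2) ℂ} {R : ℝ}
    (hc : ConvOn R h) {y : ℂ → Fin 2 → ℂ} (hy : ∀ i, AnalyticAt ℂ (fun t => y t i) 0)
    (hy0 : ∀ i, ‖y 0 i‖ < R) : AnalyticAt ℂ (fun t => evalSeries h (y t)) 0 := by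
  have h1 : ∀ᶠ t in 𝓝 (0 : ℂ), ∀ i, ‖y t i‖ < R ∧ AnalyticAt ℂ (fun t => y t i) t :=
    eventually_all.2 fun i => ((hy i).continuousAt.norm.eventually (gt_mem_nhds (hy0 i))).and
      (hy i).eventually_analyticAt
  obtain ⟨S, hS, hSo, h0⟩ := eventually_nhds_iff.1 h1
  have : DifferentiableOn ℂ (fun t => evalSeries h (y t)) S := by
    refine Complex.differentiableOn_tsum_of_summable_norm hc (fun a => ?_) hSo
      fun a t ht => norm_term_le (fun i => (hS t ht i).1.le) a
    have : ∀ i, DifferentiableOn ℂ (fun t => y t i) S := fun i t ht =>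
      (hS t ht i).2.differentiableAt.differentiableWithinAt
    fun_prop
  exact this.analyticAt (hSo.mem_nhds h0)

section evalPoly
variable {P : ConvSeries[X]} {R : ℝ}

theorem evalPoly_eq (P : ConvSeries[X]) (p : Fin 3 → ℂ) : evalPoly P p =
    ∑ k ∈ Finset.range (P.natDegree + 1),
      evalSeries (P.coeff k : MvPowerSeries (Fin 2) ℂ) (fun i => p i.castSucc) * p 2 ^ k := by
  have : (fun i : Fin 2 => p i.castSucc) = ![p 0, p 1] := by
    ext i; fin_cases i <;> rfl
  rw [this]; rfl

theorem analyticAt_evalPoly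
    (hc : ∀ k, ConvOn R (P.coeff k : MvPowerSeries (Fin 2) ℂ)) {p : ℂ → Fin 3 → ℂ}
    (hp : ∀ i, AnalyticAt ℂ (fun t => p t i) 0) (hp0 : ∀ i : Fin 2, ‖p 0 i.castSucc‖ < R) :
    AnalyticAt ℂ (fun t => evalPoly P (p t)) 0 := by
  simp only [evalPoly_eq]
  refine Finset.analyticAt_fun_sum _ fun k _ => ?_
  exact (analyticAt_evalSeries (hc k) (fun i => hp i.castSucc) hp0).mul ((hp 2).pow k)

/-- Allows a curve to be replaced by its jet. As `P` is a polynomial in `z`, the last coordinate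
only has to be bounded, not small. -/
theorem evalPoly_sub_isBigO {s : ℝ} (hsR : s < R)
    (hc : ∀ k, ConvOn R (P.coeff k : MvPowerSeries (Fin 2) ℂ)) {p q : ℝ → Fin 3 → ℂ} {M : ℝ}
    {l : Filter ℝ} (hp : ∀ᶠ t in l, ∀ i : Fin 2, ‖p t i.castSucc‖ ≤ s)
    (hq : ∀ᶠ t in l, ∀ i : Fin 2, ‖q t i.castSucc‖ ≤ s)
    (hp2 : (fun t => p t 2) =O[l] fun _ => (1 : ℝ)) (hq2 : (fun t => q t 2) =O[l] fun _ => (1 : ℝ))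
    (h : ∀ i, (fun t => p t i - q t i) =O[l] fun t => t ^ M) :
    (fun t => evalPoly P (p t) - evalPoly P (q t)) =O[l] fun t => t ^ M := by
  simp only [evalPoly_eq, ← Finset.sum_sub_distrib]
  refine IsBigO.fun_sum fun k _ => ?_
  have h1 : (fun t => evalSeries (P.coeff k : MvPowerSeries (Fin 2) ℂ) (fun i => p t i.castSucc) -
      evalSeries (P.coeff k : MvPowerSeries (Fin 2) ℂ) (fun i => q t i.castSucc)) =O[l]
        fun t => t ^ M := by
    obtain ⟨C, hC0, hC⟩ := (hc k).lipschitz hsR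
    refine IsBigO.trans (IsBigO.of_bound C ?_) ((h 0).norm_left.add (h 1).norm_left)
    filter_upwards [hp, hq] with t h1 h2
    rw [Real.norm_of_nonneg (by positivity)]
    exact hC _ _ h1 h2
  have h2 : (fun t => evalSeries (P.coeff k : MvPowerSeries (Fin 2) ℂ)
      (fun i => q t i.castSucc)) =O[l] fun _ => (1 : ℝ) := by
    obtain ⟨C, hC0, hC⟩ := (hc k).exists_bound
    refine IsBigO.of_bound C ?_
    filter_upwards [hq] with t ht
    rw [norm_one, mul_one]
    exact hC _ fun i => (ht i).trans hsR.le
  have h3 : ∀ k : ℕ, (fun t => p t 2 ^ k - q t 2 ^ k) =O[l] fun t => t ^ M := by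
    intro k
    induction k with
    | zero => simpa using isBigO_zero _ _
    | succ k ih =>
      have h4 : (fun t => (p t 2 ^ k - q t 2 ^ k) * p t 2 + q t 2 ^ k * (p t 2 - q t 2)) =O[l]
          fun t => t ^ M := by
        refine IsBigO.add ?_ ?_
        · simpa using ih.mul hp2
        · simpa using (hq2.pow k).mul (h 2)
      exact h4.congr_left fun t => by ring
  have h4 := h1.mul (hp2.pow k)
  have h6 := h2.mul (h3 k)
  simp only [one_pow, mul_one, one_mul] at h4 h6
  have h5 := h4.add h6
  exact h5.congr_left fun t => by ring

end evalPoly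

/-! ### Branches over analytic curves -/

/-- The roots `U` are chosen for each `t` independently, without continuity; only their absolute
values matter, and these are determined by `x`. -/
theorem branch_of_pow {r : ℝ} (hr : 0 ≤ r) {μ : Fin 2 → ℕ} {x h : Fin 2 → ℂ → ℂ}
    {U : ℝ → Fin 2 → ℂ} (hU : ∀ᶠ t : ℝ in 𝓝[>] 0, ∀ i, U t i ^ n = x i t)
    (hx : ∀ i, ∀ᶠ t in 𝓝 0, x i t = t ^ μ i * h i t) (hh : ∀ i, ContinuousAt (h i) 0)
    (hh0 : ∀ i, h i 0 ≠ 0) (hx0 : ∀ i, ‖x i 0‖ < r ^ n) : Branch n r μ U := by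
  constructor
  · have h1 : ∀ᶠ t : ℝ in 𝓝[>] 0, ∀ i, ‖x i t‖ < r ^ n := eventually_all.2 fun i => by
      have h2 : ContinuousAt (x i) 0 := by
        have : ContinuousAt (fun t => t ^ μ i * h i t) 0 := by
          have := hh i
          fun_prop
        exact this.congr ((hx i).mono fun t ht => ht.symm)
      exact tendsto_ofReal_nhdsGT.eventually (h2.norm.eventually (gt_mem_nhds (hx0 i)))
    filter_upwards [hU, h1] with t h2 h3 i
    refine le_of_lt (lt_of_pow_lt_pow_left₀ n hr ?_)
    rw [← norm_pow, h2 i]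
    exact h3 i
  · intro i
    have hc : Tendsto (fun t : ℝ => h i t) (𝓝[>] 0) (𝓝 (h i 0)) :=
      (hh i).tendsto.comp tendsto_ofReal_nhdsGT
    have h1 : (fun t : ℝ => h i t) =Θ[𝓝[>] 0] fun _ => (1 : ℝ) := by
      refine ⟨hc.isBigO_one ℝ, (isBigO_const_left_iff_pos_le_norm one_ne_zero).2
        ⟨‖h i 0‖ / 2, half_pos (norm_pos_iff.2 (hh0 i)), ?_⟩⟩
      exact (hc.norm.eventually (lt_mem_nhds (half_lt_self (norm_pos_iff.2 (hh0 i))))).mono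
        fun t ht => ht.le
    have h2 : (fun t : ℝ => (t : ℂ) ^ μ i) =Θ[𝓝[>] 0] fun t => (t ^ ((μ i : ℝ) / n)) ^ n := by
      refine IsTheta.of_norm_eventuallyEq_norm ?_
      filter_upwards [self_mem_nhdsWithin] with t ht
      have ht' : 0 < t := ht
      rw [norm_pow, Complex.norm_real, ← Real.rpow_mul_natCast ht'.le,
        div_mul_cancel₀ _ (by exact_mod_cast NeZero.ne n), Real.rpow_natCast, norm_pow]
    have h3 : (fun t => U t i ^ n) =Θ[𝓝[>] 0] fun t => (t ^ ((μ i : ℝ) / n)) ^ n := by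
      have h4 := h2.mul h1
      simp only [mul_one] at h4
      refine IsTheta.trans (EventuallyEq.isTheta ?_) h4
      filter_upwards [hU, tendsto_ofReal_nhdsGT.eventually (hx i)] with t h5 h6
      rw [h5 i, h6]
    exact ⟨IsBigO.of_pow (NeZero.ne n) h3.1, IsBigO.of_pow (NeZero.ne n) h3.2⟩

namespace QOSurface
variable (X : QOSurface n) {R r ε : ℝ} {m J j : ℕ} {ν : Fin 2 → ℕ}

theorem Good.pow_le {X : QOSurface n} (hG : X.Good R r) : r ^ n ≤ r :=
  (pow_le_pow_of_le_one hG.pos.le (hG.lt.le.trans hG.le_one) NeZero.one_le).trans_eq (pow_one r)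

/-- The jets of the surface, in terms of the order of `f` along the curve. -/
theorem mem_jets_iff (hG : X.Good R r) (hε : ε ≤ r ^ n) {γ : Jet m} :
    γ ∈ X.jets ε m ↔ γ ∈ jetDomain ε m ∧ (fun t : ℝ => evalPoly X.f (γ.curve t)) =O[𝓝[>] 0]
      fun t => t ^ ((m + 1 : ℕ) : ℝ) := by
  refine and_congr_right fun hγ => ?_
  have h0 : ∀ i : Fin 2, ‖γ.curve 0 i.castSucc‖ < R := fun i => by
    have : γ.curve 0 i.castSucc = γ i.castSucc 0 := by
      rw [Jet.curve, Finset.sum_eq_single 0]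
      · simp
      · intro k _ hk
        rw [zero_pow fun h => hk (Fin.ext h), mul_zero]
      · simp
    rw [this]
    refine lt_of_lt_of_le ?_ ((hε.trans hG.pow_le).trans hG.lt.le)
    fin_cases i
    exacts [hγ.1, hγ.2]
  rw [isBigO_pow_iff_iteratedDeriv (g := fun t => evalPoly X.f (γ.curve t))
    (analyticAt_evalPoly hG.convf (fun i => analyticAt_curve γ i 0) h0)]
  simp only [Nat.lt_succ_iff]

/-- The exponent `c_J`, at which an approximation of `ζ_J` has to be good in order to give an
`m`-jet of the surface. -/
def cJ (m : ℕ) (ν : Fin 2 → ℕ) (J : ℕ) : ℚ := ((X.K X.g).card * (m + 1) - X.S ν J) / (X.K J).card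

theorem card_mul_cJ (m : ℕ) (ν : Fin 2 → ℕ) (J : ℕ) :
    (X.K J).card * X.cJ m ν J = (X.K X.g).card * (m + 1) - X.S ν J := by
  have : ((X.K J).card : ℚ) ≠ 0 := by exact_mod_cast (X.card_K_pos J).ne'
  rw [cJ]; field_simp

/-- This and the next three bounds are the inequalities for the levels, rewritten through `|G_k| c_k
= |G_g| (m + 1) - S_k`. Strictness comes from the gap between `m` and `m + 1`. -/
theorem Levels.pair_lt_cJ {X : QOSurface n} (L : X.Levels m ν J j) :
    pair ν (X.lam J) < X.cJ m ν J := by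
  have h1 : (0 : ℚ) < (X.K J).card := by exact_mod_cast X.card_K_pos J
  have h2 : (0 : ℚ) < (X.K X.g).card := by exact_mod_cast X.card_K_pos X.g
  have h3 := L.lower
  have h4 := X.card_mul_cJ m ν J
  refine lt_of_mul_lt_mul_left (a := ((X.K J).card : ℚ)) ?_ h1.le
  rw [h4]
  linarith

theorem Levels.pair_succ_lt_cJ {X : QOSurface n} (L : X.Levels m ν J j) {k : ℕ} (hk : k < J) :
    pair ν (X.lam (k + 1)) < X.cJ m ν k := by
  have h1 : (0 : ℚ) < (X.K k).card := by exact_mod_cast X.card_K_pos k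
  have h2 : (0 : ℚ) < (X.K X.g).card := by exact_mod_cast X.card_K_pos X.g
  have h3 := L.lower_of_lt k hk
  have h4 := X.card_mul_cJ m ν k
  refine lt_of_mul_lt_mul_left (a := ((X.K k).card : ℚ)) ?_ h1.le
  rw [h4]
  linarith

theorem Levels.cJ_le {X : QOSurface n} (L : X.Levels m ν J j) (hJ : J < X.g) :
    X.cJ m ν J ≤ pair ν (X.lam (J + 1)) := by
  have h1 : (0 : ℚ) < (X.K J).card := by exact_mod_cast X.card_K_pos J
  refine le_of_mul_le_mul_left (a := ((X.K J).card : ℚ)) ?_ h1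
  rw [X.card_mul_cJ]
  linarith [L.upper hJ]

theorem Levels.cJ_le_add_one {X : QOSurface n} (L : X.Levels m ν J j) (hJ : j < J) :
    X.cJ m ν J ≤ pair ν (X.lam J) + 1 := by
  have h1 : (0 : ℚ) < (X.K J).card := by exact_mod_cast X.card_K_pos J
  refine le_of_mul_le_mul_left (a := ((X.K J).card : ℚ)) ?_ h1
  rw [X.card_mul_cJ]
  linarith [L.upper_of_lt hJ]

/-- Curves that approximate `ζ_J` up to order `c_J` give jets of the surface. -/
theorem jetOf_mem_D (hG : X.Good R r) (hε : ε ≤ r ^ n) (L : X.Levels m ν J j)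
    (hν : ∀ i, ν i ≤ m) {F : Fin 3 → ℂ → ℂ} (hF : ∀ i, AnalyticAt ℂ (F i) 0)
    {h : Fin 2 → ℂ → ℂ} (hh : ∀ i, AnalyticAt ℂ (h i) 0) (hh0 : ∀ i, h i 0 ≠ 0)
    (hFh : ∀ i, ∀ᶠ t in 𝓝 0, F i.castSucc t = t ^ ν i * h i t)
    (hF0 : ∀ i : Fin 2, ‖F i.castSucc 0‖ < ε) {U : ℝ → Fin 2 → ℂ}
    (hU : ∀ᶠ t : ℝ in 𝓝[>] 0, ∀ i, U t i ^ n = F i.castSucc t)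
    (hz : (fun t : ℝ => F 2 t - evalSeries (X.trunc J).toSeries (U t)) =O[𝓝[>] 0]
      fun t => t ^ ((X.cJ m ν J : ℚ) : ℝ)) : jetOf m F ∈ X.D ε m ν := by
  have hord : ∀ i : Fin 2, ∀ k ≤ ν i, iteratedDeriv k (F i.castSucc) 0 =
      if k = ν i then (Nat.factorial k : ℂ) * h i 0 else 0 := by
    intro i k hk
    rw [Filter.EventuallyEq.iteratedDeriv_eq k (hFh i), iteratedDeriv_fun_mul (by fun_prop) (hh i).contDiffAt]
    simp only [iteratedDeriv_fun_pow_zero]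
    rw [Finset.sum_eq_single_of_mem k (by simp)]
    · split_ifs with h1
      · simp [h1]
      · simp
    · intro b hb hbk
      have : b ≠ ν i := by have := Finset.mem_range.1 hb; omega
      simp [this]
  have hdom : jetOf m F ∈ jetDomain ε m := by
    constructor
    · simpa [jetOf] using hF0 0
    · simpa [jetOf] using hF0 1
  have hbr : Branch n r ν U := branch_of_pow hG.pos.le hU hFh (fun i => (hh i).continuousAt) hh0
    fun i => (hF0 i).trans_le hε
  refine ⟨(X.mem_jets_iff hG hε).2 ⟨hdom, ?_⟩, fun i => ⟨fun k hk => ?_, ⟨ν i, ?_⟩, rfl, ?_⟩⟩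
  · have h1 := X.isBigO_evalPoly hG hbr (p := fun t i => F i t)
      (hU.mono fun t ht i => (ht i).symm) L.le_g hz
      (M := ((m + 1 : ℕ) : ℝ)) (by exact_mod_cast L.pair_lt_cJ.le)
      (fun hJ => by exact_mod_cast L.cJ_le hJ) (by
        have := X.card_mul_cJ m ν J
        have h2 : ((X.K X.g).card * ((m + 1 : ℕ) : ℚ) : ℚ) ≤
            X.S ν J + (X.K J).card * X.cJ m ν J := by push_cast; linarith
        exact_mod_cast h2)
    have hb : ∀ G : ℂ → ℂ, AnalyticAt ℂ G 0 → (fun t : ℝ => G t) =O[𝓝[>] 0] fun _ => (1 : ℝ) :=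
      fun G hGa => (hGa.continuousAt.tendsto.comp tendsto_ofReal_nhdsGT).isBigO_one ℝ
    have hle : ∀ G : Fin 2 → ℂ → ℂ, (∀ i, AnalyticAt ℂ (G i) 0) → (∀ i, ‖G i 0‖ < ε) →
        ∀ᶠ t : ℝ in 𝓝[>] 0, ∀ i, ‖G i t‖ ≤ r := fun G hGa hG0 => eventually_all.2 fun i => by
      refine (tendsto_ofReal_nhdsGT.eventually ((hGa i).continuousAt.norm.eventually
        (gt_mem_nhds (hG0 i)))).mono fun t ht => ht.le.trans (hε.trans hG.pow_le)
    -- The `m`-jet agrees with the curve modulo `t ^ (m + 1)`, hence so do the values of `f`.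
    have h3 := evalPoly_sub_isBigO (P := X.f) hG.lt hG.convf
      (p := fun t => (jetOf m F).curve t) (q := fun t i => F i t) (l := 𝓝[>] 0)
      (hle (fun i t => (jetOf m F).curve t i.castSucc) (fun i => analyticAt_curve _ _ 0) fun i => by
        have : (jetOf m F).curve 0 i.castSucc = F i.castSucc 0 := by
          have := jetOf_curve (jetOf m F) i.castSucc 0
          simpa [jetOf] using this
        rw [this]
        exact hF0 i)
      (hle (fun i => F i.castSucc) (fun i => hF _) hF0)
      (hb _ (analyticAt_curve (jetOf m F) 2 0)) (hb _ (hF 2))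
      (curve_jetOf_sub_isBigO hF)
    exact (h3.add h1).congr_left fun t => by ring
  · rw [jetOf, hord i k hk.le, if_neg hk.ne, zero_div]
  · exact Nat.lt_succ_of_le (hν i)
  · rw [jetOf, hord i _ le_rfl, if_pos rfl, mul_div_cancel_left₀]
    · exact hh0 i
    · exact_mod_cast Nat.factorial_ne_zero _

end QOSurface

/-! ### Limits of jets -/

/-- The only property of the Zariski closure needed for membership: analytic subsets are closed in
`Ω`. -/
theorem mem_zariskiClosure_of_tendsto {E : Type*} [NormedAddCommGroup E] [NormedSpace ℂ E]
    {Ω S : Set E} {p : E} (hp : p ∈ Ω) {ι : Type*} {l : Filter ι} [l.NeBot] {q : ι → E}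
    (hq : Tendsto q l (𝓝 p)) (hS : ∀ᶠ s in l, q s ∈ S) : p ∈ zariskiClosure Ω S := by
  refine ⟨hp, fun A hA hSA => ?_⟩
  obtain ⟨W, hW, hpW, -, r, h, hh, H⟩ := hA.2 p hp
  refine (H p hpW).2 fun i => ?_
  have h1 : Tendsto (fun s => h i (q s)) l (𝓝 (h i p)) := (hh i p hpW).continuousAt.tendsto.comp hq
  refine tendsto_nhds_unique (h1.congr' ?_) tendsto_const_nhds
  filter_upwards [hS, hq.eventually (hW.mem_nhds hpW)] with s hs1 hs2
  exact (H _ hs2).1 (hSA hs1) i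

theorem zariskiClosure_subset {E : Type*} [NormedAddCommGroup E] [NormedSpace ℂ E]
    {Ω S T : Set E} (h : S ⊆ zariskiClosure Ω T) : zariskiClosure Ω S ⊆ zariskiClosure Ω T :=
  fun _ hp => ⟨hp.1, fun A hA hT => hp.2 A hA fun _ hq => (h hq).2 A hA hT⟩

/-! ### Families of analytic germs -/

/-- A family `F s`, `s ≥ 0` small, of analytic functions on a fixed neighbourhood of `0` that
depends continuously on `s`. -/
def AnalyticFamily (F : ℝ → ℂ → ℂ) : Prop :=
  ∀ᶠ δ : ℝ in 𝓝[>] 0, ContinuousOn (Function.uncurry F) (Set.Icc 0 δ ×ˢ Metric.closedBall 0 δ) ∧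
    ∀ s ∈ Set.Icc 0 δ, DifferentiableOn ℂ (F s) (Metric.ball 0 δ)

namespace AnalyticFamily
variable {F G : ℝ → ℂ → ℂ}

theorem add (hF : AnalyticFamily F) (hG : AnalyticFamily G) :
    AnalyticFamily fun s t => F s t + G s t := by
  filter_upwards [hF, hG] with δ h1 h2
  exact ⟨h1.1.add h2.1, fun s hs => (h1.2 s hs).add (h2.2 s hs)⟩

theorem mul (hF : AnalyticFamily F) (hG : AnalyticFamily G) :
    AnalyticFamily fun s t => F s t * G s t := by
  filter_upwards [hF, hG] with δ h1 h2
  exact ⟨h1.1.mul h2.1, fun s hs => (h1.2 s hs).mul (h2.2 s hs)⟩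

theorem pow (hF : AnalyticFamily F) (k : ℕ) : AnalyticFamily fun s t => F s t ^ k := by
  filter_upwards [hF] with δ h1
  exact ⟨h1.1.pow k, fun s hs => (h1.2 s hs).pow k⟩

theorem of_analyticAt {f : ℂ → ℂ} (hf : AnalyticAt ℂ f 0) : AnalyticFamily fun _ t => f t := by
  obtain ⟨ρ, hρ, H⟩ := Metric.eventually_nhds_iff.1 hf.eventually_analyticAt
  filter_upwards [eventually_pos_lt hρ] with δ hδ
  have hd : ∀ t ∈ Metric.closedBall (0 : ℂ) δ, DifferentiableAt ℂ f t := fun t ht =>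
    (H ((Metric.mem_closedBall.1 ht).trans_lt hδ.2)).differentiableAt
  refine ⟨ContinuousOn.comp (g := f) (f := Prod.snd) (t := Metric.closedBall 0 δ)
    (fun t ht => (hd t ht).continuousAt.continuousWithinAt) continuousOn_snd fun x hx => hx.2,
    fun s _ t ht => (hd t (Metric.ball_subset_closedBall ht)).differentiableWithinAt⟩

theorem ofReal : AnalyticFamily fun s _ => (s : ℂ) :=
  Eventually.of_forall fun δ => ⟨by fun_prop, fun s _ => differentiableOn_const _⟩

theorem tendsto (hF : AnalyticFamily F) (k : ℕ) :
    Tendsto (fun s => iteratedDeriv k (F s) 0) (𝓝[>] 0) (𝓝 (iteratedDeriv k (F 0) 0)) := by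
  obtain ⟨δ, h, hδ⟩ := (Eventually.and hF self_mem_nhdsWithin).exists
  exact tendsto_iteratedDeriv_of_continuousOn hδ hδ h.1 h.2 k

theorem tendsto_zero (hF : AnalyticFamily F) :
    Tendsto (fun s => F s 0) (𝓝[>] 0) (𝓝 (F 0 0)) := by
  simpa using hF.tendsto 0

theorem analyticAt (hF : AnalyticFamily F) : ∀ᶠ s in 𝓝[>] 0, AnalyticAt ℂ (F s) 0 := by
  obtain ⟨δ, h, hδ⟩ := (Eventually.and hF self_mem_nhdsWithin).exists
  have hδ' : 0 < δ := hδ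
  filter_upwards [eventually_pos_lt hδ'] with s hs
  exact (h.2 s ⟨hs.1.le, hs.2.le⟩).analyticAt (Metric.isOpen_ball.mem_nhds (Metric.mem_ball_self hδ'))

theorem eventually_lt (hF : AnalyticFamily F) {a k : ℕ} {b : ℝ}
    (h : (0 : ℝ) ^ a * ‖F 0 0‖ ^ k < b) : ∀ᶠ δ : ℝ in 𝓝[>] 0, ∀ s ∈ Set.Icc 0 δ,
      ∀ t ∈ Metric.closedBall (0 : ℂ) δ, ‖t‖ ^ a * ‖F s t‖ ^ k < b := by
  obtain ⟨δ₀, h0, hδ₀⟩ := (Eventually.and hF self_mem_nhdsWithin).exists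
  have hδ₀' : 0 < δ₀ := hδ₀
  have hc : ContinuousOn (fun x : ℝ × ℂ => ‖x.2‖ ^ a * ‖Function.uncurry F x‖ ^ k)
      (Set.Icc 0 δ₀ ×ˢ Metric.closedBall 0 δ₀) :=
    (continuousOn_snd.norm.pow a).mul (h0.1.norm.pow k)
  have h1 := (hc (0, 0) ⟨⟨le_rfl, hδ₀'.le⟩, Metric.mem_closedBall_self hδ₀'.le⟩).eventually
    (gt_mem_nhds (show ‖(0 : ℂ)‖ ^ a * ‖F 0 0‖ ^ k < b by simpa using h))
  obtain ⟨η, hη, H⟩ := Metric.eventually_nhds_iff.1 (eventually_nhdsWithin_iff.1 h1)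
  filter_upwards [eventually_pos_lt (lt_min hη hδ₀')] with δ hδ s hs t ht
  have h2 := hδ.2.trans_le (min_le_left _ _)
  have h3 := hδ.2.le.trans (min_le_right _ _)
  refine H (y := (s, t)) ?_ ⟨⟨hs.1, hs.2.trans h3⟩, Metric.closedBall_subset_closedBall h3 ht⟩
  rw [Prod.dist_eq, max_lt_iff]
  refine ⟨?_, (Metric.mem_closedBall.1 ht).trans_lt h2⟩
  rw [Real.dist_eq, sub_zero, abs_of_nonneg hs.1]
  exact hs.2.trans_lt h2

theorem evalCurve {ν d : Fin 2 → ℕ} {h : MvPowerSeries (Fin 2) ℂ} (H : CurveOK n ν d h) {R : ℝ}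
    (hR : 0 ≤ R) (hc : ConvOn R h) {Y : Fin 2 → ℝ → ℂ → ℂ} (hY : ∀ l, AnalyticFamily (Y l))
    (h0 : ∀ l, (0 : ℝ) ^ ν l * ‖Y l 0 0‖ ^ (n / d l) < R ^ n) :
    AnalyticFamily fun s t => QuasiOrdinary.evalCurve n ν d h t (fun l => Y l s t) := by
  filter_upwards [eventually_all.2 fun l => (hY l).eventually_lt (h0 l), eventually_all.2 hY]
    with δ h1 h2
  refine ⟨?_, fun s hs => ?_⟩
  · exact H.continuousOn hR hc (y := fun s t l => Y l s t) (fun l => (h2 l).1)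
      fun x hx l => (h1 l x.1 hx.1 x.2 hx.2).le
  · exact H.differentiableOn hR hc Metric.isOpen_ball (fun l => (h2 l).2 s hs)
      fun t ht l => (h1 l s hs t (Metric.ball_subset_closedBall ht)).le

end AnalyticFamily

theorem CurveOK.analyticAt {ν d : Fin 2 → ℕ} {h : MvPowerSeries (Fin 2) ℂ} (H : CurveOK n ν d h)
    {R : ℝ} (hR : 0 ≤ R) (hc : ConvOn R h) {y : Fin 2 → ℂ → ℂ} (hy : ∀ l, AnalyticAt ℂ (y l) 0)
    (h0 : ∀ l, (0 : ℝ) ^ ν l * ‖y l 0‖ ^ (n / d l) < R ^ n) :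
    AnalyticAt ℂ (fun t => evalCurve n ν d h t (fun l => y l t)) 0 := by
  have := (AnalyticFamily.evalCurve H hR hc (fun l => AnalyticFamily.of_analyticAt (hy l))
    h0).analyticAt
  obtain ⟨s, hs⟩ := this.exists
  exact hs

/-- The positive `n`-th root of `t`. -/
def rootn (n : ℕ) (t : ℝ) : ℂ := ((t ^ ((n : ℝ)⁻¹) : ℝ) : ℂ)

theorem rootn_pow {t : ℝ} (ht : 0 ≤ t) : rootn n t ^ n = t := by
  rw [rootn, ← Complex.ofReal_pow, Real.rpow_inv_natCast_pow ht (NeZero.ne n)]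

theorem eventually_norm_rootn_mul_le {r : ℝ} (hr : 0 ≤ r) {u : ℂ → ℂ} (hu : ContinuousAt u 0)
    {k : ℕ} (hu0 : (0 : ℝ) ^ k * ‖u 0‖ ^ n < r ^ n) :
    ∀ᶠ t : ℝ in 𝓝[>] 0, ‖rootn n t ^ k * u t‖ ≤ r := by
  have h1 : ContinuousAt (fun t : ℂ => ‖t‖ ^ k * ‖u t‖ ^ n) 0 := by fun_prop
  have h2 := tendsto_ofReal_nhdsGT.eventually (h1.eventually
    (gt_mem_nhds (show ‖(0 : ℂ)‖ ^ k * ‖u 0‖ ^ n < r ^ n by simpa using hu0)))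
  filter_upwards [h2, self_mem_nhdsWithin] with t h3 h4
  refine le_of_lt (lt_of_pow_lt_pow_left₀ n hr ?_)
  rw [norm_mul, mul_pow, norm_pow, ← pow_mul, mul_comm k n, pow_mul, ← norm_pow,
    rootn_pow (le_of_lt h4)]
  exact h3

/-- The leading coefficient of an analytic function. -/
theorem exists_tendsto_div_pow {e : ℂ → ℂ} (he : AnalyticAt ℂ e 0) {Q : ℕ}
    (h : (fun t : ℝ => e t) =O[𝓝[>] 0] fun t => t ^ (Q : ℝ)) :
    ∃ W : ℂ, Tendsto (fun t : ℝ => e t / (t : ℂ) ^ Q) (𝓝[>] 0) (𝓝 W) ∧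
      (fun t : ℝ => e t - W * (t : ℂ) ^ Q) =O[𝓝[>] 0] fun t => t ^ ((Q + 1 : ℕ) : ℝ) := by
  obtain ⟨f, hf, hev⟩ := (natCast_le_analyticOrderAt he).1
    (natCast_le_analyticOrderAt_of_isBigO he le_rfl h (lt_add_one _))
  refine ⟨f 0, ?_, ?_⟩
  · refine (hf.continuousAt.tendsto.comp tendsto_ofReal_nhdsGT).congr' ?_
    filter_upwards [tendsto_ofReal_nhdsGT.eventually hev, self_mem_nhdsWithin] with t h2 h3
    have h4 : (t : ℂ) ^ Q ≠ 0 := pow_ne_zero _ (by exact_mod_cast (ne_of_gt h3))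
    rw [h2, sub_zero, smul_eq_mul, mul_div_cancel_left₀ _ h4, Function.comp_apply]
  · have h2 : (fun t : ℂ => f t - f 0) =O[𝓝 0] fun t => t := by
      simpa using hf.differentiableAt.isBigO_sub
    have h3 := (isBigO_refl (fun t : ℂ => t ^ Q) (𝓝 0)).mul h2
    refine isBigO_real_of_pow (g := fun t => e t - f 0 * t ^ Q) ?_ le_rfl le_rfl
    refine h3.congr' ?_ (Eventually.of_forall fun t => (pow_succ t Q).symm)
    filter_upwards [hev] with t ht
    rw [ht, sub_zero, smul_eq_mul]
    ring

/-- Besides the existence of the coefficient of `t ^ Q`, this gives an explicit bound for it, which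
later shows that corrections tend to zero with the parameter `s`. -/
theorem exists_leading_coeff {e : ℂ → ℂ} (he : AnalyticAt ℂ e 0) {Q : ℕ} {b : ℝ → ℝ} {b₀ : ℝ}
    (hb : Tendsto b (𝓝[>] 0) (𝓝 b₀)) (h : ∀ᶠ t : ℝ in 𝓝[>] 0, ‖e t‖ ≤ b t * t ^ Q) :
    ∃ W : ℂ, ‖W‖ ≤ b₀ ∧ (fun t : ℝ => e t - W * (t : ℂ) ^ Q) =O[𝓝[>] 0]
      fun t => t ^ ((Q + 1 : ℕ) : ℝ) := by
  have h1 : (fun t : ℝ => e t) =O[𝓝[>] 0] fun t => t ^ (Q : ℝ) := by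
    have h2 := (hb.isBigO_one ℝ).mul (isBigO_refl (fun t : ℝ => t ^ Q) (𝓝[>] 0))
    refine (IsBigO.of_bound 1 ?_).trans (h2.congr_right fun t => by rw [one_mul, Real.rpow_natCast])
    filter_upwards [h] with t ht
    rw [one_mul]
    exact ht.trans (le_abs_self _)
  obtain ⟨W, hW1, hW2⟩ := exists_tendsto_div_pow he h1
  refine ⟨W, le_of_tendsto_of_tendsto hW1.norm hb ?_, hW2⟩
  filter_upwards [h, self_mem_nhdsWithin] with t h3 h4
  rw [norm_div, norm_pow, Complex.norm_real, Real.norm_of_nonneg (le_of_lt h4),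
    div_le_iff₀ (pow_pos h4 Q)]
  exact h3

/-- For an analytic function, `o(t ^ Q)` means that the coefficient of `t ^ Q` vanishes too. -/
theorem isBigO_pow_succ_of_isLittleO {e : ℂ → ℂ} (he : AnalyticAt ℂ e 0) {Q : ℕ}
    (h : (fun t : ℝ => e t) =o[𝓝[>] 0] fun t => t ^ (Q : ℝ)) :
    (fun t : ℝ => e t) =O[𝓝[>] 0] fun t => t ^ ((Q + 1 : ℕ) : ℝ) := by
  have h1 : (fun t : ℝ => e t) =o[𝓝[>] 0] fun t => (t : ℂ) ^ Q := by
    refine h.trans_isBigO (IsBigO.of_bound 1 ?_)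
    filter_upwards with t
    rw [one_mul, Real.rpow_natCast, norm_pow, norm_pow, Complex.norm_real]
  obtain ⟨W, hW1, hW2⟩ := exists_tendsto_div_pow he h.isBigO
  obtain rfl := tendsto_nhds_unique hW1 h1.tendsto_div_nhds_zero
  simpa using hW2

namespace QOSurface
variable (X : QOSurface n) {R r ε : ℝ} {m J j : ℕ} {ν : Fin 2 → ℕ}

/-- Duality of `N_J` and `M_J`: along a curve of order `ν` the monomials with exponents in `M_J`
have integral order in `t`. -/
theorem dvd_sum_of_memN (h : X.MemN J ν) {a : Fin 2 →₀ ℕ} (ha : vec n a ∈ latM X.lam J) :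
    n ∣ ∑ i, ν i * a i := by
  obtain ⟨z, hz⟩ := h _ ha
  have hn : (n : ℚ) ≠ 0 := cast_ne_zero_of_neZero
  have h1 : ((∑ i, ν i * a i : ℕ) : ℚ) = n * z := by
    rw [← hz, pair, Finset.mul_sum]
    push_cast
    refine Finset.sum_congr rfl fun i _ => ?_
    rw [vec]
    field_simp
  rw [← Int.natCast_dvd_natCast]
  exact ⟨z, by exact_mod_cast h1⟩

theorem exists_nat_pair_eq (h : X.MemN J ν) (hJ : J ≤ X.g) {k : ℕ} (hk1 : 1 ≤ k) (hk : k ≤ J) :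
    ∃ Q : ℕ, pair ν (X.lam k) = Q := by
  obtain ⟨z, hz⟩ := h.mono hk _ (lam_mem_latM hk1)
  have h1 : 0 ≤ pair ν (X.lam k) := Finset.sum_nonneg fun i _ =>
    mul_nonneg (by positivity) (X.charExponents.nonneg (hk.trans hJ) i)
  rw [hz] at h1
  obtain ⟨Q, rfl⟩ := Int.eq_ofNat_of_zero_le (by exact_mod_cast h1 : 0 ≤ z)
  exact ⟨Q, by simpa using hz⟩

theorem curveOK_one_sub (h : X.MemN J ν) (hJ : J ≤ X.g) {k : ℕ} (hk : k ≤ J) :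
    CurveOK n ν (fun _ => 1) ((X.trunc J).toSeries - (X.trunc k).toSeries) :=
  ⟨fun _ => one_dvd n, fun _ ha => X.dvd_sum_of_memN h
    (X.vec_mem_latM_trunc hJ (X.coeff_trunc_sub hk ha).2.2), fun _ _ _ => one_dvd _⟩

theorem prod_rootn_pow {A : Fin 2 →₀ ℕ} {Q : ℕ} (hQ : pair ν (vec n A) = Q) {t : ℝ} (ht : 0 ≤ t)
    (u : Fin 2 → ℂ) :
    ∏ l, (rootn n t ^ ν l * u l) ^ A l = (t : ℂ) ^ Q * ∏ l, u l ^ A l := by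
  have h1 : ∑ l, ν l * A l = n * Q := by
    have hn : (n : ℚ) ≠ 0 := cast_ne_zero_of_neZero
    have : ((∑ l, ν l * A l : ℕ) : ℚ) = n * Q := by
      rw [← hQ, pair, Finset.mul_sum]
      push_cast
      refine Finset.sum_congr rfl fun i _ => ?_
      rw [vec]
      field_simp
    exact_mod_cast this
  simp only [mul_pow, Finset.prod_mul_distrib, ← pow_mul]
  rw [Finset.prod_pow_eq_pow_sum, h1, pow_mul, rootn_pow ht]

/-- The first terms of `ζ_J - ζ_k` along a curve can be removed by a correction whose size is
controlled by the first monomial of that difference. -/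
theorem exists_correction (hG : X.Good R r) (hN : X.MemN J ν) (hJ : J ≤ X.g) {k : ℕ} (hk : k < J)
    {A : Fin 2 →₀ ℕ} (hA : vec n A = X.lam (k + 1)) {Q : ℕ} (hQ : pair ν (X.lam (k + 1)) = Q) :
    ∃ C : ℝ, ∀ u : Fin 2 → ℂ → ℂ, (∀ l, AnalyticAt ℂ (u l) 0) →
      (∀ l, (0 : ℝ) ^ ν l * ‖u l 0‖ ^ n < r ^ n) →
      ∃ W : ℂ, ‖W‖ ≤ C * ∏ l, ‖u l 0‖ ^ A l ∧
        (fun t : ℝ => evalSeries (X.trunc J).toSeries (fun l => rootn n t ^ ν l * u l t) -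
          evalSeries (X.trunc k).toSeries (fun l => rootn n t ^ ν l * u l t) - W * (t : ℂ) ^ Q)
          =O[𝓝[>] 0] fun t => t ^ ((Q + 1 : ℕ) : ℝ) := by
  have hc : ConvOn R ((X.trunc J).toSeries - (X.trunc k).toSeries) :=
    (hG.conv_trunc J).sub hG.R_pos.le (hG.conv_trunc k)
  obtain ⟨C, hC0, hC⟩ := (hc.shift hG.R_pos A).exists_bound
  have hok := X.curveOK_one_sub hN hJ hk.le
  refine ⟨C, fun u hu hu0 => ?_⟩
  have hlt : ∀ l, (0 : ℝ) ^ ν l * ‖u l 0‖ ^ (n / 1) < R ^ n := fun l => by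
    rw [Nat.div_one]
    exact (hu0 l).trans (pow_lt_pow_left₀ hG.lt hG.pos.le (NeZero.ne n))
  have hU : ∀ᶠ t : ℝ in 𝓝[>] 0, ∀ l, ‖rootn n t ^ ν l * u l t‖ ≤ r := eventually_all.2 fun l =>
    eventually_norm_rootn_mul_le hG.pos.le (hu l).continuousAt (hu0 l)
  -- After extracting `u ^ A` from `ζ_J - ζ_k` the remaining factor is bounded by `C`, uniformly in
  -- the curve; the monomial itself contributes exactly `t ^ Q ∏ u_l ^ A_l`.
  obtain ⟨W, hW1, hW2⟩ := exists_leading_coeff (hok.analyticAt hG.R_pos.le hc hu hlt) (Q := Q)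
    (b := fun t : ℝ => C * ∏ l, ‖u l t‖ ^ A l) (b₀ := C * ∏ l, ‖u l 0‖ ^ A l) (by
      refine tendsto_const_nhds.mul (tendsto_finsetProd _ fun l _ => ?_)
      exact (((hu l).continuousAt.tendsto.comp tendsto_ofReal_nhdsGT).norm).pow _) (by
      filter_upwards [hU, self_mem_nhdsWithin] with t h1 h2
      rw [hok.evalCurve_eq (rootn_pow (le_of_lt h2)) (fun l => pow_one (u l t)),
        evalSeries_eq_mul_shift (A := A), prod_rootn_pow (hA ▸ hQ) (le_of_lt h2), norm_mul, norm_mul,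
        norm_pow, Complex.norm_real, Real.norm_of_nonneg (le_of_lt h2), norm_prod]
      · have h3 := hC _ fun l => (h1 l).trans hG.lt.le
        have h4 : (0 : ℝ) ≤ t ^ Q * ∏ l, ‖u l t ^ A l‖ :=
          mul_nonneg (pow_nonneg (le_of_lt h2) _) (Finset.prod_nonneg fun _ _ => norm_nonneg _)
        refine (mul_le_mul_of_nonneg_left h3 h4).trans_eq ?_
        simp only [norm_pow]
        ring
      · intro a ha
        rw [← vec_le_vec (n := n), hA]
        exact (X.coeff_trunc_sub hk.le ha).2.1)
  refine ⟨W, hW1, hW2.congr' ?_ EventuallyEq.rfl⟩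
  filter_upwards [hU, self_mem_nhdsWithin] with t h1 h2
  rw [hok.evalCurve_eq (rootn_pow (le_of_lt h2)) (fun l => pow_one (u l t)),
    evalSeries_sub (hG.conv_trunc J) (hG.conv_trunc k) fun l => (h1 l).trans hG.lt.le]

end QOSurface

/-! ### Limits of families of jets of order `ν` -/

namespace QOSurface
variable (X : QOSurface n) {R r ε : ℝ} {m J j : ℕ} {ν : Fin 2 → ℕ}

/-- A jet is in the closure of `D_m^ν` if it is the limit of a family of jets, obtained by moving
only the coordinates `x_i` and `z`, that approximate `ζ_k` sufficiently well. -/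
theorem mem_C_of_family (hG : X.Good R r) (hε : ε ≤ r ^ n) (L : X.Levels m ν J j)
    (hν : ∀ l, ν l ≤ m) {i : Fin 2} {γ : Jet m} (hγ : γ ∈ jetDomain ε m)
    {g v : Fin 2 → ℂ → ℂ} (hg : ∀ l, l ≠ i → AnalyticAt ℂ (g l) 0)
    (hγg : ∀ l, l ≠ i → ∀ᶠ t in 𝓝 0, γ.curve t l.castSucc = t ^ ν l * g l t)
    (hv : ∀ l, l ≠ i → AnalyticAt ℂ (v l) 0) (hv0 : ∀ l, l ≠ i → v l 0 ≠ 0)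
    (hvg : ∀ l, l ≠ i → ∀ᶠ t in 𝓝 0, v l t ^ n = g l t)
    {G Z : ℝ → ℂ → ℂ} (hGf : AnalyticFamily G) (hZf : AnalyticFamily Z)
    (hG0 : ∀ᶠ t in 𝓝 0, γ.curve t i.castSucc = t ^ ν i * G 0 t)
    (hZ0 : ∀ᶠ t in 𝓝 0, γ.curve t 2 = Z 0 t) (hG00 : G 0 0 = 0) {k : ℕ} (hk : k ≤ J)
    (hkJ : k < J → j ≤ k ∧ X.lam (k + 1) i ≠ 0) {κ : ℝ} (h1 : k = J → ((X.cJ m ν J : ℚ) : ℝ) ≤ κ)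
    (h2 : k < J → ((pair ν (X.lam J) : ℚ) : ℝ) + 1 ≤ κ)
    (H : ∀ᶠ s in 𝓝[>] 0, G s 0 ≠ 0 ∧ ∃ w : ℂ → ℂ, AnalyticAt ℂ w 0 ∧
      (∀ᶠ t in 𝓝 0, w t ^ n = G s t) ∧
      (fun t : ℝ => Z s t - evalSeries (X.trunc k).toSeries
        (fun l => rootn n t ^ ν l * Function.update v i w l t)) =O[𝓝[>] 0] fun t => t ^ κ) :
    γ ∈ X.C ε m ν := by
  have hdom : ∀ l : Fin 2, ‖γ l.castSucc 0‖ < ε := fun l => by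
    fin_cases l
    exacts [hγ.1, hγ.2]
  have hcurve0 : ∀ l, γ.curve 0 l = γ l 0 := fun l => by
    simpa using jetOf_curve γ l 0
  have hnorm : ∀ᶠ s in 𝓝[>] 0, ‖(0 : ℂ) ^ ν i * G s 0‖ < ε := by
    have h3 : Tendsto (fun s => ‖(0 : ℂ) ^ ν i * G s 0‖) (𝓝[>] 0) (𝓝 ‖(0 : ℂ) ^ ν i * G 0 0‖) :=
      (hGf.tendsto_zero.const_mul _).norm
    refine h3.eventually (gt_mem_nhds ?_)
    rw [← hG0.self_of_nhds, hcurve0]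
    exact hdom i
  have hother : ∀ l, l ≠ i → ‖(0 : ℂ) ^ ν l * g l 0‖ < ε := fun l hl => by
    rw [← (hγg l hl).self_of_nhds, hcurve0]
    exact hdom l
  -- correction of the last coordinate
  have hcorr : ∃ (W : ℝ → ℂ) (Q : ℕ), Tendsto W (𝓝[>] 0) (𝓝 0) ∧ ∀ᶠ s in 𝓝[>] 0, G s 0 ≠ 0 ∧
      ∃ w : ℂ → ℂ, AnalyticAt ℂ w 0 ∧ (∀ᶠ t in 𝓝 0, w t ^ n = G s t) ∧
      (fun t : ℝ => Z s t + W s * (t : ℂ) ^ Q - evalSeries (X.trunc J).toSeries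
        (fun l => rootn n t ^ ν l * Function.update v i w l t)) =O[𝓝[>] 0]
          fun t => t ^ ((X.cJ m ν J : ℚ) : ℝ) := by
    rcases hk.eq_or_lt with rfl | hlt
    · refine ⟨fun _ => 0, 0, tendsto_const_nhds, H.mono ?_⟩
      rintro s ⟨ha, w, hw1, hw2, hw3⟩
      refine ⟨ha, w, hw1, hw2, ?_⟩
      simp only [zero_mul, add_zero]
      exact hw3.trans (rpow_isBigO_rpow le_rfl (h1 rfl))
    · obtain ⟨hjk, hlam⟩ := hkJ hlt
      obtain ⟨A, hA⟩ := X.charExponents.exists_vec (hlt.trans_le L.le_g : k + 1 ≤ X.g)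
      obtain ⟨Q, hQ⟩ := X.exists_nat_pair_eq L.memN L.le_g (Nat.succ_le_succ k.zero_le) hlt
      have hQJ : pair ν (X.lam J) = Q := by rw [← L.pair_eq k hjk hlt, hQ]
      have hAi : A i ≠ 0 := fun h0 => hlam (by rw [← hA, vec, h0]; simp)
      obtain ⟨C, hC⟩ := X.exists_correction hG L.memN L.le_g hlt hA hQ
      set a : Fin 2 → ℝ := fun l => ‖v l 0‖ ^ A l with ha
      -- The coefficient `W` is bounded by a constant times `|w(0)| ^ A_i`, where `|w(0)| = |G s 0|
      -- ^ (1/n)`. Since `A_i > 0`, this tends to `0` with `s`.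
      have key : ∀ᶠ s in 𝓝[>] 0, ∃ W : ℂ, ‖W‖ ≤ C * ∏ l, (Function.update a i
          ((‖G s 0‖ ^ ((n : ℝ)⁻¹)) ^ A i)) l ∧ G s 0 ≠ 0 ∧
          ∃ w : ℂ → ℂ, AnalyticAt ℂ w 0 ∧ (∀ᶠ t in 𝓝 0, w t ^ n = G s t) ∧
          (fun t : ℝ => Z s t + W * (t : ℂ) ^ Q - evalSeries (X.trunc J).toSeries
            (fun l => rootn n t ^ ν l * Function.update v i w l t)) =O[𝓝[>] 0]
              fun t => t ^ ((X.cJ m ν J : ℚ) : ℝ) := by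
        filter_upwards [H, hnorm] with s ⟨hs1, w, hw1, hw2, hw3⟩ hs2
        have hw0 : w 0 ^ n = G s 0 := hw2.self_of_nhds
        obtain ⟨W, hW1, hW2⟩ := hC (Function.update v i w) (fun l => by
          rcases eq_or_ne l i with rfl | hl
          · simpa using hw1
          · simpa [hl] using hv l hl) (fun l => by
          refine lt_of_lt_of_le ?_ hε
          rw [← norm_pow]
          rcases eq_or_ne l i with rfl | hl
          · rw [Function.update_self, hw0]
            simpa using hs2
          · rw [Function.update_of_ne hl, (hvg l hl).self_of_nhds]
            simpa using hother l hl)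
        refine ⟨W, hW1.trans_eq ?_, hs1, w, hw1, hw2, ?_⟩
        · congr 1
          refine Finset.prod_congr rfl fun l _ => ?_
          rcases eq_or_ne l i with rfl | hl
          · rw [Function.update_self, Function.update_self, ← hw0, norm_pow,
              Real.pow_rpow_inv_natCast (norm_nonneg _) (NeZero.ne n)]
          · rw [Function.update_of_ne hl, Function.update_of_ne hl]
        -- As `c_J ≤ ⟨ν, λ_J⟩ + 1 = Q + 1`, removing the single term `t ^ Q` of `ζ_J - ζ_k` is
        -- enough.
        · have hle : ((X.cJ m ν J : ℚ) : ℝ) ≤ ((Q + 1 : ℕ) : ℝ) := by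
            have := L.cJ_le_add_one (hjk.trans_lt hlt)
            rw [hQJ] at this
            exact_mod_cast this
          have hle2 : ((X.cJ m ν J : ℚ) : ℝ) ≤ κ := by
            refine le_trans ?_ (h2 hlt)
            exact_mod_cast L.cJ_le_add_one (hjk.trans_lt hlt)
          have := (hw3.trans (rpow_isBigO_rpow le_rfl hle2)).sub
            (hW2.trans (rpow_isBigO_rpow le_rfl hle))
          exact this.congr_left fun t => by ring
      have hlim : Tendsto (fun s => C * ∏ l, (Function.update a i
          ((‖G s 0‖ ^ ((n : ℝ)⁻¹)) ^ A i)) l) (𝓝[>] 0) (𝓝 0) := by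
        have h3 : Tendsto (fun s => (‖G s 0‖ ^ ((n : ℝ)⁻¹)) ^ A i) (𝓝[>] 0) (𝓝 0) := by
          have h4 := hGf.tendsto_zero.norm
          rw [hG00, norm_zero] at h4
          have h5 := (h4.rpow_const (p := (n : ℝ)⁻¹) (Or.inr (by positivity))).pow (A i)
          rwa [Real.zero_rpow (inv_ne_zero (by exact_mod_cast NeZero.ne n)), zero_pow hAi] at h5
        have h4 : ∀ x : ℝ, ∏ l, Function.update a i x l = x * ∏ l ∈ Finset.univ.erase i, a l := by
          intro x
          rw [← Finset.mul_prod_erase _ _ (Finset.mem_univ i), Function.update_self]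
          congr 1
          refine Finset.prod_congr rfl fun l hl => ?_
          rw [Function.update_of_ne (Finset.ne_of_mem_erase hl)]
        simp only [h4]
        simpa using (h3.mul_const (∏ l ∈ Finset.univ.erase i, a l)).const_mul C
      choose! W hW using fun s (hs : ∃ W : ℂ, ‖W‖ ≤ C * ∏ l, (Function.update a i
          ((‖G s 0‖ ^ ((n : ℝ)⁻¹)) ^ A i)) l ∧ G s 0 ≠ 0 ∧
          ∃ w : ℂ → ℂ, AnalyticAt ℂ w 0 ∧ (∀ᶠ t in 𝓝 0, w t ^ n = G s t) ∧
          (fun t : ℝ => Z s t + W * (t : ℂ) ^ Q - evalSeries (X.trunc J).toSeries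
            (fun l => rootn n t ^ ν l * Function.update v i w l t)) =O[𝓝[>] 0]
              fun t => t ^ ((X.cJ m ν J : ℚ) : ℝ)) => hs
      exact ⟨W, Q, squeeze_zero_norm' (key.mono fun s hs => (hW s hs).1) hlim,
        key.mono fun s hs => (hW s hs).2⟩
  obtain ⟨W, Q, hW, Hs⟩ := hcorr
  -- The deformed curve: `x_i` and the corrected `z` move with `s`, and the other coordinate stays
  -- that of the given jet.
  set F : ℝ → Fin 3 → ℂ → ℂ := fun s => Fin.snoc (α := fun _ => ℂ → ℂ)
    (fun l t => if l = i then t ^ ν i * G s t else γ.curve t l.castSucc)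
    (fun t => Z s t + W s * t ^ Q) with hF
  have hF2 : ∀ s, F s 2 = fun t => Z s t + W s * t ^ Q := fun s => Fin.snoc_last _ _
  have hFi : ∀ s, F s i.castSucc = fun t => t ^ ν i * G s t := fun s => by
    rw [hF]; simp
  have hFl : ∀ s l, l ≠ i → F s l.castSucc = fun t => γ.curve t l.castSucc := fun s l hl => by
    rw [hF]; simp [hl]
  have hpowfam : AnalyticFamily fun s t => t ^ ν i * G s t :=
    (AnalyticFamily.of_analyticAt (f := fun t => t ^ ν i) (by fun_prop)).mul hGf
  refine mem_zariskiClosure_of_tendsto (l := 𝓝[>] (0 : ℝ)) (q := fun s => jetOf m (F s)) hγ ?_ ?_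
  · rw [tendsto_pi_nhds]
    intro l
    rw [tendsto_pi_nhds]
    intro k
    rw [← jetOf_curve γ l k]
    unfold jetOf
    refine Tendsto.div_const ?_ _
    induction l using Fin.lastCases with
    | last =>
      change Tendsto (fun s => iteratedDeriv k (F s 2) 0) _ _
      have h3 := (hZf.tendsto k).add (hW.mul_const (iteratedDeriv k (fun t : ℂ => t ^ Q) 0))
      rw [zero_mul, add_zero, ← Filter.EventuallyEq.iteratedDeriv_eq k hZ0] at h3
      refine h3.congr' ?_
      filter_upwards [hZf.analyticAt] with s hs
      rw [hF2, iteratedDeriv_fun_add hs.contDiffAt (by fun_prop), iteratedDeriv_const_mul_field]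
    | cast l =>
      rcases eq_or_ne l i with rfl | hl
      · simp only [hFi]
        rw [Filter.EventuallyEq.iteratedDeriv_eq k hG0]
        exact hpowfam.tendsto k
      · simp only [hFl _ l hl]
        exact tendsto_const_nhds
  · filter_upwards [Hs, hGf.analyticAt, hZf.analyticAt, hnorm] with s ⟨hs1, w, hw1, hw2, hw3⟩ hs2 hs3
      hs4
    have hU0 : ∀ l, ∀ᶠ t in 𝓝 (0 : ℂ), F s l.castSucc t =
        t ^ ν l * Function.update g i (G s) l t := fun l => by
      rcases eq_or_ne l i with rfl | hl
      · rw [hFi, Function.update_self]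
        exact Eventually.of_forall fun _ => rfl
      · rw [hFl _ _ hl, Function.update_of_ne hl]
        exact hγg l hl
    refine X.jetOf_mem_D hG hε L hν (h := Function.update g i (G s)) ?_ ?_ ?_ hU0 ?_
      (U := fun t l => rootn n t ^ ν l * Function.update v i w l t) ?_ ?_
    · intro l
      induction l using Fin.lastCases with
      | last =>
        change AnalyticAt ℂ (F s 2) 0
        rw [hF2]
        fun_prop
      | cast l =>
        rcases eq_or_ne l i with rfl | hl
        · rw [hFi]
          fun_prop
        · rw [hFl _ _ hl]
          exact analyticAt_curve _ _ _
    · intro l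
      rcases eq_or_ne l i with rfl | hl
      · simpa using hs2
      · simpa [hl] using hg l hl
    · intro l
      rcases eq_or_ne l i with rfl | hl
      · simpa using hs1
      · rw [Function.update_of_ne hl, ← (hvg l hl).self_of_nhds]
        exact pow_ne_zero _ (hv0 l hl)
    · intro l
      rcases eq_or_ne l i with rfl | hl
      · rw [hFi]; exact hs4
      · rw [hFl _ _ hl]
        exact (congrArg norm (hcurve0 _)).trans_lt (hdom l)
    · refine eventually_all.2 fun l => ?_
      filter_upwards [tendsto_ofReal_nhdsGT.eventually (hU0 l), self_mem_nhdsWithin,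
        (show ∀ᶠ t : ℝ in 𝓝[>] 0, Function.update v i w l t ^ n = Function.update g i (G s) l t by
          refine tendsto_ofReal_nhdsGT.eventually (p := fun t : ℂ => Function.update v i w l t ^ n =
            Function.update g i (G s) l t) ?_
          rcases eq_or_ne l i with rfl | hl
          · simpa using hw2
          · simpa [hl] using hvg l hl)] with t h3 h4 h5
      rw [h3, mul_pow, ← pow_mul, mul_comm (ν l), pow_mul, rootn_pow (le_of_lt h4), h5]
    · simp only [hF2]
      exact hw3

end QOSurface

/-! ### Evaluation along curves, as a function of one coordinate -/

/-- The value of `h` at `x_l = t ^ ν_l * v_l ^ n`, for `l ≠ i`, and `x_i = t ^ ν_i * y ^ (n / d)`. -/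
def curveEval (n : ℕ) (ν : Fin 2 → ℕ) (i : Fin 2) (d : ℕ) (v : Fin 2 → ℂ → ℂ)
    (h : MvPowerSeries (Fin 2) ℂ) (y t : ℂ) : ℂ :=
  evalCurve n ν (Function.update (fun _ => 1) i d) h t
    (fun l => Function.update v i (fun _ => y) l t)

/-- The branch `u_i = t ^ (ν_i / n) * w`, `u_l = t ^ (ν_l / n) * v_l` for `l ≠ i`. -/
def branchOf (n : ℕ) (ν : Fin 2 → ℕ) (i : Fin 2) (v : Fin 2 → ℂ → ℂ) (w : ℂ → ℂ) (t : ℝ) :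
    Fin 2 → ℂ := fun l => rootn n t ^ ν l * Function.update v i w l t

section
variable {ν : Fin 2 → ℕ} {i : Fin 2} {d : ℕ} {v : Fin 2 → ℂ → ℂ} {h : MvPowerSeries (Fin 2) ℂ}

theorem curveEval_eq (H : CurveOK n ν (Function.update (fun _ => 1) i d) h) {t : ℝ} (ht : 0 ≤ t)
    {w : ℂ → ℂ} {y : ℂ} (hw : w t ^ d = y) :
    curveEval n ν i d v h y t = evalSeries h (branchOf n ν i v w t) := by
  refine H.evalCurve_eq (rootn_pow ht) fun l => ?_
  rcases eq_or_ne l i with rfl | hl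
  · simpa using hw
  · simp [hl]

theorem analyticFamily_curveEval (H : CurveOK n ν (Function.update (fun _ => 1) i d) h) {R : ℝ}
    (hR : 0 ≤ R) (hc : ConvOn R h) (hv : ∀ l, l ≠ i → AnalyticAt ℂ (v l) 0)
    (hv0 : ∀ l, l ≠ i → (0 : ℝ) ^ ν l * ‖v l 0‖ ^ n < R ^ n) {Y : ℝ → ℂ → ℂ}
    (hY : AnalyticFamily Y) (hY0 : (0 : ℝ) ^ ν i * ‖Y 0 0‖ ^ (n / d) < R ^ n) :
    AnalyticFamily fun s t => curveEval n ν i d v h (Y s t) t := by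
  have h1 := AnalyticFamily.evalCurve H hR hc
    (Y := Function.update (fun l _ t => v l t) i Y) (fun l => by
      rcases eq_or_ne l i with rfl | hl
      · simpa using hY
      · simpa [hl] using AnalyticFamily.of_analyticAt (hv l hl)) (fun l => by
      rcases eq_or_ne l i with rfl | hl
      · simpa using hY0
      · simpa [hl] using hv0 l hl)
  convert h1 using 3 with s t
  unfold curveEval
  congr 1
  ext l
  rcases eq_or_ne l i with rfl | hl
  · simp
  · simp [hl]

theorem analyticAt_curveEval (H : CurveOK n ν (Function.update (fun _ => 1) i d) h) {R : ℝ}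
    (hR : 0 ≤ R) (hc : ConvOn R h) (hv : ∀ l, l ≠ i → AnalyticAt ℂ (v l) 0)
    (hv0 : ∀ l, l ≠ i → (0 : ℝ) ^ ν l * ‖v l 0‖ ^ n < R ^ n) {y : ℂ → ℂ}
    (hy : AnalyticAt ℂ y 0) (hy0 : (0 : ℝ) ^ ν i * ‖y 0‖ ^ (n / d) < R ^ n) :
    AnalyticAt ℂ (fun t => curveEval n ν i d v h (y t) t) 0 := by
  obtain ⟨s, hs⟩ := (analyticFamily_curveEval H hR hc hv hv0
    (AnalyticFamily.of_analyticAt hy) hy0).analyticAt.exists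
  exact hs

end

/-! ### Jets of order `ν'` written on a closest branch, and directions absent from `λ_j` -/

namespace QOSurface
variable (X : QOSurface n) {R r ε : ℝ} {m J j : ℕ} {ν ν' : Fin 2 → ℕ} {i : Fin 2}

/-- A jet of the surface with `ord x_l = ν'_l`, where `ν'` and `ν` differ in the coordinate `i`
only, written in terms of a branch of the coordinates for which `ζ` is closest to the jet. -/
structure JetBranch (R r : ℝ) {m : ℕ} (γ : Jet m) (ν ν' : Fin 2 → ℕ) (i : Fin 2)
    (g v : Fin 2 → ℂ → ℂ) (u : ℂ → ℂ) (l : Filter ℝ) : Prop where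
  good : X.Good R r
  lt : ν i < ν' i
  eq : ∀ l, l ≠ i → ν' l = ν l
  analytic : ∀ l, AnalyticAt ℂ (g l) 0
  curve_eq : ∀ l t, γ.curve t l.castSucc = t ^ ν l * g l t
  norm_lt : ∀ l : Fin 2, ‖γ.curve 0 l.castSucc‖ < r ^ n
  zero : g i 0 = 0
  analytic_v : ∀ l, l ≠ i → AnalyticAt ℂ (v l) 0
  v_ne_zero : ∀ l, l ≠ i → v l 0 ≠ 0
  v_pow : ∀ l, l ≠ i → ∀ᶠ t in 𝓝 0, v l t ^ n = g l t
  u_pow : ∀ t, u t ^ n = g i t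
  neBot : l.NeBot
  le : l ≤ 𝓝[>] 0
  branch : Branch n r ν' (branchOf n ν i v u)
  closest : ∀ ω : Rots n, ∀ᶠ t : ℝ in l,
    ‖γ.curve t 2 - evalSeries X.ζ.toSeries (branchOf n ν i v u t)‖ ≤
      ‖γ.curve t 2 - evalSeries X.ζ.toSeries (ω.val * branchOf n ν i v u t)‖
  prod : ∀ k ≤ X.g, (fun t : ℝ => ∏ ω ∈ X.K k, (γ.curve t 2 -
    evalSeries X.ζ.toSeries (ω.val * branchOf n ν i v u t))) =O[l]
      fun t => t ^ (((X.K X.g).card * (m + 1) - X.S ν' k : ℚ) : ℝ)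

theorem exists_factor_of_mem_D {γ : Jet m} (hγ : γ ∈ X.D ε m ν') (l : Fin 2) :
    ∃ h : ℂ → ℂ, (∀ t, AnalyticAt ℂ h t) ∧ h 0 ≠ 0 ∧ ∀ t, γ.curve t l.castSucc = t ^ ν' l * h t := by
  obtain ⟨h1, k₀, hk₀, h2⟩ := hγ.2 l
  refine ⟨fun t => ∑ k : Fin (m + 1), γ l.castSucc k * t ^ ((k : ℕ) - ν' l), fun t => by fun_prop,
    ?_, fun t => ?_⟩
  · beta_reduce
    rw [Finset.sum_eq_single k₀]
    · simpa [hk₀] using h2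
    · intro k _ hk
      rcases lt_trichotomy (k : ℕ) (ν' l) with h | h | h
      · rw [h1 k h, zero_mul]
      · exact absurd (Fin.ext (h.trans hk₀.symm)) hk
      · rw [zero_pow (by omega), mul_zero]
    · simp
  · rw [Jet.curve, Finset.mul_sum]
    refine Finset.sum_congr rfl fun k _ => ?_
    rcases lt_or_ge (k : ℕ) (ν' l) with h | h
    · rw [h1 k h]; ring
    · rw [mul_left_comm, ← pow_add, Nat.add_sub_cancel' h]

/-- Only `g i` vanishes at `0`, by the strict inequality in the direction `i`. The coordinates are
rotated by the `θ` of the closest conjugate, so that afterwards `ζ` itself is closest. -/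
theorem exists_jetBranch (hG : X.Good R r) (hε : ε ≤ r ^ n) {γ : Jet m} (hγ : γ ∈ X.D ε m ν')
    (hi : ν i < ν' i) (hl : ∀ l, l ≠ i → ν' l = ν l) :
    ∃ g v u l, X.JetBranch R r γ ν ν' i g v u l := by
  choose h hh hh0 hcurve using fun l => X.exists_factor_of_mem_D hγ l
  have hle : ∀ l, ν l ≤ ν' l := fun l => by
    rcases eq_or_ne l i with rfl | h
    · exact hi.le
    · exact (hl l h).ge
  set g : Fin 2 → ℂ → ℂ := fun l t => t ^ (ν' l - ν l) * h l t with hg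
  have hga : ∀ l, AnalyticAt ℂ (g l) 0 := fun l => by
    have := hh l 0
    fun_prop
  have hgc : ∀ l t, γ.curve t l.castSucc = t ^ ν l * g l t := fun l t => by
    rw [hcurve, hg, ← mul_assoc, ← pow_add, Nat.add_sub_cancel' (hle l)]
  have hg0 : ∀ l, l ≠ i → g l 0 ≠ 0 := fun l h => by
    simpa [hg, hl l h] using hh0 l
  have hnorm : ∀ l : Fin 2, ‖γ.curve 0 l.castSucc‖ < r ^ n := fun l => by
    have h1 : γ.curve 0 l.castSucc = γ l.castSucc 0 := by simpa using jetOf_curve γ l.castSucc 0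
    rw [h1]
    refine lt_of_lt_of_le ?_ hε
    fin_cases l
    exacts [hγ.1.1.1, hγ.1.1.2]
  have hroot : ∀ l, ∃ v : ℂ → ℂ, l ≠ i → AnalyticAt ℂ v 0 ∧ v 0 ≠ 0 ∧
      ∀ᶠ t in 𝓝 0, v t ^ n = g l t := fun l => by
    by_cases h : l = i
    · exact ⟨0, fun h' => absurd h h'⟩
    obtain ⟨w, hw⟩ := IsAlgClosed.exists_pow_nat_eq (g l 0) (NeZero.pos n)
    obtain ⟨v, hv1, hv2, hv3⟩ := exists_analytic_root (hga l) (NeZero.ne n) hw (hg0 l h)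
    refine ⟨v, fun _ => ⟨hv1, ?_, hv3⟩⟩
    rintro h0
    rw [← hv2, h0, zero_pow (NeZero.ne n)] at hw
    exact hg0 l h hw.symm
  choose v hv using hroot
  -- As `g i` vanishes at `0`, it need not have an analytic `n`-th root; roots are chosen point by
  -- point.
  choose u hu using fun t => IsAlgClosed.exists_pow_nat_eq (g i t) (NeZero.pos n)
  have hUpow : ∀ᶠ t : ℝ in 𝓝[>] 0, ∀ l, branchOf n ν i v u t l ^ n = γ.curve t l.castSucc := by
    refine eventually_all.2 fun l => ?_
    have h1 : ∀ᶠ t in 𝓝 (0 : ℂ), Function.update v i u l t ^ n = g l t := by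
      rcases eq_or_ne l i with rfl | h
      · simpa using Eventually.of_forall hu
      · simpa [h] using (hv l h).2.2
    filter_upwards [tendsto_ofReal_nhdsGT.eventually h1, self_mem_nhdsWithin] with t h2 h3
    rw [branchOf, mul_pow, ← pow_mul, mul_comm (ν l), pow_mul, rootn_pow (le_of_lt h3), h2, hgc]
  have hbr : Branch n r ν' (branchOf n ν i v u) := by
    refine branch_of_pow hG.pos.le (x := fun l t => γ.curve t l.castSucc) (h := h) hUpow
      (fun l => Eventually.of_forall (hcurve l)) (fun l => (hh l 0).continuousAt) hh0 hnorm
  have hf := ((X.mem_jets_iff hG hε).1 hγ.1).2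
  obtain ⟨l, θ, hl1, hl2, hl3, hl4⟩ := X.exists_closest_conjugate hG hbr
    (p := fun t => γ.curve t) (hUpow.mono fun t ht k => (ht k).symm) hf
  have hrot : ∀ t, branchOf n ν i (fun l t => θ.val l * v l t) (fun t => θ.val i * u t) t =
      θ.val * branchOf n ν i v u t := fun t => by
    ext l
    rw [Pi.mul_apply, branchOf, branchOf]
    rcases eq_or_ne l i with rfl | h
    · simp only [Function.update_self]; ring
    · simp only [Function.update_of_ne h]; ring
  refine ⟨g, fun l t => θ.val l * v l t, fun t => θ.val i * u t, l, hG, hi, hl, hga, hgc, hnorm, ?_,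
    fun l h => analyticAt_const.mul (hv l h).1, fun l h => mul_ne_zero (θ.val_ne_zero l) (hv l h).2.1,
    fun l h => (hv l h).2.2.mono fun t ht => ?_, fun t => ?_, hl1, hl2, ?_, ?_, ?_⟩
  · simp [hg, Nat.sub_ne_zero_of_lt hi]
  · rw [mul_pow, θ.val_pow, one_mul, ht]
  · rw [mul_pow, θ.val_pow, one_mul, hu]
  · simp only [funext hrot]
    exact hbr.rot θ
  · simpa only [hrot] using hl3
  · intro k hk
    simp only [hrot]
    refine (hl4 k hk).congr_right fun t => ?_
    push_cast
    rfl

namespace JetBranch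
variable {X} {γ : Jet m} {g v : Fin 2 → ℂ → ℂ} {u : ℂ → ℂ} {l : Filter ℝ}

theorem pair_eq (B : X.JetBranch R r γ ν ν' i g v u l)
    {w : Fin 2 → ℚ} (hw : w i = 0) : pair ν' w = pair ν w := by
  refine Finset.sum_congr rfl fun k _ => ?_
  rcases eq_or_ne k i with rfl | h
  · rw [hw, mul_zero, mul_zero]
  · rw [B.eq k h]

theorem pair_le (B : X.JetBranch R r γ ν ν' i g v u l)
    {w : Fin 2 → ℚ} (hw : 0 ≤ w) : pair ν w ≤ pair ν' w := by
  refine Finset.sum_le_sum fun k _ => mul_le_mul_of_nonneg_right ?_ (hw k)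
  rcases eq_or_ne k i with rfl | h
  · exact_mod_cast B.lt.le
  · rw [B.eq k h]

theorem pair_lt (B : X.JetBranch R r γ ν ν' i g v u l)
    {w : Fin 2 → ℚ} (hw : 0 ≤ w) (hwi : w i ≠ 0) : pair ν w < pair ν' w := by
  refine Finset.sum_lt_sum (fun k _ => mul_le_mul_of_nonneg_right ?_ (hw k)) ⟨i, Finset.mem_univ _,
    mul_lt_mul_of_pos_right (by exact_mod_cast B.lt) (lt_of_le_of_ne (hw i) hwi.symm)⟩
  rcases eq_or_ne k i with rfl | h
  · exact_mod_cast B.lt.le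
  · rw [B.eq k h]

theorem S_eq (B : X.JetBranch R r γ ν ν' i g v u l)
    {k : ℕ} (hk : k ≤ X.g) (h0 : X.lam k i = 0) : X.S ν' k = X.S ν k := by
  induction k with
  | zero => rfl
  | succ k ih =>
    rw [S, S, ih (k.le_succ.trans hk) (X.charExponents.coord_eq_zero k.le_succ hk h0),
      B.pair_eq h0]

theorem v_norm_lt' (B : X.JetBranch R r γ ν ν' i g v u l) (k : Fin 2) (hk : k ≠ i) :
    (0 : ℝ) ^ ν k * ‖v k 0‖ ^ n < r ^ n := by
  have h1 := B.norm_lt k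
  rw [B.curve_eq, ← (B.v_pow k hk).self_of_nhds] at h1
  simpa only [norm_mul, norm_pow, norm_zero] using h1

theorem v_norm_lt (B : X.JetBranch R r γ ν ν' i g v u l) (k : Fin 2) (hk : k ≠ i) :
    (0 : ℝ) ^ ν k * ‖v k 0‖ ^ n < R ^ n :=
  (B.v_norm_lt' k hk).trans (pow_lt_pow_left₀ B.good.lt B.good.pos.le (NeZero.ne n))

theorem zero_norm_lt (B : X.JetBranch R r γ ν ν' i g v u l)
    {k : ℕ} (hk : k ≠ 0) : (0 : ℝ) ^ ν i * ‖(0 : ℂ)‖ ^ k < R ^ n := by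
  rw [norm_zero, zero_pow hk, mul_zero]
  exact pow_pos B.good.R_pos n

/-- The last coordinate of the jet is close to `ζ`. -/
theorem sub_isBigO (B : X.JetBranch R r γ ν ν' i g v u l)
    {k : ℕ} (hk : k ≤ X.g) (h0 : X.lam k i = 0) :
    (fun t : ℝ => γ.curve t 2 - evalSeries X.ζ.toSeries (branchOf n ν i v u t)) =O[l]
      fun t => t ^ ((X.cJ m ν k : ℚ) : ℝ) := by
  -- The jet has order `ν'`, but the exponents `λ_1, …, λ_k` do not see the direction `i`. So `S_k`,
  -- and with it `c_k`, may be computed from `ν`.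
  refine X.isBigO_of_prod_K B.le B.closest ((B.prod k hk).congr_right fun t => ?_)
  rw [B.S_eq hk h0, ← X.card_mul_cJ]
  push_cast
  rfl

theorem sub_trunc_isBigO (B : X.JetBranch R r γ ν ν' i g v u l)
    {k : ℕ} (hk : k ≤ X.g) (h0 : X.lam k i = 0) {κ : ℝ}
    (h1 : κ ≤ ((X.cJ m ν k : ℚ) : ℝ))
    (h2 : k < X.g → κ ≤ ((pair ν' (X.lam (k + 1)) : ℚ) : ℝ)) :
    (fun t : ℝ => γ.curve t 2 - evalSeries (X.trunc k).toSeries (branchOf n ν i v u t)) =O[l]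
      fun t => t ^ κ := by
  have h3 := (B.sub_isBigO hk h0).trans (rpow_isBigO_rpow B.le h1)
  rcases hk.eq_or_lt with rfl | hlt
  · rwa [trunc_g]
  · have h4 := ((X.trunc_g_sub_isBigO B.good B.branch hlt).mono B.le).trans
      (rpow_isBigO_rpow B.le (h2 hlt))
    exact (h3.add h4).congr_left fun t => by ring

/-- If `λ_1, …, λ_k` do not involve `x_i`, the `i`-th coordinates of `M_k` are integers. So `ζ_k` is
a power series in `x_i` itself, and no root of `g i` is needed to evaluate it. -/
theorem curveOK (B : X.JetBranch R r γ ν ν' i g v u l)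
    (hN : X.MemN J ν) {k : ℕ} (hk : k ≤ J) (hJ : J ≤ X.g) (h0 : X.lam k i = 0) :
    CurveOK n ν (Function.update (fun _ => 1) i n) (X.trunc k).toSeries := by
  refine ⟨fun a => ?_, fun a ha => X.dvd_sum_of_memN (hN.mono hk)
    (X.vec_mem_latM_trunc (hk.trans hJ) ha), fun a ha b => ?_⟩
  · rcases eq_or_ne a i with rfl | h
    · simp
    · simp [h]
  · rcases eq_or_ne b i with rfl | h
    · rw [Function.update_self]
      obtain ⟨z, hz⟩ := exists_int_of_mem_latM (i := b) (fun k' _ hk' =>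
        X.charExponents.coord_eq_zero hk' (hk.trans hJ) h0)
        (X.vec_mem_latM_trunc (hk.trans hJ) ha)
      have hn : (n : ℚ) ≠ 0 := cast_ne_zero_of_neZero
      have h1 : (a b : ℚ) = n * z := by
        rw [← hz, vec]; field_simp
      rw [← Int.natCast_dvd_natCast]
      exact ⟨z, by exact_mod_cast h1⟩
    · simp [h]

/-- The last coordinate of the jet minus `ζ_k`, as an analytic function. -/
theorem analyticAt_sub (B : X.JetBranch R r γ ν ν' i g v u l)
    (hN : X.MemN J ν) {k : ℕ} (hk : k ≤ J) (hJ : J ≤ X.g) (h0 : X.lam k i = 0) :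
    AnalyticAt ℂ (fun t => γ.curve t 2 - curveEval n ν i n v (X.trunc k).toSeries (g i t) t) 0 :=
  (analyticAt_curve γ 2 0).sub (analyticAt_curveEval (B.curveOK hN hk hJ h0) B.good.R_pos.le
    (B.good.conv_trunc k) B.analytic_v B.v_norm_lt (B.analytic i)
    (by
      rw [B.zero]
      exact B.zero_norm_lt (by rw [Nat.div_self (NeZero.pos n)]; exact one_ne_zero)))

theorem curveEval_eq' (B : X.JetBranch R r γ ν ν' i g v u l)
    (hN : X.MemN J ν) {k : ℕ} (hk : k ≤ J) (hJ : J ≤ X.g) (h0 : X.lam k i = 0)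
    {t : ℝ} (ht : 0 ≤ t) : curveEval n ν i n v (X.trunc k).toSeries (g i t) t =
      evalSeries (X.trunc k).toSeries (branchOf n ν i v u t) :=
  curveEval_eq (B.curveOK hN hk hJ h0) ht (B.u_pow t)

theorem sub_curveEval_isBigO (B : X.JetBranch R r γ ν ν' i g v u l)
    (hN : X.MemN J ν) {k : ℕ} (hk : k ≤ J) (hJ : J ≤ X.g)
    (h0 : X.lam k i = 0) {κ : ℝ} (h1 : κ ≤ ((X.cJ m ν k : ℚ) : ℝ))
    (h2 : k < X.g → κ ≤ ((pair ν' (X.lam (k + 1)) : ℚ) : ℝ)) :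
    (fun t : ℝ => γ.curve t 2 - curveEval n ν i n v (X.trunc k).toSeries (g i t) t) =O[l]
      fun t => t ^ κ := by
  refine (B.sub_trunc_isBigO (hk.trans hJ) h0 h1 h2).congr' ?_ EventuallyEq.rfl
  filter_upwards [B.le self_mem_nhdsWithin] with t ht
  rw [B.curveEval_eq' hN hk hJ h0 (le_of_lt ht)]

/-- The estimate along the filter `l` extends to all small `t`, because `ζ_J` is analytic along the
curve; `c_J` does not exceed the order `⟨ν', λ_{J+1}⟩` of the neglected terms. -/
theorem sub_curveEval_isBigO_top (B : X.JetBranch R r γ ν ν' i g v u l)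
    (L : X.Levels m ν J j) (h0 : X.lam J i = 0) :
    (fun t : ℝ => γ.curve t 2 - curveEval n ν i n v (X.trunc J).toSeries (g i t) t) =O[𝓝[>] 0]
      fun t => t ^ ((X.cJ m ν J : ℚ) : ℝ) := by
  have := B.neBot
  refine isBigO_rpow_of_isBigO (B.analyticAt_sub L.memN le_rfl L.le_g h0) B.le
    (B.sub_curveEval_isBigO L.memN le_rfl L.le_g h0 le_rfl fun hJ => ?_)
  exact_mod_cast (L.cJ_le hJ).trans (B.pair_le (X.charExponents.nonneg hJ))

/-- Both limitations of the precision are strictly larger than `Q`: `c_k` by the choice of `J`, and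
`⟨ν', λ_{k+1}⟩` because `ν'` exceeds `ν` in a direction that `λ_{k+1}` involves. Analyticity rounds
this up to `Q + 1`. -/
theorem sub_curveEval_isBigO_pow (B : X.JetBranch R r γ ν ν' i g v u l)
    (L : X.Levels m ν J j) {k : ℕ} (hk : k < J)
    (h0 : X.lam k i = 0) (h1 : X.lam (k + 1) i ≠ 0) {Q : ℕ} (hQ : pair ν (X.lam (k + 1)) = Q) :
    (fun t => γ.curve t 2 - curveEval n ν i n v (X.trunc k).toSeries (g i t) t) =O[𝓝 0]
      fun t => t ^ (Q + 1) := by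
  have := B.neBot
  have h2 := L.pair_succ_lt_cJ hk
  have h3 := B.pair_lt (X.charExponents.nonneg (hk.trans_le L.le_g)) h1
  rw [hQ] at h2 h3
  refine isBigO_pow_of_isBigO (B.analyticAt_sub L.memN hk.le L.le_g h0) B.le
    (B.sub_curveEval_isBigO L.memN hk.le L.le_g h0 (κ := ((min (X.cJ m ν k)
      (pair ν' (X.lam (k + 1))) : ℚ) : ℝ)) (by exact_mod_cast min_le_left _ _)
      fun _ => by exact_mod_cast min_le_right _ _) ?_
  have h4 : (Q : ℚ) < min (X.cJ m ν k) (pair ν' (X.lam (k + 1))) := lt_min h2 h3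
  have h5 : (Q : ℝ) < ((min (X.cJ m ν k) (pair ν' (X.lam (k + 1))) : ℚ) : ℝ) := by exact_mod_cast h4
  push_cast at h5 ⊢
  linarith

/-- The closure relation in the direction of a coordinate that does not occur in `λ_1, …, λ_j`. -/
theorem mem_C_of_lam_eq_zero (B : X.JetBranch R r γ ν ν' i g v u l)
    (hε : ε ≤ r ^ n) (L : X.Levels m ν J j) (hν : ∀ l, ν l ≤ m)
    (hγ : γ ∈ jetDomain ε m) (h0 : X.lam j i = 0) : γ ∈ X.C ε m ν := by
  -- The maximal `k` keeps `ζ_k` analytic in `x_i`, while `λ_{k+1}`, if `k < J`, involves `x_i`, so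
  -- that the correction of order `Q` tends to zero.
  obtain ⟨k, hjk, hkJ, hk0, hk1⟩ := exists_greatest (p := fun k => X.lam k i = 0) h0 L.le
  have hGf : AnalyticFamily fun s t => g i t + (s : ℂ) :=
    (AnalyticFamily.of_analyticAt (B.analytic i)).add AnalyticFamily.ofReal
  have hok := B.curveOK L.memN hkJ L.le_g hk0
  have h00 : (0 : ℝ) ^ ν i * ‖g i 0 + ((0 : ℝ) : ℂ)‖ ^ (n / n) < R ^ n := by
    rw [B.zero, Complex.ofReal_zero, add_zero]
    exact B.zero_norm_lt (by rw [Nat.div_self (NeZero.pos n)]; exact one_ne_zero)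
  have hE : AnalyticFamily fun s t => curveEval n ν i n v (X.trunc k).toSeries (g i t + (s : ℂ)) t :=
    analyticFamily_curveEval hok B.good.R_pos.le (B.good.conv_trunc k) B.analytic_v B.v_norm_lt
      hGf h00
  -- The family is `Z_s = (z - ζ_k(g)) + ζ_k(g + s)`: the distance to `ζ_k` is kept while `x_i`
  -- moves.
  have hZ := (AnalyticFamily.of_analyticAt (B.analyticAt_sub L.memN hkJ L.le_g hk0)).add hE
  obtain ⟨κ, h1, h2, h3⟩ : ∃ κ : ℝ, (k = J → ((X.cJ m ν J : ℚ) : ℝ) ≤ κ) ∧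
      (k < J → ((pair ν (X.lam J) : ℚ) : ℝ) + 1 ≤ κ) ∧ (fun t : ℝ => γ.curve t 2 -
        curveEval n ν i n v (X.trunc k).toSeries (g i t) t) =O[𝓝[>] 0] fun t => t ^ κ := by
    rcases hkJ.eq_or_lt with rfl | hlt
    · exact ⟨_, fun _ => le_rfl, fun h => (lt_irrefl _ h).elim, B.sub_curveEval_isBigO_top L hk0⟩
    · obtain ⟨Q, hQ⟩ := X.exists_nat_pair_eq L.memN L.le_g (Nat.succ_le_succ k.zero_le) hlt
      refine ⟨((Q + 1 : ℕ) : ℝ), fun h => absurd h hlt.ne, fun _ => ?_,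
        isBigO_real_of_pow (B.sub_curveEval_isBigO_pow L hlt hk0 (hk1 _ k.lt_succ_self hlt) hQ)
          le_rfl le_rfl⟩
      rw [← L.pair_eq k hjk hlt, hQ]
      push_cast
      exact le_rfl
  refine X.mem_C_of_family B.good hε L hν hγ (fun l _ => B.analytic l)
    (fun l _ => Eventually.of_forall (B.curve_eq l)) B.analytic_v B.v_ne_zero B.v_pow hGf hZ
    (Eventually.of_forall fun t => by rw [B.curve_eq]; simp)
    (Eventually.of_forall fun t => by simp) (by simp [B.zero]) hkJ
    (fun hlt => ⟨hjk, hk1 _ k.lt_succ_self hlt⟩) h1 h2 ?_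
  filter_upwards [self_mem_nhdsWithin] with s hs
  have hs0 : (s : ℂ) ≠ 0 := by exact_mod_cast (ne_of_gt hs)
  have hg0 : g i 0 + (s : ℂ) ≠ 0 := by rwa [B.zero, zero_add]
  obtain ⟨w₀, hw₀⟩ := IsAlgClosed.exists_pow_nat_eq (g i 0 + (s : ℂ)) (NeZero.pos n)
  obtain ⟨w, hw1, -, hw2⟩ := exists_analytic_root (h := fun t => g i t + (s : ℂ))
    ((B.analytic i).add analyticAt_const) (NeZero.ne n) hw₀ hg0
  refine ⟨hg0, w, hw1, hw2, h3.congr' ?_ EventuallyEq.rfl⟩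
  filter_upwards [tendsto_ofReal_nhdsGT.eventually hw2, self_mem_nhdsWithin] with t h4 h5
  rw [curveEval_eq hok (le_of_lt h5) h4]
  change _ = _ + _ - evalSeries _ (branchOf n ν i v w t)
  ring

end JetBranch

end QOSurface

/-! ### A characteristic exponent with `λ_{k+1}^{(i)} = 1 / n_{k+1}` -/

theorem tendsto_rootn : Tendsto (rootn n) (𝓝[>] 0) (𝓝 0) := by
  have h1 := (Real.continuousAt_rpow_const 0 ((n : ℝ)⁻¹) (Or.inr (by positivity))).tendsto
  rw [Real.zero_rpow (inv_ne_zero (by exact_mod_cast NeZero.ne n))] at h1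
  have h2 := (Complex.continuous_ofReal.tendsto 0).comp (h1.mono_left (nhdsWithin_le_nhds (s := Set.Ioi 0)))
  rwa [Complex.ofReal_zero] at h2

namespace QOSurface
variable (X : QOSurface n) {R r : ℝ} {ν : Fin 2 → ℕ} {i : Fin 2} {k q : ℕ} {A : Fin 2 →₀ ℕ}

/-- The coordinate `x_i` does not occur in `λ_1, …, λ_k`, and `λ_{k+1}^{(i)} = 1 / n_{k+1}`. -/
structure Transversal (ν : Fin 2 → ℕ) (i : Fin 2) (k : ℕ) (A : Fin 2 →₀ ℕ) (q : ℕ) : Prop where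
  lt : k < X.g
  memN : X.MemN (k + 1) ν
  zero : X.lam k i = 0
  idx_mul : (idx X.lam (k + 1) : ℚ) * X.lam (k + 1) i = 1
  vec_eq : vec n A = X.lam (k + 1)
  pair_eq : pair ν (X.lam (k + 1)) = q

/-- The difference `ζ_{k+1} - ζ_k`. -/
def diff (k : ℕ) : MvPowerSeries (Fin 2) ℂ := (X.trunc (k + 1)).toSeries - (X.trunc k).toSeries

theorem Good.conv_diff {X : QOSurface n} (hG : X.Good R r) (k : ℕ) : ConvOn R (X.diff k) :=
  (hG.conv_trunc (k + 1)).sub hG.R_pos.le (hG.conv_trunc k)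

namespace Transversal
variable {X}

theorem mul_eq (T : X.Transversal ν i k A q) : A i * idx X.lam (k + 1) = n := by
  have h1 := T.idx_mul
  have hn : (n : ℚ) ≠ 0 := cast_ne_zero_of_neZero
  rw [← T.vec_eq, vec] at h1
  field_simp at h1
  rw [mul_comm]
  exact_mod_cast h1

theorem A_ne_zero (T : X.Transversal ν i k A q) : A i ≠ 0 := fun h =>
  NeZero.ne n (by rw [← T.mul_eq, h, zero_mul])

theorem idx_ne_zero (T : X.Transversal ν i k A q) : idx X.lam (k + 1) ≠ 0 := fun h =>
  NeZero.ne n (by rw [← T.mul_eq, h, mul_zero])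

theorem div_eq (T : X.Transversal ν i k A q) : n / A i = idx X.lam (k + 1) := by
  conv_lhs => rw [← T.mul_eq]
  exact Nat.mul_div_cancel_left _ (Nat.pos_of_ne_zero T.A_ne_zero)

theorem mem_latM (T : X.Transversal ν i k A q) {a : Fin 2 →₀ ℕ}
    (ha : MvPowerSeries.coeff a (X.diff k) ≠ 0) : vec n a ∈ latM X.lam (k + 1) :=
  X.vec_mem_latM_trunc T.lt (X.coeff_trunc_sub k.le_succ ha).2.2

theorem le_of_coeff (T : X.Transversal ν i k A q) {a : Fin 2 →₀ ℕ}
    (ha : MvPowerSeries.coeff a (X.diff k) ≠ 0) : A ≤ a := by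
  rw [← vec_le_vec (n := n), T.vec_eq]
  exact (X.coeff_trunc_sub k.le_succ ha).2.1

/-- The exponents of `ζ_{k+1} - ζ_k` are determined modulo `M_k` by their `i`-th coordinate. -/
theorem exists_eq_mul (T : X.Transversal ν i k A q) {a : Fin 2 →₀ ℕ}
    (ha : vec n a ∈ latM X.lam (k + 1)) :
    ∃ z : ℤ, (a i : ℤ) = A i * z ∧ vec n a - z • X.lam (k + 1) ∈ latM X.lam k := by
  obtain ⟨z, hz⟩ := mem_latM_succ.1 ha
  obtain ⟨w, hw⟩ := exists_int_of_mem_latM (i := i) (fun k' _ hk' =>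
    X.charExponents.coord_eq_zero hk' T.lt.le T.zero) hz
  have hn : (n : ℚ) ≠ 0 := cast_ne_zero_of_neZero
  refine ⟨z + idx X.lam (k + 1) * w, ?_, ?_⟩
  · have h1 : (a i : ℚ) = z * A i + n * w := by
      have h2 : X.lam (k + 1) i = (A i : ℚ) / n := by rw [← T.vec_eq, vec]
      rw [Pi.sub_apply, Pi.smul_apply, h2, vec, zsmul_eq_mul] at hw
      field_simp at hw
      linarith
    have h3 : (n : ℚ) = A i * idx X.lam (k + 1) := by exact_mod_cast T.mul_eq.symm
    have h4 : (a i : ℚ) = A i * (z + idx X.lam (k + 1) * w) := by rw [h1, h3]; ring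
    exact_mod_cast h4
  · have h1 : ((idx X.lam (k + 1) * w : ℤ)) • X.lam (k + 1) ∈ latM X.lam k :=
      (zsmul_mem_latM_iff k _).2 (dvd_mul_right _ _)
    rw [add_smul, ← sub_sub]
    exact sub_mem hz h1

theorem dvd (T : X.Transversal ν i k A q) {a : Fin 2 →₀ ℕ}
    (ha : vec n a ∈ latM X.lam (k + 1)) : A i ∣ a i := by
  obtain ⟨z, hz, -⟩ := T.exists_eq_mul ha
  rw [← Int.natCast_dvd_natCast]
  exact ⟨z, hz⟩

/-- All exponents of `ζ_{k+1} - ζ_k` are divisible by `A_i` in the direction `i`. So this difference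
is a series in `y = u_i ^ A_i`, and `y` is an `n_{k+1}`-th root of `u_i ^ n` because `A_i n_{k+1} =
n`. -/
theorem curveOK (T : X.Transversal ν i k A q) :
    CurveOK n ν (Function.update (fun _ => 1) i (A i)) (X.diff k) := by
  refine ⟨fun b => ?_, fun a ha => X.dvd_sum_of_memN T.memN (T.mem_latM ha), fun a ha b => ?_⟩
  · rcases eq_or_ne b i with rfl | h
    · rw [Function.update_self, ← T.mul_eq]; exact dvd_mul_right _ _
    · simp [h]
  · rcases eq_or_ne b i with rfl | h
    · rw [Function.update_self]; exact T.dvd (T.mem_latM ha)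
    · simp [h]

/-- For `ω` acting trivially on `M_k`, the values of `ζ_{k+1} - ζ_k` at the conjugates of a point
of a branch are obtained by rotating the coordinate `u_i` only. -/
theorem evalSeries_rot (T : X.Transversal ν i k A q) {ω : Rots n} (hω : ω ∈ charKer n X.lam k)
    {v : Fin 2 → ℂ → ℂ} {u : ℂ → ℂ} {t : ℝ} (ht : 0 ≤ t) :
    evalSeries (X.diff k) (ω.val * branchOf n ν i v u t) =
      curveEval n ν i (A i) v (X.diff k) ((∏ l, ω.val l ^ A l) * u t ^ A i) t := by
  obtain ⟨ρ, hρ⟩ := IsAlgClosed.exists_pow_nat_eq (∏ l, ω.val l ^ A l)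
    (Nat.pos_of_ne_zero T.A_ne_zero)
  rw [curveEval_eq T.curveOK ht (w := fun t => ρ * u t) (by rw [mul_pow, hρ])]
  refine tsum_congr fun a => ?_
  by_cases ha : MvPowerSeries.coeff a (X.diff k) = 0
  · rw [ha, zero_mul, zero_mul]
  congr 1
  -- Modulo `M_k`, on which `ω` is trivial, the exponent `a / n` is the multiple `(a_i / A_i)
  -- λ_{k+1}`; so `ω` acts as if only `u_i` were multiplied by `ρ`.
  have h1 : ∏ l, ω.val l ^ a l = ρ ^ a i := by
    obtain ⟨z, hz1, hz2⟩ := T.exists_eq_mul (T.mem_latM ha)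
    obtain ⟨b, hb⟩ := T.dvd (T.mem_latM ha)
    have hzb : z = b := by
      have : (A i : ℤ) * z = A i * b := by rw [← hz1, hb]; push_cast; rfl
      exact mul_left_cancel₀ (by exact_mod_cast T.A_ne_zero) this
    have h2 : zvec n (toInt a - z • toInt A) ∈ latM X.lam k := by
      rw [map_sub, map_zsmul, zvec_toInt, zvec_toInt, T.vec_eq]
      exact hz2
    have h3 := mem_charKer.1 hω _ h2
    have h4 : ω.char (toInt a) = ω.char (toInt A) ^ z := by
      have h5 : toInt a = (toInt a - z • toInt A) + z • toInt A := by abel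
      rw [h5, Rots.char_add, h3, one_mul, Rots.char_zsmul]
    rw [← Rots.char_toInt, h4, hzb, zpow_natCast, Units.val_pow_eq_pow_val, Rots.char_toInt, ← hρ,
      ← pow_mul, hb]
  simp only [Pi.mul_apply, mul_pow, Finset.prod_mul_distrib]
  rw [h1]
  have h2 : ∀ w : ℂ → ℂ, ∏ l, branchOf n ν i v w t l ^ a l =
      (w t) ^ a i * ((rootn n t ^ ν i) ^ a i * ∏ l ∈ Finset.univ.erase i,
        (rootn n t ^ ν l * v l t) ^ a l) := by
    intro w
    rw [← Finset.mul_prod_erase _ _ (Finset.mem_univ i), branchOf, Function.update_self, mul_pow]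
    rw [mul_comm ((rootn n t ^ ν i) ^ a i), mul_assoc]
    congr 2
    refine Finset.prod_congr rfl fun l hl => ?_
    rw [branchOf, Function.update_of_ne (Finset.ne_of_mem_erase hl)]
  rw [h2, h2, mul_pow]
  ring

/-- The point at which the contracted unit factor of `ζ_{k+1} - ζ_k` is evaluated. -/
def unitPt (ν : Fin 2 → ℕ) (i : Fin 2) (d : ℕ) (v : Fin 2 → ℂ → ℂ) (τ : ℂ) (t y : ℂ) : Fin 2 → ℂ :=
  fun l => (τ ^ ν l) ^ (Function.update (fun _ => 1) i d l : ℕ) * Function.update v i (fun _ => y) l t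

/-- The contracted unit factor of `ζ_{k+1} - ζ_k`. -/
def unitFactor (X : QOSurface n) (k : ℕ) (i : Fin 2) (A : Fin 2 →₀ ℕ) : MvPowerSeries (Fin 2) ℂ :=
  contract (Function.update (fun _ => 1) i (A i)) (shift A (X.diff k))

/-- The factor of `ζ_{k+1} - ζ_k` besides `t ^ q * y`. -/
def cofactor (X : QOSurface n) (ν : Fin 2 → ℕ) (k : ℕ) (i : Fin 2) (A : Fin 2 →₀ ℕ)
    (v : Fin 2 → ℂ → ℂ) (τ t y : ℂ) : ℂ :=
  (∏ l ∈ Finset.univ.erase i, v l t ^ A l) *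
    evalSeries (unitFactor X k i A) (unitPt ν i (A i) v τ t y)

theorem exponents_ne_zero (T : X.Transversal ν i k A q) (l : Fin 2) :
    (Function.update (fun _ => 1) i (A i) l : ℕ) ≠ 0 := by
  rcases eq_or_ne l i with rfl | h
  · simpa using T.A_ne_zero
  · simp [h]

theorem evalSeries_shift (T : X.Transversal ν i k A q) (V : Fin 2 → ℂ) :
    evalSeries (shift A (X.diff k)) V = evalSeries (unitFactor X k i A)
      (fun l => V l ^ (Function.update (fun _ => 1) i (A i) l : ℕ)) := by
  refine evalSeries_eq_contract T.exponents_ne_zero (fun a ha l => ?_) V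
  rcases eq_or_ne l i with rfl | h
  · rw [Function.update_self]
    have := T.dvd (T.mem_latM ha)
    rw [Finsupp.add_apply] at this
    exact (Nat.dvd_add_left dvd_rfl).1 this
  · simp [h]

/-- The product is analytic in `t`, but the contraction was made in the direction `i` only, so the
unit factor taken separately is written in terms of the `n`-th root `τ` of `t`. Only its continuity
and a Lipschitz bound in `y` are used. -/
theorem curveEval_eq_mul (T : X.Transversal ν i k A q) {v : Fin 2 → ℂ → ℂ} {t : ℝ} (ht : 0 ≤ t)
    (y : ℂ) : curveEval n ν i (A i) v (X.diff k) y t =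
      (t : ℂ) ^ q * (y * cofactor X ν k i A v (rootn n t) t y) := by
  obtain ⟨w, hw⟩ := IsAlgClosed.exists_pow_nat_eq y (Nat.pos_of_ne_zero T.A_ne_zero)
  rw [curveEval_eq T.curveOK ht (w := fun _ => w) hw,
    evalSeries_eq_mul_shift (A := A) fun a ha => T.le_of_coeff ha, T.evalSeries_shift]
  have h1 : (fun l => branchOf n ν i v (fun _ => w) t l ^
      (Function.update (fun _ => 1) i (A i) l : ℕ)) = unitPt ν i (A i) v (rootn n t) t y := by
    ext l
    rw [branchOf, unitPt, mul_pow]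
    congr 1
    rcases eq_or_ne l i with rfl | h
    · simpa using hw
    · simp [h]
  rw [h1]
  unfold branchOf
  rw [prod_rootn_pow (T.vec_eq ▸ T.pair_eq) ht, ← Finset.mul_prod_erase _ _ (Finset.mem_univ i),
    Function.update_self, hw, cofactor, Finset.prod_congr rfl
      (g := fun l => v l t ^ A l) fun l hl => by
        rw [Function.update_of_ne (Finset.ne_of_mem_erase hl)]]
  ring

theorem conv_unitFactor (T : X.Transversal ν i k A q) (hG : X.Good R r) :
    ConvOn (R ^ n) (unitFactor X k i A) := by
  refine ((hG.conv_diff k).shift hG.R_pos A).contract hG.R_pos.le hG.le_one T.exponents_ne_zero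
    fun l => ?_
  rcases eq_or_ne l i with rfl | h
  · rw [Function.update_self]
    exact Nat.le_of_dvd (NeZero.pos n) ⟨_, T.mul_eq.symm⟩
  · rw [Function.update_of_ne h]
    exact NeZero.one_le

section estimates
variable {v : Fin 2 → ℂ → ℂ}

theorem norm_unitPt_zero_lt (T : X.Transversal ν i k A q) (hr : 0 < r)
    (hv : ∀ l, l ≠ i → (0 : ℝ) ^ ν l * ‖v l 0‖ ^ n < r ^ n) (l : Fin 2) :
    ‖unitPt ν i (A i) v 0 0 0 l‖ < r := by
  rcases eq_or_ne l i with rfl | h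
  · simpa [unitPt] using hr
  · rw [unitPt, Function.update_of_ne h, Function.update_of_ne h, pow_one]
    refine lt_of_pow_lt_pow_left₀ n hr.le (lt_of_le_of_lt ?_ (hv l h))
    rw [norm_mul, norm_pow, norm_zero, mul_pow]
    refine mul_le_mul_of_nonneg_right ?_ (by positivity)
    exact pow_le_of_le_one (by positivity) (pow_le_one₀ le_rfl zero_le_one) (NeZero.ne n)

/-- The coordinates other than `x_i` need not vanish at `t = 0`, so nonvanishing of the unit at the
origin alone would not suffice; the radius `r` was chosen so that the unit has no zero on the
polydisc. -/
theorem cofactor_zero_ne_zero (T : X.Transversal ν i k A q) (hG : X.Good R r)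
    (hv : ∀ l, l ≠ i → (0 : ℝ) ^ ν l * ‖v l 0‖ ^ n < r ^ n) (hv0 : ∀ l, l ≠ i → v l 0 ≠ 0) :
    cofactor X ν k i A v 0 0 0 ≠ 0 := by
  refine mul_ne_zero (Finset.prod_ne_zero_iff.2 fun l hl =>
    pow_ne_zero _ (hv0 l (Finset.ne_of_mem_erase hl))) ?_
  have h1 := T.evalSeries_shift fun l => (0 : ℂ) ^ ν l * Function.update v i (fun _ => 0) l 0
  have h2 : (fun l => ((0 : ℂ) ^ ν l * Function.update v i (fun _ => 0) l 0) ^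
      (Function.update (fun _ => 1) i (A i) l : ℕ)) = unitPt ν i (A i) v 0 0 0 := by
    ext l
    rcases eq_or_ne l i with rfl | h
    · simp [unitPt, T.A_ne_zero]
    · simp [unitPt, h]
  rw [h2] at h1
  rw [← h1]
  refine hG.unit k (k + 1) k.lt_succ_self T.lt A T.vec_eq _ fun l => ?_
  rcases eq_or_ne l i with rfl | h
  · simpa using hG.pos.le
  · have := T.norm_unitPt_zero_lt hG.pos hv l
    rw [unitPt, Function.update_of_ne h, pow_one] at this
    exact this.le

theorem tendsto_unitPt (hv : ∀ l, l ≠ i → ContinuousAt (v l) 0) (d : ℕ) (l : Fin 2) :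
    Tendsto (fun x : ℝ × ℂ => unitPt ν i d v (rootn n x.1) x.1 x.2 l) (𝓝[>] 0 ×ˢ 𝓝 0)
      (𝓝 (unitPt ν i d v 0 0 0 l)) := by
  unfold unitPt
  refine (((tendsto_rootn.comp tendsto_fst).pow _).pow _).mul ?_
  rcases eq_or_ne l i with rfl | h
  · simpa using tendsto_snd
  · simp only [Function.update_of_ne h]
    exact (hv l h).tendsto.comp (tendsto_ofReal_nhdsGT.comp tendsto_fst)

theorem tendsto_cofactor (T : X.Transversal ν i k A q) (hG : X.Good R r)
    (hvc : ∀ l, l ≠ i → ContinuousAt (v l) 0)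
    (hv : ∀ l, l ≠ i → (0 : ℝ) ^ ν l * ‖v l 0‖ ^ n < r ^ n) :
    Tendsto (fun x : ℝ × ℂ => cofactor X ν k i A v (rootn n x.1) x.1 x.2) (𝓝[>] 0 ×ˢ 𝓝 0)
      (𝓝 (cofactor X ν k i A v 0 0 0)) := by
  refine Tendsto.mul (tendsto_finsetProd _ fun l hl => ?_) ?_
  · exact ((hvc l (Finset.ne_of_mem_erase hl)).tendsto.comp
      (tendsto_ofReal_nhdsGT.comp tendsto_fst)).pow _
  · refine ((T.conv_unitFactor hG).continuousAt (U := unitPt ν i (A i) v 0 0 0) fun l =>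
      (T.norm_unitPt_zero_lt hG.pos hv l).trans hG.lt_pow).tendsto.comp ?_
    exact tendsto_pi_nhds.2 fun l => tendsto_unitPt hvc _ l

/-- `ζ_{k+1} - ζ_k` is strictly differentiable as a function of `y`, uniformly in `t`. -/
theorem norm_curveEval_sub_sub_le (T : X.Transversal ν i k A q) (hG : X.Good R r)
    (hvc : ∀ l, l ≠ i → ContinuousAt (v l) 0)
    (hv : ∀ l, l ≠ i → (0 : ℝ) ^ ν l * ‖v l 0‖ ^ n < r ^ n) {δ : ℝ} (hδ : 0 < δ) :
    ∃ η : ℝ, 0 < η ∧ ∀ᶠ t : ℝ in 𝓝[>] 0, ∀ y₁ y₂ : ℂ, ‖y₁‖ ≤ η → ‖y₂‖ ≤ η →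
      ‖curveEval n ν i (A i) v (X.diff k) y₁ t - curveEval n ν i (A i) v (X.diff k) y₂ t -
        (t : ℂ) ^ q * (cofactor X ν k i A v 0 0 0 * (y₁ - y₂))‖ ≤ δ * t ^ q * ‖y₁ - y₂‖ := by
  obtain ⟨C, hC0, hC⟩ := (T.conv_unitFactor hG).lipschitz hG.lt_pow
  set b : ℝ := ‖∏ l ∈ Finset.univ.erase i, v l 0 ^ A l‖ + 1 with hb
  have hb0 : 0 < b := by positivity
  have h1 : ∀ᶠ x : ℝ × ℂ in 𝓝[>] 0 ×ˢ 𝓝 0,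
      ‖cofactor X ν k i A v (rootn n x.1) x.1 x.2 - cofactor X ν k i A v 0 0 0‖ < δ / 2 := by
    have := ((T.tendsto_cofactor hG hvc hv).sub_const (cofactor X ν k i A v 0 0 0)).norm
    rw [sub_self, norm_zero] at this
    exact this.eventually (gt_mem_nhds (half_pos hδ))
  have h2 : ∀ᶠ x : ℝ × ℂ in 𝓝[>] 0 ×ˢ 𝓝 0, ∀ l,
      ‖unitPt ν i (A i) v (rootn n x.1) x.1 x.2 l‖ < r := eventually_all.2 fun l =>
    (tendsto_unitPt hvc _ l).norm.eventually (gt_mem_nhds (T.norm_unitPt_zero_lt hG.pos hv l))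
  have h3 : ∀ᶠ t : ℝ in 𝓝[>] 0, ‖∏ l ∈ Finset.univ.erase i, v l t ^ A l‖ < b := by
    have : Tendsto (fun t : ℝ => ∏ l ∈ Finset.univ.erase i, v l t ^ A l) (𝓝[>] 0)
        (𝓝 (∏ l ∈ Finset.univ.erase i, v l 0 ^ A l)) := tendsto_finsetProd _ fun l hl =>
      ((hvc l (Finset.ne_of_mem_erase hl)).tendsto.comp tendsto_ofReal_nhdsGT).pow _
    exact this.norm.eventually (gt_mem_nhds (lt_add_one _))
  obtain ⟨p, hp, p', hp', H⟩ := eventually_prod_iff.1 (h1.and h2)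
  obtain ⟨η₀, hη₀, hη⟩ := Metric.eventually_nhds_iff.1 hp'
  refine ⟨min (η₀ / 2) (δ / 2 / (b * (C + 1))), lt_min (half_pos hη₀) (by positivity), ?_⟩
  have h4 : ∀ᶠ t : ℝ in 𝓝[>] 0, ‖rootn n t‖ < 1 := by
    have := (tendsto_rootn (n := n)).norm
    rw [norm_zero] at this
    exact this.eventually (gt_mem_nhds one_pos)
  filter_upwards [hp, h3, h4, self_mem_nhdsWithin] with t ht1 ht2 ht3 ht4 y₁ y₂ hy₁ hy₂
  have ht0 : 0 < t := ht4
  have hsmall : ∀ y : ℂ, ‖y‖ ≤ min (η₀ / 2) (δ / 2 / (b * (C + 1))) → p' y := fun y hy => by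
    refine hη ?_
    rw [dist_zero_right]
    exact (hy.trans (min_le_left _ _)).trans_lt (half_lt_self hη₀)
  obtain ⟨ha1, ha2⟩ := H ht1 (hsmall y₁ hy₁)
  obtain ⟨hb1, hb2⟩ := H ht1 (hsmall y₂ hy₂)
  rw [T.curveEval_eq_mul ht0.le, T.curveEval_eq_mul ht0.le]
  set c := cofactor X ν k i A v 0 0 0
  have hlip : ‖cofactor X ν k i A v (rootn n t) t y₁ - cofactor X ν k i A v (rootn n t) t y₂‖ ≤
      b * (C * ‖y₁ - y₂‖) := by
    rw [cofactor, cofactor, ← mul_sub, norm_mul]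
    refine mul_le_mul ht2.le ((hC _ _ (fun l => (ha2 l).le) fun l => (hb2 l).le).trans ?_)
      (norm_nonneg _) hb0.le
    refine mul_le_mul_of_nonneg_left ?_ hC0
    have hpt : ∀ l, ‖unitPt ν i (A i) v (rootn n t) t y₁ l - unitPt ν i (A i) v (rootn n t) t y₂ l‖ ≤
        if l = i then ‖y₁ - y₂‖ else 0 := by
      intro l
      rw [unitPt, unitPt, ← mul_sub]
      split_ifs with h
      · subst h
        simp only [Function.update_self]
        rw [norm_mul]
        refine mul_le_of_le_one_left (norm_nonneg _) ?_
        rw [norm_pow, norm_pow]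
        exact pow_le_one₀ (by positivity) (pow_le_one₀ (norm_nonneg _) ht3.le)
      · simp [Function.update_of_ne h]
    refine (add_le_add (hpt 0) (hpt 1)).trans (le_of_eq ?_)
    have := Finset.sum_ite_eq' Finset.univ i (fun _ => ‖y₁ - y₂‖)
    rw [Fin.sum_univ_two] at this
    simpa using this
  have hexp : (t : ℂ) ^ q * (y₁ * cofactor X ν k i A v (rootn n t) t y₁) -
      (t : ℂ) ^ q * (y₂ * cofactor X ν k i A v (rootn n t) t y₂) - (t : ℂ) ^ q * (c * (y₁ - y₂)) =
      (t : ℂ) ^ q * ((y₁ - y₂) * (cofactor X ν k i A v (rootn n t) t y₁ - c) +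
        y₂ * (cofactor X ν k i A v (rootn n t) t y₁ -
          cofactor X ν k i A v (rootn n t) t y₂)) := by ring
  rw [hexp, norm_mul, norm_pow, Complex.norm_real, Real.norm_of_nonneg ht0.le,
    mul_comm δ, mul_assoc]
  refine mul_le_mul_of_nonneg_left ?_ (by positivity)
  refine (norm_add_le _ _).trans ?_
  rw [norm_mul, norm_mul]
  have h5 : ‖y₁ - y₂‖ * ‖cofactor X ν k i A v (rootn n t) t y₁ - c‖ ≤ ‖y₁ - y₂‖ * (δ / 2) :=
    mul_le_mul_of_nonneg_left ha1.le (norm_nonneg _)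
  have h6 : ‖y₂‖ * ‖cofactor X ν k i A v (rootn n t) t y₁ -
      cofactor X ν k i A v (rootn n t) t y₂‖ ≤ (δ / 2) * ‖y₁ - y₂‖ := by
    have h7 : ‖y₂‖ * (b * (C + 1)) ≤ δ / 2 := by
      rw [← le_div_iff₀ (by positivity)]
      exact hy₂.trans (min_le_right _ _)
    calc _ ≤ ‖y₂‖ * (b * (C * ‖y₁ - y₂‖)) := mul_le_mul_of_nonneg_left hlip (norm_nonneg _)
      _ ≤ ‖y₂‖ * (b * ((C + 1) * ‖y₁ - y₂‖)) := by gcongr; linarith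
      _ = ‖y₂‖ * (b * (C + 1)) * ‖y₁ - y₂‖ := by ring
      _ ≤ _ := mul_le_mul_of_nonneg_right h7 (norm_nonneg _)
  linarith

theorem norm_curveEval_sub_bounds (T : X.Transversal ν i k A q) (hG : X.Good R r)
    (hvc : ∀ l, l ≠ i → ContinuousAt (v l) 0)
    (hv : ∀ l, l ≠ i → (0 : ℝ) ^ ν l * ‖v l 0‖ ^ n < r ^ n) (hv0 : ∀ l, l ≠ i → v l 0 ≠ 0) :
    ∃ c : ℝ, 0 < c ∧ ∃ η : ℝ, 0 < η ∧ ∀ᶠ t : ℝ in 𝓝[>] 0, ∀ y₁ y₂ : ℂ, ‖y₁‖ ≤ η → ‖y₂‖ ≤ η →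
      c * (t ^ q * ‖y₁ - y₂‖) ≤ ‖curveEval n ν i (A i) v (X.diff k) y₁ t -
        curveEval n ν i (A i) v (X.diff k) y₂ t‖ ∧
      ‖curveEval n ν i (A i) v (X.diff k) y₁ t - curveEval n ν i (A i) v (X.diff k) y₂ t‖ ≤
        3 * c * (t ^ q * ‖y₁ - y₂‖) := by
  have hc := norm_pos_iff.2 (T.cofactor_zero_ne_zero hG hv hv0)
  set c := cofactor X ν k i A v 0 0 0
  obtain ⟨η, hη, H⟩ := T.norm_curveEval_sub_sub_le hG hvc hv (half_pos hc)
  refine ⟨‖c‖ / 2, half_pos hc, η, hη, ?_⟩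
  filter_upwards [H, self_mem_nhdsWithin] with t ht1 ht2 y₁ y₂ hy₁ hy₂
  have ht0 : 0 < t := ht2
  have h1 := ht1 y₁ y₂ hy₁ hy₂
  set e := curveEval n ν i (A i) v (X.diff k) y₁ t - curveEval n ν i (A i) v (X.diff k) y₂ t
  have h2 : ‖(t : ℂ) ^ q * (c * (y₁ - y₂))‖ = ‖c‖ * (t ^ q * ‖y₁ - y₂‖) := by
    rw [norm_mul, norm_mul, norm_pow, Complex.norm_real, Real.norm_of_nonneg ht0.le]
    ring
  have h3 := norm_sub_norm_le ((t : ℂ) ^ q * (c * (y₁ - y₂))) e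
  have h4 := norm_sub_norm_le e ((t : ℂ) ^ q * (c * (y₁ - y₂)))
  rw [norm_sub_rev _ e] at h3
  rw [h2] at h3 h4
  have h5 : ‖c‖ / 2 * t ^ q * ‖y₁ - y₂‖ = ‖c‖ / 2 * (t ^ q * ‖y₁ - y₂‖) := by ring
  rw [h5] at h1
  constructor <;> linarith

end estimates

end Transversal

end QOSurface

/-! ### The parameter `y` of a transversal direction and its relation to `x_i` -/

namespace QOSurface
variable (X : QOSurface n) {R r ε : ℝ} {m J : ℕ} {ν ν' : Fin 2 → ℕ} {i : Fin 2} {k q : ℕ}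
  {A : Fin 2 →₀ ℕ}

namespace Transversal
variable {X}

theorem exists_of_levels {j : ℕ} (L : X.Levels m ν J (j + 1)) (h0 : X.lam j i = 0)
    (h1 : (idx X.lam (j + 1) : ℚ) * X.lam (j + 1) i = 1) :
    ∃ A q, X.Transversal ν i j A q := by
  have hj : j + 1 ≤ X.g := L.le.trans L.le_g
  obtain ⟨A, hA⟩ := X.charExponents.exists_vec hj
  obtain ⟨q, hq⟩ := X.exists_nat_pair_eq L.memN L.le_g (Nat.succ_le_succ j.zero_le) L.le
  exact ⟨A, q, hj, L.memN.mono L.le, h0, h1, hA, hq⟩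

theorem lam_ne_zero (T : X.Transversal ν i k A q) : X.lam (k + 1) i ≠ 0 := fun h => by
  simpa [h] using T.idx_mul

theorem zero_norm_lt (T : X.Transversal ν i k A q) (hG : X.Good R r) :
    (0 : ℝ) ^ ν i * ‖(0 : ℂ)‖ ^ (n / A i) < R ^ n := by
  rw [norm_zero, T.div_eq, zero_pow T.idx_ne_zero, mul_zero]
  exact pow_pos hG.R_pos n

/-- The equation `w = ζ_{k+1} - ζ_k` can be solved for `y` up to any order. -/
theorem exists_curveEval_sub_isBigO (T : X.Transversal ν i k A q) (hG : X.Good R r)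
    {v : Fin 2 → ℂ → ℂ} (hva : ∀ l, l ≠ i → AnalyticAt ℂ (v l) 0)
    (hv : ∀ l, l ≠ i → (0 : ℝ) ^ ν l * ‖v l 0‖ ^ n < r ^ n) (hv0 : ∀ l, l ≠ i → v l 0 ≠ 0)
    {w : ℂ → ℂ} (hw : AnalyticAt ℂ w 0)
    (h : (fun t : ℝ => w t) =O[𝓝[>] 0] fun t => t ^ ((q + 1 : ℕ) : ℝ)) (M : ℕ) :
    ∃ y : ℂ → ℂ, AnalyticAt ℂ y 0 ∧ y 0 = 0 ∧
      (fun t : ℝ => w t - curveEval n ν i (A i) v (X.diff k) (y t) t) =O[𝓝[>] 0]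
        fun t => t ^ ((q + (M + 1) : ℕ) : ℝ) := by
  induction M with
  | zero =>
    refine ⟨fun _ => 0, analyticAt_const, rfl, h.congr' ?_ EventuallyEq.rfl⟩
    filter_upwards [self_mem_nhdsWithin] with t ht
    rw [T.curveEval_eq_mul (le_of_lt ht), zero_mul, mul_zero, sub_zero]
  | succ M ih =>
    obtain ⟨y, hy, hy0, hO⟩ := ih
    have hE : ∀ y : ℂ → ℂ, AnalyticAt ℂ y 0 → y 0 = 0 →
        AnalyticAt ℂ (fun t => w t - curveEval n ν i (A i) v (X.diff k) (y t) t) 0 :=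
      fun y hy hy0 => hw.sub (analyticAt_curveEval T.curveOK hG.R_pos.le (hG.conv_diff k) hva
        (fun l hl => (hv l hl).trans (pow_lt_pow_left₀ hG.lt hG.pos.le (NeZero.ne n))) hy
        (by rw [hy0]; exact T.zero_norm_lt hG))
    -- Newton's method, one coefficient at a time: the error starts with `W t ^ (q + M + 1)`, the
    -- derivative in `y` is `c t ^ q` to first order, so `y` is corrected by `(W / c) t ^ (M + 1)`.
    obtain ⟨W, -, hW⟩ := exists_tendsto_div_pow (hE y hy hy0) hO
    set c := cofactor X ν k i A v 0 0 0
    have hc : c ≠ 0 := T.cofactor_zero_ne_zero hG hv hv0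
    set y' : ℂ → ℂ := fun t => y t + W / c * t ^ (M + 1) with hy'
    have hya : AnalyticAt ℂ y' 0 := by fun_prop
    have hy'0 : y' 0 = 0 := by simp [hy', hy0]
    refine ⟨y', hya, hy'0, isBigO_pow_succ_of_isLittleO (hE y' hya hy'0) ?_⟩
    have h1 : (fun t : ℝ => curveEval n ν i (A i) v (X.diff k) (y' t) t -
        curveEval n ν i (A i) v (X.diff k) (y t) t - W * (t : ℂ) ^ (q + (M + 1))) =o[𝓝[>] 0]
        fun t => t ^ ((q + (M + 1) : ℕ) : ℝ) := by
      refine isLittleO_iff.2 fun δ hδ => ?_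
      obtain ⟨η, hη, H⟩ := T.norm_curveEval_sub_sub_le hG (fun l hl => (hva l hl).continuousAt) hv
        (show 0 < δ / (‖W / c‖ + 1) by positivity)
      have hsm : ∀ f : ℂ → ℂ, AnalyticAt ℂ f 0 → f 0 = 0 → ∀ᶠ t : ℝ in 𝓝[>] 0, ‖f t‖ ≤ η :=
        fun f hf hf0 => by
          have h2 := (hf.continuousAt.tendsto.comp tendsto_ofReal_nhdsGT).norm
          rw [hf0, norm_zero] at h2
          exact (h2.eventually (gt_mem_nhds hη)).mono fun t ht => le_of_lt ht
      filter_upwards [H, hsm y hy hy0, hsm y' hya hy'0, self_mem_nhdsWithin] with t h2 h3 h4 h5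
      have ht : 0 < t := h5
      have h6 := h2 (y' t) (y t) h4 h3
      have h7 : y' t - y t = W / c * (t : ℂ) ^ (M + 1) := by simp [hy']
      rw [h7] at h6
      have h8 : (t : ℂ) ^ q * (c * (W / c * (t : ℂ) ^ (M + 1))) = W * (t : ℂ) ^ (q + (M + 1)) := by
        rw [← mul_assoc c, mul_div_cancel₀ W hc, pow_add]
        ring
      rw [h8, norm_mul, norm_pow, Complex.norm_real, Real.norm_of_nonneg ht.le] at h6
      rw [Real.rpow_natCast, norm_pow, Real.norm_of_nonneg ht.le]
      refine h6.trans ?_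
      have h9 : δ / (‖W / c‖ + 1) * ‖W / c‖ ≤ δ := by
        rw [div_mul_eq_mul_div, div_le_iff₀ (by positivity)]
        gcongr
        linarith
      calc _ = δ / (‖W / c‖ + 1) * ‖W / c‖ * t ^ (q + (M + 1)) := by rw [pow_add]; ring
        _ ≤ _ := by gcongr
    have h2 : (fun t : ℝ => w t - curveEval n ν i (A i) v (X.diff k) (y t) t -
        W * (t : ℂ) ^ (q + (M + 1))) =o[𝓝[>] 0] fun t => t ^ ((q + (M + 1) : ℕ) : ℝ) := by
      refine hW.trans_isLittleO ?_
      simp only [Real.rpow_natCast]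
      exact (isLittleO_pow_pow (Nat.lt_succ_self _)).mono nhdsWithin_le_nhds
    exact (h2.sub h1).congr_left fun t => by ring

/-- The product of `y - χ(ω) u ^ A_i` over `G_k` is `(y ^ n_{k+1} - u ^ n) ^ |G_{k+1}|`. Of the
`|G_k|` factors `t ^ q`, all but `|G_{k+1}|` are cancelled by the extra exponent in the hypothesis,
and a root is taken. -/
theorem isBigO_of_prod (T : X.Transversal ν i k A q) {l : Filter ℝ} (hl : l ≤ 𝓝[>] 0)
    {y u : ℝ → ℂ} {a : ℝ} (h : (fun t : ℝ => ∏ ω ∈ X.K k, ((t : ℂ) ^ q *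
      (y t - (∏ l, ω.val l ^ A l) * u t ^ A i))) =O[l] fun t => t ^ ((X.K (k + 1)).card * a +
        ((X.K k).card - (X.K (k + 1)).card) * q)) :
    (fun t : ℝ => (t : ℂ) ^ q * (u t ^ n - y t ^ idx X.lam (k + 1))) =O[l] fun t => t ^ a := by
  classical
  refine isBigO_rpow_of_pow hl (X.card_K_pos (k + 1)).ne' ?_
  have hcard : (X.K (k + 1)).card ≤ (X.K k).card := Finset.card_le_card (X.K_anti k.le_succ)
  have h1 := (h.norm_left.mul (isBigO_refl
    (fun t : ℝ => t ^ (-(((X.K k).card - (X.K (k + 1)).card : ℝ) * q))) l)).trans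
    (rpow_mul_rpow_eventuallyEq hl _ _).isBigO
  rw [add_neg_cancel_right] at h1
  refine IsBigO.of_norm_left (h1.congr' ?_ EventuallyEq.rfl)
  filter_upwards [hl self_mem_nhdsWithin] with t ht
  have ht0 : 0 < t := ht
  have h2 : ∏ ω ∈ X.K k, (y t - (∏ l, ω.val l ^ A l) * u t ^ A i) =
      (y t ^ idx X.lam (k + 1) - u t ^ n) ^ (X.K (k + 1)).card := by
    have h3 := prod_charKer_sub_mul T.vec_eq (y t) (u t ^ A i)
    rw [← pow_mul, T.mul_eq, X.card_K] at h3
    rw [← h3, ← X.prod_K]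
    refine Finset.prod_congr rfl fun ω _ => ?_
    rw [← Rots.char_toInt]
    rfl
  rw [Finset.prod_mul_distrib, Finset.prod_const, h2, norm_mul, norm_pow, norm_pow, norm_pow,
    norm_pow, norm_mul, norm_pow, Complex.norm_real, Real.norm_of_nonneg ht0.le, norm_sub_rev]
  have h4 : t ^ (-(((X.K k).card - (X.K (k + 1)).card : ℝ) * q)) =
      ((t ^ q) ^ ((X.K k).card - (X.K (k + 1)).card))⁻¹ := by
    rw [Real.rpow_neg ht0.le, ← Nat.cast_sub hcard, mul_comm, Real.rpow_natCast_mul ht0.le,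
      Real.rpow_natCast]
  rw [h4, mul_pow]
  obtain ⟨d, hd⟩ := Nat.exists_eq_add_of_le hcard
  have h5 : (t ^ q) ^ d ≠ 0 := by positivity
  rw [hd, Nat.add_sub_cancel_left, pow_add]
  field_simp

end Transversal

namespace JetBranch
variable {X} {γ : Jet m} {g v : Fin 2 → ℂ → ℂ} {u y : ℂ → ℂ} {l : Filter ℝ} {Λ : ℝ}

theorem tendsto_u (B : X.JetBranch R r γ ν ν' i g v u l) :
    Tendsto (fun t : ℝ => u t) (𝓝[>] 0) (𝓝 0) := by
  have h1 := ((B.analytic i).continuousAt.tendsto.comp tendsto_ofReal_nhdsGT).norm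
  rw [B.zero, norm_zero] at h1
  have h2 := h1.rpow_const (p := (n : ℝ)⁻¹) (Or.inr (by positivity))
  rw [Real.zero_rpow (inv_ne_zero (by exact_mod_cast NeZero.ne n))] at h2
  refine tendsto_zero_iff_norm_tendsto_zero.2 (h2.congr fun t => ?_)
  rw [Function.comp_apply, ← B.u_pow, norm_pow, Real.pow_rpow_inv_natCast (norm_nonneg _)
    (NeZero.ne n)]

/-- At the point rotated by `ω ∈ G_k`, `ζ_k` is unchanged, `ζ_{k+1} - ζ_k` is obtained by replacing
`y` by `χ(ω) u ^ A_i`, and the later terms are `O(t ^ Λ)`. As `ζ_{k+1} - ζ_k` is bi-Lipschitz in `y`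
up to the factor `t ^ q`, a conjugate of `ζ` near `z` forces `χ(ω) u ^ A_i` to be near `y`. -/
theorem sub_rot_isBigO (B : X.JetBranch R r γ ν ν' i g v u l) (T : X.Transversal ν i k A q)
    (hN : X.MemN J ν) (hk : k ≤ J) (hJ : J ≤ X.g) (hy : AnalyticAt ℂ y 0) (hy0 : y 0 = 0)
    (hΛ : k + 1 < X.g → Λ ≤ ((pair ν' (X.lam (k + 2)) : ℚ) : ℝ))
    (h : (fun t : ℝ => γ.curve t 2 - curveEval n ν i n v (X.trunc k).toSeries (g i t) t -
      curveEval n ν i (A i) v (X.diff k) (y t) t) =O[𝓝[>] 0] fun t => t ^ Λ)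
    {ω : Rots n} (hω : ω ∈ X.K k) :
    (fun t : ℝ => (t : ℂ) ^ q * (y t - (∏ l, ω.val l ^ A l) * u t ^ A i)) =O[𝓝[>] 0]
      fun t => ‖γ.curve t 2 - evalSeries X.ζ.toSeries (ω.val * branchOf n ν i v u t)‖ + t ^ Λ := by
  obtain ⟨c, hc, η, hη, H⟩ := T.norm_curveEval_sub_bounds B.good
    (fun l hl => (B.analytic_v l hl).continuousAt) B.v_norm_lt' B.v_ne_zero
  set χ := ∏ l, ω.val l ^ A l
  have hsmall : ∀ f : ℝ → ℂ, Tendsto f (𝓝[>] 0) (𝓝 0) → ∀ᶠ t in 𝓝[>] 0, ‖f t‖ ≤ η :=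
    fun f hf => by
      have := hf.norm
      rw [norm_zero] at this
      exact (this.eventually (gt_mem_nhds hη)).mono fun t ht => le_of_lt ht
  have hysm := hsmall (fun t => y t) (by
    have := hy.continuousAt.tendsto.comp tendsto_ofReal_nhdsGT
    rwa [hy0] at this)
  have husm := hsmall (fun t => χ * u t ^ A i) (by
    have := (B.tendsto_u.pow (A i)).const_mul χ
    rwa [zero_pow T.A_ne_zero, mul_zero] at this)
  have h1 : (fun t : ℝ => (t : ℂ) ^ q * (y t - χ * u t ^ A i)) =O[𝓝[>] 0] fun t : ℝ =>
      curveEval n ν i (A i) v (X.diff k) (y t) t -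
        curveEval n ν i (A i) v (X.diff k) (χ * u t ^ A i) t := by
    refine IsBigO.of_bound c⁻¹ ?_
    filter_upwards [H, hysm, husm, self_mem_nhdsWithin] with t h1 h2 h3 h4
    rw [inv_mul_eq_div, le_div_iff₀ hc, mul_comm, norm_mul, norm_pow, Complex.norm_real,
      Real.norm_of_nonneg (le_of_lt h4)]
    exact (h1 _ _ h2 h3).1
  refine h1.trans ?_
  have h2 : (fun t : ℝ => evalSeries X.ζ.toSeries (ω.val * branchOf n ν i v u t) -
      evalSeries (X.trunc (k + 1)).toSeries (ω.val * branchOf n ν i v u t)) =O[𝓝[>] 0]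
      fun t => t ^ Λ := by
    rcases (Nat.succ_le_of_lt T.lt).eq_or_lt with h3 | h3
    · rw [Nat.succ_eq_add_one] at h3
      rw [h3, trunc_g]
      simp only [sub_self]
      exact isBigO_zero _ _
    · exact (X.trunc_g_sub_isBigO B.good (B.branch.rot ω) h3).trans
        (rpow_isBigO_rpow le_rfl (hΛ h3))
  have h3 : ∀ f : ℝ → ℂ, f =O[𝓝[>] 0] (fun t : ℝ => t ^ Λ) → f =O[𝓝[>] 0] fun t : ℝ =>
      ‖γ.curve t 2 - evalSeries X.ζ.toSeries (ω.val * branchOf n ν i v u t)‖ + t ^ Λ := by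
    intro f hf
    refine hf.trans (IsBigO.of_bound 1 ?_)
    filter_upwards [self_mem_nhdsWithin] with t ht
    have ht0 : 0 < t := ht
    rw [one_mul, Real.norm_of_nonneg (by positivity), Real.norm_of_nonneg (by positivity)]
    exact le_add_of_nonneg_left (norm_nonneg _)
  have h4 : (fun t : ℝ => γ.curve t 2 -
      evalSeries X.ζ.toSeries (ω.val * branchOf n ν i v u t)) =O[𝓝[>] 0] fun t : ℝ =>
      ‖γ.curve t 2 - evalSeries X.ζ.toSeries (ω.val * branchOf n ν i v u t)‖ + t ^ Λ := by
    refine IsBigO.of_bound 1 ?_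
    filter_upwards [self_mem_nhdsWithin] with t ht
    have ht0 : 0 < t := ht
    rw [one_mul, Real.norm_of_nonneg (by positivity)]
    exact le_add_of_nonneg_right (by positivity)
  refine ((h4.add (h3 _ h2)).sub (h3 _ h)).congr' ?_ EventuallyEq.rfl
  filter_upwards [self_mem_nhdsWithin, (B.branch.rot ω).le] with t ht hU
  have h5 := T.evalSeries_rot (X.mem_K.1 hω) (v := v) (u := u) (le_of_lt ht)
  rw [diff, evalSeries_sub (B.good.conv_trunc _) (B.good.conv_trunc _)
    (fun l => (hU l).trans B.good.lt.le), X.evalSeries_rot_trunc T.lt.le (X.mem_K.1 hω),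
    ← B.curveEval_eq' hN hk hJ T.zero (le_of_lt ht), ← diff] at h5
  rw [← h5]
  ring

/-- The coordinate `x_i` of the jet agrees with `t ^ ν_i * y ^ n_{k+1}`. -/
theorem exists_sub_pow_isBigO (B : X.JetBranch R r γ ν ν' i g v u l) (T : X.Transversal ν i k A q)
    (hN : X.MemN J ν) (hk : k ≤ J) (hJ : J ≤ X.g) (hy : AnalyticAt ℂ y 0) (hy0 : y 0 = 0)
    (hΛ : k + 1 < X.g → Λ ≤ ((pair ν' (X.lam (k + 2)) : ℚ) : ℝ))
    (h : (fun t : ℝ => γ.curve t 2 - curveEval n ν i n v (X.trunc k).toSeries (g i t) t -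
      curveEval n ν i (A i) v (X.diff k) (y t) t) =O[𝓝[>] 0] fun t => t ^ Λ) :
    ∃ l' : Filter ℝ, l'.NeBot ∧ l' ≤ 𝓝[>] 0 ∧
      (fun t : ℝ => (t : ℂ) ^ q * (g i t - y t ^ idx X.lam (k + 1))) =O[l'] fun t =>
        t ^ min ((X.cJ m ν (k + 1) : ℚ) : ℝ) Λ := by
  have hD := fun ω hω => B.sub_rot_isBigO T hN hk hJ hy hy0 hΛ h (ω := ω) hω
  have hN' := B.neBot
  by_cases hfr : ∃ᶠ t : ℝ in l, t ^ Λ ≤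
      ‖γ.curve t 2 - evalSeries X.ζ.toSeries (branchOf n ν i v u t)‖
  -- If even the closest distance is at least `t ^ Λ` along a subfilter, the error `t ^ Λ` is
  -- absorbed in every factor, and the product estimate for the jet gives the exponent `c_{k+1}`.
  · have hne := frequently_mem_iff_neBot.1 hfr
    refine ⟨_, hne, inf_le_left.trans B.le, ?_⟩
    set l₁ := l ⊓ 𝓟 {t | t ^ Λ ≤ ‖γ.curve t 2 -
      evalSeries X.ζ.toSeries (branchOf n ν i v u t)‖} with hl₁
    have hle : l₁ ≤ 𝓝[>] 0 := inf_le_left.trans B.le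
    refine IsBigO.trans ?_ (rpow_isBigO_rpow hle (min_le_left _ _))
    have h1 : (fun t : ℝ => ∏ ω ∈ X.K k, ((t : ℂ) ^ q *
        (y t - (∏ l, ω.val l ^ A l) * u t ^ A i))) =O[l₁] fun t => t ^ ((X.K (k + 1)).card *
          ((X.cJ m ν (k + 1) : ℚ) : ℝ) + ((X.K k).card - (X.K (k + 1)).card) * q) := by
      refine ((IsBigO.finsetProd (s := X.K k) (g := fun ω (t : ℝ) => γ.curve t 2 -
        evalSeries X.ζ.toSeries (ω.val * branchOf n ν i v u t)) fun ω hω => ?_).trans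
        ((B.prod k T.lt.le).mono inf_le_left)).congr_right fun t => ?_
      · refine ((hD ω hω).mono hle).trans (IsBigO.of_bound 2 ?_)
        filter_upwards [hle self_mem_nhdsWithin, inf_le_left (a := l) (B.closest ω),
          mem_inf_of_right (mem_principal_self _)] with t h1 h2 h3
        have ht : 0 < t := h1
        rw [Real.norm_of_nonneg (by positivity)]
        have h4 : t ^ Λ ≤ _ := h3
        linarith
      · have h2 := X.card_mul_cJ m ν (k + 1)
        rw [S, T.pair_eq] at h2
        rw [B.S_eq T.lt.le T.zero]
        congr 1
        have h3 : ((X.K X.g).card * (m + 1) - X.S ν k : ℚ) = (X.K (k + 1)).card *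
          X.cJ m ν (k + 1) + ((X.K k).card - (X.K (k + 1)).card) * q := by rw [h2]; ring
        exact_mod_cast congrArg (fun x : ℚ => (x : ℝ)) h3
    exact (T.isBigO_of_prod hle h1).congr_left fun t => by rw [B.u_pow]
  -- Otherwise `z` is within `t ^ Λ` of `ζ`, hence of all conjugates in `G_{k+1}`. Their factors are
  -- `O(t ^ Λ)`, the others are trivially `O(t ^ q)`, and this gives the exponent `Λ`.
  · refine ⟨l, hN', B.le, ?_⟩
    refine IsBigO.trans ?_ (rpow_isBigO_rpow B.le (min_le_right _ _))
    have h0 : (fun t : ℝ => γ.curve t 2 -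
        evalSeries X.ζ.toSeries (branchOf n ν i v u t)) =O[l] fun t => t ^ Λ := by
      refine IsBigO.of_bound 1 ?_
      filter_upwards [not_frequently.1 hfr, B.le self_mem_nhdsWithin] with t h1 h2
      rw [one_mul, Real.norm_of_nonneg (Real.rpow_nonneg (le_of_lt h2) _)]
      exact (not_le.1 h1).le
    have h1 : ∀ ω ∈ X.K (k + 1), (fun t : ℝ => (t : ℂ) ^ q *
        (y t - (∏ l, ω.val l ^ A l) * u t ^ A i)) =O[l] fun t => t ^ Λ := by
      intro ω hω
      refine ((hD ω (X.K_anti k.le_succ hω)).mono B.le).trans ?_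
      refine IsBigO.add (IsBigO.norm_left ?_) (isBigO_refl _ _)
      have h2 : (fun t : ℝ => evalSeries X.ζ.toSeries (ω.val * branchOf n ν i v u t) -
          evalSeries X.ζ.toSeries (branchOf n ν i v u t)) =O[l] fun t => t ^ Λ := by
        rcases (Nat.succ_le_of_lt T.lt).eq_or_lt with h3 | h3
        · rw [Nat.succ_eq_add_one] at h3
          rw [h3] at hω
          simp only [X.evalSeries_rot _ (X.mem_K.1 hω), sub_self]
          exact isBigO_zero _ _
        · exact ((X.rot_sub_isBigO B.good B.branch h3 (X.mem_K.1 hω)).mono B.le).trans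
            (rpow_isBigO_rpow B.le (hΛ h3))
      exact (h0.sub h2).congr_left fun t => by ring
    have h2 : ∀ ω ∈ X.K k \ X.K (k + 1), (fun t : ℝ => (t : ℂ) ^ q *
        (y t - (∏ l, ω.val l ^ A l) * u t ^ A i)) =O[l] fun t => t ^ (q : ℝ) := by
      intro ω _
      have h3 : (fun t : ℝ => y t - (∏ l, ω.val l ^ A l) * u t ^ A i) =O[l] fun _ => (1 : ℝ) :=
        (((hy.continuousAt.tendsto.comp tendsto_ofReal_nhdsGT).sub
          ((B.tendsto_u.pow (A i)).const_mul (∏ l, ω.val l ^ A l))).isBigO_one ℝ).mono B.le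
      have h4 : (fun t : ℝ => (t : ℂ) ^ q) =O[l] fun t => t ^ (q : ℝ) :=
        IsBigO.of_bound 1 (Eventually.of_forall fun t => by
          rw [one_mul, Real.rpow_natCast, norm_pow, norm_pow, Complex.norm_real])
      exact (h4.mul h3).congr_right fun t => mul_one _
    have h3 := prod_isBigO_of_sdiff (u := X.K k) (s := X.K (k + 1)) B.le (X.K_anti k.le_succ)
      ((IsBigO.finsetProd h1).trans (prod_rpow_eventuallyEq B.le _ Λ).isBigO) h2
    exact (T.isBigO_of_prod B.le h3).congr_left fun t => by rw [B.u_pow]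

end JetBranch

end QOSurface

/-! ### The deformation in a transversal direction, and the conclusion -/

namespace QOSurface
variable (X : QOSurface n) {R r ε : ℝ} {m J : ℕ} {ν ν' : Fin 2 → ℕ} {i : Fin 2} {k q : ℕ}
  {A : Fin 2 →₀ ℕ}

namespace JetBranch
variable {X} {γ : Jet m} {g v : Fin 2 → ℂ → ℂ} {u y : ℂ → ℂ} {l : Filter ℝ}

/-- A solution `y` of `z - ζ_k = ζ_{k+1} - ζ_k` up to high order, such that `x_i` is close to
`t ^ ν_i * y ^ n_{k+1}`. -/
theorem exists_approx (B : X.JetBranch R r γ ν ν' i g v u l) (T : X.Transversal ν i k A q)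
    (L : X.Levels m ν J (k + 1)) :
    ∃ (κ : ℝ) (y : ℂ → ℂ), (k + 1 = J → ((X.cJ m ν J : ℚ) : ℝ) ≤ κ) ∧
      (k + 1 < J → ((pair ν (X.lam J) : ℚ) : ℝ) + 1 ≤ κ) ∧ AnalyticAt ℂ y 0 ∧ y 0 = 0 ∧
      (fun t : ℝ => γ.curve t 2 - curveEval n ν i n v (X.trunc k).toSeries (g i t) t -
        curveEval n ν i (A i) v (X.diff k) (y t) t) =O[𝓝[>] 0] (fun t => t ^ κ) ∧
      (fun t : ℝ => (t : ℂ) ^ q * (g i t - y t ^ idx X.lam (k + 1))) =O[𝓝[>] 0]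
        fun t => t ^ κ := by
  have hkJ : k < J := L.le
  have han := B.analyticAt_sub L.memN hkJ.le L.le_g T.zero
  -- To leading order `Q = q`, the function `z - ζ_k` vanishes to order `q + 1`, so the equation can
  -- be solved for `y` with `y(0) = 0` to any prescribed order.
  have hsolve : ∀ a : ℝ, ∃ y : ℂ → ℂ, AnalyticAt ℂ y 0 ∧ y 0 = 0 ∧
      (fun t : ℝ => γ.curve t 2 - curveEval n ν i n v (X.trunc k).toSeries (g i t) t -
        curveEval n ν i (A i) v (X.diff k) (y t) t) =O[𝓝[>] 0] fun t => t ^ a := by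
    intro a
    obtain ⟨M, hM⟩ := exists_nat_ge a
    obtain ⟨y, hy, hy0, hO⟩ := T.exists_curveEval_sub_isBigO B.good B.analytic_v B.v_norm_lt'
      B.v_ne_zero han (isBigO_real_of_pow (B.sub_curveEval_isBigO_pow L hkJ T.zero T.lam_ne_zero
        T.pair_eq) le_rfl le_rfl) M
    refine ⟨y, hy, hy0, hO.trans (rpow_isBigO_rpow le_rfl (hM.trans ?_))⟩
    exact_mod_cast (by omega : M ≤ q + (M + 1))
  have hR : ∀ y : ℂ → ℂ, AnalyticAt ℂ y 0 →
      AnalyticAt ℂ (fun t => t ^ q * (g i t - y t ^ idx X.lam (k + 1))) 0 := fun y hy => by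
    have := B.analytic i
    fun_prop
  rcases (Nat.succ_le_of_lt hkJ).eq_or_lt with h1 | h1
  · rw [Nat.succ_eq_add_one] at h1
    subst h1
    obtain ⟨y, hy, hy0, hO⟩ := hsolve ((X.cJ m ν (k + 1) : ℚ) : ℝ)
    refine ⟨_, y, fun _ => le_rfl, fun h => (lt_irrefl _ h).elim, hy, hy0, hO, ?_⟩
    obtain ⟨l', hl1, hl2, hl3⟩ := B.exists_sub_pow_isBigO T L.memN hkJ.le L.le_g hy hy0
      (fun h => by
        exact_mod_cast (L.cJ_le h).trans (B.pair_le (X.charExponents.nonneg h))) hO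
    rw [min_self] at hl3
    exact isBigO_rpow_of_isBigO (hR y hy) hl2 hl3
  · rw [Nat.succ_eq_add_one] at h1
    have h2 : X.lam (k + 2) i ≠ 0 := fun h =>
      T.lam_ne_zero (X.charExponents.coord_eq_zero (k + 1).le_succ (h1.trans_le L.le_g) h)
    obtain ⟨Q, hQ⟩ := X.exists_nat_pair_eq L.memN L.le_g (k := k + 2) (by omega) h1
    have hQJ : pair ν (X.lam J) = Q := by rw [← L.pair_eq (k + 1) le_rfl h1, hQ]
    have h3 : (Q : ℚ) < pair ν' (X.lam (k + 2)) :=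
      hQ ▸ B.pair_lt (X.charExponents.nonneg (h1.trans_le L.le_g)) h2
    have h4 : (Q : ℚ) < X.cJ m ν (k + 1) := hQ ▸ L.pair_succ_lt_cJ h1
    -- The precision `⟨ν', λ_{k+2}⟩` is what the comparison with `x_i` needs, and `Q + 1` is what
    -- the deformation needs. The comparison then yields an exponent larger than `Q`, which
    -- analyticity raises to `Q + 1`.
    obtain ⟨y, hy, hy0, hO⟩ := hsolve (max ((pair ν' (X.lam (k + 2)) : ℚ) : ℝ) ((Q + 1 : ℕ) : ℝ))
    refine ⟨((Q + 1 : ℕ) : ℝ), y, fun h => absurd h h1.ne, fun _ => ?_, hy, hy0,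
      hO.trans (rpow_isBigO_rpow le_rfl (le_max_right _ _)), ?_⟩
    · rw [hQJ]
      push_cast
      exact le_rfl
    · obtain ⟨l', hl1, hl2, hl3⟩ := B.exists_sub_pow_isBigO T L.memN hkJ.le L.le_g hy hy0
        (fun _ => le_rfl) (hO.trans (rpow_isBigO_rpow le_rfl (le_max_left _ _)))
      refine isBigO_real_of_pow (isBigO_pow_of_isBigO (hR y hy) hl2 hl3 ?_) le_rfl le_rfl
      have h5 : (Q : ℝ) < min ((X.cJ m ν (k + 1) : ℚ) : ℝ) ((pair ν' (X.lam (k + 2)) : ℚ) : ℝ) :=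
        lt_min (by exact_mod_cast h4) (by exact_mod_cast h3)
      push_cast
      linarith

/-- The difference of two functions is bounded by the difference of their powers. -/
theorem isBigO_sub_of_pow {a b : ℂ → ℂ} (ha : AnalyticAt ℂ a 0) (hb : AnalyticAt ℂ b 0) {c : ℂ}
    (ha0 : a 0 = c) (hb0 : b 0 = c) (hc : c ≠ 0) {p : ℕ} (hp : p ≠ 0) :
    (fun t => a t - b t) =O[𝓝 0] fun t => a t ^ p - b t ^ p := by
  set σ : ℂ → ℂ := fun t => ∑ l ∈ Finset.range p, a t ^ l * b t ^ (p - 1 - l)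
  have hσ : ContinuousAt σ 0 := by
    have h1 := ha.continuousAt
    have h2 := hb.continuousAt
    fun_prop
  have hσ0 : σ 0 ≠ 0 := by
    have : ∀ l ∈ Finset.range p, a 0 ^ l * b 0 ^ (p - 1 - l) = c ^ (p - 1) := fun l hl => by
      rw [ha0, hb0, ← pow_add]
      congr 1
      have := Finset.mem_range.1 hl
      omega
    change ∑ l ∈ Finset.range p, a 0 ^ l * b 0 ^ (p - 1 - l) ≠ 0
    rw [Finset.sum_congr rfl this, Finset.sum_const, Finset.card_range, nsmul_eq_mul]
    exact mul_ne_zero (by exact_mod_cast hp) (pow_ne_zero _ hc)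
  have h1 := ((hσ.inv₀ hσ0).isBigO_one ℂ).mul (isBigO_refl (fun t => a t ^ p - b t ^ p) (𝓝 0))
  refine h1.congr' ?_ (Eventually.of_forall fun t => one_mul _)
  filter_upwards [hσ.eventually_ne hσ0] with t ht
  rw [← (Commute.all (a t) (b t)).geom_sum₂_mul, ← mul_assoc]
  change (σ t)⁻¹ * σ t * _ = _
  rw [inv_mul_cancel₀ ht, one_mul]

/-- The closure relation in the direction of a coordinate that occurs first in `λ_{k+1}`, with
exponent `1 / n_{k+1}`. -/
theorem mem_C_of_transversal (B : X.JetBranch R r γ ν ν' i g v u l) (hε : ε ≤ r ^ n)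
    (T : X.Transversal ν i k A q) (L : X.Levels m ν J (k + 1)) (hν : ∀ l, ν l ≤ m)
    (hγ : γ ∈ jetDomain ε m) : γ ∈ X.C ε m ν := by
  obtain ⟨κ, y, h1, h2, hy, hy0, hO, hR⟩ := B.exists_approx T L
  have hkJ : k < J := L.le
  set p := idx X.lam (k + 1) with hp
  have hp0 : p ≠ 0 := T.idx_ne_zero
  have hok := B.curveOK L.memN hkJ.le L.le_g T.zero
  -- Moving `y` to `y + s` moves `y ^ p` to `(y + s) ^ p`; the small error `g i - y ^ p` is carried
  -- along unchanged, so that `G 0 = g i` holds exactly.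
  set G : ℝ → ℂ → ℂ := fun s t => g i t - y t ^ p + (y t + (s : ℂ)) ^ p with hG
  have hyf : AnalyticFamily fun s t => y t + (s : ℂ) :=
    (AnalyticFamily.of_analyticAt hy).add AnalyticFamily.ofReal
  have hRa : AnalyticAt ℂ (fun t => g i t - y t ^ p) 0 := by
    have := B.analytic i
    fun_prop
  have hGf : AnalyticFamily G := (AnalyticFamily.of_analyticAt hRa).add (hyf.pow p)
  have hGs : ∀ s, G s 0 = (s : ℂ) ^ p := fun s => by simp [hG, B.zero, hy0, hp0]
  have hG00 : G 0 0 = 0 := by rw [hGs, Complex.ofReal_zero, zero_pow hp0]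
  have hZk : AnalyticFamily fun s t => curveEval n ν i n v (X.trunc k).toSeries (G s t) t :=
    analyticFamily_curveEval hok B.good.R_pos.le (B.good.conv_trunc k) B.analytic_v B.v_norm_lt
      hGf (by
        rw [hG00]
        exact B.zero_norm_lt (by rw [Nat.div_self (NeZero.pos n)]; exact one_ne_zero))
  have hEf : AnalyticFamily fun s t => curveEval n ν i (A i) v (X.diff k) (y t + (s : ℂ)) t :=
    analyticFamily_curveEval T.curveOK B.good.R_pos.le (B.good.conv_diff k) B.analytic_v
      B.v_norm_lt hyf (by
        rw [hy0, Complex.ofReal_zero, add_zero]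
        exact T.zero_norm_lt B.good)
  have hE0 : AnalyticAt ℂ (fun t => curveEval n ν i (A i) v (X.diff k) (y t) t) 0 :=
    analyticAt_curveEval T.curveOK B.good.R_pos.le (B.good.conv_diff k) B.analytic_v
      B.v_norm_lt hy (by rw [hy0]; exact T.zero_norm_lt B.good)
  -- With `E = ζ_{k+1} - ζ_k` as a function of `y`, the family is `Z_s = (z - ζ_k(g) - E(y)) +
  -- ζ_k(G_s) + E(y + s)`, which is `z` for `s = 0`.
  have hZ := ((AnalyticFamily.of_analyticAt ((B.analyticAt_sub L.memN hkJ.le L.le_g T.zero).fun_sub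
    hE0)).add hZk).add hEf
  refine X.mem_C_of_family B.good hε L hν hγ (fun l _ => B.analytic l)
    (fun l _ => Eventually.of_forall (B.curve_eq l)) B.analytic_v B.v_ne_zero B.v_pow hGf hZ
    (Eventually.of_forall fun t => by rw [B.curve_eq]; simp [hG])
    (Eventually.of_forall fun t => by simp [hG]; ring) hG00 (k := k + 1) hkJ
    (fun hlt => ⟨le_rfl, fun h =>
      T.lam_ne_zero (X.charExponents.coord_eq_zero (k + 1).le_succ (hlt.trans_le L.le_g) h)⟩)
    h1 h2 ?_
  obtain ⟨c, hc, η, hη, H⟩ := T.norm_curveEval_sub_bounds B.good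
    (fun l hl => (B.analytic_v l hl).continuousAt) B.v_norm_lt' B.v_ne_zero
  have hGsmall : ∀ᶠ s in 𝓝[>] 0, ‖G s 0‖ < r ^ n := by
    have h3 := hGf.tendsto_zero.norm
    rw [hG00, norm_zero] at h3
    exact h3.eventually (gt_mem_nhds (pow_pos B.good.pos n))
  filter_upwards [eventually_pos_lt hη, hGsmall, hGf.analyticAt] with s hs hGs' hGa
  have hs0 : (s : ℂ) ≠ 0 := by exact_mod_cast hs.1.ne'
  have hG0 : G s 0 ≠ 0 := by rw [hGs]; exact pow_ne_zero _ hs0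
  -- The root `w` of `G s` is selected so that `w(0) ^ A_i = s`. Then `w ^ A_i` and `y + s` have the
  -- same nonzero value at `0`, and closeness of their `p`-th powers gives closeness of the two
  -- functions.
  obtain ⟨w₀, hw₀⟩ := IsAlgClosed.exists_pow_nat_eq (s : ℂ) (Nat.pos_of_ne_zero T.A_ne_zero)
  obtain ⟨w, hw1, hw2, hw3⟩ := exists_analytic_root hGa (NeZero.ne n) (w := w₀)
    (by rw [hGs, ← hw₀, ← pow_mul, T.mul_eq]) hG0
  refine ⟨hG0, w, hw1, hw3, ?_⟩
  have hws : w 0 ^ A i = s := by rw [hw2, hw₀]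
  -- the two values of `y` agree to high order
  have hdiff : (fun t : ℝ => (t : ℂ) ^ q * (y t + s - w t ^ A i)) =O[𝓝[>] 0] fun t => t ^ κ := by
    have h3 := (isBigO_sub_of_pow (a := fun t => y t + s) (b := fun t => w t ^ A i) (by fun_prop)
      (by fun_prop) (by rw [hy0, zero_add]) hws hs0 hp0).comp_tendsto tendsto_ofReal_nhdsGT
    refine ((isBigO_refl (fun t : ℝ => (t : ℂ) ^ q) (𝓝[>] 0)).mul h3).trans ?_
    refine hR.neg_left.congr' ?_ EventuallyEq.rfl
    filter_upwards [tendsto_ofReal_nhdsGT.eventually hw3] with t ht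
    simp only [Function.comp_apply]
    rw [← pow_mul, T.mul_eq, ht, hG]
    ring
  have hbd : ∀ f : ℂ → ℂ, AnalyticAt ℂ f 0 → f 0 = s → ∀ᶠ t : ℝ in 𝓝[>] 0, ‖f t‖ ≤ η :=
    fun f hf hf0 => by
      have h3 := (hf.continuousAt.tendsto.comp tendsto_ofReal_nhdsGT).norm
      rw [hf0, Complex.norm_real, Real.norm_of_nonneg hs.1.le] at h3
      exact (h3.eventually (gt_mem_nhds hs.2)).mono fun t ht => le_of_lt ht
  have hEd : (fun t : ℝ => curveEval n ν i (A i) v (X.diff k) (y t + s) t -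
      curveEval n ν i (A i) v (X.diff k) (w t ^ A i) t) =O[𝓝[>] 0] fun t => t ^ κ := by
    refine IsBigO.trans (IsBigO.of_bound (3 * c) ?_) hdiff
    filter_upwards [H, hbd (fun t => y t + s) (by fun_prop) (by rw [hy0, zero_add]),
      hbd (fun t => w t ^ A i) (by fun_prop) hws, self_mem_nhdsWithin] with t h3 h4 h5 h6
    rw [norm_mul, norm_pow, Complex.norm_real, Real.norm_of_nonneg (le_of_lt h6)]
    exact (h3 _ _ h4 h5).2
  have hU : ∀ᶠ t : ℝ in 𝓝[>] 0, ∀ l, ‖branchOf n ν i v w t l‖ ≤ r := by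
    refine eventually_all.2 fun l => eventually_norm_rootn_mul_le B.good.pos.le
      (u := Function.update v i w l) ?_ ?_
    · rcases eq_or_ne l i with rfl | hl
      · simpa using hw1.continuousAt
      · simpa [hl] using (B.analytic_v l hl).continuousAt
    · rcases eq_or_ne l i with rfl | hl
      · rw [Function.update_self, ← norm_pow, hw3.self_of_nhds]
        exact (mul_le_of_le_one_left (norm_nonneg _) (pow_le_one₀ le_rfl zero_le_one)).trans_lt hGs'
      · rw [Function.update_of_ne hl]
        exact B.v_norm_lt' l hl
  refine (hO.add hEd).congr' ?_ EventuallyEq.rfl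
  filter_upwards [tendsto_ofReal_nhdsGT.eventually hw3, hU, self_mem_nhdsWithin] with t h3 h4 h5
  rw [curveEval_eq hok (le_of_lt h5) h3, curveEval_eq (w := w) T.curveOK (le_of_lt h5) rfl, diff,
    evalSeries_sub (B.good.conv_trunc _) (B.good.conv_trunc _)
      fun l => (h4 l).trans B.good.lt.le, ← diff]
  change _ = _ + _ + _ - evalSeries _ (branchOf n ν i v w t)
  ring

end JetBranch

/-- Regularity of `X⁽ʲ⁾`, `j = j'(m, ν)`, puts `ν' - ν` on a coordinate ray and leaves only the two
kinds of directions for which a deformation has been constructed. -/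
theorem D_subset_C (hG : X.Good R r) (hε : ε ≤ r ^ n) (hν : ν ∈ X.Llt m) (hlt : ν < ν')
    (hreg : (fun l => (ν' l : ℝ) - (ν l : ℝ)) ∈ X.sigmaReg (X.jIdx' m ν)) :
    X.D ε m ν' ⊆ X.C ε m ν := by
  intro γ hγ
  have L := X.levels_of_mem_Llt hν
  obtain ⟨i, hi, hcase⟩ := X.exists_of_mem_sigmaReg L.one_le (L.le.trans L.le_g) hreg fun h0 =>
    hlt.ne (funext fun l => by
      have : (ν' l : ℝ) - ν l = 0 := congrFun h0 l
      exact_mod_cast (sub_eq_zero.1 this).symm)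
  have hl : ∀ l, l ≠ i → ν' l = ν l := fun l h => by
    exact_mod_cast sub_eq_zero.1 (hi l h)
  have hνi : ν i < ν' i := by
    refine lt_of_le_of_ne (hlt.le i) fun h => hlt.ne (funext fun l => ?_)
    rcases eq_or_ne l i with rfl | h'
    exacts [h, (hl l h').symm]
  obtain ⟨g, v, u, l, B⟩ := X.exists_jetBranch hG hε hγ hνi hl
  rcases hcase with h0 | ⟨h0, h1⟩
  · exact B.mem_C_of_lam_eq_zero hε L hν.1.1.1 hγ.1.1 h0
  · generalize X.jIdx' m ν = j at L h0 h1
    obtain ⟨j, rfl⟩ := Nat.exists_eq_add_of_le' L.one_le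
    obtain ⟨A, q, T⟩ := Transversal.exists_of_levels L h0 h1
    exact B.mem_C_of_transversal hε T L hν.1.1.1 hγ.1.1

end QOSurface

end

end QuasiOrdinary

theorem proposition4p14 {n : ℕ} [NeZero n] (X : QuasiOrdinary.QOSurface n) :
    ∃ ε₀ : ℝ, 0 < ε₀ ∧ ∀ ε : ℝ, 0 < ε → ε ≤ ε₀ →
      ∀ m : ℕ, 0 < m → ∀ ν ∈ X.Llt m, ∀ ν' ∈ X.P m ∪ X.Llt m, ν < ν' →
        (fun i => (ν' i : ℝ) - (ν i : ℝ)) ∈ X.sigmaReg (X.jIdx' m ν) →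
          X.C ε m ν' ⊆ X.C ε m ν := by
  obtain ⟨R, r, hG⟩ := X.exists_good
  -- For `|x_i| < r ^ n` all `n`-th roots of the coordinates lie in the polydisc of radius `r`.
  refine ⟨r ^ n, pow_pos hG.pos n, fun ε _ hε m _ ν hν ν' _ hlt hreg => ?_⟩
  exact QuasiOrdinary.zariskiClosure_subset (X.D_subset_C hG hε hν hlt hreg)
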